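/- **Setting.** Let $X=\mathcal O_{\mathbb P^1}(-1,-1,0)$ with contraction $f\colon X\to Y_0=\{xy=zw\}\times\mathbb C$. A (compactly supported) perverse coherent system $(F,s)$, $F\in\mathrm{Per}(X/Y_0)$, $s\colon\mathcal O_X\to F$, is identified in the standard way with a finite-dimensional representation of the framed quiver with vertices $\infty,0,1$, $V_\infty=\mathbb C$, $V_0=\mathrm{Hom}(\mathcal O_X,F)$, $V_1=\mathrm{Hom}(\mathcal O_X(Z_\infty),F)$, arrows $s\colon V_\infty\to V_0$, $a_1,a_2\colon V_0\to V_1$, $b_1,b_2\colon V_1\to V_0$, $c\colon V_0\to V_0$, $d\colon V_1\to V_1$ and relations $a_2b_ia_1=a_1b_ia_2$, $b_2a_ib_1=b_1a_ib_2$, $da_i=a_ic$, $cb_i=b_id$; isomorphisms are given by $GL(V_0)\times GL(V_1)$. One has $\chi(F)=\dim V_0$ and $\deg F=\dim V_0-\dim V_1$. For $\Theta=(\theta_0,\theta_1)\in\mathbb R^2$ put $\Theta(V)=\theta_0\dim V_0+\theta_1\dim V_1$; $(F,s)$ is $\Theta$-stable if $\Theta(V')<0$ for every nonzero subrepresentation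 $V'$ with $V'_\infty=0$ and $\Theta(V')<\Theta(V)$ for every proper subrepresentation $V'$ with $V'_\infty=\mathbb C$; $\Theta$-semistability is defined with $\le$. For $k\ge1$ let $L_-^-(k)=\{\theta_0<\theta_1,\ k\theta_0+(k-1)\theta_1=0\}$. For $\Theta\in L_-^-(k)$ let $\Theta_\pm=(\theta_0\mp\varepsilon,\theta_1)$ with $\varepsilon>0$ sufficiently small. Let $T_0=\{t\in(\mathbb C^*)^4: t_0t_1t_2t_3=1\}$ act by scaling $a_1,a_2,b_1,b_2,c,d$ by $t_1,t_2,1,t_0,t_3,t_3$. Every $T_0$-fixed stable $(F,s)$ has a unique $T_0$-equivariant structure for which $s$ is invariant. For $l\ge1$ let $I_{l\mathbb P^1}=(\mathcal O_X\twoheadrightarrow\mathcal O_{\mathbb P^1}\otimes\sum_{j=0}^{l-1}t_3^j)$. Let $\pi_\pm^{-1}(P_r)$ be the set of isomorphism classes of $T_0$-fixed $\Theta_\pm$-stable $I=(\mathcal O_X\to F)$ which are, as $\Theta$-semistable objects, S-equivalent to $I_{l\mathbb P^1}\oplus\mathcal O_{\mathbb P^1}(k-1)^{\oplus r}[-1]$.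 Let $\lambda_i$ be the equivariant parameter of $t_i$ (so $\lambda_3=-\lambda_0-\lambda_1-\lambda_2$) and work in $\mathbb Q(\lambda_0,\lambda_1,\lambda_2,m)$. The contribution of $I$ is $$c(I)=(-1)^{\chi(F)+\deg F+\mathrm{sign}(F)}\; e_{T_0}\bigl(-\chi_X(F)+\chi_Y(F,F)\bigr)\cdot e_{T_0\times\mathbb C^*}\bigl(\chi_X(F)^\vee\otimes e^m\bigr),$$ where $\chi_Y(F,F)=\chi_{\mathbb P^1}(F,F)-\chi_{\mathbb P^1}(F,F\otimes N)+\chi_{\mathbb P^1}(F,F\otimes\wedge^2N)$ is computed from the pushforward of $F$ to $\mathbb P^1$, with $N=\mathcal O_{\mathbb P^1}(-Z_\infty)t_1^{-1}\oplus\mathcal O_{\mathbb P^1}t_3^{-1}$ and $\chi(\mathcal O_{\mathbb P^1}(aZ_0+bZ_\infty))=\frac{t_0^{b+1}-t_0^{-a}}{t_0-1}$. *Sign rule.* Put $\mathrm{sign}(F)=0$ on the fibers of $\pi_-$. A point of a fiber of $\pi_+$ is given by the canonical morphism from $I_{l\mathbb P^1}$ to $$\bigoplus_{i=1}^{k-1}F_i\,t_1\sum_{j<d_i}t_3^j\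 \oplus\ \bigoplus_{i=1}^{k-1}F_i\,t_2\sum_{j<e_i}t_3^j\ \oplus\ \bigoplus_{i=0}^{k-1}F_i\,t_3^l\sum_{j<f_i}t_3^j,\qquad F_i=\mathcal O_{\mathbb P^1}\bigl((k-1-i)Z_0+iZ_\infty\bigr),$$ (with exponents determined by the equivariant K-class of $F$), and $\mathrm{sign}(F)$ is the number of $i$ with $e_i>0$. For $N\ge0$ let $W(k,l,\Theta,N)$ be the statement: for all sufficiently small $\varepsilon>0$, the fibers $\pi_\pm^{-1}(P_r)$ with $r\le N$ are finite and the Euler classes at their points are defined, the power series in the denominator below has nonzero constant term, and the coefficients of $t^n$, $0\le n\le N$, agree on the two sides of $$\frac{\sum_{r\ge0}t^r\sum_{I\in\pi_+^{-1}(P_r)}c(I)}{\sum_{r\ge0}t^r\sum_{I\in\pi_-^{-1}(P_r)}c(I)}=(1-t)^{k\frac{m}{\lambda_3}}:=\sum_{n\ge0}(-1)^n\binom{k\frac m{\lambda_3}}{n}t^n .$$ **Proposition.** 1. For every $\Theta\in L_-^-(2)$, $W(2,l,\Theta,N)$ holds for $(l,N)=(1,16)$, $(2,10)$, $(3,9)$,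 $(4,9)$, $(5,8)$, $(6,7)$, for $l=7,8,9,10$ with $N=6$, and for every $l\ge1$ with $N=5$. 2. For $\Theta\in L_-^-(k)$ and $l=1$, $W(k,1,\Theta,N)$ holds for $k=3$ with $N=5$, for $k=4,5$ with $N=2$, and for every $3\le k\le12$ with $N=1$. -/

import Mathlib

open Filter Topology

/-!
Perverse coherent systems on `X = O_{P¹}(-1,-1,0)` are handled through the framed quiver with
relations that describes them. The system `(F, s : O_X → F)` is the representation with
`V₀ = Hom(O_X, F) = H⁰(F)`, `V₁ = Hom(O_X(Z_∞), F) = H⁰(F(-Z_∞))`, framing `s`, where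
`b₁, b₂ : V₁ → V₀` are the homogeneous coordinates of `P¹`, `a₁, a₂ : V₀ → V₁` are the fibre
coordinates of `O(-1) ⊕ O(-1)`, and the loops are the fibre coordinate of the trivial summand.
-/

namespace PervConifold

/-! ### Representations of the framed quiver with relations -/

/-- A representation of the framed quiver (vertices `∞, 0, 1`, with spaces `U, V₀, V₁`). The arrows
`a₁, a₂, b₁, b₂` are `a 0, a 1, b 0, b 1`. -/
structure FramedRep (U V₀ V₁ : Type) [AddCommGroup U] [Module ℂ U] [AddCommGroup V₀] [Module ℂ V₀]
    [AddCommGroup V₁] [Module ℂ V₁] where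
  fr : U →ₗ[ℂ] V₀
  a : Fin 2 → V₀ →ₗ[ℂ] V₁
  b : Fin 2 → V₁ →ₗ[ℂ] V₀
  c : V₀ →ₗ[ℂ] V₀
  d : V₁ →ₗ[ℂ] V₁
  rel_aba : ∀ i x, a 1 (b i (a 0 x)) = a 0 (b i (a 1 x))
  rel_bab : ∀ i y, b 1 (a i (b 0 y)) = b 0 (a i (b 1 y))
  rel_a : ∀ i x, d (a i x) = a i (c x)
  rel_b : ∀ i y, c (b i y) = b i (d y)

section

variable {U V₀ V₁ U' V₀' V₁' : Type} [AddCommGroup U] [Module ℂ U] [AddCommGroup V₀] [Module ℂ V₀]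
  [AddCommGroup V₁] [Module ℂ V₁] [AddCommGroup U'] [Module ℂ U'] [AddCommGroup V₀'] [Module ℂ V₀']
  [AddCommGroup V₁'] [Module ℂ V₁']

/-- A triple of linear maps is a morphism of representations. -/
structure IsHom (R : FramedRep U V₀ V₁) (R' : FramedRep U' V₀' V₁') (fU : U →ₗ[ℂ] U')
    (f₀ : V₀ →ₗ[ℂ] V₀') (f₁ : V₁ →ₗ[ℂ] V₁') : Prop where
  fr : ∀ u, f₀ (R.fr u) = R'.fr (fU u)
  a : ∀ i x, f₁ (R.a i x) = R'.a i (f₀ x)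
  b : ∀ i y, f₀ (R.b i y) = R'.b i (f₁ y)
  c : ∀ x, f₀ (R.c x) = R'.c (f₀ x)
  d : ∀ y, f₁ (R.d y) = R'.d (f₁ y)

/-- Subrepresentations. -/
structure SubRep (R : FramedRep U V₀ V₁) where
  sU : Submodule ℂ U
  s₀ : Submodule ℂ V₀
  s₁ : Submodule ℂ V₁
  fr_mem : ∀ u ∈ sU, R.fr u ∈ s₀
  a_mem : ∀ i, ∀ x ∈ s₀, R.a i x ∈ s₁
  b_mem : ∀ i, ∀ y ∈ s₁, R.b i y ∈ s₀
  c_mem : ∀ x ∈ s₀, R.c x ∈ s₀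
  d_mem : ∀ y ∈ s₁, R.d y ∈ s₁

/-- A subrepresentation as a representation. -/
def SubRep.toRep {R : FramedRep U V₀ V₁} (W : SubRep R) : FramedRep W.sU W.s₀ W.s₁ where
  fr := R.fr.restrict W.fr_mem
  a i := (R.a i).restrict (W.a_mem i)
  b i := (R.b i).restrict (W.b_mem i)
  c := R.c.restrict W.c_mem
  d := R.d.restrict W.d_mem
  rel_aba i x := Subtype.ext (R.rel_aba i x)
  rel_bab i y := Subtype.ext (R.rel_bab i y)
  rel_a i x := Subtype.ext (R.rel_a i x)
  rel_b i y := Subtype.ext (R.rel_b i y)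

/-- `W ⊆ W'` and the subquotient `W'/W` is isomorphic to `A`: there is a morphism from `W'` onto `A`
with kernel `W`. -/
def IsSubquotient {R : FramedRep U V₀ V₁} (W W' : SubRep R) (A : FramedRep U' V₀' V₁') : Prop :=
  (W.sU ≤ W'.sU ∧ W.s₀ ≤ W'.s₀ ∧ W.s₁ ≤ W'.s₁) ∧
  ∃ (fU : W'.sU →ₗ[ℂ] U') (f₀ : W'.s₀ →ₗ[ℂ] V₀') (f₁ : W'.s₁ →ₗ[ℂ] V₁'),
    IsHom W'.toRep A fU f₀ f₁ ∧
    Function.Surjective fU ∧ Function.Surjective f₀ ∧ Function.Surjective f₁ ∧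
    (∀ u, fU u = 0 ↔ (u : U) ∈ W.sU) ∧ (∀ x, f₀ x = 0 ↔ (x : V₀) ∈ W.s₀) ∧
    (∀ y, f₁ y = 0 ↔ (y : V₁) ∈ W.s₁)

/-- `Θ(V₀', V₁') = θ₀ dim V₀' + θ₁ dim V₁'`. -/
noncomputable def slope (θ : ℝ × ℝ) (n₀ n₁ : ℕ) : ℝ := θ.1 * n₀ + θ.2 * n₁

/-- `Θ`-stability of a framed representation with one-dimensional framing space. -/
def IsStable (θ : ℝ × ℝ) (R : FramedRep ℂ V₀ V₁) : Prop :=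
  (∀ W : SubRep R, W.sU = ⊥ → (W.s₀ ≠ ⊥ ∨ W.s₁ ≠ ⊥) →
    slope θ (Module.finrank ℂ W.s₀) (Module.finrank ℂ W.s₁) < 0) ∧
  (∀ W : SubRep R, W.sU = ⊤ → (W.s₀ ≠ ⊤ ∨ W.s₁ ≠ ⊤) →
    slope θ (Module.finrank ℂ W.s₀) (Module.finrank ℂ W.s₁) <
      slope θ (Module.finrank ℂ V₀) (Module.finrank ℂ V₁))

/-- `R` has a filtration whose subquotients are one copy of `I₀` and `r` copies of `S`. When `I₀` and
`S` are `Θ`-stable with `Θ(S) = 0`, this is a Jordan–Hölder filtration, so it says that `R` is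
`Θ`-semistable and S-equivalent to the polystable object `I₀ ⊕ S^{⊕ r}`. -/
def HasJHFactors {E₀ E₁ L₀ L₁ : Type} [AddCommGroup E₀] [Module ℂ E₀] [AddCommGroup E₁]
    [Module ℂ E₁] [AddCommGroup L₀] [Module ℂ L₀] [AddCommGroup L₁] [Module ℂ L₁]
    (R : FramedRep ℂ V₀ V₁) (I₀ : FramedRep ℂ E₀ E₁) (S : FramedRep PUnit L₀ L₁) (r : ℕ) : Prop :=
  ∃ (W : Fin (r + 2) → SubRep R) (p : Fin (r + 1)),
    ((W 0).sU = ⊥ ∧ (W 0).s₀ = ⊥ ∧ (W 0).s₁ = ⊥) ∧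
    ((W (Fin.last _)).sU = ⊤ ∧ (W (Fin.last _)).s₀ = ⊤ ∧ (W (Fin.last _)).s₁ = ⊤) ∧
    IsSubquotient (W p.castSucc) (W p.succ) I₀ ∧
    ∀ j, j ≠ p → IsSubquotient (W j.castSucc) (W j.succ) S

/-! ### The Calabi–Yau torus and its characters -/

/-- The torus `T₀ = {(t₀,t₁,t₂,t₃) : t₀t₁t₂t₃ = 1}`. -/
abbrev Torus : Type := {t : Fin 4 → ℂˣ // ∏ i, t i = 1}

/-- The representation `t · R`: the arrows `a₁, a₂, b₁, b₂, c, d` are scaled by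
`t₁, t₂, 1, t₀, t₃, t₃`. -/
def FramedRep.twist (t : Torus) (R : FramedRep U V₀ V₁) : FramedRep U V₀ V₁ where
  fr := R.fr
  a i := ((![t.1 1, t.1 2] i : ℂˣ) : ℂ) • R.a i
  b i := ((![1, t.1 0] i : ℂˣ) : ℂ) • R.b i
  c := (t.1 3 : ℂ) • R.c
  d := (t.1 3 : ℂ) • R.d
  rel_aba i x := by
    simp only [LinearMap.smul_apply, map_smul, R.rel_aba, smul_smul]
    congr 1
    simp only [Matrix.cons_val_zero, Matrix.cons_val_one]
    ring
  rel_bab i y := by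
    simp only [LinearMap.smul_apply, map_smul, R.rel_bab, smul_smul]
    congr 1
    simp only [Matrix.cons_val_zero, Matrix.cons_val_one]
    ring
  rel_a i x := by
    simp only [LinearMap.smul_apply, map_smul, R.rel_a, smul_smul, mul_comm]
  rel_b i y := by
    simp only [LinearMap.smul_apply, map_smul, R.rel_b, smul_smul, mul_comm]

/-- The linear automorphisms `(g₀, g₁)` give an isomorphism of framed representations `R ≅ t · R`.
(For a stable `R` there is at most one such pair, so that a torus fixed stable `R` carries a unique
`T₀`-equivariant structure for which the framing is invariant, given by these pairs.) -/
def IsTorusIso (t : Torus) (R : FramedRep ℂ V₀ V₁) (g₀ : V₀ ≃ₗ[ℂ] V₀) (g₁ : V₁ ≃ₗ[ℂ] V₁) : Prop :=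
  IsHom R (R.twist t) LinearMap.id g₀.toLinearMap g₁.toLinearMap

/-- The isomorphism class of `R` is a `T₀`-fixed point. -/
def IsTorusFixed (R : FramedRep ℂ V₀ V₁) : Prop :=
  ∀ t : Torus, ∃ g₀ g₁, IsTorusIso t R g₀ g₁

/-- The character lattice of `T₀`, with basis `t₀, t₁, t₂`. -/
abbrev Wt : Type := Fin 3 → ℤ

/-- The characters `t₀, t₁, t₂, t₃`, where `t₃ = (t₀t₁t₂)⁻¹`. -/
def tw : Fin 4 → Wt := ![![1, 0, 0], ![0, 1, 0], ![0, 0, 1], ![-1, -1, -1]]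

/-- The value of a character at a point of the torus. -/
def charVal (w : Wt) (t : Torus) : ℂˣ := ∏ i : Fin 3, t.1 i.castSucc ^ w i

/-- The weight space of `V₀` of weight `w`. -/
def weightSpace₀ (R : FramedRep ℂ V₀ V₁) (w : Wt) : Submodule ℂ V₀ :=
  ⨅ (t : Torus) (g₀ : V₀ ≃ₗ[ℂ] V₀) (g₁ : V₁ ≃ₗ[ℂ] V₁) (_ : IsTorusIso t R g₀ g₁),
    LinearMap.ker (g₀.toLinearMap - (charVal w t : ℂ) • LinearMap.id)

/-- The weight space of `V₁` of weight `w`. -/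
def weightSpace₁ (R : FramedRep ℂ V₀ V₁) (w : Wt) : Submodule ℂ V₁ :=
  ⨅ (t : Torus) (g₀ : V₀ ≃ₗ[ℂ] V₀) (g₁ : V₁ ≃ₗ[ℂ] V₁) (_ : IsTorusIso t R g₀ g₁),
    LinearMap.ker (g₁.toLinearMap - (charVal w t : ℂ) • LinearMap.id)

/-! ### Equivariant K-theory -/

/-- `K^{T₀}(pt)`, the group ring of the character lattice. -/
abbrev KT : Type := AddMonoidAlgebra ℤ Wt

/-- The class of a character. -/
noncomputable def ch (w : Wt) : KT := AddMonoidAlgebra.single w 1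

/-- The involution `w ↦ w⁻¹`, that is, dualisation. -/
noncomputable def dual (V : KT) : KT := AddMonoidAlgebra.mapDomain (fun w => -w) V

/-- A class `G` of `K^{T₀}(P¹)`, recorded by the pair `(χ(G), χ(G(-Z_∞)))`, which determines it. -/
abbrev KP1 : Type := KT × KT

/-- The class of the pushforward of `F` to `P¹`, for a torus fixed stable system `(F, s)`. -/
noncomputable def kClass (R : FramedRep ℂ V₀ V₁) : KP1 :=
  (∑ᶠ w, (Module.finrank ℂ (weightSpace₀ R w) : ℤ) • ch w,
   ∑ᶠ w, (Module.finrank ℂ (weightSpace₁ R w) : ℤ) • ch w)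

end

/-- `G ↦ G(-Z_∞)`. On `P¹` one has `O(Z₀) = O(Z_∞) ⊗ t₀⁻¹`, and the Koszul complex of the two torus
fixed points gives `t₀ G(-2Z_∞) - (1 + t₀) G(-Z_∞) + G = 0`. -/
noncomputable def twistZinf (G : KP1) : KP1 :=
  (G.2, (1 + ch (-tw 0)) * G.2 - ch (-tw 0) * G.1)

/-- `χ_{P¹}(F, G)`; it is `χ(G)` for `F = O` and `χ(G(-Z_∞))` for `F = O(Z_∞)`. -/
noncomputable def chiP1 (F G : KP1) : KT :=
  dual F.1 * G.1 + dual F.2 * G.2 - (1 + ch (-tw 0)) * (dual F.2 * G.1)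

/-- `χ_Y(F, G)` for `F, G` pushed forward along the zero section of `Y = O_{P¹}(-1,0)`, whose normal
bundle is `N = O(-Z_∞) t₁⁻¹ ⊕ O t₃⁻¹`:
`χ_Y(F,G) = χ_{P¹}(F,G) - χ_{P¹}(F,G ⊗ N) + χ_{P¹}(F,G ⊗ Λ²N)`. -/
noncomputable def chiY (F G : KP1) : KT :=
  chiP1 F G - chiP1 F (ch (-tw 1) • twistZinf G + ch (-tw 3) • G)
    + chiP1 F (ch (-tw 1 - tw 3) • twistZinf G)

/-- The square root `χ_X(I,I)₀^{1/2} = -χ_X(F) + χ_Y(F,F)`. -/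
noncomputable def sqrtClass (F : KP1) : KT := -F.1 + chiY F F

/-! ### Equivariant parameters and Euler classes -/

/-- The field `Λ = ℚ(λ₀, λ₁, λ₂, m)`. -/
abbrev Lam : Type := FractionRing (MvPolynomial (Fin 4) ℚ)

/-- The insertion parameter `m`. -/
noncomputable def mPar : Lam := algebraMap (MvPolynomial (Fin 4) ℚ) Lam (MvPolynomial.X 3)

/-- The equivariant weight of a character: `λ₀, λ₁, λ₂` are the weights of `t₀, t₁, t₂`. -/
noncomputable def lin (w : Wt) : Lam :=
  ∑ i : Fin 3, (w i : Lam) * algebraMap (MvPolynomial (Fin 4) ℚ) Lam (MvPolynomial.X i.castSucc)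

/-- `λ₃ = -(λ₀ + λ₁ + λ₂)`. -/
noncomputable def lam3 : Lam := lin (tw 3)

/-- The Euler class `e_{T₀}(V)`, for `V` in which the trivial character has multiplicity `≥ 0`. -/
noncomputable def euler (V : KT) : Lam := V.coeff.prod fun w n => lin w ^ n

/-- The Euler class `e_{T₀ × ℂ^*}(V ⊗ e^m)`. -/
noncomputable def eulerM (V : KT) : Lam := V.coeff.prod fun w n => (lin w + mPar) ^ n

/-! ### Moduli points and fibres -/

/-- Representations with dimension vector `(d₀, d₁)` and framing space `ℂ`. -/
abbrev RepSpace (d₀ d₁ : ℕ) : Type := FramedRep ℂ (Fin d₀ → ℂ) (Fin d₁ → ℂ)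

/-- The orbits of `GL(V₀) × GL(V₁)`. -/
def isoSetoid (d₀ d₁ : ℕ) : Setoid (RepSpace d₀ d₁) where
  r R R' := ∃ (g₀ : (Fin d₀ → ℂ) ≃ₗ[ℂ] (Fin d₀ → ℂ)) (g₁ : (Fin d₁ → ℂ) ≃ₗ[ℂ] (Fin d₁ → ℂ)),
    IsHom R R' LinearMap.id g₀.toLinearMap g₁.toLinearMap
  iseqv := {
    refl := fun _ => ⟨LinearEquiv.refl ℂ _, LinearEquiv.refl ℂ _,
      ⟨fun _ => rfl, fun _ _ => rfl, fun _ _ => rfl, fun _ => rfl, fun _ => rfl⟩⟩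
    symm := fun {R R'} ⟨g₀, g₁, h⟩ => ⟨g₀.symm, g₁.symm,
      ⟨fun u => by
          have := h.fr u
          simp only [LinearEquiv.coe_coe, LinearMap.id_apply] at this ⊢
          rw [← this, LinearEquiv.symm_apply_apply],
        fun i x => by
          have := h.a i (g₀.symm x)
          simp only [LinearEquiv.coe_coe, LinearEquiv.apply_symm_apply] at this ⊢
          rw [← this, LinearEquiv.symm_apply_apply],
        fun i x => by
          have := h.b i (g₁.symm x)
          simp only [LinearEquiv.coe_coe, LinearEquiv.apply_symm_apply] at this ⊢
          rw [← this, LinearEquiv.symm_apply_apply],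
        fun x => by
          have := h.c (g₀.symm x)
          simp only [LinearEquiv.coe_coe, LinearEquiv.apply_symm_apply] at this ⊢
          rw [← this, LinearEquiv.symm_apply_apply],
        fun x => by
          have := h.d (g₁.symm x)
          simp only [LinearEquiv.coe_coe, LinearEquiv.apply_symm_apply] at this ⊢
          rw [← this, LinearEquiv.symm_apply_apply]⟩⟩
    trans := fun {R R' R''} ⟨g₀, g₁, h⟩ ⟨g₀', g₁', h'⟩ => ⟨g₀.trans g₀', g₁.trans g₁',
      ⟨fun u => (congrArg g₀' (h.fr u)).trans (h'.fr u),
        fun i x => (congrArg g₁' (h.a i x)).trans (h'.a i (g₀ x)),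
        fun i y => (congrArg g₀' (h.b i y)).trans (h'.b i (g₁ y)),
        fun x => (congrArg g₀' (h.c x)).trans (h'.c (g₀ x)),
        fun y => (congrArg g₁' (h.d y)).trans (h'.d (g₁ y))⟩⟩ }

/-- Isomorphism classes of framed representations with dimension vector `(d₀, d₁)`. -/
abbrev Moduli (d₀ d₁ : ℕ) : Type := Quotient (isoSetoid d₀ d₁)

/-- The `T₀`-fixed `Θ'`-stable isomorphism classes lying over the point `I₀ ⊕ S^{⊕ r}` (a polystable
object for a stability parameter on a wall adjacent to `Θ'`). Here `(e₀, e₁)` and `(n₀, n₁)` are the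
dimension vectors of `I₀` and `S`. -/
def fibre (θ' : ℝ × ℝ) {e₀ e₁ n₀ n₁ : ℕ} (I₀ : RepSpace e₀ e₁)
    (S : FramedRep PUnit (Fin n₀ → ℂ) (Fin n₁ → ℂ)) (r : ℕ) :
    Set (Moduli (e₀ + r * n₀) (e₁ + r * n₁)) :=
  {q | ∃ R, Quotient.mk _ R = q ∧ IsStable θ' R ∧ IsTorusFixed R ∧ HasJHFactors R I₀ S r}

/-- The contribution of `I = (O_X → F)`, namely `e(χ_X(I,I)₀^{1/2}) · e(χ_X(F)^∨ ⊗ e^m)`, with the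
extra sign `(-1)^{χ(F) + deg F + sign(F)}`, where `χ(F) = d₀` and `deg F = d₀ - d₁`. -/
noncomputable def contribution {d₀ d₁ : ℕ} (sgn : ℤ) (R : RepSpace d₀ d₁) : Lam :=
  (-1 : Lam) ^ ((d₀ : ℤ) + ((d₀ : ℤ) - d₁) + sgn) * euler (sqrtClass (kClass R))
    * eulerM (dual (kClass R).1)

/-- `∑_r t^r ∑_{I ∈ fibre over I₀ ⊕ S^{⊕ r}} (contribution of I)`, for the sign rule `sgn`. -/
noncomputable def fibreSeries (θ' : ℝ × ℝ) {e₀ e₁ n₀ n₁ : ℕ} (I₀ : RepSpace e₀ e₁)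
    (S : FramedRep PUnit (Fin n₀ → ℂ) (Fin n₁ → ℂ)) (sgn : ∀ {d₀ d₁ : ℕ}, RepSpace d₀ d₁ → ℤ) :
    PowerSeries Lam :=
  PowerSeries.mk fun r => ∑ᶠ q ∈ fibre θ' I₀ S r, contribution (sgn q.out) q.out

/-- `(1 - t)^x = ∑_d (-1)^d (x choose d) t^d`. -/
noncomputable def oneSubPow (x : Lam) : PowerSeries Lam :=
  PowerSeries.mk fun d => (-1) ^ d * Ring.choose x d

/-! ### The objects `I_{lP¹}` and `O_{P¹}(k-1)` -/

/-- `I_{lP¹} = (O_X ↠ O_{P¹} ⊗ (1 + t₃ + ⋯ + t₃^{l-1}))`: here `V₀ = ℂ[c]/c^l` with basis `1, c, …`,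
the framing is `1`, and `V₁ = 0`. -/
def thickIdeal (l : ℕ) : RepSpace l 0 where
  fr := LinearMap.pi fun j => if j.val = 0 then LinearMap.id else 0
  a _ := 0
  b _ := 0
  c := LinearMap.pi fun j =>
    if h : 0 < j.val then LinearMap.proj ⟨j.val - 1, by omega⟩ else 0
  d := 0
  rel_aba _ _ := rfl
  rel_bab _ _ := rfl
  rel_a _ _ := rfl
  rel_b i y := by simp

/-- `O_{P¹}(k-1)` on the zero section: `V₀ = H⁰(O(k-1))` and `V₁ = H⁰(O(k-2))` with their monomial
bases, `b₁` and `b₂` being multiplication by the homogeneous coordinates. -/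
def lineRep (k : ℕ) : FramedRep PUnit (Fin k → ℂ) (Fin (k - 1) → ℂ) where
  fr := 0
  a _ := 0
  b := ![LinearMap.pi fun j => if h : j.val < k - 1 then LinearMap.proj ⟨j.val, h⟩ else 0,
    LinearMap.pi fun j => if h : 0 < j.val then LinearMap.proj ⟨j.val - 1, by omega⟩ else 0]
  c := 0
  d := 0
  rel_aba _ _ := rfl
  rel_bab i y := by simp
  rel_a _ _ := rfl
  rel_b i y := by simp

/-! ### The sign rule -/

/-- The class of `O_{P¹}(aZ₀ + bZ_∞)` for `a + b ≥ 0`: by Riemann–Roch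
`χ(O(aZ₀ + bZ_∞)) = (t₀^{b+1} - t₀^{-a}) / (t₀ - 1) = ∑_{j=-a}^{b} t₀^j`. -/
noncomputable def lineClass (a b : ℤ) : KP1 :=
  (∑ j ∈ Finset.Icc (-a) b, ch (j • tw 0), ∑ j ∈ Finset.Icc (-a) (b - 1), ch (j • tw 0))

/-- `1 + t₃ + ⋯ + t₃^{n-1}`. -/
noncomputable def thick (n : ℕ) : KT := ∑ j ∈ Finset.range n, ch (j • tw 3)

/-- The class of the sheaf `F` in the system `(O_X → F)` given by the canonical morphism from
`I_{lP¹}` to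
`⨁_{i=1}^{k-1} F_i t₁ ∑_{j<d_i} t₃^j ⊕ ⨁_{i=1}^{k-1} F_i t₂ ∑_{j<e_i} t₃^j`
`⊕ ⨁_{i=0}^{k-1} F_i t₃^l ∑_{j<f_i} t₃^j`, where `F_i = O_{P¹}((k-1-i)Z₀ + iZ_∞)`. -/
noncomputable def canonicalClass (k l : ℕ) (d e f : ℕ → ℕ) : KP1 :=
  thick l • lineClass 0 0
    + ∑ i ∈ Finset.Icc 1 (k - 1), (ch (tw 1) * thick (d i)) • lineClass ((k : ℤ) - 1 - i) i
    + ∑ i ∈ Finset.Icc 1 (k - 1), (ch (tw 2) * thick (e i)) • lineClass ((k : ℤ) - 1 - i) i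
    + ∑ i ∈ Finset.range k, (ch (l • tw 3) * thick (f i)) • lineClass ((k : ℤ) - 1 - i) i

open Classical in
/-- The sign rule on the fibres of `π₊`: `sign(F)` is the number of positive `e_i`, for `F` in the
canonical form with exponents `d_i, e_i, f_i` (the class of `F` determines these exponents).
For `k = 2` there is only `e₁`, so `sign(F)` is `1` or `0` according as `e₁ > 0` or `e₁ = 0`. -/
noncomputable def signPlus (k l : ℕ) {d₀ d₁ : ℕ} (R : RepSpace d₀ d₁) : ℤ :=
  if h : ∃ e : ℕ → ℕ, ∃ d f : ℕ → ℕ, kClass R = canonicalClass k l d e f then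
    (((Finset.Icc 1 (k - 1)).filter fun i => 0 < h.choose i).card : ℤ)
  else 0

/-! ### The wall-crossing identity -/

/-- The wall `L₋⁻(k)`. -/
def wallLmm (k : ℕ) : Set (ℝ × ℝ) := {θ | θ.1 < θ.2 ∧ (k : ℝ) * θ.1 + ((k : ℝ) - 1) * θ.2 = 0}

/-- The identity `(∑_r t^r ∑_{π₊⁻¹} …) / (∑_r t^r ∑_{π₋⁻¹} …) = (1 - t)^{k m / λ₃}` for `Θ` on the
wall `L₋⁻(k)`, `Θ_± = (θ₀ ∓ 0⁺, θ₁)` and `I₀ = I_{lP¹}`, up to degree `t^N`, together with the facts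
that the sums are finite, that the Euler classes are defined (no character that is trivial occurs with
negative multiplicity) and that the denominator is invertible. -/
def WallCrossingUpTo (k l : ℕ) (θ : ℝ × ℝ) (N : ℕ) : Prop :=
  ∀ᶠ ε in 𝓝[>] (0 : ℝ),
    (∀ θ' ∈ ({(θ.1 - ε, θ.2), (θ.1 + ε, θ.2)} : Set (ℝ × ℝ)), ∀ r ≤ N,
      (fibre θ' (thickIdeal l) (lineRep k) r).Finite ∧
      ∀ q ∈ fibre θ' (thickIdeal l) (lineRep k) r, 0 ≤ (sqrtClass (kClass q.out)).coeff 0) ∧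
    PowerSeries.constantCoeff
      (fibreSeries (θ.1 + ε, θ.2) (thickIdeal l) (lineRep k) fun _ => 0) ≠ 0 ∧
    ∀ n ≤ N,
      PowerSeries.coeff n
        (fibreSeries (θ.1 - ε, θ.2) (thickIdeal l) (lineRep k) (signPlus k l)
          * (fibreSeries (θ.1 + ε, θ.2) (thickIdeal l) (lineRep k) fun _ => 0)⁻¹)
      = PowerSeries.coeff n (oneSubPow (k * (mPar / lam3)))

end PervConifold

/-! ### Kronecker modules: the two shifts and iterated extensions of `O(k-1)` -/

/-! The identity holds for all k ≥ 2, l ≥ 1 and in every degree (`wallCrossingUpTo`); the listed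
cases are instances. Below, κ = k - 2, and the variable l of the lemmas is one less than the l of
the theorem, so that the thickened line is ℂ[c]/c^(l+1).

Fixed points. A Kronecker module that is an iterated extension of copies of O(k-1) splits, so an
object in a fibre is, as a pair of vector spaces, ℂ[c]/c^(l+1) plus M ⊗ O(k-1) with dim M = r. Next
to the wall, stability leaves one direction of extension. For Θ₊ the copies of O(k-1) form a
subobject, and c^(l+1)·1 together with the a_i·1 must generate M under c; for Θ₋ the thickened line
is the subobject, and the extension class is a set of functionals that must separate the points of
M. The generators and their c-translates, respectively the functionals, are eigenvectors of the
torus with pairwise different characters. Hence M is multiplicity free, and a fixed point is a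
finite set of weights meeting each t₃-string in an initial segment (`IsPlusConf`) or in a final
segment (`IsMinusConf`).

Localisation. Put m = sλ₃ with s = l + 1 + d. The insertion is then the Euler class of a genuine
T₀-character, and its sum with the square root equals, up to a class of the form V^∨ - V, a virtual
tangent character. The Euler class of the latter is a product of factors (x_i - x_j ∓ λ₃)/(x_i -
x_j), where x_w is the linear form of the weight w, while V^∨ - V contributes only a sign; the
trivial characters in V account exactly for sign(F). Let X be the set of weights admissible for Θ₊,
with the infinite strings cut at length d, and let Y be the set for Θ₋. A subset that is not a union
of segments of the required kind has a vanishing factor, so both localisation sums extend over all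
subsets of X and of Y of the given size.

Source identity. The two sums are the two sides of the type A rational Euler transformation of
Kajihara and Noumi (`SourceIdentity.sum_subsets_eq`), which relates them by the factor (1 - t)^(|X|
- |Y|), and |X| - |Y| = ks = km/λ₃ (`card_plusSet`). It follows from expanding one determinant of
Cauchy–Vandermonde type along rows and along columns.

Interpolation. After the common factor is removed, the coefficients of t^n are polynomials in m.
They satisfy the identity at m = sλ₃ for infinitely many s, hence identically (`plusPoly_eq`). -/

namespace PervConifold

section Kronecker

variable {κ : ℕ} {M : Type*} [AddCommGroup M] [Module ℂ M]

/-- Multiplication by the two homogeneous coordinates on `M ⊗ H⁰(O(κ))`. -/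
def sh (κ : ℕ) (M : Type*) [AddCommGroup M] [Module ℂ M] :
    Fin 2 → (Fin (κ + 1) → M) →ₗ[ℂ] (Fin (κ + 2) → M) :=
  ![LinearMap.pi fun j => if h : j.val < κ + 1 then LinearMap.proj ⟨j.val, h⟩ else 0,
    LinearMap.pi fun j => if h : 0 < j.val then LinearMap.proj ⟨j.val - 1, by omega⟩ else 0]

@[simp] theorem sh_zero_castSucc (f : Fin (κ + 1) → M) (j : Fin (κ + 1)) :
    sh κ M 0 f j.castSucc = f j := by
  have h : (j.castSucc : ℕ) < κ + 1 := j.isLt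
  simp only [sh, Matrix.cons_val_zero, LinearMap.pi_apply, dif_pos h]
  rfl

@[simp] theorem sh_zero_last (f : Fin (κ + 1) → M) : sh κ M 0 f (Fin.last _) = 0 := by
  simp [sh]

@[simp] theorem sh_one_zero (f : Fin (κ + 1) → M) : sh κ M 1 f 0 = 0 := by
  simp [sh]

@[simp] theorem sh_one_succ (f : Fin (κ + 1) → M) (j : Fin (κ + 1)) :
    sh κ M 1 f j.succ = f j := by
  simp [sh]

theorem sh_zero_single (j : Fin (κ + 1)) (m : M) :
    sh κ M 0 (Pi.single j m) = Pi.single j.castSucc m := by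
  ext i
  refine Fin.lastCases ?_ (fun i => ?_) i
  · rw [sh_zero_last, Pi.single_eq_of_ne (Fin.castSucc_lt_last j).ne']
  · by_cases h : i = j
    · subst h; simp
    · rw [sh_zero_castSucc, Pi.single_eq_of_ne h, Pi.single_eq_of_ne (by simpa using h)]

theorem sh_one_single (j : Fin (κ + 1)) (m : M) :
    sh κ M 1 (Pi.single j m) = Pi.single j.succ m := by
  ext i
  refine Fin.cases ?_ (fun i => ?_) i
  · rw [sh_one_zero, Pi.single_eq_of_ne (Fin.succ_ne_zero j).symm]
  · by_cases h : i = j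
    · subst h; simp
    · rw [sh_one_succ, Pi.single_eq_of_ne h, Pi.single_eq_of_ne (by simpa using h)]

theorem sh_comp {N : Type*} [AddCommGroup N] [Module ℂ N] (g : M →ₗ[ℂ] N) (i : Fin 2)
    (f : Fin (κ + 1) → M) : sh κ N i (fun j => g (f j)) = fun j => g (sh κ M i f j) := by
  fin_cases i
  · ext j
    refine Fin.lastCases ?_ (fun j => ?_) j <;> simp
  · ext j
    refine Fin.cases ?_ (fun j => ?_) j <;> simp

/-- Morphisms `O(κ+1) → M ⊗ O(κ+1)` of Kronecker modules are given by elements of `M`. -/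
theorem exists_eq_single (n : Fin (κ + 1) → Fin (κ + 1) → M)
    (h : ∀ j : Fin κ, sh κ M 1 (n j.castSucc) = sh κ M 0 (n j.succ)) :
    ∃ m, ∀ j, n j = Pi.single j m := by
  -- Extended by zero, F is constant along diagonals (`h1`). A diagonal below the main one starts in
  -- column 0, where it vanishes (`h2`), and one above runs into column κ + 1, outside the range;
  -- only the main diagonal survives.
  let F : ℕ → ℕ → M := fun j i =>
    if h : j < κ + 1 ∧ i < κ + 1 then n ⟨j, h.1⟩ ⟨i, h.2⟩ else 0
  have hF : ∀ j i : Fin (κ + 1), n j i = F j i := by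
    intro j i
    simp only [F]
    rw [dif_pos ⟨j.isLt, i.isLt⟩]
  have h1 : ∀ j i, j < κ → i ≤ κ → F j i = F (j + 1) (i + 1) := by
    intro j i hj hi
    have := congrFun (h ⟨j, hj⟩) (Fin.succ ⟨i, by omega⟩)
    rw [sh_one_succ] at this
    have e1 : F j i = n (Fin.castSucc ⟨j, hj⟩) ⟨i, by omega⟩ := (hF ⟨j, by omega⟩ ⟨i, by omega⟩).symm
    rw [e1, this]
    rcases Nat.lt_or_ge i κ with hi' | hi'
    · have : Fin.succ (⟨i, by omega⟩ : Fin (κ + 1)) = Fin.castSucc ⟨i + 1, by omega⟩ := rfl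
      rw [this, sh_zero_castSucc]
      exact hF _ _
    · obtain rfl : i = κ := le_antisymm hi hi'
      have : Fin.succ (⟨i, by omega⟩ : Fin (i + 1)) = Fin.last _ := rfl
      rw [this, sh_zero_last]
      simp [F]
  have h2 : ∀ j, j < κ → F (j + 1) 0 = 0 := by
    intro j hj
    have := congrFun (h ⟨j, hj⟩) 0
    rw [sh_one_zero, show (0 : Fin (κ + 2)) = Fin.castSucc 0 from rfl, sh_zero_castSucc] at this
    have e := hF (Fin.succ ⟨j, hj⟩) 0
    rw [← this] at e
    exact e.symm
  have low : ∀ i j, i < j → j ≤ κ → F j i = 0 := by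
    intro i
    induction i with
    | zero =>
      intro j hj hjκ
      obtain ⟨j, rfl⟩ := Nat.exists_eq_succ_of_ne_zero hj.ne'
      exact h2 j (by omega)
    | succ i ih =>
      intro j hj hjκ
      obtain ⟨j, rfl⟩ := Nat.exists_eq_succ_of_ne_zero (Nat.ne_zero_of_lt hj)
      rw [Nat.succ_eq_add_one, ← h1 j i (by omega) (by omega)]
      exact ih j (by omega) (by omega)
  have high : ∀ d i j, i + d = κ → j < i → F j i = 0 := by
    intro d
    induction d with
    | zero =>
      intro i j hi hj
      rw [h1 j i (by omega) (by omega)]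
      simp only [F]
      rw [dif_neg (by omega)]
    | succ d ih =>
      intro i j hi hj
      rw [h1 j i (by omega) (by omega)]
      exact ih _ _ (by omega) (by omega)
  have diag : ∀ j, j ≤ κ → F j j = F 0 0 := by
    intro j
    induction j with
    | zero => intro; rfl
    | succ j ih => intro hj; rw [← h1 j j (by omega) (by omega)]; exact ih (by omega)
  refine ⟨F 0 0, fun j => ?_⟩
  ext i
  rw [hF]
  rcases lt_trichotomy (i : ℕ) j with hij | hij | hij
  · rw [low _ _ hij (by omega), Pi.single_eq_of_ne (by rintro rfl; omega)]
  · obtain rfl : i = j := Fin.ext hij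
    rw [diag _ (by omega), Pi.single_eq_same]
  · rw [high (κ - i) _ _ (by omega) hij, Pi.single_eq_of_ne (by rintro rfl; omega)]

/-- Functions with values in a submodule. -/
def piSub (n : ℕ) (N : Submodule ℂ M) : Submodule ℂ (Fin n → M) := Submodule.pi Set.univ fun _ => N

@[simp] theorem mem_piSub {n : ℕ} {N : Submodule ℂ M} {f : Fin n → M} :
    f ∈ piSub n N ↔ ∀ j, f j ∈ N := by
  simp [piSub]

theorem finrank_piSub (n : ℕ) (N : Submodule ℂ M) [FiniteDimensional ℂ N] :
    Module.finrank ℂ (piSub n N) = n * Module.finrank ℂ N := by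
  let e : (Fin n → N) ≃ₗ[ℂ] piSub n N :=
    { toFun := fun f => ⟨fun j => f j, mem_piSub.2 fun j => (f j).2⟩
      invFun := fun f j => ⟨f.1 j, mem_piSub.1 f.2 j⟩
      map_add' := fun _ _ => rfl
      map_smul' := fun _ _ => rfl
      left_inv := fun _ => rfl
      right_inv := fun _ => rfl }
  rw [← e.finrank_eq, Module.finrank_pi_fintype]
  simp

variable {V₀ V₁ : Type*} [AddCommGroup V₀] [Module ℂ V₀] [AddCommGroup V₁] [Module ℂ V₁]

/-- Morphisms from `O(κ+1)` to the Kronecker module `b`, modulo `A` in degree zero. -/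
def kHom (κ : ℕ) (b : Fin 2 → V₁ →ₗ[ℂ] V₀) (A : Submodule ℂ V₀) : Submodule ℂ (Fin (κ + 1) → V₁) where
  carrier := {n | ∀ j : Fin κ, b 1 (n j.castSucc) - b 0 (n j.succ) ∈ A}
  add_mem' := by
    intro n n' hn hn' j
    have := A.add_mem (hn j) (hn' j)
    simp only [Pi.add_apply, map_add]
    convert this using 1
    abel
  zero_mem' := by intro j; simp
  smul_mem' := by
    intro z n hn j
    have := A.smul_mem z (hn j)
    simpa [smul_sub] using this

theorem mem_kHom {b : Fin 2 → V₁ →ₗ[ℂ] V₀} {A : Submodule ℂ V₀} {n : Fin (κ + 1) → V₁} :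
    n ∈ kHom κ b A ↔ ∀ j : Fin κ, b 1 (n j.castSucc) - b 0 (n j.succ) ∈ A := Iff.rfl

/-- Rank–nullity: `kHom` is the kernel of a map from `V₁^(κ+1)` to `(A'/A)^κ`, with one factor for
each overlap between consecutive monomials. This is the Euler characteristic bound for morphisms out
of O(κ+1). -/
theorem le_finrank_kHom [FiniteDimensional ℂ V₀] [FiniteDimensional ℂ V₁]
    (b : Fin 2 → V₁ →ₗ[ℂ] V₀) (A A' : Submodule ℂ V₀) (hA : A ≤ A') (hb : ∀ i y, b i y ∈ A') :
    (κ + 1) * Module.finrank ℂ V₁ + κ * Module.finrank ℂ A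
      ≤ Module.finrank ℂ (kHom κ b A) + κ * Module.finrank ℂ A' := by
  let Φ : (Fin (κ + 1) → V₁) →ₗ[ℂ] (Fin κ → V₀ ⧸ A) := LinearMap.pi fun j =>
    A.mkQ ∘ₗ (b 1 ∘ₗ LinearMap.proj j.castSucc - b 0 ∘ₗ LinearMap.proj j.succ)
  have hker : LinearMap.ker Φ = kHom κ b A := by
    ext n
    rw [LinearMap.mem_ker, mem_kHom, funext_iff]
    refine forall_congr' fun j => ?_
    simp only [Φ, LinearMap.pi_apply, LinearMap.comp_apply, LinearMap.sub_apply,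
      LinearMap.proj_apply, Submodule.mkQ_apply, Pi.zero_apply, Submodule.Quotient.mk_eq_zero]
  have hrange : LinearMap.range Φ ≤ piSub κ (A'.map A.mkQ) := by
    rintro _ ⟨n, rfl⟩
    rw [mem_piSub]
    intro j
    exact Submodule.mem_map_of_mem (A'.sub_mem (hb 1 _) (hb 0 _))
  have h1 := LinearMap.finrank_range_add_finrank_ker Φ
  have h2 := Submodule.finrank_mono hrange
  rw [finrank_piSub] at h2
  have h3 : Module.finrank ℂ (A'.map A.mkQ) + Module.finrank ℂ A = Module.finrank ℂ A' := by
    have := LinearMap.finrank_range_add_finrank_ker (A.mkQ.domRestrict A')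
    rw [LinearMap.range_domRestrict, LinearMap.ker_domRestrict, Submodule.ker_mkQ] at this
    rw [← this]
    congr 1
    exact ((Submodule.submoduleOfEquivOfLe hA).finrank_eq).symm
  rw [hker] at h1
  have h4 : Module.finrank ℂ (Fin (κ + 1) → V₁) = (κ + 1) * Module.finrank ℂ V₁ := by
    rw [Module.finrank_pi_fintype]; simp
  rw [h4] at h1
  rw [← h3, mul_add]
  omega

/-- Semistability of `M ⊗ O(κ+1)`; the subobjects of the same slope are `M' ⊗ O(κ+1)`. -/
theorem finrank_sub_le [FiniteDimensional ℂ M] (W₀ : Submodule ℂ (Fin (κ + 2) → M))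
    (W₁ : Submodule ℂ (Fin (κ + 1) → M)) (hW : ∀ i, ∀ f ∈ W₁, sh κ M i f ∈ W₀) :
    (κ + 2) * Module.finrank ℂ W₁ ≤ (κ + 1) * Module.finrank ℂ W₀ ∧
    ((κ + 2) * Module.finrank ℂ W₁ = (κ + 1) * Module.finrank ℂ W₀ →
      ∃ M' : Submodule ℂ M, W₀ = piSub _ M' ∧ W₁ = piSub _ M') := by
  classical
  -- M' is the largest subspace with M' ⊗ O(κ+1) inside W. Modulo it no nonzero morphism from O(κ+1)
  -- into W remains, and `le_finrank_kHom` gives (κ+1)w₁ ≤ κw₀ for the dimensions of the images,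
  -- which is stronger than semistability.
  let M' : Submodule ℂ M :=
    (⨅ j, W₀.comap (LinearMap.single ℂ (fun _ => M) j)) ⊓ ⨅ j, W₁.comap (LinearMap.single ℂ (fun _ => M) j)
  have hM'₀ : ∀ m ∈ M', ∀ j, Pi.single j m ∈ W₀ := fun m hm j => by
    have := (Submodule.mem_iInf _).1 hm.1 j
    simpa using this
  have hM'₁ : ∀ m ∈ M', ∀ j, Pi.single j m ∈ W₁ := fun m hm j => by
    have := (Submodule.mem_iInf _).1 hm.2 j
    simpa using this
  have hp0 : piSub _ M' ≤ W₀ := by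
    intro f hf
    rw [mem_piSub] at hf
    rw [← Finset.univ_sum_single f]
    exact W₀.sum_mem fun j _ => hM'₀ _ (hf j) j
  have hp1 : piSub _ M' ≤ W₁ := by
    intro f hf
    rw [mem_piSub] at hf
    rw [← Finset.univ_sum_single f]
    exact W₁.sum_mem fun j _ => hM'₁ _ (hf j) j
  let π : ∀ n : ℕ, (Fin n → M) →ₗ[ℂ] (Fin n → M ⧸ M') := fun n =>
    LinearMap.pi fun j => M'.mkQ ∘ₗ LinearMap.proj j
  have hπ : ∀ n (f : Fin n → M), π n f = fun j => M'.mkQ (f j) := fun _ _ => rfl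
  have hkerπ : ∀ n, LinearMap.ker (π n) = piSub n M' := by
    intro n
    ext f
    rw [LinearMap.mem_ker, mem_piSub, funext_iff]
    exact forall_congr' fun j => by simp [hπ]
  have hdim : ∀ n (W : Submodule ℂ (Fin n → M)), piSub n M' ≤ W →
      Module.finrank ℂ (W.map (π n)) + n * Module.finrank ℂ M' = Module.finrank ℂ W := by
    intro n W hW
    have := LinearMap.finrank_range_add_finrank_ker ((π n).domRestrict W)
    rw [LinearMap.range_domRestrict, LinearMap.ker_domRestrict, hkerπ] at this
    rw [← this, ← finrank_piSub]
    congr 1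
    exact ((Submodule.submoduleOfEquivOfLe hW).finrank_eq).symm
  have d0 := hdim _ W₀ hp0
  have d1 := hdim _ W₁ hp1
  have hbar : ∀ i, ∀ y ∈ W₁.map (π _), sh κ (M ⧸ M') i y ∈ W₀.map (π _) := by
    rintro i _ ⟨f, hf, rfl⟩
    exact ⟨_, hW i f hf, (sh_comp M'.mkQ i f).symm⟩
  let b : Fin 2 → W₁.map (π _) →ₗ[ℂ] W₀.map (π _) := fun i => (sh κ (M ⧸ M') i).restrict (hbar i)
  have hcount := le_finrank_kHom (κ := κ) b ⊥ ⊤ bot_le (fun _ _ => trivial)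
  rw [finrank_bot, mul_zero, add_zero, finrank_top] at hcount
  have hzero : kHom κ b ⊥ = ⊥ := by
    rw [Submodule.eq_bot_iff]
    intro n hn
    have hn' : ∀ j : Fin κ, sh κ (M ⧸ M') 1 (n j.castSucc) = sh κ (M ⧸ M') 0 (n j.succ) := by
      intro j
      have := hn j
      rw [Submodule.mem_bot, sub_eq_zero] at this
      exact congrArg Subtype.val this
    obtain ⟨m, hm⟩ := exists_eq_single (fun j => (n j : Fin (κ + 1) → M ⧸ M')) hn'
    obtain ⟨m, rfl⟩ := M'.mkQ_surjective m
    have lift1 : ∀ j, Pi.single j m ∈ W₁ := by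
      intro j
      obtain ⟨f, hf, hfj⟩ := (n j).2
      have : f - Pi.single j m ∈ piSub _ M' := by
        rw [← hkerπ, LinearMap.mem_ker, map_sub, hfj, hm j, sub_eq_zero, hπ]
        ext i
        by_cases h : i = j
        · subst h; simp
        · rw [Pi.single_eq_of_ne h, Pi.single_eq_of_ne h, map_zero]
      have := W₁.sub_mem hf (hp1 this)
      simpa using this
    have lift0 : ∀ j, Pi.single j m ∈ W₀ := by
      intro j
      refine Fin.lastCases ?_ (fun j => ?_) j
      · have := hW 1 _ (lift1 (Fin.last _))
        rwa [sh_one_single, Fin.succ_last] at this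
      · have := hW 0 _ (lift1 j)
        rwa [sh_zero_single] at this
    have hmM : m ∈ M' := by
      refine ⟨(Submodule.mem_iInf _).2 fun j => ?_, (Submodule.mem_iInf _).2 fun j => ?_⟩
      · simpa using lift0 j
      · simpa using lift1 j
    ext j
    rw [hm j, Submodule.mkQ_apply, (Submodule.Quotient.mk_eq_zero _).2 hmM, Pi.single_zero]
    rfl
  rw [hzero, finrank_bot, zero_add] at hcount
  -- Since κ(κ+2) = (κ+1)² - 1, the bound leaves a surplus w₀; in the case of equality this surplus
  -- must vanish, so W is M' ⊗ O(κ+1).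
  have key : (κ + 1) * ((κ + 2) * Module.finrank ℂ (W₁.map (π (κ + 1))))
      + Module.finrank ℂ (W₀.map (π (κ + 2)))
      ≤ (κ + 1) * ((κ + 1) * Module.finrank ℂ (W₀.map (π (κ + 2)))) := by
    nlinarith [Nat.mul_le_mul_left (κ + 2) hcount]
  constructor
  · rw [← d0, ← d1]
    have : (κ + 2) * Module.finrank ℂ (W₁.map (π (κ + 1)))
        ≤ (κ + 1) * Module.finrank ℂ (W₀.map (π (κ + 2))) :=
      Nat.le_of_mul_le_mul_left (le_of_add_le_left key) (Nat.succ_pos κ)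
    nlinarith
  · intro heq
    rw [← d0, ← d1] at heq
    have heq' : (κ + 2) * Module.finrank ℂ (W₁.map (π (κ + 1)))
        = (κ + 1) * Module.finrank ℂ (W₀.map (π (κ + 2))) := by nlinarith
    rw [heq'] at key
    have h0 : Module.finrank ℂ (W₀.map (π (κ + 2))) = 0 := by omega
    have h1 : Module.finrank ℂ (W₁.map (π (κ + 1))) = 0 := by
      rw [h0, mul_zero] at heq'
      exact (Nat.mul_eq_zero.1 heq').resolve_left (by omega)
    refine ⟨M', (Submodule.eq_of_le_of_finrank_eq hp0 ?_).symm,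
      (Submodule.eq_of_le_of_finrank_eq hp1 ?_).symm⟩
    · rw [finrank_piSub, ← d0, h0, zero_add]
    · rw [finrank_piSub, ← d1, h1, zero_add]

/-- Evaluation `Hom(O(κ+1), E) ⊗ O(κ+1) → E` in degree one. -/
def kEval₁ (b : Fin 2 → V₁ →ₗ[ℂ] V₀) (A : Submodule ℂ V₀) :
    (Fin (κ + 1) → kHom κ b A) →ₗ[ℂ] V₁ :=
  ∑ j, LinearMap.proj j ∘ₗ (kHom κ b A).subtype ∘ₗ LinearMap.proj j

/-- Evaluation `Hom(O(κ+1), E) ⊗ O(κ+1) → E` in degree zero. -/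
def kEval₀ (b : Fin 2 → V₁ →ₗ[ℂ] V₀) (A : Submodule ℂ V₀) :
    (Fin (κ + 2) → kHom κ b A) →ₗ[ℂ] V₀ :=
  ∑ j : Fin (κ + 1), b 0 ∘ₗ LinearMap.proj j ∘ₗ (kHom κ b A).subtype ∘ₗ LinearMap.proj j.castSucc
    + b 1 ∘ₗ LinearMap.proj (Fin.last κ) ∘ₗ (kHom κ b A).subtype ∘ₗ LinearMap.proj (Fin.last _)

theorem kEval₁_apply (b : Fin 2 → V₁ →ₗ[ℂ] V₀) (A : Submodule ℂ V₀) (f : Fin (κ + 1) → kHom κ b A) :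
    kEval₁ b A f = ∑ j, (f j).1 j := by
  simp [kEval₁]

theorem kEval₀_apply (b : Fin 2 → V₁ →ₗ[ℂ] V₀) (A : Submodule ℂ V₀) (f : Fin (κ + 2) → kHom κ b A) :
    kEval₀ b A f = ∑ j : Fin (κ + 1), b 0 ((f j.castSucc).1 j)
      + b 1 ((f (Fin.last _)).1 (Fin.last _)) := by
  simp [kEval₀]

theorem b_zero_kEval₁ (b : Fin 2 → V₁ →ₗ[ℂ] V₀) (A : Submodule ℂ V₀)
    (f : Fin (κ + 1) → kHom κ b A) : b 0 (kEval₁ b A f) = kEval₀ b A (sh κ _ 0 f) := by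
  simp [kEval₀_apply, kEval₁_apply]

/-- `kEval₀` uses `b 0` on all monomials but the last, so `b 1` is respected only up to the defects
of the morphisms, which lie in A. These defects are the later data β. -/
theorem b_one_kEval₁ (b : Fin 2 → V₁ →ₗ[ℂ] V₀) (A : Submodule ℂ V₀)
    (f : Fin (κ + 1) → kHom κ b A) : b 1 (kEval₁ b A f) = kEval₀ b A (sh κ _ 1 f)
      + ∑ j : Fin κ, (b 1 ((f j.castSucc).1 j.castSucc) - b 0 ((f j.castSucc).1 j.succ)) := by
  rw [kEval₀_apply, kEval₁_apply, map_sum, Fin.sum_univ_castSucc]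
  rw [Fin.sum_univ_succ (f := fun j : Fin (κ + 1) => b 0 ((sh κ _ 1 f j.castSucc).1 j))]
  have h0 : sh κ (kHom κ b A) 1 f (Fin.castSucc 0) = 0 := sh_one_zero f
  have h1 : ∀ j : Fin κ, sh κ (kHom κ b A) 1 f j.succ.castSucc = f j.castSucc := fun j => by
    rw [← Fin.succ_castSucc, sh_one_succ]
  have h2 : sh κ (kHom κ b A) 1 f (Fin.last _) = f (Fin.last _) := by
    rw [← Fin.succ_last, sh_one_succ]
  simp only [h0, h1, h2, Finset.sum_sub_distrib, Submodule.coe_zero, Pi.zero_apply, map_zero]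
  abel

/-- `E = (V₀, V₁)` is, modulo `A 0` in degree zero, an iterated extension of `r` copies of
`O(κ+1)`. -/
structure IsKroneckerFiltration (κ : ℕ) {r : ℕ} (b : Fin 2 → V₁ →ₗ[ℂ] V₀)
    (A : Fin (r + 1) → Submodule ℂ V₀) (B : Fin (r + 1) → Submodule ℂ V₁) : Prop where
  bot : B 0 = ⊥
  top : B (Fin.last _) = ⊤
  le₀ : ∀ s : Fin r, A s.castSucc ≤ A s.succ
  le₁ : ∀ s : Fin r, B s.castSucc ≤ B s.succ
  mem : ∀ s i, ∀ y ∈ B s, b i y ∈ A s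
  quot : ∀ s : Fin r, ∃ (f₀ : A s.succ →ₗ[ℂ] (Fin (κ + 2) → ℂ)) (f₁ : B s.succ →ₗ[ℂ] (Fin (κ + 1) → ℂ)),
    (∀ i (y : B s.succ), f₀ ⟨b i y, mem s.succ i y y.2⟩ = sh κ ℂ i (f₁ y)) ∧
    Function.Surjective f₀ ∧ Function.Surjective f₁ ∧
    (∀ x, f₀ x = 0 ↔ (x : V₀) ∈ A s.castSucc) ∧ (∀ y, f₁ y = 0 ↔ (y : V₁) ∈ B s.castSucc)

namespace IsKroneckerFiltration

variable {r : ℕ} {b : Fin 2 → V₁ →ₗ[ℂ] V₀} {A : Fin (r + 1) → Submodule ℂ V₀}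
  {B : Fin (r + 1) → Submodule ℂ V₁}

theorem zero_le (H : IsKroneckerFiltration κ b A B) (s : Fin (r + 1)) : A 0 ≤ A s := by
  induction s using Fin.induction with
  | zero => exact le_rfl
  | succ s ih => exact ih.trans (H.le₀ s)

theorem finrank_step {V : Type*} [AddCommGroup V] [Module ℂ V] [FiniteDimensional ℂ V]
    {N N' : Submodule ℂ V} (h : N ≤ N') {n : ℕ} (f : N' →ₗ[ℂ] (Fin n → ℂ))
    (hf : Function.Surjective f) (hker : ∀ x, f x = 0 ↔ (x : V) ∈ N) :
    Module.finrank ℂ N' = Module.finrank ℂ N + n := by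
  have := LinearMap.finrank_range_add_finrank_ker f
  rw [LinearMap.range_eq_top.2 hf, finrank_top, Module.finrank_fin_fun] at this
  have hk : LinearMap.ker f = N.submoduleOf N' := by
    ext x
    rw [LinearMap.mem_ker, hker]
    rfl
  rw [hk, (Submodule.submoduleOfEquivOfLe h).finrank_eq] at this
  omega

theorem finrank_eq [FiniteDimensional ℂ V₀] [FiniteDimensional ℂ V₁]
    (H : IsKroneckerFiltration κ b A B) (s : Fin (r + 1)) :
    Module.finrank ℂ (A s) = Module.finrank ℂ (A 0) + s * (κ + 2) ∧
    Module.finrank ℂ (B s) = s * (κ + 1) := by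
  induction s using Fin.induction with
  | zero => simp [H.bot]
  | succ s ih =>
    obtain ⟨f₀, f₁, -, h0, h1, k0, k1⟩ := H.quot s
    rw [finrank_step (H.le₀ s) f₀ h0 k0, finrank_step (H.le₁ s) f₁ h1 k1, ih.1, ih.2]
    simp only [Fin.val_castSucc, Fin.val_succ]
    constructor <;> ring

/-- Descent along the filtration. On a quotient O(κ+1) each component of f induces an endomorphism,
hence a scalar, and the evaluation returns the vector z of these scalars. If the value lies in A 0
then z = 0, and f drops by one step, down to B 0 = ⊥. -/
theorem eq_zero_of_kEval₀_mem (H : IsKroneckerFiltration κ b A B)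
    {f : Fin (κ + 2) → kHom κ b (A 0)} (hf : kEval₀ b (A 0) f ∈ A 0) : f = 0 := by
  have key : ∀ s : Fin (r + 1), (∀ j i, (f j).1 i ∈ B s) → ∀ j i, (f j).1 i ∈ B 0 := by
    intro s
    induction s using Fin.induction with
    | zero => exact id
    | succ s ih =>
      intro hs
      apply ih
      obtain ⟨f₀, f₁, hb, -, -, k0, k1⟩ := H.quot s
      have hz : ∀ j, ∃ z : ℂ, ∀ i, f₁ ⟨(f j).1 i, hs j i⟩ = Pi.single i z := by
        intro j
        refine exists_eq_single (fun i => f₁ ⟨(f j).1 i, hs j i⟩) fun i => ?_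
        rw [← hb, ← hb, ← sub_eq_zero, ← map_sub, k0]
        exact H.zero_le s.castSucc ((f j).2 i)
      choose z hz using hz
      have hsum : f₀ ⟨kEval₀ b (A 0) f, H.zero_le s.succ hf⟩ = z := by
        have hx : (⟨kEval₀ b (A 0) f, H.zero_le s.succ hf⟩ : A s.succ)
            = ∑ j : Fin (κ + 1), ⟨b 0 ((f j.castSucc).1 j), H.mem s.succ 0 _ (hs _ _)⟩
              + ⟨b 1 ((f (Fin.last _)).1 (Fin.last _)), H.mem s.succ 1 _ (hs _ _)⟩ := by
          apply Subtype.ext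
          refine (kEval₀_apply b (A 0) f).trans ?_
          simp
        have e0 : ∀ j : Fin (κ + 1), f₀ ⟨b 0 ((f j.castSucc).1 j), H.mem s.succ 0 _ (hs _ _)⟩
            = Pi.single j.castSucc (z j.castSucc) := fun j => by
          rw [hb 0 ⟨(f j.castSucc).1 j, hs _ _⟩, hz, sh_zero_single]
        have e1 : f₀ ⟨b 1 ((f (Fin.last _)).1 (Fin.last _)), H.mem s.succ 1 _ (hs _ _)⟩
            = Pi.single (Fin.last _) (z (Fin.last _)) := by
          rw [hb 1 ⟨(f (Fin.last _)).1 (Fin.last _), hs _ _⟩, hz, sh_one_single, Fin.succ_last]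
        rw [hx, map_add, map_sum, e1, Finset.sum_congr rfl fun j _ => e0 j,
          ← Fin.sum_univ_castSucc (f := fun j => Pi.single j (z j)), Finset.univ_sum_single]
      have hz0 : z = 0 := by
        rw [← hsum, k0]
        exact H.zero_le _ hf
      intro j i
      have := hz j i
      rw [hz0, Pi.zero_apply, Pi.single_zero, k1] at this
      exact this
  ext j i
  have := key (Fin.last _) (fun j i => by rw [H.top]; trivial) j i
  rw [H.bot, Submodule.mem_bot] at this
  simpa using this

theorem kEval₀_mem (H : IsKroneckerFiltration κ b A B) (f : Fin (κ + 2) → kHom κ b (A 0)) :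
    kEval₀ b (A 0) f ∈ A (Fin.last _) := by
  rw [kEval₀_apply]
  have hm : ∀ i y, b i y ∈ A (Fin.last _) := fun i y =>
    H.mem (Fin.last _) i y (by rw [H.top]; trivial)
  exact Submodule.add_mem _ (Submodule.sum_mem _ fun j _ => hm _ _) (hm _ _)

theorem kEval₁_injective (H : IsKroneckerFiltration κ b A B) :
    Function.Injective (kEval₁ (κ := κ) b (A 0)) := by
  rw [← LinearMap.ker_eq_bot, Submodule.eq_bot_iff]
  intro f hf
  rw [LinearMap.mem_ker] at hf
  have h := b_zero_kEval₁ b (A 0) f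
  rw [hf, map_zero] at h
  have h0 := H.eq_zero_of_kEval₀_mem (f := sh κ _ 0 f) (by rw [← h]; exact zero_mem _)
  ext1 j
  rw [← sh_zero_castSucc f j, h0]
  rfl

/-- Injectivity of the evaluation bounds the dimension from above, the count in `le_finrank_kHom`
from below. Equality of the two bounds is the splitting of iterated extensions. -/
theorem finrank_kHom [FiniteDimensional ℂ V₀] [FiniteDimensional ℂ V₁]
    (H : IsKroneckerFiltration κ b A B) : Module.finrank ℂ (kHom κ b (A 0)) = r := by
  have h1 := LinearMap.finrank_le_finrank_of_injective H.kEval₁_injective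
  rw [Module.finrank_pi_fintype] at h1
  simp only [Finset.sum_const, Finset.card_univ, Fintype.card_fin, smul_eq_mul] at h1
  have hV : Module.finrank ℂ V₁ = r * (κ + 1) := by
    rw [← finrank_top, ← H.top, (H.finrank_eq _).2, Fin.val_last]
  have h2 := le_finrank_kHom (κ := κ) b (A 0) (A (Fin.last _)) (H.zero_le _)
    (fun i y => H.mem (Fin.last _) i y (by rw [H.top]; trivial))
  rw [(H.finrank_eq (Fin.last _)).1, hV, Fin.val_last] at h2
  rw [hV] at h1
  apply le_antisymm
  · rw [mul_comm r] at h1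
    exact Nat.le_of_mul_le_mul_left h1 (Nat.succ_pos κ)
  · nlinarith

theorem kEval₁_bijective [FiniteDimensional ℂ V₀] [FiniteDimensional ℂ V₁]
    (H : IsKroneckerFiltration κ b A B) : Function.Bijective (kEval₁ (κ := κ) b (A 0)) := by
  refine ⟨H.kEval₁_injective, ?_⟩
  rw [← LinearMap.injective_iff_surjective_of_finrank_eq_finrank]
  · exact H.kEval₁_injective
  · rw [Module.finrank_pi_fintype]
    simp only [Finset.sum_const, Finset.card_univ, Fintype.card_fin, smul_eq_mul]
    rw [H.finrank_kHom, ← finrank_top ℂ V₁, ← H.top, (H.finrank_eq _).2, Fin.val_last, mul_comm]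

/-- The image of the evaluation meets A 0 trivially by `eq_zero_of_kEval₀_mem`, and the dimensions
add up, so the two span the top of the filtration. -/
theorem exists_kEval₀ [FiniteDimensional ℂ V₀] [FiniteDimensional ℂ V₁]
    (H : IsKroneckerFiltration κ b A B) {x : V₀} (hx : x ∈ A (Fin.last _)) :
    ∃ f, x - kEval₀ (κ := κ) b (A 0) f ∈ A 0 := by
  set R := LinearMap.range (kEval₀ (κ := κ) b (A 0)) with hR
  have hinj : Function.Injective (kEval₀ (κ := κ) b (A 0)) := by
    rw [← LinearMap.ker_eq_bot, Submodule.eq_bot_iff]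
    intro f hf
    exact H.eq_zero_of_kEval₀_mem (by rw [LinearMap.mem_ker.1 hf]; exact zero_mem _)
  have hRd : Module.finrank ℂ R = r * (κ + 2) := by
    rw [LinearMap.finrank_range_of_inj hinj, Module.finrank_pi_fintype]
    simp [H.finrank_kHom, mul_comm]
  have hinf : R ⊓ A 0 = ⊥ := by
    rw [Submodule.eq_bot_iff]
    rintro _ ⟨⟨f, rfl⟩, hf⟩
    rw [H.eq_zero_of_kEval₀_mem hf, map_zero]
  have hsup : R ⊔ A 0 = A (Fin.last _) := by
    apply Submodule.eq_of_le_of_finrank_eq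
    · refine sup_le ?_ (H.zero_le _)
      rintro _ ⟨f, rfl⟩
      exact H.kEval₀_mem f
    · have := Submodule.finrank_sup_add_finrank_inf_eq R (A 0)
      rw [hinf, finrank_bot, add_zero] at this
      rw [this, hRd, (H.finrank_eq (Fin.last _)).1, Fin.val_last, add_comm]
  rw [← hsup, Submodule.mem_sup] at hx
  obtain ⟨_, ⟨f, rfl⟩, a, ha, rfl⟩ := hx
  exact ⟨f, by simpa using ha⟩

end IsKroneckerFiltration

end Kronecker

end PervConifold

/-! ### Isomorphisms of framed representations and weights -/

namespace PervConifold

section RepIso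

variable {V₀ V₁ V₀' V₁' V₀'' V₁'' : Type} [AddCommGroup V₀] [Module ℂ V₀] [AddCommGroup V₁]
  [Module ℂ V₁] [AddCommGroup V₀'] [Module ℂ V₀'] [AddCommGroup V₁'] [Module ℂ V₁']
  [AddCommGroup V₀''] [Module ℂ V₀''] [AddCommGroup V₁''] [Module ℂ V₁'']

/-- Isomorphism of framed representations, the identity on the framing space. -/
def RepIso (R : FramedRep ℂ V₀ V₁) (R' : FramedRep ℂ V₀' V₁') : Prop :=
  ∃ (g₀ : V₀ ≃ₗ[ℂ] V₀') (g₁ : V₁ ≃ₗ[ℂ] V₁'),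
    IsHom R R' LinearMap.id g₀.toLinearMap g₁.toLinearMap

theorem IsHom.symm {R : FramedRep ℂ V₀ V₁} {R' : FramedRep ℂ V₀' V₁'} {g₀ : V₀ ≃ₗ[ℂ] V₀'}
    {g₁ : V₁ ≃ₗ[ℂ] V₁'} (h : IsHom R R' LinearMap.id g₀.toLinearMap g₁.toLinearMap) :
    IsHom R' R LinearMap.id g₀.symm.toLinearMap g₁.symm.toLinearMap where
  fr u := by
    have := h.fr u
    simp only [LinearEquiv.coe_coe, LinearMap.id_apply] at this ⊢
    rw [← this, LinearEquiv.symm_apply_apply]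
  a i x := by
    have := h.a i (g₀.symm x)
    simp only [LinearEquiv.coe_coe, LinearEquiv.apply_symm_apply] at this ⊢
    rw [← this, LinearEquiv.symm_apply_apply]
  b i x := by
    have := h.b i (g₁.symm x)
    simp only [LinearEquiv.coe_coe, LinearEquiv.apply_symm_apply] at this ⊢
    rw [← this, LinearEquiv.symm_apply_apply]
  c x := by
    have := h.c (g₀.symm x)
    simp only [LinearEquiv.coe_coe, LinearEquiv.apply_symm_apply] at this ⊢
    rw [← this, LinearEquiv.symm_apply_apply]
  d x := by
    have := h.d (g₁.symm x)
    simp only [LinearEquiv.coe_coe, LinearEquiv.apply_symm_apply] at this ⊢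
    rw [← this, LinearEquiv.symm_apply_apply]

theorem IsHom.trans {R : FramedRep ℂ V₀ V₁} {R' : FramedRep ℂ V₀' V₁'} {R'' : FramedRep ℂ V₀'' V₁''}
    {g₀ : V₀ ≃ₗ[ℂ] V₀'} {g₁ : V₁ ≃ₗ[ℂ] V₁'} {g₀' : V₀' ≃ₗ[ℂ] V₀''} {g₁' : V₁' ≃ₗ[ℂ] V₁''}
    (h : IsHom R R' LinearMap.id g₀.toLinearMap g₁.toLinearMap)
    (h' : IsHom R' R'' LinearMap.id g₀'.toLinearMap g₁'.toLinearMap) :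
    IsHom R R'' LinearMap.id (g₀.trans g₀').toLinearMap (g₁.trans g₁').toLinearMap where
  fr u := (congrArg g₀' (h.fr u)).trans (h'.fr u)
  a i x := (congrArg g₁' (h.a i x)).trans (h'.a i (g₀ x))
  b i x := (congrArg g₀' (h.b i x)).trans (h'.b i (g₁ x))
  c x := (congrArg g₀' (h.c x)).trans (h'.c (g₀ x))
  d x := (congrArg g₁' (h.d x)).trans (h'.d (g₁ x))

theorem RepIso.symm {R : FramedRep ℂ V₀ V₁} {R' : FramedRep ℂ V₀' V₁'} (h : RepIso R R') :
    RepIso R' R :=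
  let ⟨g₀, g₁, hg⟩ := h
  ⟨g₀.symm, g₁.symm, hg.symm⟩

theorem RepIso.trans {R : FramedRep ℂ V₀ V₁} {R' : FramedRep ℂ V₀' V₁'} {R'' : FramedRep ℂ V₀'' V₁''}
    (h : RepIso R R') (h' : RepIso R' R'') : RepIso R R'' :=
  let ⟨_, _, hg⟩ := h
  let ⟨_, _, hg'⟩ := h'
  ⟨_, _, hg.trans hg'⟩

/-- The preimage of a subrepresentation under an isomorphism. -/
def SubRep.comap {R : FramedRep ℂ V₀ V₁} {R' : FramedRep ℂ V₀' V₁'} {g₀ : V₀ ≃ₗ[ℂ] V₀'}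
    {g₁ : V₁ ≃ₗ[ℂ] V₁'} (h : IsHom R R' LinearMap.id g₀.toLinearMap g₁.toLinearMap) (W : SubRep R') :
    SubRep R where
  sU := W.sU
  s₀ := W.s₀.comap g₀.toLinearMap
  s₁ := W.s₁.comap g₁.toLinearMap
  fr_mem u hu := by rw [Submodule.mem_comap, h.fr]; exact W.fr_mem u hu
  a_mem i x hx := by rw [Submodule.mem_comap, h.a]; exact W.a_mem i _ hx
  b_mem i x hx := by rw [Submodule.mem_comap, h.b]; exact W.b_mem i _ hx
  c_mem x hx := by rw [Submodule.mem_comap, h.c]; exact W.c_mem _ hx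
  d_mem x hx := by rw [Submodule.mem_comap, h.d]; exact W.d_mem _ hx

theorem finrank_comap_equiv (g : V₀ ≃ₗ[ℂ] V₀') (N : Submodule ℂ V₀') :
    Module.finrank ℂ (N.comap g.toLinearMap) = Module.finrank ℂ N := by
  rw [Submodule.comap_equiv_eq_map_symm]
  exact LinearEquiv.finrank_map_eq g.symm N

theorem comap_equiv_eq_bot (g : V₀ ≃ₗ[ℂ] V₀') (N : Submodule ℂ V₀') :
    N.comap g.toLinearMap = ⊥ ↔ N = ⊥ := by
  rw [Submodule.comap_equiv_eq_map_symm]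
  exact Submodule.map_eq_bot_iff (e := g.symm)

theorem comap_equiv_eq_top (g : V₀ ≃ₗ[ℂ] V₀') (N : Submodule ℂ V₀') :
    N.comap g.toLinearMap = ⊤ ↔ N = ⊤ := by
  constructor
  · intro h
    rw [eq_top_iff]
    intro x _
    have : g.symm x ∈ N.comap g.toLinearMap := by rw [h]; trivial
    simpa using this
  · rintro rfl
    rfl

theorem RepIso.isStable {R : FramedRep ℂ V₀ V₁} {R' : FramedRep ℂ V₀' V₁'} (h : RepIso R R')
    {θ : ℝ × ℝ} (hR : IsStable θ R) : IsStable θ R' := by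
  obtain ⟨g₀, g₁, hg⟩ := h
  constructor
  · intro W hU h0
    have := hR.1 (W.comap hg) hU (h0.imp (mt (comap_equiv_eq_bot _ _).1) (mt (comap_equiv_eq_bot _ _).1))
    rwa [show (W.comap hg).s₀ = W.s₀.comap g₀.toLinearMap from rfl,
      show (W.comap hg).s₁ = W.s₁.comap g₁.toLinearMap from rfl, finrank_comap_equiv,
      finrank_comap_equiv] at this
  · intro W hU h0
    have := hR.2 (W.comap hg) hU (h0.imp (mt (comap_equiv_eq_top _ _).1) (mt (comap_equiv_eq_top _ _).1))
    rwa [show (W.comap hg).s₀ = W.s₀.comap g₀.toLinearMap from rfl,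
      show (W.comap hg).s₁ = W.s₁.comap g₁.toLinearMap from rfl, finrank_comap_equiv,
      finrank_comap_equiv, g₀.finrank_eq, g₁.finrank_eq] at this

theorem IsTorusIso.conj {R : FramedRep ℂ V₀ V₁} {R' : FramedRep ℂ V₀' V₁'} {g₀ : V₀ ≃ₗ[ℂ] V₀'}
    {g₁ : V₁ ≃ₗ[ℂ] V₁'} (h : IsHom R R' LinearMap.id g₀.toLinearMap g₁.toLinearMap) {t : Torus}
    {k₀ : V₀ ≃ₗ[ℂ] V₀} {k₁ : V₁ ≃ₗ[ℂ] V₁} (hk : IsTorusIso t R k₀ k₁) :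
    IsTorusIso t R' (g₀.symm.trans (k₀.trans g₀)) (g₁.symm.trans (k₁.trans g₁)) := by
  have h2 : IsHom (R.twist t) (R'.twist t) LinearMap.id g₀.toLinearMap g₁.toLinearMap :=
    { fr := h.fr
      a := fun i x => by simpa [FramedRep.twist] using h.a i x
      b := fun i x => by simpa [FramedRep.twist] using h.b i x
      c := fun x => by simpa [FramedRep.twist] using h.c x
      d := fun x => by simpa [FramedRep.twist] using h.d x }
  exact h.symm.trans (IsHom.trans hk h2)

theorem RepIso.isTorusFixed {R : FramedRep ℂ V₀ V₁} {R' : FramedRep ℂ V₀' V₁'} (h : RepIso R R')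
    (hR : IsTorusFixed R) : IsTorusFixed R' := by
  obtain ⟨g₀, g₁, hg⟩ := h
  intro t
  obtain ⟨k₀, k₁, hk⟩ := hR t
  exact ⟨_, _, hk.conj hg⟩

theorem IsSubquotient.comap {R : FramedRep ℂ V₀ V₁} {R' : FramedRep ℂ V₀' V₁'} {g₀ : V₀ ≃ₗ[ℂ] V₀'}
    {g₁ : V₁ ≃ₗ[ℂ] V₁'} (h : IsHom R R' LinearMap.id g₀.toLinearMap g₁.toLinearMap)
    {U A₀ A₁ : Type} [AddCommGroup U] [Module ℂ U] [AddCommGroup A₀] [Module ℂ A₀] [AddCommGroup A₁]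
    [Module ℂ A₁] {S : FramedRep U A₀ A₁} {W W' : SubRep R'} (hW : IsSubquotient W W' S) :
    IsSubquotient (W.comap h) (W'.comap h) S := by
  obtain ⟨⟨hU, h0, h1⟩, fU, f₀, f₁, hf, sU, s0, s1, kU, k0, k1⟩ := hW
  let r₀ : W'.s₀.comap g₀.toLinearMap →ₗ[ℂ] W'.s₀ := g₀.toLinearMap.restrict fun _ hx => hx
  let r₁ : W'.s₁.comap g₁.toLinearMap →ₗ[ℂ] W'.s₁ := g₁.toLinearMap.restrict fun _ hx => hx
  have hr₀ : Function.Surjective r₀ := fun x =>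
    ⟨⟨g₀.symm x, by simp⟩, Subtype.ext (by simp [r₀])⟩
  have hr₁ : Function.Surjective r₁ := fun x =>
    ⟨⟨g₁.symm x, by simp⟩, Subtype.ext (by simp [r₁])⟩
  refine ⟨⟨hU, Submodule.comap_mono h0, Submodule.comap_mono h1⟩, fU, f₀ ∘ₗ r₀, f₁ ∘ₗ r₁,
    ⟨fun u => ?_, fun i x => ?_, fun i x => ?_, fun x => ?_, fun x => ?_⟩, sU, s0.comp hr₀,
    s1.comp hr₁, kU, fun x => k0 _, fun x => k1 _⟩
  · refine Eq.trans (congrArg f₀ (Subtype.ext ?_)) (hf.fr u)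
    exact h.fr u
  · refine Eq.trans (congrArg f₁ (Subtype.ext ?_)) (hf.a i (r₀ x))
    exact h.a i x
  · refine Eq.trans (congrArg f₀ (Subtype.ext ?_)) (hf.b i (r₁ x))
    exact h.b i x
  · refine Eq.trans (congrArg f₀ (Subtype.ext ?_)) (hf.c (r₀ x))
    exact h.c x
  · refine Eq.trans (congrArg f₁ (Subtype.ext ?_)) (hf.d (r₁ x))
    exact h.d x

theorem RepIso.hasJHFactors {R : FramedRep ℂ V₀ V₁} {R' : FramedRep ℂ V₀' V₁'} (h : RepIso R' R)
    {E₀ E₁ L₀ L₁ : Type} [AddCommGroup E₀] [Module ℂ E₀] [AddCommGroup E₁]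
    [Module ℂ E₁] [AddCommGroup L₀] [Module ℂ L₀] [AddCommGroup L₁] [Module ℂ L₁]
    {I₀ : FramedRep ℂ E₀ E₁} {S : FramedRep PUnit L₀ L₁} {r : ℕ} (hR : HasJHFactors R I₀ S r) :
    HasJHFactors R' I₀ S r := by
  obtain ⟨g₀, g₁, hg⟩ := h
  obtain ⟨W, p, ⟨b1, b2, b3⟩, ⟨t1, t2, t3⟩, hp, hj⟩ := hR
  refine ⟨fun s => (W s).comap hg, p, ⟨b1, ?_, ?_⟩, ⟨t1, ?_, ?_⟩, hp.comap hg,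
    fun j hne => (hj j hne).comap hg⟩
  · exact (comap_equiv_eq_bot _ _).2 b2
  · exact (comap_equiv_eq_bot _ _).2 b3
  · exact (comap_equiv_eq_top _ _).2 t2
  · exact (comap_equiv_eq_top _ _).2 t3

/-- A framed representation moved to other spaces. -/
def FramedRep.transport (R : FramedRep ℂ V₀ V₁) (g₀ : V₀ ≃ₗ[ℂ] V₀') (g₁ : V₁ ≃ₗ[ℂ] V₁') :
    FramedRep ℂ V₀' V₁' where
  fr := g₀.toLinearMap ∘ₗ R.fr
  a i := g₁.toLinearMap ∘ₗ R.a i ∘ₗ g₀.symm.toLinearMap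
  b i := g₀.toLinearMap ∘ₗ R.b i ∘ₗ g₁.symm.toLinearMap
  c := g₀.toLinearMap ∘ₗ R.c ∘ₗ g₀.symm.toLinearMap
  d := g₁.toLinearMap ∘ₗ R.d ∘ₗ g₁.symm.toLinearMap
  rel_aba i x := by simp [R.rel_aba]
  rel_bab i x := by simp [R.rel_bab]
  rel_a i x := by simp [R.rel_a]
  rel_b i x := by simp [R.rel_b]

theorem repIso_transport (R : FramedRep ℂ V₀ V₁) (g₀ : V₀ ≃ₗ[ℂ] V₀') (g₁ : V₁ ≃ₗ[ℂ] V₁') :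
    RepIso R (R.transport g₀ g₁) :=
  ⟨g₀, g₁, ⟨fun _ => rfl, fun i x => by simp [FramedRep.transport],
    fun i x => by simp [FramedRep.transport], fun x => by simp [FramedRep.transport],
    fun x => by simp [FramedRep.transport]⟩⟩

end RepIso

section Weights

variable {V₀ V₁ : Type} [AddCommGroup V₀] [Module ℂ V₀] [AddCommGroup V₁] [Module ℂ V₁]

theorem slope_add (θ : ℝ × ℝ) (a b c d : ℕ) :
    slope θ (a + b) (c + d) = slope θ a c + slope θ b d := by
  simp only [slope]; push_cast; ring

/-- The equivariant structure of a torus fixed stable representation is unique. -/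
theorem IsTorusIso.unique [FiniteDimensional ℂ V₀] [FiniteDimensional ℂ V₁] {θ : ℝ × ℝ}
    {R : FramedRep ℂ V₀ V₁} (hR : IsStable θ R) {t : Torus}
    {g₀ g₀' : V₀ ≃ₗ[ℂ] V₀} {g₁ g₁' : V₁ ≃ₗ[ℂ] V₁} (h : IsTorusIso t R g₀ g₁)
    (h' : IsTorusIso t R g₀' g₁') : g₀ = g₀' ∧ g₁ = g₁' := by
  -- The kernel of the difference is a framed subrepresentation and its range an unframed one, the
  -- twisted arrows being unit multiples of the original ones. Their values of Θ add up to Θ(V),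
  -- which contradicts the two stability inequalities unless the difference is zero.
  set D₀ := g₀.toLinearMap - g₀'.toLinearMap with hD₀
  set D₁ := g₁.toLinearMap - g₁'.toLinearMap with hD₁
  have ha : ∀ i x, D₁ (R.a i x) = (R.twist t).a i (D₀ x) := fun i x => by
    rw [hD₁, hD₀, LinearMap.sub_apply, LinearMap.sub_apply, h.a, h'.a, map_sub]
  have hb : ∀ i x, D₀ (R.b i x) = (R.twist t).b i (D₁ x) := fun i x => by
    rw [hD₁, hD₀, LinearMap.sub_apply, LinearMap.sub_apply, h.b, h'.b, map_sub]
  have hc : ∀ x, D₀ (R.c x) = (R.twist t).c (D₀ x) := fun x => by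
    rw [hD₀, LinearMap.sub_apply, LinearMap.sub_apply, h.c, h'.c, map_sub]
  have hd : ∀ x, D₁ (R.d x) = (R.twist t).d (D₁ x) := fun x => by
    rw [hD₁, LinearMap.sub_apply, LinearMap.sub_apply, h.d, h'.d, map_sub]
  let K : SubRep R :=
    { sU := ⊤
      s₀ := LinearMap.ker D₀
      s₁ := LinearMap.ker D₁
      fr_mem := fun u _ => by
        rw [LinearMap.mem_ker, hD₀, LinearMap.sub_apply, h.fr, h'.fr, sub_self]
      a_mem := fun i x hx => by rw [LinearMap.mem_ker] at hx ⊢; rw [ha, hx, map_zero]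
      b_mem := fun i x hx => by rw [LinearMap.mem_ker] at hx ⊢; rw [hb, hx, map_zero]
      c_mem := fun x hx => by rw [LinearMap.mem_ker] at hx ⊢; rw [hc, hx, map_zero]
      d_mem := fun x hx => by rw [LinearMap.mem_ker] at hx ⊢; rw [hd, hx, map_zero] }
  have hunit : ∀ {V : Type} [AddCommGroup V] [Module ℂ V] (N : Submodule ℂ V) (z : ℂˣ) (x : V),
      (z : ℂ) • x ∈ N → x ∈ N := fun N z x hx => (N.smul_mem_iff z.ne_zero).1 hx
  let J : SubRep R :=
    { sU := ⊥
      s₀ := LinearMap.range D₀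
      s₁ := LinearMap.range D₁
      fr_mem := fun u hu => by
        rw [(Submodule.mem_bot ℂ).1 hu, map_zero]; exact zero_mem _
      a_mem := by
        rintro i _ ⟨x, rfl⟩
        exact hunit _ (![t.1 1, t.1 2] i) _ ⟨_, ha i x⟩
      b_mem := by
        rintro i _ ⟨x, rfl⟩
        exact hunit _ (![1, t.1 0] i) _ ⟨_, hb i x⟩
      c_mem := by
        rintro _ ⟨x, rfl⟩
        exact hunit _ (t.1 3) _ ⟨_, hc x⟩
      d_mem := by
        rintro _ ⟨x, rfl⟩
        exact hunit _ (t.1 3) _ ⟨_, hd x⟩ }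
  have hdim := slope_add θ (Module.finrank ℂ J.s₀) (Module.finrank ℂ K.s₀)
    (Module.finrank ℂ J.s₁) (Module.finrank ℂ K.s₁)
  rw [show Module.finrank ℂ J.s₀ + Module.finrank ℂ K.s₀ = Module.finrank ℂ V₀ from
      LinearMap.finrank_range_add_finrank_ker D₀,
    show Module.finrank ℂ J.s₁ + Module.finrank ℂ K.s₁ = Module.finrank ℂ V₁ from
      LinearMap.finrank_range_add_finrank_ker D₁] at hdim
  have hzero : D₀ = 0 ∧ D₁ = 0 := by
    by_contra hne
    have h1 := hR.1 J rfl (by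
      by_contra hJ
      push Not at hJ
      exact hne ⟨LinearMap.range_eq_bot.1 hJ.1, LinearMap.range_eq_bot.1 hJ.2⟩)
    have h2 := hR.2 K rfl (by
      by_contra hK
      push Not at hK
      exact hne ⟨LinearMap.ker_eq_top.1 hK.1, LinearMap.ker_eq_top.1 hK.2⟩)
    linarith
  exact ⟨LinearEquiv.toLinearMap_injective (sub_eq_zero.1 hzero.1),
    LinearEquiv.toLinearMap_injective (sub_eq_zero.1 hzero.2)⟩

/-- A point of the torus at which all characters take distinct values. -/
noncomputable def genericPoint : Torus :=
  ⟨![Units.mk0 2 (by norm_num), Units.mk0 3 (by norm_num), Units.mk0 5 (by norm_num),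
    Units.mk0 (1 / 30) (by norm_num)], by
      rw [Fin.prod_univ_four]
      apply Units.ext
      simp
      norm_num⟩

theorem charVal_genericPoint (w : Wt) :
    (charVal w genericPoint : ℂ) = ((2 ^ w 0 * 3 ^ w 1 * 5 ^ w 2 : ℚ) : ℂ) := by
  simp only [charVal, genericPoint, Fin.prod_univ_three]
  push_cast
  rfl

/-- The values are 2^a 3^b 5^c, and the exponents are recovered as p-adic valuations. One torus
element therefore separates all characters. -/
theorem charVal_genericPoint_injective :
    Function.Injective fun w : Wt => (charVal w genericPoint : ℂ) := by
  intro w w' h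
  simp only [charVal_genericPoint] at h
  have h' : (2 ^ w 0 * 3 ^ w 1 * 5 ^ w 2 : ℚ) = 2 ^ w' 0 * 3 ^ w' 1 * 5 ^ w' 2 := by exact_mod_cast h
  have val : ∀ (p : ℕ) [Fact p.Prime] (v : Wt), padicValRat p (2 ^ v 0 * 3 ^ v 1 * 5 ^ v 2 : ℚ)
      = v 0 * padicValRat p 2 + v 1 * padicValRat p 3 + v 2 * padicValRat p 5 := by
    intro p _ v
    rw [padicValRat.mul (by positivity) (by positivity), padicValRat.mul (by positivity) (by positivity),
      padicValRat.zpow, padicValRat.zpow, padicValRat.zpow]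
  have : Fact (Nat.Prime 5) := ⟨by norm_num⟩
  have cross : ∀ p q : ℕ, p.Prime → q.Prime → p ≠ q → padicValNat p q = 0 := fun p q hp hq hpq =>
    padicValNat.eq_zero_of_not_dvd fun hd => hpq ((Nat.prime_dvd_prime_iff_eq hp hq).1 hd)
  have self : ∀ p : ℕ, p.Prime → padicValNat p p = 1 := fun p hp =>
    have : Fact p.Prime := ⟨hp⟩
    padicValNat_self
  have P2 : Nat.Prime 2 := by norm_num
  have P3 : Nat.Prime 3 := by norm_num
  have P5 : Nat.Prime 5 := by norm_num
  have cast : ∀ p q : ℕ, padicValRat p (q : ℚ) = padicValNat p q := fun p q => padicValRat.of_nat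
  have e : ∀ p : ℕ, padicValRat p 2 = padicValNat p 2 ∧ padicValRat p 3 = padicValNat p 3 ∧
    padicValRat p 5 = padicValNat p 5 := fun p => ⟨cast p 2, cast p 3, cast p 5⟩
  ext i
  fin_cases i
  · have := congrArg (padicValRat 2) h'
    rw [val, val, (e 2).1, (e 2).2.1, (e 2).2.2, self 2 P2, cross 2 3 P2 P3 (by norm_num),
      cross 2 5 P2 P5 (by norm_num)] at this
    simpa using this
  · have := congrArg (padicValRat 3) h'
    rw [val, val, (e 3).1, (e 3).2.1, (e 3).2.2, self 3 P3, cross 3 2 P3 P2 (by norm_num),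
      cross 3 5 P3 P5 (by norm_num)] at this
    simpa using this
  · have := congrArg (padicValRat 5) h'
    rw [val, val, (e 5).1, (e 5).2.1, (e 5).2.2, self 5 P5, cross 5 2 P5 P2 (by norm_num),
      cross 5 3 P5 P3 (by norm_num)] at this
    simpa using this

/-- `R` carries an equivariant structure, given in suitable coordinates by the weights `w₀`, `w₁`. -/
def HasWeights (R : FramedRep ℂ V₀ V₁) {ι₀ ι₁ : Type} (w₀ : ι₀ → Wt) (w₁ : ι₁ → Wt) : Prop :=
  ∃ (ρ₀ : V₀ ≃ₗ[ℂ] (ι₀ → ℂ)) (ρ₁ : V₁ ≃ₗ[ℂ] (ι₁ → ℂ)), ∀ t, ∃ g₀ g₁, IsTorusIso t R g₀ g₁ ∧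
    (∀ x i, ρ₀ (g₀ x) i = charVal (w₀ i) t * ρ₀ x i) ∧ ∀ y i, ρ₁ (g₁ y) i = charVal (w₁ i) t * ρ₁ y i

theorem HasWeights.isTorusFixed {R : FramedRep ℂ V₀ V₁} {ι₀ ι₁ : Type} {w₀ : ι₀ → Wt}
    {w₁ : ι₁ → Wt} (h : HasWeights R w₀ w₁) : IsTorusFixed R := fun t =>
  let ⟨_, _, H⟩ := h
  let ⟨g₀, g₁, hg, _⟩ := H t
  ⟨g₀, g₁, hg⟩

theorem HasWeights.of_repIso {V₀' V₁' : Type} [AddCommGroup V₀'] [Module ℂ V₀'] [AddCommGroup V₁']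
    [Module ℂ V₁'] {R : FramedRep ℂ V₀ V₁} {R' : FramedRep ℂ V₀' V₁'} {ι₀ ι₁ : Type} {w₀ : ι₀ → Wt}
    {w₁ : ι₁ → Wt} (h : HasWeights R w₀ w₁) (hR : RepIso R R') : HasWeights R' w₀ w₁ := by
  obtain ⟨k₀, k₁, hk⟩ := hR
  obtain ⟨ρ₀, ρ₁, H⟩ := h
  refine ⟨k₀.symm.trans ρ₀, k₁.symm.trans ρ₁, fun t => ?_⟩
  obtain ⟨g₀, g₁, hg, h0, h1⟩ := H t
  exact ⟨_, _, hg.conj hk, fun x i => by simp [h0], fun y i => by simp [h1]⟩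

theorem finrank_coordinateSubspace {V ι : Type} [AddCommGroup V] [Module ℂ V] [Fintype ι]
    (ρ : V ≃ₗ[ℂ] (ι → ℂ)) (P : ι → Prop) [DecidablePred P] (N : Submodule ℂ V)
    (hN : ∀ x, x ∈ N ↔ ∀ i, ¬ P i → ρ x i = 0) :
    Module.finrank ℂ N = (Finset.univ.filter P).card := by
  let e : N ≃ₗ[ℂ] ({i // P i} → ℂ) :=
    { toFun := fun x i => ρ x i
      map_add' := fun x y => by ext i; simp
      map_smul' := fun z x => by ext i; simp
      invFun := fun f => ⟨ρ.symm fun i => if h : P i then f ⟨i, h⟩ else 0, by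
        rw [hN]; intro i hi; simp [hi]⟩
      left_inv := fun x => by
        apply Subtype.ext
        apply ρ.injective
        ext i
        by_cases hi : P i
        · simp [hi]
        · simp [hi, (hN x).1 x.2 i hi]
      right_inv := fun f => by ext i; simp [i.2] }
  rw [e.finrank_eq, Module.finrank_fintype_fun_eq_card, Fintype.card_subtype]

theorem finsum_finrank_smul_ch {V ι : Type} [AddCommGroup V] [Module ℂ V] [Fintype ι]
    (ρ : V ≃ₗ[ℂ] (ι → ℂ)) (w : ι → Wt) (N : Wt → Submodule ℂ V)
    (hN : ∀ v x, x ∈ N v ↔ ∀ i, w i ≠ v → ρ x i = 0) :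
    ∑ᶠ v, (Module.finrank ℂ (N v) : ℤ) • ch v = ∑ i, ch (w i) := by
  classical
  have hdim : ∀ v, Module.finrank ℂ (N v) = (Finset.univ.filter fun i => w i = v).card := fun v =>
    finrank_coordinateSubspace ρ (fun i => w i = v) (N v) (hN v)
  rw [finsum_eq_sum_of_support_subset (s := Finset.univ.image w), Finset.sum_comp]
  · exact Finset.sum_congr rfl fun v _ => by rw [hdim, natCast_zsmul]
  · intro v hv
    simp only [Finset.coe_image, Finset.coe_univ, Set.image_univ, Set.mem_range]
    by_contra hne
    apply hv
    have : Module.finrank ℂ (N v) = 0 := by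
      rw [hdim, Finset.card_eq_zero, Finset.filter_eq_empty_iff]
      intro i _ hi
      exact hne ⟨i, hi⟩
    simp only [this, Nat.cast_zero, zero_smul]

/-- A vector of the weight space is tested at `genericPoint` alone, where different characters
differ. Conversely, uniqueness of the equivariant structure for a stable R makes every isomorphism
in the definition of the weight space equal to the given diagonal one. -/
theorem HasWeights.kClass_eq [FiniteDimensional ℂ V₀] [FiniteDimensional ℂ V₁] {θ : ℝ × ℝ}
    {R : FramedRep ℂ V₀ V₁} (hR : IsStable θ R) {ι₀ ι₁ : Type} [Fintype ι₀] [Fintype ι₁]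
    {w₀ : ι₀ → Wt} {w₁ : ι₁ → Wt} (h : HasWeights R w₀ w₁) :
    kClass R = (∑ i, ch (w₀ i), ∑ i, ch (w₁ i)) := by
  obtain ⟨ρ₀, ρ₁, H⟩ := h
  have sep : ∀ v v' : Wt, v ≠ v' → ∀ z : ℂ, (charVal v genericPoint : ℂ) * z
      = charVal v' genericPoint * z → z = 0 := by
    intro v v' hne z hz
    by_contra h0
    exact hne (charVal_genericPoint_injective (mul_right_cancel₀ h0 hz))
  rw [kClass, finsum_finrank_smul_ch ρ₀ w₀, finsum_finrank_smul_ch ρ₁ w₁]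
  · intro v x
    simp only [weightSpace₁, Submodule.mem_iInf, LinearMap.mem_ker, LinearMap.sub_apply,
      LinearMap.smul_apply, LinearMap.id_apply, LinearEquiv.coe_coe, sub_eq_zero]
    constructor
    · intro hx i hi
      obtain ⟨g₀, g₁, hg, h0, h1⟩ := H genericPoint
      have := congrFun (congrArg ρ₁ (hx _ _ _ hg)) i
      rw [h1, map_smul] at this
      exact sep _ _ hi _ this
    · intro hx t g₀ g₁ hg
      obtain ⟨k₀, k₁, hk, h0, h1⟩ := H t
      rw [(hg.unique hR hk).2]
      apply ρ₁.injective
      ext i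
      rw [h1, map_smul, Pi.smul_apply, smul_eq_mul]
      by_cases hi : w₁ i = v
      · rw [hi]
      · rw [hx i hi, mul_zero, mul_zero]
  · intro v x
    simp only [weightSpace₀, Submodule.mem_iInf, LinearMap.mem_ker, LinearMap.sub_apply,
      LinearMap.smul_apply, LinearMap.id_apply, LinearEquiv.coe_coe, sub_eq_zero]
    constructor
    · intro hx i hi
      obtain ⟨g₀, g₁, hg, h0, h1⟩ := H genericPoint
      have := congrFun (congrArg ρ₀ (hx _ _ _ hg)) i
      rw [h0, map_smul] at this
      exact sep _ _ hi _ this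
    · intro hx t g₀ g₁ hg
      obtain ⟨k₀, k₁, hk, h0, h1⟩ := H t
      rw [(hg.unique hR hk).1]
      apply ρ₀.injective
      ext i
      rw [h0, map_smul, Pi.smul_apply, smul_eq_mul]
      by_cases hi : w₀ i = v
      · rw [hi]
      · rw [hx i hi, mul_zero, mul_zero]

end Weights

end PervConifold

/-! ### Standard representations -/

namespace PervConifold

/-- Linear data for a framed representation `V₀ = ℂ[c]/c^{l+1} ⊕ M ⊗ H⁰(O(κ+1))`,
`V₁ = M ⊗ H⁰(O(κ))`: an extension, in one of the two directions, of `I_{(l+1)P¹}` and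
`M ⊗ O(κ+1)`. -/
structure StdData (κ l : ℕ) (M : Type) [AddCommGroup M] [Module ℂ M] where
  -- Here v is c^(l+1)·1, α i j is the component of a_i·1 in the j-th slot, and β j is the defect of
  -- b₁ on slot j against b₀ on slot j + 1. The condition hα reflects that a_i kills M ⊗ H⁰(O(κ+1)),
  -- so that d^(l+1) a_i·1 = a_i c^(l+1)·1 = 0.
  c : M →ₗ[ℂ] M
  v : Fin (κ + 2) → M
  α : Fin 2 → Fin (κ + 1) → M
  β : Fin κ → M →ₗ[ℂ] (Fin (l + 1) → ℂ)
  hα : ∀ i j, (c ^ (l + 1)) (α i j) = 0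
  hβ : ∀ j m, β j (c m) = (thickIdeal (l + 1)).c (β j m)
  hz : β = 0 ∨ (v = 0 ∧ α = 0)

section Jets

variable {l : ℕ}

@[simp] theorem thickIdeal_c_zero (p : Fin (l + 1) → ℂ) : (thickIdeal (l + 1)).c p 0 = 0 := by
  simp [thickIdeal]

@[simp] theorem thickIdeal_c_succ (p : Fin (l + 1) → ℂ) (j : Fin l) :
    (thickIdeal (l + 1)).c p j.succ = p j.castSucc := by
  simp only [thickIdeal, LinearMap.pi_apply]
  rw [dif_pos (by simp)]
  rfl

theorem thickIdeal_fr (u : ℂ) : (thickIdeal (l + 1)).fr u = Pi.single 0 u := by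
  ext j
  refine Fin.cases ?_ (fun j => ?_) j
  · simp [thickIdeal]
  · simp only [thickIdeal, LinearMap.pi_apply]
    rw [if_neg (by simp), Pi.single_eq_of_ne (Fin.succ_ne_zero j)]
    rfl

theorem thickIdeal_c_pow_fr (n : Fin (l + 1)) (u : ℂ) :
    ((thickIdeal (l + 1)).c ^ (n : ℕ)) ((thickIdeal (l + 1)).fr u) = Pi.single n u := by
  induction n using Fin.induction with
  | zero => simp [thickIdeal_fr]
  | succ n ih =>
    rw [Fin.val_succ, pow_succ', Module.End.mul_apply, ← Fin.val_castSucc, ih]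
    ext j
    refine Fin.cases ?_ (fun j => ?_) j
    · rw [thickIdeal_c_zero, Pi.single_eq_of_ne (Fin.succ_ne_zero n).symm]
    · rw [thickIdeal_c_succ]
      by_cases h : j = n
      · subst h; simp
      · rw [Pi.single_eq_of_ne (by simpa using h), Pi.single_eq_of_ne (by simpa using h)]

variable {V : Type*} [AddCommGroup V] [Module ℂ V]

/-- `p ↦ ∑ p_n cⁿ x`. -/
def jet (l : ℕ) (c : V →ₗ[ℂ] V) (x : V) : (Fin (l + 1) → ℂ) →ₗ[ℂ] V :=
  ∑ n : Fin (l + 1), LinearMap.smulRight (LinearMap.proj n) ((c ^ (n : ℕ)) x)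

theorem jet_apply (c : V →ₗ[ℂ] V) (x : V) (p : Fin (l + 1) → ℂ) :
    jet l c x p = ∑ n : Fin (l + 1), p n • (c ^ (n : ℕ)) x := by
  simp [jet]

theorem jet_single (c : V →ₗ[ℂ] V) (x : V) (n : Fin (l + 1)) (u : ℂ) :
    jet l c x (Pi.single n u) = u • (c ^ (n : ℕ)) x := by
  rw [jet_apply, Finset.sum_eq_single n]
  · simp
  · intro j _ hj; simp [Pi.single_eq_of_ne hj]
  · simp

/-- The loop on ℂ[c]/c^(l+1) drops the top coefficient, whereas in V it survives as a multiple of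
c^(l+1)x. Through this term v enters the representation. -/
theorem map_jet (c : V →ₗ[ℂ] V) (x : V) (p : Fin (l + 1) → ℂ) :
    c (jet l c x p) = jet l c x ((thickIdeal (l + 1)).c p) + p (Fin.last l) • (c ^ (l + 1)) x := by
  rw [jet_apply, jet_apply, map_sum, Fin.sum_univ_castSucc,
    Fin.sum_univ_succ (f := fun n => (thickIdeal (l + 1)).c p n • (c ^ (n : ℕ)) x)]
  simp only [thickIdeal_c_zero, thickIdeal_c_succ, zero_smul, zero_add, map_smul, Fin.val_castSucc,
    Fin.val_succ, Fin.val_last, pow_succ', Module.End.mul_apply]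

theorem jet_zero (c : V →ₗ[ℂ] V) : jet l c 0 = 0 := by
  ext; simp [jet_apply]

theorem jet_intertwine {V' : Type*} [AddCommGroup V'] [Module ℂ V'] (c : V →ₗ[ℂ] V) (x : V)
    (c' : V' →ₗ[ℂ] V') (g : V →ₗ[ℂ] V') (h : ∀ x, g (c x) = c' (g x)) (p : Fin (l + 1) → ℂ) :
    g (jet l c x p) = jet l c' (g x) p := by
  have hp : ∀ n : ℕ, g ((c ^ n) x) = (c' ^ n) (g x) := by
    intro n
    induction n with
    | zero => rfl
    | succ n ih => rw [pow_succ', Module.End.mul_apply, h, ih, pow_succ', Module.End.mul_apply]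
  rw [jet_apply, jet_apply, map_sum]
  exact Finset.sum_congr rfl fun n _ => by rw [map_smul, hp]

end Jets

namespace StdData

variable {κ l : ℕ} {M : Type} [AddCommGroup M] [Module ℂ M] (D : StdData κ l M)

/-- The framed representation with the given linear data. -/
def toRep : FramedRep ℂ ((Fin (l + 1) → ℂ) × (Fin (κ + 2) → M)) (Fin (κ + 1) → M) where
  fr := LinearMap.inl ℂ _ _ ∘ₗ (thickIdeal (l + 1)).fr
  a i := (LinearMap.pi fun j => jet l D.c (D.α i j)) ∘ₗ LinearMap.fst ℂ _ _
  b := ![LinearMap.inr ℂ _ _ ∘ₗ sh κ M 0,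
    LinearMap.prod (∑ j : Fin κ, D.β j ∘ₗ LinearMap.proj j.castSucc) (sh κ M 1)]
  c := LinearMap.prod ((thickIdeal (l + 1)).c ∘ₗ LinearMap.fst ℂ _ _)
    ((LinearMap.pi fun j => D.c ∘ₗ LinearMap.proj j) ∘ₗ LinearMap.snd ℂ _ _
      + LinearMap.smulRight (LinearMap.proj (Fin.last l) ∘ₗ LinearMap.fst ℂ _ _) D.v)
  d := LinearMap.pi fun j => D.c ∘ₗ LinearMap.proj j
  rel_aba i x := by
    rcases D.hz with h | ⟨-, h⟩
    · fin_cases i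
      · ext j; simp
      · ext j; simp [h]
    · fin_cases i <;> · ext j; simp [h, jet_zero]
  rel_bab i y := by
    rcases D.hz with h | ⟨-, h⟩
    · simp [h]
    · fin_cases i <;> simp [h, jet_zero, LinearMap.pi_zero]
  rel_a i x := by
    ext j
    simp [map_jet, D.hα]
  rel_b i y := by
    fin_cases i
    · refine Prod.ext ?_ ?_
      · simp
      · simp
        exact (sh_comp D.c 0 y).symm
    · refine Prod.ext ?_ ?_
      · simp [D.hβ]
      · rcases D.hz with h | ⟨h, -⟩
        · simp [h]
          exact (sh_comp D.c 1 y).symm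
        · simp [h]
          exact (sh_comp D.c 1 y).symm

@[simp] theorem toRep_fr (u : ℂ) : D.toRep.fr u = (Pi.single 0 u, 0) := by
  simp [toRep, thickIdeal_fr]

@[simp] theorem toRep_a (i : Fin 2) (x) : D.toRep.a i x = fun j => jet l D.c (D.α i j) x.1 := rfl

@[simp] theorem toRep_b_zero (y) : D.toRep.b 0 y = (0, sh κ M 0 y) := rfl

@[simp] theorem toRep_b_one (y) :
    D.toRep.b 1 y = (∑ j : Fin κ, D.β j (y j.castSucc), sh κ M 1 y) := by
  simp [toRep]

theorem toRep_b_snd (i : Fin 2) (y) : (D.toRep.b i y).2 = sh κ M i y := by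
  fin_cases i <;> simp

@[simp] theorem toRep_c (x) : D.toRep.c x
    = ((thickIdeal (l + 1)).c x.1, fun j => D.c (x.2 j) + x.1 (Fin.last l) • D.v j) := rfl

@[simp] theorem toRep_d (y) : D.toRep.d y = fun j => D.c (y j) := rfl

theorem finrank_V₀ [FiniteDimensional ℂ M] :
    Module.finrank ℂ ((Fin (l + 1) → ℂ) × (Fin (κ + 2) → M))
      = (l + 1) + (κ + 2) * Module.finrank ℂ M := by
  simp [Module.finrank_pi_fintype]

theorem finrank_V₁ [FiniteDimensional ℂ M] :
    Module.finrank ℂ (Fin (κ + 1) → M) = (κ + 1) * Module.finrank ℂ M := by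
  simp [Module.finrank_pi_fintype]

/-- An isomorphism of the spaces `M` compatible with the data. -/
theorem repIso {M' : Type} [AddCommGroup M'] [Module ℂ M'] (D' : StdData κ l M') (e : M ≃ₗ[ℂ] M')
    (hc : ∀ m, e (D.c m) = D'.c (e m)) (hv : ∀ j, e (D.v j) = D'.v j)
    (hα : ∀ i j, e (D.α i j) = D'.α i j) (hβ : ∀ j m, D.β j m = D'.β j (e m)) :
    RepIso D.toRep D'.toRep := by
  refine ⟨LinearEquiv.prodCongr (LinearEquiv.refl ℂ _) (LinearEquiv.piCongrRight fun _ => e),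
    LinearEquiv.piCongrRight fun _ => e, ⟨fun u => ?_, fun i x => ?_, fun i y => ?_, fun x => ?_,
      fun y => ?_⟩⟩
  · refine Prod.ext ?_ ?_
    · simp
    · ext j; simp
  · ext j
    have := jet_intertwine (l := l) D.c (D.α i j) D'.c e.toLinearMap hc x.1
    simpa [hα] using this
  · fin_cases i
    · refine Prod.ext ?_ ?_
      · simp
      · exact (sh_comp e.toLinearMap 0 y).symm
    · refine Prod.ext ?_ ?_
      · simp [hβ]
      · simp
        exact (sh_comp e.toLinearMap 1 y).symm
  · refine Prod.ext ?_ ?_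
    · simp
    · ext j; simp [hc, hv]
  · ext j; simp [hc]

end StdData

end PervConifold

/-! ### Stability and Jordan–Hölder filtrations of the standard representations -/

namespace PervConifold

theorem finrank_eq_map_snd_add_comap_inl {A B : Type*} [AddCommGroup A] [Module ℂ A] [AddCommGroup B]
    [Module ℂ B] [FiniteDimensional ℂ A] [FiniteDimensional ℂ B] (W : Submodule ℂ (A × B)) :
    Module.finrank ℂ W = Module.finrank ℂ (W.map (LinearMap.snd ℂ A B))
      + Module.finrank ℂ (W.comap (LinearMap.inl ℂ A B)) := by
  have := LinearMap.finrank_range_add_finrank_ker ((LinearMap.snd ℂ A B).domRestrict W)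
  rw [LinearMap.range_domRestrict] at this
  rw [← this]
  congr 1
  let e : W.comap (LinearMap.inl ℂ A B) ≃ₗ[ℂ] LinearMap.ker ((LinearMap.snd ℂ A B).domRestrict W) :=
    { toFun := fun x => ⟨⟨(x, 0), x.2⟩, rfl⟩
      map_add' := fun x y => by ext <;> simp
      map_smul' := fun x y => by ext <;> simp
      invFun := fun x => ⟨x.1.1.1, by
        have h : x.1.1.2 = 0 := x.2
        rw [Submodule.mem_comap, LinearMap.inl_apply, ← h]
        exact x.1.2⟩
      left_inv := fun x => rfl
      right_inv := fun x => by
        have h : x.1.1.2 = 0 := x.2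
        apply Subtype.ext
        apply Subtype.ext
        exact Prod.ext rfl h.symm }
  exact e.finrank_eq.symm

theorem finrank_eq_map_fst_add_comap_inr {A B : Type*} [AddCommGroup A] [Module ℂ A] [AddCommGroup B]
    [Module ℂ B] [FiniteDimensional ℂ A] [FiniteDimensional ℂ B] (W : Submodule ℂ (A × B)) :
    Module.finrank ℂ W = Module.finrank ℂ (W.map (LinearMap.fst ℂ A B))
      + Module.finrank ℂ (W.comap (LinearMap.inr ℂ A B)) := by
  have := LinearMap.finrank_range_add_finrank_ker ((LinearMap.fst ℂ A B).domRestrict W)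
  rw [LinearMap.range_domRestrict] at this
  rw [← this]
  congr 1
  let e : W.comap (LinearMap.inr ℂ A B) ≃ₗ[ℂ] LinearMap.ker ((LinearMap.fst ℂ A B).domRestrict W) :=
    { toFun := fun x => ⟨⟨(0, x), x.2⟩, rfl⟩
      map_add' := fun x y => by ext <;> simp
      map_smul' := fun x y => by ext <;> simp
      invFun := fun x => ⟨x.1.1.2, by
        have h : x.1.1.1 = 0 := x.2
        rw [Submodule.mem_comap, LinearMap.inr_apply, ← h]
        exact x.1.2⟩
      left_inv := fun x => rfl
      right_inv := fun x => by
        have h : x.1.1.1 = 0 := x.2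
        apply Subtype.ext
        apply Subtype.ext
        exact Prod.ext h.symm rfl }
  exact e.finrank_eq.symm

/-- On the wall θ = z(-(κ+1), κ+2), and θ₀ < θ₁ forces z > 0. The main term is z times an integer
that vanishes on the dimension vector of O(κ+1), so it is zero or at least z in absolute value. -/
theorem slope_eq_of_mem_wallLmm {κ : ℕ} {θ : ℝ × ℝ} (hθ : θ ∈ wallLmm (κ + 2)) :
    ∃ z > 0, ∀ (ε : ℝ) (n₀ n₁ : ℕ), slope (θ.1 + ε, θ.2) n₀ n₁
      = z * ((κ + 2) * n₁ - (κ + 1) * n₀) + ε * n₀ := by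
  obtain ⟨h1, h2⟩ := hθ
  push_cast at h2
  have h3 : θ.1 = -((κ + 1) * (θ.2 / (κ + 2))) := by
    field_simp
    linarith
  have hz : 0 < θ.2 / (κ + 2) := by
    have e : θ.2 = (κ + 2) * (θ.2 / (κ + 2)) := by field_simp
    rw [h3, e] at h1
    field_simp at h1
    by_contra hneg
    have : θ.2 ≤ 0 := by
      by_contra hpos
      exact hneg (div_pos (not_le.1 hpos) (by positivity))
    nlinarith [Nat.cast_nonneg (α := ℝ) κ]
  refine ⟨_, hz, fun ε n₀ n₁ => ?_⟩
  simp only [slope]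
  rw [h3]
  field_simp
  ring

theorem natCast_sub_ge_one {a b : ℕ} (h : a < b) : (1 : ℝ) ≤ b - a := by
  have : ((a + 1 : ℕ) : ℝ) ≤ b := by exact_mod_cast h
  push_cast at this
  linarith

namespace StdData

variable {κ l : ℕ} {M : Type} [AddCommGroup M] [Module ℂ M] (D : StdData κ l M)

theorem c_pow_fr (n : Fin (l + 1)) :
    (D.toRep.c ^ (n : ℕ)) (D.toRep.fr 1) = (Pi.single n 1, 0) := by
  induction n using Fin.induction with
  | zero => simp
  | succ n ih =>
    rw [Fin.val_succ, pow_succ', Module.End.mul_apply, ← Fin.val_castSucc, ih]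
    have h := thickIdeal_c_pow_fr n.succ (1 : ℂ)
    rw [Fin.val_succ, pow_succ', Module.End.mul_apply, ← Fin.val_castSucc, thickIdeal_c_pow_fr] at h
    refine Prod.ext h ?_
    ext j
    simp

theorem c_pow_succ_fr : (D.toRep.c ^ (l + 1)) (D.toRep.fr 1) = (0, D.v) := by
  have h := D.c_pow_fr (Fin.last l)
  rw [Fin.val_last] at h
  rw [pow_succ', Module.End.mul_apply, h]
  refine Prod.ext ?_ ?_
  · ext j
    refine Fin.cases ?_ (fun j => ?_) j
    · simp
    · simp
  · ext j; simp

theorem c_pow_fr_mem (W : SubRep D.toRep) (hU : W.sU = ⊤) (n : ℕ) :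
    (D.toRep.c ^ n) (D.toRep.fr 1) ∈ W.s₀ := by
  induction n with
  | zero => exact W.fr_mem 1 (by rw [hU]; trivial)
  | succ n ih => rw [pow_succ', Module.End.mul_apply]; exact W.c_mem _ ih

/-- The vector 1 and its translates c^n·1 with n ≤ l span the thickened line, so every framed
subrepresentation contains it. -/
theorem inl_mem (W : SubRep D.toRep) (hU : W.sU = ⊤) (p : Fin (l + 1) → ℂ) : (p, 0) ∈ W.s₀ := by
  have : ((p, 0) : (Fin (l + 1) → ℂ) × (Fin (κ + 2) → M)) = ∑ n, p n • (Pi.single n 1, 0) := by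
    refine Prod.ext ?_ ?_
    · ext j
      simp [Prod.fst_sum, Finset.sum_apply, Pi.single_apply]
    · simp [Prod.snd_sum]
  rw [this]
  refine W.s₀.sum_mem fun n _ => W.s₀.smul_mem _ ?_
  rw [← D.c_pow_fr n]
  exact D.c_pow_fr_mem W hU n

variable [FiniteDimensional ℂ M]

/-- Stability on the side where `O(κ+1)` destabilises as a quotient. -/
theorem isStable_plus {θ : ℝ × ℝ} (hθ : θ ∈ wallLmm (κ + 2)) (hβ : D.β = 0)
    (hgen : ∀ N : Submodule ℂ M, (∀ m ∈ N, D.c m ∈ N) → (∀ j, D.v j ∈ N) →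
      (∀ i j, D.α i j ∈ N) → N = ⊤) :
    ∃ ε₀ : ℝ, 0 < ε₀ ∧ ∀ ε : ℝ, 0 < ε →
      ε * (((l + 1) + (κ + 2) * Module.finrank ℂ M : ℕ) : ℝ) < ε₀ →
      IsStable (θ.1 - ε, θ.2) D.toRep := by
  obtain ⟨z, hz, hslope⟩ := slope_eq_of_mem_wallLmm hθ
  -- The bound z is the smallest nonzero value of the unperturbed slope, and ε times the full
  -- dimension of V₀ stays below it.
  refine ⟨z, hz, fun ε hε hsmall => ?_⟩
  have hsl : ∀ n₀ n₁ : ℕ, slope (θ.1 - ε, θ.2) n₀ n₁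
      = z * ((κ + 2) * n₁ - (κ + 1) * n₀) - ε * n₀ := fun n₀ n₁ => by
    rw [sub_eq_add_neg, hslope]; ring
  have hsub : ∀ W : SubRep D.toRep, ∀ i, ∀ y ∈ W.s₁,
      sh κ M i y ∈ W.s₀.comap (LinearMap.inr ℂ (Fin (l + 1) → ℂ) (Fin (κ + 2) → M)) := by
    intro W i y hy
    have := W.b_mem i y hy
    rw [Submodule.mem_comap, LinearMap.inr_apply, ← D.toRep_b_snd]
    convert this
    fin_cases i <;> simp [hβ]
  constructor
  · intro W hU hne
    have h1 := (finrank_sub_le _ _ (hsub W)).1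
    have h2 := finrank_eq_map_fst_add_comap_inr W.s₀
    rw [hsl]
    have h3 : ((κ + 2) * Module.finrank ℂ W.s₁ : ℝ) ≤ (κ + 1) * Module.finrank ℂ W.s₀ := by
      have : (κ + 2) * Module.finrank ℂ W.s₁ ≤ (κ + 1) * Module.finrank ℂ W.s₀ :=
        h1.trans (Nat.mul_le_mul_left _ (by omega))
      exact_mod_cast this
    have hpos : 0 < Module.finrank ℂ W.s₀ := by
      by_contra h0
      have h0 : Module.finrank ℂ W.s₀ = 0 := by omega
      have h0' : Module.finrank ℂ W.s₁ = 0 := by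
        have : (κ + 2) * Module.finrank ℂ W.s₁ ≤ 0 := by
          refine h1.trans ?_
          rw [show Module.finrank ℂ (W.s₀.comap (LinearMap.inr ℂ (Fin (l + 1) → ℂ)
            (Fin (κ + 2) → M))) = 0 by omega, mul_zero]
        exact (Nat.mul_eq_zero.1 (Nat.le_zero.1 this)).resolve_left (by omega)
      rw [Submodule.finrank_eq_zero] at h0 h0'
      exact hne.elim (fun h => h h0) (fun h => h h0')
    have hpos' : (0 : ℝ) < Module.finrank ℂ W.s₀ := by exact_mod_cast hpos
    nlinarith [mul_pos hε hpos']
  · intro W hU hne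
    obtain ⟨h1, heq⟩ := finrank_sub_le _ _ (hsub W)
    have h2 := finrank_eq_map_fst_add_comap_inr W.s₀
    have h3 : Module.finrank ℂ (W.s₀.map (LinearMap.fst ℂ (Fin (l + 1) → ℂ) (Fin (κ + 2) → M)))
        = l + 1 := by
      have : W.s₀.map (LinearMap.fst ℂ (Fin (l + 1) → ℂ) (Fin (κ + 2) → M)) = ⊤ := by
        rw [eq_top_iff]
        intro p _
        exact ⟨_, D.inl_mem W hU p, rfl⟩
      rw [this, finrank_top, Module.finrank_fin_fun]
    rw [h3] at h2
    rw [hsl, hsl, finrank_V₀, finrank_V₁, h2]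
    set w0 := Module.finrank ℂ (W.s₀.comap (LinearMap.inr ℂ (Fin (l + 1) → ℂ) (Fin (κ + 2) → M)))
    rcases h1.lt_or_eq with hlt | h0
    · have := natCast_sub_ge_one hlt
      push_cast at this hsmall ⊢
      have hw : (0 : ℝ) ≤ ε * ((l + 1) + w0) := by positivity
      nlinarith [mul_le_mul_of_nonneg_left this hz.le]
    -- In the case of equality W meets M ⊗ O(κ+1) in N ⊗ O(κ+1). As W contains c^(l+1)·1 and the
    -- a_i·1, the subspace N contains the generators and is stable under c, so it is everything.
    · exfalso
      obtain ⟨N, hN0, hN1⟩ := heq h0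
      have hN : N = ⊤ := by
        apply hgen
        · intro m hm
          have hm' : Pi.single 0 m ∈ W.s₁ := by
            rw [hN1, mem_piSub]
            intro j
            by_cases hj : j = 0
            · subst hj; simpa using hm
            · rw [Pi.single_eq_of_ne hj]; exact zero_mem _
          have := W.d_mem _ hm'
          rw [hN1, mem_piSub] at this
          simpa using this 0
        · intro j
          have := D.c_pow_fr_mem W hU (l + 1)
          rw [D.c_pow_succ_fr] at this
          have : D.v ∈ W.s₀.comap (LinearMap.inr ℂ (Fin (l + 1) → ℂ) (Fin (κ + 2) → M)) := this
          rw [hN0, mem_piSub] at this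
          exact this j
        · intro i j
          have := W.a_mem i _ (D.c_pow_fr_mem W hU 0)
          rw [hN1, mem_piSub] at this
          simpa [jet_single] using this j
      rw [hN] at hN0 hN1
      have ht0 : W.s₀ = ⊤ := by
        rw [eq_top_iff]
        intro x _
        have hx : x.2 ∈ W.s₀.comap (LinearMap.inr ℂ (Fin (l + 1) → ℂ) (Fin (κ + 2) → M)) := by
          rw [hN0, mem_piSub]; intro; trivial
        have := W.s₀.add_mem (D.inl_mem W hU x.1) hx
        simpa using this
      have ht1 : W.s₁ = ⊤ := by
        rw [hN1, eq_top_iff]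
        intro x _
        rw [mem_piSub]; intro; trivial
      exact hne.elim (fun h => h ht0) (fun h => h ht1)

/-- Stability on the side where `O(κ+1)` destabilises as a subobject. -/
theorem isStable_minus {θ : ℝ × ℝ} (hθ : θ ∈ wallLmm (κ + 2))
    (hinj : ∀ N : Submodule ℂ M, (∀ m ∈ N, D.c m ∈ N) → (∀ j, ∀ m ∈ N, D.β j m = 0) → N = ⊥) :
    ∃ ε₀ : ℝ, 0 < ε₀ ∧ ∀ ε : ℝ, 0 < ε →
      ε * (((l + 1) + (κ + 2) * Module.finrank ℂ M : ℕ) : ℝ) < ε₀ →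
      IsStable (θ.1 + ε, θ.2) D.toRep := by
  obtain ⟨z, hz, hsl⟩ := slope_eq_of_mem_wallLmm hθ
  refine ⟨z, hz, fun ε hε hsmall => ?_⟩
  have hsub : ∀ W : SubRep D.toRep, ∀ i, ∀ y ∈ W.s₁,
      sh κ M i y ∈ W.s₀.map (LinearMap.snd ℂ (Fin (l + 1) → ℂ) (Fin (κ + 2) → M)) := by
    intro W i y hy
    exact ⟨_, W.b_mem i y hy, D.toRep_b_snd i y⟩
  constructor
  · intro W hU hne
    obtain ⟨h1, heq⟩ := finrank_sub_le _ _ (hsub W)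
    have h2 := finrank_eq_map_snd_add_comap_inl W.s₀
    have h4 : Module.finrank ℂ W.s₀ ≤ (l + 1) + (κ + 2) * Module.finrank ℂ M := by
      rw [← finrank_V₀]; exact Submodule.finrank_le _
    have h5 : ε * (Module.finrank ℂ W.s₀ : ℝ) < z :=
      (mul_le_mul_of_nonneg_left (by exact_mod_cast h4) hε.le).trans_lt hsmall
    rw [hsl]
    have h3 : (κ + 2) * Module.finrank ℂ W.s₁ < (κ + 1) * Module.finrank ℂ W.s₀ := by
      by_contra hge
      rw [not_lt] at hge
      rw [h2, mul_add] at hge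
      have hf : Module.finrank ℂ (W.s₀.comap (LinearMap.inl ℂ (Fin (l + 1) → ℂ) (Fin (κ + 2) → M)))
          = 0 := by
        by_contra hne0
        have := Nat.mul_pos (Nat.succ_pos κ) (Nat.pos_of_ne_zero hne0)
        rw [Nat.succ_eq_add_one] at this
        omega
      -- No destabilising margin remains: W meets the thickened line trivially and projects onto N ⊗
      -- O(κ+1), so N must be killed by all β j.
      rw [hf, mul_zero, add_zero] at hge
      obtain ⟨N, hN0, hN1⟩ := heq (le_antisymm h1 hge)
      rw [Submodule.finrank_eq_zero] at hf
      have hsingle : ∀ m ∈ N, ∀ j, Pi.single j m ∈ W.s₁ := by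
        intro m hm j
        rw [hN1, mem_piSub]
        intro i
        by_cases hi : i = j
        · subst hi; simpa using hm
        · rw [Pi.single_eq_of_ne hi]; exact zero_mem _
      have hN : N = ⊥ := by
        apply hinj
        · intro m hm
          have := W.d_mem _ (hsingle m hm 0)
          rw [hN1, mem_piSub] at this
          simpa using this 0
        -- For m in N the element b₁ of m in slot j minus b₀ of m in slot j + 1 lies in W. Its
        -- components in M ⊗ H⁰(O(κ+1)) cancel, and what is left is β j m, an element of the trivial
        -- intersection with the thickened line.
        · intro j m hm
          have e1 := W.b_mem 1 _ (hsingle m hm j.castSucc)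
          have e0 := W.b_mem 0 _ (hsingle m hm j.succ)
          have hmem : D.β j m ∈ W.s₀.comap (LinearMap.inl ℂ (Fin (l + 1) → ℂ) (Fin (κ + 2) → M)) := by
            have := W.s₀.sub_mem e1 e0
            rw [D.toRep_b_one, D.toRep_b_zero, sh_one_single, sh_zero_single, Fin.succ_castSucc,
              Finset.sum_eq_single j] at this
            · simpa using this
            · intro i _ hi
              rw [Pi.single_eq_of_ne (by simpa using hi), map_zero]
            · simp
          rw [hf] at hmem
          simpa using hmem
      rw [hN] at hN0 hN1
      have ht1 : W.s₁ = ⊥ := by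
        rw [hN1, Submodule.eq_bot_iff]
        intro x hx
        rw [mem_piSub] at hx
        ext j
        simpa using hx j
      have ht0 : W.s₀ = ⊥ := by
        rw [Submodule.eq_bot_iff]
        intro x hx
        have hx2 : x.2 = 0 := by
          have : x.2 ∈ W.s₀.map (LinearMap.snd ℂ (Fin (l + 1) → ℂ) (Fin (κ + 2) → M)) := ⟨x, hx, rfl⟩
          rw [hN0, mem_piSub] at this
          ext j
          simpa using this j
        have hx1 : x.1 = 0 := by
          have : x.1 ∈ W.s₀.comap (LinearMap.inl ℂ (Fin (l + 1) → ℂ) (Fin (κ + 2) → M)) := by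
            rw [Submodule.mem_comap, LinearMap.inl_apply, ← hx2]
            exact hx
          rw [hf] at this
          simpa using this
        exact Prod.ext hx1 hx2
      exact hne.elim (fun h => h ht0) (fun h => h ht1)
    have := natCast_sub_ge_one h3
    push_cast at this
    nlinarith [mul_le_mul_of_nonneg_left this hz.le]
  · intro W hU hne
    obtain ⟨h1, -⟩ := finrank_sub_le _ _ (hsub W)
    have h2 := finrank_eq_map_snd_add_comap_inl W.s₀
    have h3 : Module.finrank ℂ (W.s₀.comap (LinearMap.inl ℂ (Fin (l + 1) → ℂ) (Fin (κ + 2) → M)))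
        = l + 1 := by
      have : W.s₀.comap (LinearMap.inl ℂ (Fin (l + 1) → ℂ) (Fin (κ + 2) → M)) = ⊤ := by
        rw [eq_top_iff]
        intro p _
        exact D.inl_mem W hU p
      rw [this, finrank_top, Module.finrank_fin_fun]
    rw [h3] at h2
    have hV0 := finrank_V₀ (κ := κ) (l := l) (M := M)
    have hV1 := finrank_V₁ (κ := κ) (M := M)
    rw [hsl, hsl, hV0, hV1, h2]
    have h4 : Module.finrank ℂ W.s₀ ≤ (l + 1) + (κ + 2) * Module.finrank ℂ M := by
      rw [← hV0]; exact Submodule.finrank_le _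
    have h5 : Module.finrank ℂ W.s₁ ≤ (κ + 1) * Module.finrank ℂ M := by
      rw [← hV1]; exact Submodule.finrank_le _
    set w0 := Module.finrank ℂ (W.s₀.map (LinearMap.snd ℂ (Fin (l + 1) → ℂ) (Fin (κ + 2) → M)))
      with hw0
    have h6 : w0 ≤ (κ + 2) * Module.finrank ℂ M := by omega
    have h1' : ((κ + 2) * Module.finrank ℂ W.s₁ : ℝ) ≤ (κ + 1) * w0 := by exact_mod_cast h1
    rcases h6.lt_or_eq with hlt | hw
    · have : (w0 : ℝ) < (κ + 2) * Module.finrank ℂ M := by exact_mod_cast hlt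
      push_cast
      nlinarith [mul_le_mul_of_nonneg_left h1' hz.le, mul_lt_mul_of_pos_left this hε]
    · have ht0 : W.s₀ = ⊤ := by
        apply Submodule.eq_top_of_finrank_eq
        rw [hV0, h2, hw]; ring
      have hlt : Module.finrank ℂ W.s₁ < (κ + 1) * Module.finrank ℂ M := by
        refine lt_of_le_of_ne h5 fun heq => ?_
        have ht1 : W.s₁ = ⊤ := by
          apply Submodule.eq_top_of_finrank_eq
          rw [hV1, heq]
        exact hne.elim (fun h => h ht0) (fun h => h ht1)
      have hlt' : (Module.finrank ℂ W.s₁ : ℝ) < (κ + 1) * Module.finrank ℂ M := by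
        exact_mod_cast hlt
      rw [hw]
      push_cast
      have hzk : 0 < z * (κ + 2) := by positivity
      nlinarith [mul_lt_mul_of_pos_left hlt' hzk]

end StdData

end PervConifold

/-! ### Jordan–Hölder filtrations built from flags, and the constraints that stability puts on the
data. -/

namespace PervConifold
namespace StdData

variable {κ l : ℕ} {M : Type} [AddCommGroup M] [Module ℂ M] (D : StdData κ l M)

/-- The subrepresentation with `U`, `P ⊕ N ⊗ H⁰(O(κ+1))` and `N ⊗ H⁰(O(κ))`. -/
def subOf (U : Submodule ℂ ℂ) (P : Submodule ℂ (Fin (l + 1) → ℂ)) (N : Submodule ℂ M)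
    (hU : ∀ u ∈ U, Pi.single 0 u ∈ P) (hT : ∀ p ∈ P, (thickIdeal (l + 1)).c p ∈ P)
    (hα : ∀ i j, ∀ p ∈ P, jet l D.c (D.α i j) p ∈ N) (hβ : ∀ j, ∀ m ∈ N, D.β j m ∈ P)
    (hv : ∀ p ∈ P, ∀ j, p (Fin.last l) • D.v j ∈ N) (hc : ∀ m ∈ N, D.c m ∈ N) :
    SubRep D.toRep where
  sU := U
  s₀ := P.prod (piSub _ N)
  s₁ := piSub _ N
  fr_mem u hu := by
    rw [toRep_fr]
    exact ⟨hU u hu, zero_mem _⟩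
  a_mem i x hx := by
    rw [mem_piSub]
    exact fun j => hα i j _ hx.1
  b_mem i y hy := by
    rw [mem_piSub] at hy
    fin_cases i
    · refine ⟨zero_mem _, mem_piSub.2 fun j => ?_⟩
      refine Fin.lastCases ?_ (fun j => ?_) j <;> simp [hy]
    · simp only [Fin.mk_one, toRep_b_one]
      refine ⟨?_, mem_piSub.2 fun j => ?_⟩
      · change ∑ j : Fin κ, D.β j (y j.castSucc) ∈ P
        exact P.sum_mem fun j _ => hβ j _ (hy _)
      refine Fin.cases ?_ (fun j => ?_) j <;> simp [hy]
  c_mem x hx := ⟨hT _ hx.1, mem_piSub.2 fun j =>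
    N.add_mem (hc _ (mem_piSub.1 hx.2 j)) (hv _ hx.1 j)⟩
  d_mem y hy := mem_piSub.2 fun j => hc _ (mem_piSub.1 hy j)

/-- The product of two submodules as a module. -/
def _root_.Submodule.prodEquiv' {V W : Type*} [AddCommGroup V] [Module ℂ V] [AddCommGroup W] [Module ℂ W]
    (P : Submodule ℂ V) (Q : Submodule ℂ W) : P.prod Q ≃ₗ[ℂ] P × Q where
  toFun x := (⟨x.1.1, x.2.1⟩, ⟨x.1.2, x.2.2⟩)
  invFun x := ⟨(x.1, x.2), x.1.2, x.2.2⟩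
  map_add' _ _ := rfl
  map_smul' _ _ := rfl

theorem finrank_subOf_s₀ [FiniteDimensional ℂ M] (P : Submodule ℂ (Fin (l + 1) → ℂ))
    (N : Submodule ℂ M) : Module.finrank ℂ (P.prod (piSub (κ + 2) N))
      = Module.finrank ℂ P + (κ + 2) * Module.finrank ℂ N := by
  rw [(P.prodEquiv' (piSub (κ + 2) N)).finrank_eq, Module.finrank_prod, finrank_piSub]

/-- The subquotient `(N'/N) ⊗ O(κ+1)` for a hyperplane `N` of `N'`. -/
theorem isSubquotient_subOf {U : Submodule ℂ ℂ} {P : Submodule ℂ (Fin (l + 1) → ℂ)}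
    {N N' : Submodule ℂ M} (hU : ∀ u ∈ U, Pi.single 0 u ∈ P)
    (hT : ∀ p ∈ P, (thickIdeal (l + 1)).c p ∈ P)
    (hα : ∀ i j, ∀ p ∈ P, jet l D.c (D.α i j) p = 0) (hβ : ∀ j, ∀ m, D.β j m ∈ P)
    (hv : ∀ p ∈ P, ∀ j, p (Fin.last l) • D.v j = 0) (hNN : N ≤ N') (hcN : ∀ m ∈ N', D.c m ∈ N)
    (φ : M →ₗ[ℂ] ℂ) (hφ : ∃ m ∈ N', φ m = 1) (hker : ∀ m ∈ N', φ m = 0 ↔ m ∈ N) :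
    IsSubquotient
      (D.subOf U P N hU hT (fun i j p hp => by rw [hα i j p hp]; exact zero_mem _) (fun j m _ => hβ j m)
        (fun p hp j => by rw [hv p hp j]; exact zero_mem _) (fun m hm => hcN m (hNN hm)))
      (D.subOf U P N' hU hT (fun i j p hp => by rw [hα i j p hp]; exact zero_mem _)
        (fun j m _ => hβ j m) (fun p hp j => by rw [hv p hp j]; exact zero_mem _)
        (fun m hm => hNN (hcN m hm)))
      (lineRep (κ + 2)) := by
  obtain ⟨m₁, hm₁, hφm⟩ := hφ
  refine ⟨⟨le_rfl, Submodule.prod_mono le_rfl fun f hf => ?_, fun f hf => ?_⟩, 0,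
    (LinearMap.pi fun j => φ ∘ₗ LinearMap.proj j ∘ₗ LinearMap.snd ℂ _ _) ∘ₗ Submodule.subtype _,
    (LinearMap.pi fun j => φ ∘ₗ LinearMap.proj j) ∘ₗ Submodule.subtype _, ⟨?_, ?_, ?_, ?_, ?_⟩,
    fun x => ⟨0, Subsingleton.elim _ _⟩, fun g => ?_, fun g => ?_, fun u => ?_, fun x => ?_, fun y => ?_⟩
  · rw [mem_piSub] at hf ⊢; exact fun j => hNN (hf j)
  · change f ∈ piSub _ N at hf
    change f ∈ piSub _ N'
    rw [mem_piSub] at hf ⊢; exact fun j => hNN (hf j)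
  · intro u
    ext j
    change φ ((D.toRep.fr u).2 j) = _
    simp [lineRep]
  · intro i x
    ext j
    change φ (D.toRep.a i x j) = _
    rw [toRep_a]
    beta_reduce
    rw [hα i j _ x.2.1]
    simp [lineRep]
  · intro i y
    change (fun j => φ ((D.toRep.b i y).2 j)) = sh κ ℂ i fun j => φ (y.1 j)
    rw [toRep_b_snd, sh_comp]
  · intro x
    ext j
    change φ ((D.toRep.c x).2 j) = _
    rw [toRep_c]
    simp only
    rw [hv _ x.2.1 j, add_zero, (hker _ (hNN (hcN _ (mem_piSub.1 x.2.2 j)))).2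
      (hcN _ (mem_piSub.1 x.2.2 j))]
    rfl
  · intro y
    ext j
    change φ (D.toRep.d y j) = _
    rw [toRep_d, (hker _ (hNN (hcN _ (mem_piSub.1 y.2 j)))).2 (hcN _ (mem_piSub.1 y.2 j))]
    rfl
  · refine ⟨⟨(0, fun j => g j • m₁), zero_mem _, mem_piSub.2 fun j => N'.smul_mem _ hm₁⟩, ?_⟩
    ext j
    simp [hφm]
  · refine ⟨⟨fun j => g j • m₁, mem_piSub.2 fun j => N'.smul_mem _ hm₁⟩, ?_⟩
    ext j
    simp [hφm]
  · exact ⟨fun _ => u.2, fun _ => rfl⟩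
  · constructor
    · intro h
      exact ⟨x.2.1, mem_piSub.2 fun j => (hker _ (mem_piSub.1 x.2.2 j)).1 (congrFun h j)⟩
    · intro h
      ext j
      exact (hker _ (mem_piSub.1 x.2.2 j)).2 (mem_piSub.1 h.2 j)
  · constructor
    · intro h
      exact mem_piSub.2 fun j => (hker _ (mem_piSub.1 y.2 j)).1 (congrFun h j)
    · intro h
      ext j
      exact (hker _ (mem_piSub.1 y.2 j)).2 (mem_piSub.1 h j)

/-- A complete flag on which `c` is strictly decreasing. -/
structure Flag (c : M →ₗ[ℂ] M) (r : ℕ) where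
  N : Fin (r + 1) → Submodule ℂ M
  φ : Fin r → M →ₗ[ℂ] ℂ
  bot : N 0 = ⊥
  top : N (Fin.last r) = ⊤
  le : ∀ s : Fin r, N s.castSucc ≤ N s.succ
  c_mem : ∀ s : Fin r, ∀ m ∈ N s.succ, c m ∈ N s.castSucc
  surj : ∀ s : Fin r, ∃ m ∈ N s.succ, φ s m = 1
  ker : ∀ s : Fin r, ∀ m ∈ N s.succ, φ s m = 0 ↔ m ∈ N s.castSucc

theorem Flag.c_mem_self {c : M →ₗ[ℂ] M} {r : ℕ} (F : Flag c r) (s : Fin (r + 1)) :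
    ∀ m ∈ F.N s, c m ∈ F.N s := by
  refine Fin.cases ?_ (fun s => ?_) s
  · intro m hm
    rw [F.bot, Submodule.mem_bot] at hm
    rw [hm, map_zero]; exact zero_mem _
  · exact fun m hm => F.le s (F.c_mem s m hm)

/-- With β = 0 the part M ⊗ O(κ+1) is a subrepresentation: the flag of M filters it, and the
thickened line is the top quotient. -/
theorem hasJHFactors_plus {r : ℕ} (F : Flag D.c r) (hβ : D.β = 0) :
    HasJHFactors D.toRep (thickIdeal (l + 1)) (lineRep (κ + 2)) r := by
  let Wt' : SubRep D.toRep := D.subOf ⊤ ⊤ ⊤ (fun _ _ => trivial) (fun _ _ => trivial)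
    (fun _ _ _ _ => trivial) (fun _ _ _ => trivial) (fun _ _ _ => trivial) (fun _ _ => trivial)
  let Wn : Fin (r + 1) → SubRep D.toRep := fun s => D.subOf ⊥ ⊥ (F.N s)
    (by simp) (by simp) (by simp) (by simp [hβ]) (by simp) (F.c_mem_self s)
  refine ⟨Fin.lastCases Wt' Wn, Fin.last r, ?_, ?_, ?_, ?_⟩
  · have : (Fin.lastCases Wt' Wn (0 : Fin (r + 2)) : SubRep D.toRep) = Wn 0 :=
      Fin.lastCases_castSucc (motive := fun _ => SubRep D.toRep) (last := Wt') (cast := Wn) (i := 0)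
    beta_reduce
    rw [this]
    refine ⟨rfl, ?_, ?_⟩
    · rw [Submodule.eq_bot_iff]
      rintro x ⟨h1, h2⟩
      refine Prod.ext h1 ?_
      have h2 := mem_piSub.1 h2
      ext j
      have := h2 j
      rw [F.bot] at this
      exact this
    · rw [Submodule.eq_bot_iff]
      intro x h2
      have h2 := mem_piSub.1 h2
      ext j
      have := h2 j
      rw [F.bot] at this
      exact this
  · beta_reduce
    rw [Fin.lastCases_last]
    refine ⟨rfl, ?_, ?_⟩
    · rw [eq_top_iff]
      exact fun x _ => ⟨trivial, mem_piSub.2 fun _ => trivial⟩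
    · rw [eq_top_iff]
      exact fun x _ => mem_piSub.2 fun _ => trivial
  · beta_reduce
    rw [Fin.lastCases_castSucc, Fin.succ_last, Fin.lastCases_last]
    refine ⟨⟨bot_le, Submodule.prod_mono bot_le fun f _ => mem_piSub.2 fun _ => trivial,
      fun f _ => mem_piSub.2 fun _ => trivial⟩, Submodule.subtype _,
      LinearMap.fst ℂ _ _ ∘ₗ Submodule.subtype _, 0, ⟨?_, ?_, ?_, ?_, ?_⟩, fun u => ⟨⟨u, trivial⟩, rfl⟩,
      fun p => ⟨⟨(p, 0), trivial, zero_mem _⟩, rfl⟩, fun y => ⟨0, Subsingleton.elim _ _⟩,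
      fun u => Iff.rfl, fun x => ?_, fun y => ?_⟩
    · intro u
      change (D.toRep.fr u).1 = _
      rw [toRep_fr, thickIdeal_fr]
      rfl
    · intro i x; exact Subsingleton.elim _ _
    · intro i y
      change (D.toRep.b i y).1 = _
      fin_cases i <;> simp [hβ, thickIdeal]
    · intro x; rfl
    · intro y; exact Subsingleton.elim _ _
    · constructor
      · intro h
        exact ⟨h, mem_piSub.2 fun j => by rw [F.top]; trivial⟩
      · intro h; exact h.1
    · exact ⟨fun _ => mem_piSub.2 fun j => by rw [F.top]; trivial, fun _ => Subsingleton.elim _ _⟩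
  · intro j hj
    obtain ⟨s, rfl⟩ := Fin.exists_castSucc_eq.2 hj
    beta_reduce
    rw [Fin.lastCases_castSucc, Fin.succ_castSucc, Fin.lastCases_castSucc]
    exact D.isSubquotient_subOf (N := F.N s.castSucc) (N' := F.N s.succ) (by simp) (by simp)
      (by simp) (by simp [hβ]) (by simp) (F.le s) (F.c_mem s) (F.φ s) (F.surj s) (F.ker s)

/-- With v = 0 and α = 0 the thickened line is a subrepresentation, and the flag of M is stacked on
top of it. -/
theorem hasJHFactors_minus {r : ℕ} (F : Flag D.c r) (hv : D.v = 0) (hα : D.α = 0) :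
    HasJHFactors D.toRep (thickIdeal (l + 1)) (lineRep (κ + 2)) r := by
  let Wb : SubRep D.toRep := D.subOf ⊥ ⊥ ⊥ (by simp) (by simp) (by simp) (by simp) (by simp) (by simp)
  let Wn : Fin (r + 1) → SubRep D.toRep := fun s => D.subOf ⊤ ⊤ (F.N s)
    (by simp) (by simp) (by simp [hα, jet_zero]) (by simp) (by simp [hv]) (F.c_mem_self s)
  refine ⟨Fin.cases Wb Wn, 0, ?_, ?_, ?_, ?_⟩
  · refine ⟨rfl, ?_, ?_⟩
    · rw [Submodule.eq_bot_iff]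
      rintro x ⟨h1, h2⟩
      refine Prod.ext h1 ?_
      have h2 := mem_piSub.1 h2
      ext j
      exact h2 j
    · rw [Submodule.eq_bot_iff]
      intro x h2
      have h2 := mem_piSub.1 h2
      ext j
      exact h2 j
  · beta_reduce
    rw [← Fin.succ_last, Fin.cases_succ]
    refine ⟨rfl, ?_, ?_⟩
    · rw [eq_top_iff]
      exact fun x _ => ⟨trivial, mem_piSub.2 fun _ => by rw [F.top]; trivial⟩
    · rw [eq_top_iff]
      exact fun x _ => mem_piSub.2 fun _ => by rw [F.top]; trivial
  · beta_reduce
    rw [Fin.castSucc_zero, Fin.cases_zero, Fin.cases_succ]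
    have hz : ∀ {n : ℕ} {f : Fin n → M}, f ∈ piSub n (F.N 0) → f = 0 := by
      intro n f hf
      ext j
      have := mem_piSub.1 hf j
      rw [F.bot] at this
      exact this
    refine ⟨⟨bot_le, Submodule.prod_mono bot_le fun f hf => ?_, fun f hf => ?_⟩, Submodule.subtype _,
      LinearMap.fst ℂ _ _ ∘ₗ Submodule.subtype _, 0, ⟨?_, ?_, ?_, ?_, ?_⟩, fun u => ⟨⟨u, trivial⟩, rfl⟩,
      fun p => ⟨⟨(p, 0), trivial, zero_mem _⟩, rfl⟩, fun y => ⟨0, Subsingleton.elim _ _⟩,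
      fun u => Iff.rfl, fun x => ?_, fun y => ?_⟩
    · exact mem_piSub.2 fun j => Submodule.mem_bot (R := ℂ) |>.1 (mem_piSub.1 hf j) ▸ zero_mem _
    · exact mem_piSub.2 fun j => Submodule.mem_bot (R := ℂ) |>.1 (mem_piSub.1 hf j) ▸ zero_mem _
    · intro u
      change (D.toRep.fr u).1 = _
      rw [toRep_fr, thickIdeal_fr]
      rfl
    · intro i x; exact Subsingleton.elim _ _
    · intro i y
      change (D.toRep.b i y).1 = _
      rw [hz y.2, map_zero]
      exact (map_zero ((thickIdeal (l + 1)).b i)).symm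
    · intro x; rfl
    · intro y; exact Subsingleton.elim _ _
    · constructor
      · intro h
        refine ⟨h, ?_⟩
        rw [hz x.2.2]
        exact zero_mem _
      · intro h; exact h.1
    · refine ⟨fun _ => ?_, fun _ => Subsingleton.elim _ _⟩
      rw [hz y.2]
      exact zero_mem _
  · intro j hj
    obtain ⟨s, rfl⟩ := Fin.exists_succ_eq.2 hj
    beta_reduce
    rw [Fin.cases_succ, ← Fin.succ_castSucc, Fin.cases_succ]
    exact D.isSubquotient_subOf (N := F.N s.castSucc) (N' := F.N s.succ) (by simp) (by simp)
      (by simp [hα, jet_zero]) (by simp) (by simp [hv]) (F.le s) (F.c_mem s) (F.φ s) (F.surj s)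
      (F.ker s)

variable [FiniteDimensional ℂ M]

/-- A proper N closed under the data would give a framed subrepresentation with quotient (M/N) ⊗
O(κ+1), which has negative slope; its own slope would exceed that of the whole. -/
theorem generated_of_isStable {θ : ℝ × ℝ} (hθ : slope θ (κ + 2) (κ + 1) < 0)
    (hs : IsStable θ D.toRep) (N : Submodule ℂ M) (hc : ∀ m ∈ N, D.c m ∈ N) (hv : ∀ j, D.v j ∈ N)
    (hα : ∀ i j, D.α i j ∈ N) : N = ⊤ := by
  by_contra hN
  have hpow : ∀ (n : ℕ), ∀ m ∈ N, (D.c ^ n) m ∈ N := by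
    intro n m hm
    induction n with
    | zero => exact hm
    | succ n ih => rw [pow_succ', Module.End.mul_apply]; exact hc _ ih
  let W := D.subOf ⊤ ⊤ N (fun _ _ => trivial) (fun _ _ => trivial)
    (fun i j p _ => by
      rw [jet_apply]; exact N.sum_mem fun n _ => N.smul_mem _ (hpow _ _ (hα i j)))
    (fun _ _ _ => trivial) (fun p _ j => N.smul_mem _ (hv j)) hc
  have hlt : Module.finrank ℂ N < Module.finrank ℂ M := Submodule.finrank_lt hN
  have e1 : Module.finrank ℂ W.s₁ = (κ + 1) * Module.finrank ℂ N := finrank_piSub _ _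
  have e0 : Module.finrank ℂ W.s₀ = (l + 1) + (κ + 2) * Module.finrank ℂ N := by
    refine (finrank_subOf_s₀ _ _).trans ?_
    rw [finrank_top, Module.finrank_fin_fun]
  have h := hs.2 W rfl (Or.inr fun ht => by
    have : Module.finrank ℂ W.s₁ = (κ + 1) * Module.finrank ℂ M := by
      rw [ht, finrank_top, finrank_V₁]
    rw [e1] at this
    exact hlt.ne (Nat.eq_of_mul_eq_mul_left (Nat.succ_pos κ) this))
  rw [e0, e1, finrank_V₀, finrank_V₁] at h
  obtain ⟨d, hd⟩ := Nat.exists_eq_add_of_lt hlt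
  rw [hd] at h
  simp only [slope] at h hθ
  push_cast at h hθ
  nlinarith [mul_nonneg (Nat.cast_nonneg (α := ℝ) d) (neg_nonneg.2 hθ.le)]

/-- Such an N spans the unframed subrepresentation N ⊗ O(κ+1), whose slope is a multiple of a
positive number; stability leaves only N = ⊥. -/
theorem cogenerated_of_isStable {θ : ℝ × ℝ} (hθ : 0 < slope θ (κ + 2) (κ + 1))
    (hs : IsStable θ D.toRep) (N : Submodule ℂ M) (hc : ∀ m ∈ N, D.c m ∈ N)
    (hβ : ∀ j, ∀ m ∈ N, D.β j m = 0) : N = ⊥ := by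
  by_contra hN
  let W := D.subOf ⊥ ⊥ N (by simp) (by simp) (by simp) (by simpa using hβ) (by simp) hc
  have e1 : Module.finrank ℂ W.s₁ = (κ + 1) * Module.finrank ℂ N := finrank_piSub _ _
  have e0 : Module.finrank ℂ W.s₀ = (κ + 2) * Module.finrank ℂ N := by
    refine (finrank_subOf_s₀ _ _).trans ?_
    rw [finrank_bot, zero_add]
  have hpos : Module.finrank ℂ N ≠ 0 := fun h => hN (Submodule.finrank_eq_zero.1 h)
  have h := hs.1 W rfl (Or.inr fun ht => by
    have : Module.finrank ℂ W.s₁ = 0 := by rw [ht, finrank_bot]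
    rw [e1] at this
    exact hpos ((Nat.mul_eq_zero.1 this).resolve_left (Nat.succ_ne_zero κ)))
  rw [e0, e1] at h
  simp only [slope] at h hθ
  push_cast at h hθ
  have : (0 : ℝ) ≤ Module.finrank ℂ N := Nat.cast_nonneg _
  nlinarith [mul_nonneg this hθ.le]

end StdData

end PervConifold

/-! ### Extensions of the thickened line and copies of `O(κ+1)` -/

namespace PervConifold

variable {V₀ V₁ : Type} [AddCommGroup V₀] [Module ℂ V₀] [AddCommGroup V₁] [Module ℂ V₁]

theorem pow_jet {l : ℕ} {V : Type*} [AddCommGroup V] [Module ℂ V] (c : V →ₗ[ℂ] V) (x : V)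
    (hx : (c ^ (l + 1)) x = 0) (p : Fin (l + 1) → ℂ) : c (jet l c x p) = jet l c x ((thickIdeal (l + 1)).c p) := by
  rw [map_jet, hx, smul_zero, add_zero]

/-! ### Reading off the standard data from a Kronecker filtration. -/

section Kronecker

variable {κ r : ℕ} {R : FramedRep ℂ V₀ V₁} {A : Fin (r + 1) → Submodule ℂ V₀}
  {B : Fin (r + 1) → Submodule ℂ V₁}

/-- The action of the loops on `Hom(O(κ+1), E)`. -/
def kHomLoop (κ : ℕ) (R : FramedRep ℂ V₀ V₁) (A₀ : Submodule ℂ V₀) (hc : ∀ x ∈ A₀, R.c x ∈ A₀) :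
    kHom κ R.b A₀ →ₗ[ℂ] kHom κ R.b A₀ :=
  (LinearMap.pi fun j => R.d ∘ₗ LinearMap.proj j).restrict fun n hn j => by
    have := hc _ (hn j)
    rw [map_sub, R.rel_b, R.rel_b] at this
    exact this

theorem kHomLoop_apply {A₀ : Submodule ℂ V₀} (hc : ∀ x ∈ A₀, R.c x ∈ A₀) (m : kHom κ R.b A₀)
    (j : Fin (κ + 1)) : (kHomLoop κ R A₀ hc m).1 j = R.d (m.1 j) := rfl

theorem d_kEval₁ {A₀ : Submodule ℂ V₀} (hc : ∀ x ∈ A₀, R.c x ∈ A₀)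
    (f : Fin (κ + 1) → kHom κ R.b A₀) :
    R.d (kEval₁ R.b A₀ f) = kEval₁ R.b A₀ fun j => kHomLoop κ R A₀ hc (f j) := by
  simp only [kEval₁_apply, map_sum, kHomLoop_apply]

theorem c_kEval₀ {A₀ : Submodule ℂ V₀} (hc : ∀ x ∈ A₀, R.c x ∈ A₀)
    (f : Fin (κ + 2) → kHom κ R.b A₀) :
    R.c (kEval₀ R.b A₀ f) = kEval₀ R.b A₀ fun j => kHomLoop κ R A₀ hc (f j) := by
  simp only [kEval₀_apply, map_add, map_sum, kHomLoop_apply, R.rel_b]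

/-- The arrow a_i lowers the degree on P¹ by one, so the reason is that O(κ+1) has no nonzero
morphism to O(κ). Concretely, for a morphism n the relations make a_i b₀ n and a_i b₁ n into
morphisms again, and placing them in the last two slots evaluates to b₁a_ib₀ - b₀a_ib₁ = 0.
Injectivity of the evaluation then kills both. -/
theorem a_kEval₀ (H : IsKroneckerFiltration κ R.b A B) (ha : ∀ i, ∀ x ∈ A 0, R.a i x = 0)
    (i : Fin 2) (f : Fin (κ + 2) → kHom κ R.b (A 0)) : R.a i (kEval₀ R.b (A 0) f) = 0 := by
  have hstep : ∀ (n : kHom κ R.b (A 0)) (j : Fin κ),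
      R.a i (R.b 1 (n.1 j.castSucc)) = R.a i (R.b 0 (n.1 j.succ)) := fun n j => by
    have := ha i _ (n.2 j)
    rwa [map_sub, sub_eq_zero] at this
  have key : ∀ (n : kHom κ R.b (A 0)),
      (∀ j, R.a i (R.b 0 (n.1 j)) = 0) ∧ (∀ j, R.a i (R.b 1 (n.1 j)) = 0) := by
    intro n
    let n' : kHom κ R.b (A 0) := ⟨fun j => R.a i (R.b 0 (n.1 j)), fun j => by
      beta_reduce
      rw [R.rel_bab, hstep, sub_self]; exact zero_mem _⟩
    let n'' : kHom κ R.b (A 0) := ⟨fun j => R.a i (R.b 1 (n.1 j)), fun j => by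
      beta_reduce
      rw [hstep, R.rel_bab, sub_self]; exact zero_mem _⟩
    let f : Fin (κ + 2) → kHom κ R.b (A 0) :=
      Pi.single (Fin.last _) n' - Pi.single (Fin.last κ).castSucc n''
    have hf : f = 0 := by
      apply H.eq_zero_of_kEval₀_mem
      have h1 : ∀ m, kEval₀ R.b (A 0) (Pi.single (Fin.last _) m) = R.b 1 (m.1 (Fin.last κ)) := by
        intro m
        rw [kEval₀_apply, Pi.single_eq_same, Finset.sum_eq_zero, zero_add]
        intro j _
        rw [Pi.single_eq_of_ne (Fin.castSucc_lt_last j).ne]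
        exact map_zero _
      have h2 : ∀ m, kEval₀ R.b (A 0) (Pi.single (Fin.last κ).castSucc m)
          = R.b 0 (m.1 (Fin.last κ)) := by
        intro m
        rw [kEval₀_apply, Pi.single_eq_of_ne (Fin.castSucc_lt_last _).ne', Finset.sum_eq_single (Fin.last κ)]
        · rw [Pi.single_eq_same]
          simp
        · intro j _ hj
          rw [Pi.single_eq_of_ne (by simpa using hj)]
          exact map_zero _
        · simp
      rw [map_sub, h1, h2]
      change R.b 1 (R.a i (R.b 0 (n.1 (Fin.last κ)))) - R.b 0 (R.a i (R.b 1 (n.1 (Fin.last κ)))) ∈ A 0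
      rw [R.rel_bab, sub_self]
      exact zero_mem _
    have hlast := congrFun hf (Fin.last _)
    have hpre := congrFun hf (Fin.last κ).castSucc
    simp only [f, Pi.sub_apply, Pi.single_eq_same, Pi.zero_apply,
      Pi.single_eq_of_ne (Fin.castSucc_lt_last (Fin.last κ)).ne,
      Pi.single_eq_of_ne (Fin.castSucc_lt_last (Fin.last κ)).ne', sub_zero, zero_sub, neg_eq_zero] at hlast hpre
    exact ⟨fun j => congrFun (congrArg Subtype.val hlast) j, fun j => congrFun (congrArg Subtype.val hpre) j⟩
  rw [kEval₀_apply, map_add, map_sum, (key _).2, add_zero]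
  exact Finset.sum_eq_zero fun j _ => (key _).1 j

/-- The coordinates are p ↦ p(c)·1 on the thickened line and the evaluation on M ⊗ O(κ+1), with M =
`kHom`. The two cases of `hz` are the two directions of extension: A 0 is zero when the copies of
O(κ+1) come first, and it contains the framing vector when the thickened line does. -/
theorem exists_stdData [FiniteDimensional ℂ V₀] [FiniteDimensional ℂ V₁] {l : ℕ}
    (H : IsKroneckerFiltration κ R.b A B) (ha : ∀ i, ∀ x ∈ A 0, R.a i x = 0)
    (hc : ∀ x ∈ A 0, R.c x ∈ A 0) (hA : ∀ y ∈ A 0, ∃ p, jet l R.c (R.fr 1) p = y)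
    (hv : ∃ f, kEval₀ (κ := κ) R.b (A 0) f = (R.c ^ (l + 1)) (R.fr 1))
    (hz : A 0 = ⊥ ∨ (R.fr 1 ∈ A 0 ∧ (R.c ^ (l + 1)) (R.fr 1) = 0))
    (hinj : Function.Injective (jet l R.c (R.fr 1)))
    (hψ : Function.Bijective fun x : (Fin (l + 1) → ℂ) × (Fin (κ + 2) → kHom κ R.b (A 0)) =>
      jet l R.c (R.fr 1) x.1 + kEval₀ R.b (A 0) x.2) :
    ∃ D : StdData κ l (kHom κ R.b (A 0)), RepIso D.toRep R ∧ (A 0 = ⊥ → D.β = 0) ∧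
      (A 0 ≠ ⊥ → D.v = 0 ∧ D.α = 0) := by
  classical
  have hz' : A 0 ≠ ⊥ → (R.fr 1 ∈ A 0 ∧ (R.c ^ (l + 1)) (R.fr 1) = 0) := fun h => hz.resolve_left h
  have h₀inj : Function.Injective (kEval₀ (κ := κ) R.b (A 0)) := by
    rw [← LinearMap.ker_eq_bot, Submodule.eq_bot_iff]
    intro f hf
    exact H.eq_zero_of_kEval₀_mem (by rw [LinearMap.mem_ker.1 hf]; exact zero_mem _)
  obtain ⟨v, hv⟩ := hv
  choose α hα using fun i => H.kEval₁_bijective.2 (R.a i (R.fr 1))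
  let e := LinearEquiv.ofInjective _ hinj
  let δ : Fin κ → kHom κ R.b (A 0) →ₗ[ℂ] LinearMap.range (jet l R.c (R.fr 1)) := fun j =>
    ((R.b 1 ∘ₗ LinearMap.proj j.castSucc - R.b 0 ∘ₗ LinearMap.proj j.succ) ∘ₗ
      Submodule.subtype _).codRestrict _ fun n => hA _ (n.2 j)
  let β : Fin κ → kHom κ R.b (A 0) →ₗ[ℂ] (Fin (l + 1) → ℂ) := fun j => e.symm.toLinearMap ∘ₗ δ j
  have hβ : ∀ j n, jet l R.c (R.fr 1) (β j n) = R.b 1 (n.1 j.castSucc) - R.b 0 (n.1 j.succ) := by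
    intro j n
    have : e (e.symm (δ j n)) = δ j n := e.apply_symm_apply _
    exact congrArg Subtype.val this
  have hβ0 : A 0 = ⊥ → β = 0 := by
    intro h
    ext1 j
    ext1 n
    apply hinj
    rw [hβ]
    have := n.2 j
    exact ((congrArg (_ ∈ ·) h).mp this).trans (map_zero _).symm
  have hvα0 : A 0 ≠ ⊥ → v = 0 ∧ α = 0 := by
    intro h
    obtain ⟨h1, h2⟩ := hz' h
    refine ⟨h₀inj (by rw [hv, h2, map_zero]), ?_⟩
    ext1 i
    exact H.kEval₁_injective (by rw [hα, ha i _ h1]; exact (map_zero _).symm)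
  have hL : ∀ (n : ℕ) f, (R.d ^ n) (kEval₁ R.b (A 0) f)
      = kEval₁ R.b (A 0) fun j => ((kHomLoop κ R (A 0) hc) ^ n) (f j) := by
    intro n f
    induction n with
    | zero => rfl
    | succ n ih =>
      rw [pow_succ', Module.End.mul_apply, ih, d_kEval₁ hc]
      simp only [pow_succ', Module.End.mul_apply]
  have hac : ∀ (i : Fin 2) (n : ℕ), R.a i ((R.c ^ n) (R.fr 1)) = (R.d ^ n) (R.a i (R.fr 1)) := by
    intro i n
    induction n with
    | zero => rfl
    | succ n ih => rw [pow_succ', Module.End.mul_apply, ← R.rel_a, ih, pow_succ', Module.End.mul_apply]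
  let D : StdData κ l (kHom κ R.b (A 0)) :=
    { c := kHomLoop κ R (A 0) hc
      v := v
      α := α
      β := β
      -- The vector c^(l+1)·1 lies in the image of the evaluation, which a_i kills, so d^(l+1)
      -- annihilates a_i·1.
      hα := fun i j => by
        have h := hL (l + 1) (α i)
        rw [hα, ← hac, ← hv, a_kEval₀ H ha] at h
        exact congrFun (H.kEval₁_injective (h.symm.trans (map_zero _).symm)) j
      hβ := fun j m => by
        by_cases hA0 : A 0 = ⊥
        · rw [hβ0 hA0]; simp
        · apply hinj
          rw [hβ, ← pow_jet _ _ (hz' hA0).2, hβ, map_sub, R.rel_b, R.rel_b, kHomLoop_apply, kHomLoop_apply]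
      hz := (em (A 0 = ⊥)).imp hβ0 hvα0 }
  let G : ((Fin (l + 1) → ℂ) × (Fin (κ + 2) → kHom κ R.b (A 0))) ≃ₗ[ℂ] V₀ :=
    LinearEquiv.ofBijective (LinearMap.coprod (jet l R.c (R.fr 1)) (kEval₀ R.b (A 0))) hψ
  have hG : ∀ x, G.toLinearMap x = jet l R.c (R.fr 1) x.1 + kEval₀ R.b (A 0) x.2 := fun _ => rfl
  refine ⟨D, ⟨G, LinearEquiv.ofBijective _ H.kEval₁_bijective, ⟨fun u => ?_, fun i x => ?_, fun i y => ?_, fun x => ?_,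
      fun y => ?_⟩⟩, hβ0, hvα0⟩
  · rw [hG, StdData.toRep_fr, map_zero, add_zero, jet_single, Fin.val_zero, pow_zero,
      Module.End.one_apply, ← map_smul, smul_eq_mul, mul_one]
    rfl
  · rw [hG, map_add, a_kEval₀ H ha, add_zero, StdData.toRep_a]
    have h1 : (fun j => jet l D.c (D.α i j) x.1)
        = ∑ n : Fin (l + 1), x.1 n • fun j => ((kHomLoop κ R (A 0) hc) ^ (n : ℕ)) (α i j) := by
      ext1 j
      rw [Finset.sum_apply]
      exact jet_apply _ _ _
    rw [h1, map_sum, jet_apply, map_sum]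
    refine Finset.sum_congr rfl fun n _ => ?_
    rw [map_smul, map_smul, hac, ← hα, hL]
    rfl
  · rw [hG]
    fin_cases i
    · simp [b_zero_kEval₁]
    · simp only [Fin.mk_one, StdData.toRep_b_one, map_sum]
      rw [add_comm]
      refine Eq.trans ?_ (b_one_kEval₁ R.b (A 0) y).symm
      congr 1
      exact Finset.sum_congr rfl fun j _ => hβ j _
  · rw [hG, hG, map_add, map_jet, c_kEval₀ hc, ← hv, StdData.toRep_c, add_assoc]
    congr 1
    rw [← map_smul, ← map_add]
    congr 1
    ext1 j
    exact add_comm _ _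
  · exact (d_kEval₁ hc y).symm

end Kronecker

/-! ### Stable objects with the prescribed Jordan–Hölder factors are standard. -/

section Classification

variable {κ l r : ℕ} {R : FramedRep ℂ V₀ V₁} {θ : ℝ × ℝ}

theorem IsSubquotient.sU_eq {W W' : SubRep R} (h : IsSubquotient W W' (lineRep (κ + 2))) :
    W.sU = W'.sU := by
  obtain ⟨⟨h1, -, -⟩, fU, -, -, -, -, -, -, hk, -⟩ := h
  exact le_antisymm h1 fun u hu => (hk ⟨u, hu⟩).1 (Subsingleton.elim _ _)

theorem IsSubquotient.finrank_eq [FiniteDimensional ℂ V₀] [FiniteDimensional ℂ V₁] {W W' : SubRep R}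
    (h : IsSubquotient W W' (lineRep (κ + 2))) :
    Module.finrank ℂ W'.s₀ = Module.finrank ℂ W.s₀ + (κ + 2) ∧
    Module.finrank ℂ W'.s₁ = Module.finrank ℂ W.s₁ + (κ + 1) := by
  obtain ⟨⟨-, h0, h1⟩, -, f₀, f₁, -, -, s0, s1, -, k0, k1⟩ := h
  exact ⟨IsKroneckerFiltration.finrank_step h0 f₀ s0 k0, IsKroneckerFiltration.finrank_step h1 f₁ s1 k1⟩

theorem IsSubquotient.kronecker {W W' : SubRep R} (h : IsSubquotient W W' (lineRep (κ + 2))) :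
    ∃ (f₀ : W'.s₀ →ₗ[ℂ] (Fin (κ + 2) → ℂ)) (f₁ : W'.s₁ →ₗ[ℂ] (Fin (κ + 1) → ℂ)),
    (∀ i (y : W'.s₁), f₀ ⟨R.b i y, W'.b_mem i y y.2⟩ = sh κ ℂ i (f₁ y)) ∧
    Function.Surjective f₀ ∧ Function.Surjective f₁ ∧
    (∀ x, f₀ x = 0 ↔ (x : V₀) ∈ W.s₀) ∧ (∀ y, f₁ y = 0 ↔ (y : V₁) ∈ W.s₁) := by
  obtain ⟨-, fU, f₀, f₁, hf, -, s0, s1, -, k0, k1⟩ := h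
  exact ⟨f₀, f₁, hf.b, s0, s1, k0, k1⟩

/-- A surjection onto the thickened line is, up to a scalar, inverse to `p ↦ p(c) · 1`. -/
theorem IsHom.jet_eq {W : SubRep R} {fU : W.sU →ₗ[ℂ] ℂ} {f₀ : W.s₀ →ₗ[ℂ] (Fin (l + 1) → ℂ)}
    {f₁ : W.s₁ →ₗ[ℂ] (Fin 0 → ℂ)} (hf : IsHom W.toRep (thickIdeal (l + 1)) fU f₀ f₁)
    (hU : (1 : ℂ) ∈ W.sU) (p : Fin (l + 1) → ℂ) :
    ∃ h, f₀ ⟨jet l R.c (R.fr 1) p, h⟩ = fU ⟨1, hU⟩ • p := by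
  have hpow : ∀ n : ℕ, ∃ h : (R.c ^ n) (R.fr 1) ∈ W.s₀, f₀ ⟨(R.c ^ n) (R.fr 1), h⟩
      = ((thickIdeal (l + 1)).c ^ n) ((thickIdeal (l + 1)).fr (fU ⟨1, hU⟩)) := by
    intro n
    induction n with
    | zero => exact ⟨W.fr_mem 1 hU, hf.fr ⟨1, hU⟩⟩
    | succ n ih =>
      obtain ⟨h, e⟩ := ih
      refine ⟨by rw [pow_succ', Module.End.mul_apply]; exact W.c_mem _ h, ?_⟩
      have := hf.c ⟨_, h⟩
      rw [e] at this
      refine Eq.trans (congrArg f₀ (Subtype.ext ?_)) (this.trans ?_)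
      · exact congrArg (fun g => g (R.fr 1)) (pow_succ' R.c n)
      · rw [pow_succ']; rfl
  have hm : jet l R.c (R.fr 1) p ∈ W.s₀ := by
    rw [jet_apply]
    exact Submodule.sum_mem _ fun n _ => Submodule.smul_mem _ _ (hpow n).1
  refine ⟨hm, ?_⟩
  have : (⟨jet l R.c (R.fr 1) p, hm⟩ : W.s₀)
      = ∑ n : Fin (l + 1), p n • ⟨(R.c ^ (n : ℕ)) (R.fr 1), (hpow n).1⟩ := by
    apply Subtype.ext
    rw [AddSubmonoidClass.coe_finsetSum]
    exact jet_apply _ _ _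
  rw [this, map_sum]
  have h2 : ∀ n : Fin (l + 1), f₀ (p n • ⟨(R.c ^ (n : ℕ)) (R.fr 1), (hpow n).1⟩)
      = p n • Pi.single n (fU ⟨1, hU⟩) := fun n => by
    rw [map_smul, (hpow n).2, thickIdeal_c_pow_fr]
  rw [Finset.sum_congr rfl fun n _ => h2 n]
  ext j
  rw [Finset.sum_apply, Finset.sum_eq_single j]
  · simp [mul_comm]
  · intro n _ hn
    rw [Pi.smul_apply, Pi.single_eq_of_ne hn.symm, smul_zero]
  · simp

/-- For negative slope of O(κ+1) stability forbids it as top quotient. Hence the thickened line is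
the last factor, and the steps below it form a Kronecker filtration starting from zero. -/
theorem exists_stdData_plus [FiniteDimensional ℂ V₀] [FiniteDimensional ℂ V₁]
    (hθ : slope θ (κ + 2) (κ + 1) < 0) (hR : IsStable θ R)
    (hJ : HasJHFactors R (thickIdeal (l + 1)) (lineRep (κ + 2)) r) :
    ∃ (A : Submodule ℂ V₀) (D : StdData κ l (kHom κ R.b A)),
      Module.finrank ℂ (kHom κ R.b A) = r ∧ RepIso D.toRep R ∧ D.β = 0 := by
  obtain ⟨W, p, h0, h1, hp, hj⟩ := hJ
  have hlast : p = Fin.last r := by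
    by_contra hne
    have hS := hj (Fin.last r) (Ne.symm hne)
    rw [Fin.succ_last] at hS
    obtain ⟨e0, e1⟩ := hS.finrank_eq
    rw [h1.2.1, finrank_top] at e0
    rw [h1.2.2, finrank_top] at e1
    have := hR.2 (W (Fin.last r).castSucc) (hS.sU_eq.trans h1.1) (Or.inr fun ht => by
      rw [ht, finrank_top] at e1
      omega)
    rw [e0, e1] at this
    simp only [slope] at this hθ
    push_cast at this hθ
    linarith
  subst hlast
  have hS : ∀ s : Fin r, IsSubquotient (W s.castSucc.castSucc) (W s.succ.castSucc)
      (lineRep (κ + 2)) := fun s => by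
    have := hj s.castSucc (Fin.castSucc_lt_last s).ne
    rwa [Fin.succ_castSucc] at this
  rw [Fin.succ_last] at hp
  obtain ⟨-, fU, f₀, f₁, hf, sU, s0, -, kU, k0, k1⟩ := hp
  have hU : (1 : ℂ) ∈ (W (Fin.last (r + 1))).sU := by rw [h1.1]; trivial
  have hz : fU ⟨1, hU⟩ ≠ 0 := by
    intro h
    obtain ⟨u, hu⟩ := sU 1
    have : u = u.1 • (⟨1, hU⟩ : (W (Fin.last (r + 1))).sU) := by
      apply Subtype.ext; simp
    rw [this, map_smul, h, smul_zero] at hu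
    exact zero_ne_one hu
  have H : IsKroneckerFiltration κ R.b (fun s : Fin (r + 1) => (W s.castSucc).s₀)
      (fun s => (W s.castSucc).s₁) :=
    ⟨h0.2.2, by
      rw [eq_top_iff]
      exact fun y _ => (k1 ⟨y, by rw [h1.2.2]; trivial⟩).1 (Subsingleton.elim _ _),
      fun s => (hS s).1.2.1, fun s => (hS s).1.2.2, fun s => (W s.castSucc).b_mem,
      fun s => (hS s).kronecker⟩
  have hA : (W (0 : Fin (r + 1)).castSucc).s₀ = ⊥ := h0.2.1
  have h₀ : ∀ x ∈ (W (0 : Fin (r + 1)).castSucc).s₀, x = 0 := fun x hx => by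
    rwa [hA, Submodule.mem_bot] at hx
  have hexact : ∀ x : (W (Fin.last (r + 1))).s₀, f₀ x = 0 →
      ∃ f, kEval₀ (κ := κ) R.b _ f = (x : V₀) := fun x hx => by
    obtain ⟨f, hf⟩ := H.exists_kEval₀ ((k0 x).1 hx)
    exact ⟨f, (sub_eq_zero.1 (h₀ _ hf)).symm⟩
  have hinj : Function.Injective (jet l R.c (R.fr 1)) := by
    rw [← LinearMap.ker_eq_bot, Submodule.eq_bot_iff]
    intro p hp
    obtain ⟨h, e⟩ := hf.jet_eq hU p
    have : (⟨jet l R.c (R.fr 1) p, h⟩ : (W (Fin.last (r + 1))).s₀) = 0 := Subtype.ext hp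
    rw [this, map_zero] at e
    exact (smul_eq_zero.1 e.symm).resolve_left hz
  -- Modulo the steps below, c^(l+1)·1 is a multiple of c^(l+1) in ℂ[c]/c^(l+1), hence zero; it
  -- therefore lies in the part filled by copies of O(κ+1).
  have hv : ∃ f, kEval₀ (κ := κ) R.b (W (0 : Fin (r + 1)).castSucc).s₀ f = (R.c ^ (l + 1)) (R.fr 1) := by
    obtain ⟨h, e⟩ := hf.jet_eq hU (Pi.single (Fin.last l) 1)
    have h2 := hf.c ⟨_, h⟩
    rw [e, map_smul] at h2
    have h3 : (thickIdeal (l + 1)).c (Pi.single (Fin.last l) 1) = 0 := by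
      ext j
      refine Fin.cases ?_ (fun j => ?_) j
      · simp
      · rw [thickIdeal_c_succ, Pi.single_eq_of_ne (Fin.castSucc_lt_last j).ne]; rfl
    rw [h3, smul_zero] at h2
    obtain ⟨f, hf⟩ := hexact _ h2
    refine ⟨f, hf.trans ?_⟩
    change R.c (jet l R.c (R.fr 1) (Pi.single (Fin.last l) 1)) = _
    rw [jet_single, one_smul, Fin.val_last, pow_succ', Module.End.mul_apply]
  have hψ : Function.Bijective fun x : (Fin (l + 1) → ℂ) × (Fin (κ + 2) → kHom κ R.b _) =>
      jet l R.c (R.fr 1) x.1 + kEval₀ R.b (W (0 : Fin (r + 1)).castSucc).s₀ x.2 := by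
    constructor
    · intro x y hxy
      have hsub : jet l R.c (R.fr 1) (x.1 - y.1) = kEval₀ R.b _ (y.2 - x.2) := by
        rw [map_sub, map_sub]
        exact sub_eq_sub_iff_add_eq_add.2 (Eq.trans hxy (add_comm _ _))
      obtain ⟨h, e⟩ := hf.jet_eq hU (x.1 - y.1)
      have hm : jet l R.c (R.fr 1) (x.1 - y.1) ∈ (W (Fin.last r).castSucc).s₀ := by
        rw [hsub]; exact H.kEval₀_mem _
      rw [(k0 ⟨_, h⟩).2 hm] at e
      have h1 := sub_eq_zero.1 ((smul_eq_zero.1 e.symm).resolve_left hz)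
      rw [h1, sub_self, map_zero] at hsub
      have h2 := H.eq_zero_of_kEval₀_mem (f := y.2 - x.2) (by rw [← hsub]; exact zero_mem _)
      exact Prod.ext h1 (sub_eq_zero.1 h2).symm
    · intro x
      have hx : x ∈ (W (Fin.last (r + 1))).s₀ := by rw [h1.2.1]; trivial
      obtain ⟨h, e⟩ := hf.jet_eq hU ((fU ⟨1, hU⟩)⁻¹ • f₀ ⟨x, hx⟩)
      rw [smul_inv_smul₀ hz] at e
      obtain ⟨f, hf⟩ := hexact (⟨x, hx⟩ - ⟨_, h⟩) (by rw [map_sub, e, sub_self])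
      refine ⟨((fU ⟨1, hU⟩)⁻¹ • f₀ ⟨x, hx⟩, f), ?_⟩
      beta_reduce
      rw [hf]
      exact add_sub_cancel _ _
  obtain ⟨D, hD, hβ, -⟩ := exists_stdData (l := l) H (fun i x hx => by rw [h₀ x hx, map_zero])
    (W (0 : Fin (r + 1)).castSucc).c_mem (fun y hy => ⟨0, by rw [h₀ y hy, map_zero]⟩) hv
    (Or.inl hA) hinj hψ
  exact ⟨_, D, H.finrank_kHom, hD, hβ hA⟩

/-- For positive slope of O(κ+1) stability forbids it as a subobject. Hence the thickened line is
the first factor, and the filtration above it is a Kronecker filtration modulo that line. -/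
theorem exists_stdData_minus [FiniteDimensional ℂ V₀] [FiniteDimensional ℂ V₁]
    (hθ : 0 < slope θ (κ + 2) (κ + 1)) (hR : IsStable θ R)
    (hJ : HasJHFactors R (thickIdeal (l + 1)) (lineRep (κ + 2)) r) :
    ∃ (A : Submodule ℂ V₀) (D : StdData κ l (kHom κ R.b A)),
      Module.finrank ℂ (kHom κ R.b A) = r ∧ RepIso D.toRep R ∧ D.v = 0 ∧ D.α = 0 := by
  obtain ⟨W, p, h0, h1, hp, hj⟩ := hJ
  have hfirst : p = 0 := by
    by_contra hne
    have hS := hj 0 (Ne.symm hne)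
    obtain ⟨e0, e1⟩ := hS.finrank_eq
    rw [Fin.castSucc_zero, h0.2.1, finrank_bot, zero_add] at e0
    rw [Fin.castSucc_zero, h0.2.2, finrank_bot, zero_add] at e1
    have := hR.1 (W (0 : Fin (r + 1)).succ) (hS.sU_eq.symm.trans h0.1) (Or.inr fun ht => by
      rw [ht, finrank_bot] at e1
      omega)
    rw [e0, e1] at this
    simp only [slope] at this hθ
    push_cast at this hθ
    linarith
  subst hfirst
  have hS : ∀ s : Fin r, IsSubquotient (W s.castSucc.succ) (W s.succ.succ)
      (lineRep (κ + 2)) := fun s => by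
    have := hj s.succ (Fin.succ_ne_zero s)
    rwa [← Fin.succ_castSucc] at this
  rw [Fin.castSucc_zero] at hp
  obtain ⟨-, fU, f₀, f₁, hf, sU, s0, -, kU, k0, k1⟩ := hp
  have hU : (1 : ℂ) ∈ (W (0 : Fin (r + 1)).succ).sU := by
    obtain ⟨u, hu⟩ := sU 1
    have hne : u.1 ≠ 0 := fun h => by
      rw [show u = 0 from Subtype.ext h, map_zero] at hu
      exact zero_ne_one hu
    have := Submodule.smul_mem _ (u.1)⁻¹ u.2
    rwa [smul_eq_mul, inv_mul_cancel₀ hne] at this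
  have hz : fU ⟨1, hU⟩ ≠ 0 := by
    intro h
    have := (kU _).1 h
    rw [h0.1] at this
    exact one_ne_zero ((Submodule.mem_bot ℂ).1 this)
  have hb1 : ∀ y ∈ (W (0 : Fin (r + 1)).succ).s₁, y = 0 := fun y hy => by
    have := (k1 ⟨y, hy⟩).1 (Subsingleton.elim _ _)
    rwa [h0.2.2, Submodule.mem_bot] at this
  have H : IsKroneckerFiltration κ R.b (fun s : Fin (r + 1) => (W s.succ).s₀)
      (fun s => (W s.succ).s₁) :=
    ⟨(Submodule.eq_bot_iff _).2 hb1, by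
      have := h1.2.2
      rwa [← Fin.succ_last] at this,
      fun s => (hS s).1.2.1, fun s => (hS s).1.2.2, fun s => (W s.succ).b_mem,
      fun s => (hS s).kronecker⟩
  have hinj₀ : Function.Injective f₀ := by
    rw [← LinearMap.ker_eq_bot, Submodule.eq_bot_iff]
    intro x hx
    have := (k0 x).1 hx
    rw [h0.2.1, Submodule.mem_bot] at this
    exact Subtype.ext this
  have hrange : ∀ y ∈ (W (0 : Fin (r + 1)).succ).s₀, ∃ p, jet l R.c (R.fr 1) p = y := by
    intro y hy
    obtain ⟨h, e⟩ := hf.jet_eq hU ((fU ⟨1, hU⟩)⁻¹ • f₀ ⟨y, hy⟩)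
    rw [smul_inv_smul₀ hz] at e
    exact ⟨_, congrArg Subtype.val (hinj₀ e)⟩
  have hinj : Function.Injective (jet l R.c (R.fr 1)) := by
    rw [← LinearMap.ker_eq_bot, Submodule.eq_bot_iff]
    intro p hp
    obtain ⟨h, e⟩ := hf.jet_eq hU p
    have : (⟨jet l R.c (R.fr 1) p, h⟩ : (W (0 : Fin (r + 1)).succ).s₀) = 0 := Subtype.ext hp
    rw [this, map_zero] at e
    exact (smul_eq_zero.1 e.symm).resolve_left hz
  have hfr := (W (0 : Fin (r + 1)).succ).fr_mem 1 hU
  have hpow : (R.c ^ (l + 1)) (R.fr 1) = 0 := by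
    obtain ⟨h, e⟩ := hf.jet_eq hU (Pi.single (Fin.last l) 1)
    have h2 := hf.c ⟨_, h⟩
    rw [e, map_smul] at h2
    have h3 : (thickIdeal (l + 1)).c (Pi.single (Fin.last l) 1) = 0 := by
      ext j
      refine Fin.cases ?_ (fun j => ?_) j
      · simp
      · rw [thickIdeal_c_succ, Pi.single_eq_of_ne (Fin.castSucc_lt_last j).ne]; rfl
    rw [h3, smul_zero] at h2
    have h4 : R.c (jet l R.c (R.fr 1) (Pi.single (Fin.last l) 1)) = 0 :=
      congrArg Subtype.val (hinj₀ (h2.trans (map_zero f₀).symm))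
    rwa [jet_single, one_smul, Fin.val_last, ← Module.End.mul_apply, ← pow_succ'] at h4
  have hA : (W (0 : Fin (r + 1)).succ).s₀ ≠ ⊥ := fun h => by
    rw [h, Submodule.mem_bot] at hfr
    have : (Pi.single 0 1 : Fin (l + 1) → ℂ) = 0 := hinj (by
      rw [jet_single, map_zero, one_smul]; exact hfr)
    exact one_ne_zero (α := ℂ) (by simpa using congrFun this 0)
  have hψ : Function.Bijective fun x : (Fin (l + 1) → ℂ) × (Fin (κ + 2) → kHom κ R.b _) =>
      jet l R.c (R.fr 1) x.1 + kEval₀ R.b (W (0 : Fin (r + 1)).succ).s₀ x.2 := by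
    constructor
    · intro x y hxy
      have hsub : jet l R.c (R.fr 1) (x.1 - y.1) = kEval₀ R.b _ (y.2 - x.2) := by
        rw [map_sub, map_sub]
        exact sub_eq_sub_iff_add_eq_add.2 (Eq.trans hxy (add_comm _ _))
      obtain ⟨h, -⟩ := hf.jet_eq hU (x.1 - y.1)
      rw [hsub] at h
      have h2 := H.eq_zero_of_kEval₀_mem h
      rw [h2, map_zero, ← map_zero (jet l R.c (R.fr 1))] at hsub
      exact Prod.ext (sub_eq_zero.1 (hinj hsub)) (sub_eq_zero.1 h2).symm
    · intro x
      obtain ⟨f, hf⟩ := H.exists_kEval₀ (x := x) (by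
        have := h1.2.1
        rw [← Fin.succ_last] at this
        rw [this]; trivial)
      obtain ⟨p, hp⟩ := hrange _ hf
      refine ⟨(p, f), ?_⟩
      change jet l R.c (R.fr 1) p + kEval₀ R.b _ f = x
      rw [hp]
      exact sub_add_cancel _ _
  obtain ⟨D, hD, -, hv⟩ := exists_stdData (l := l) H
    (fun i x hx => hb1 _ ((W (0 : Fin (r + 1)).succ).a_mem i x hx))
    (W (0 : Fin (r + 1)).succ).c_mem hrange ⟨0, by rw [map_zero, hpow]⟩
    (Or.inr ⟨hfr, hpow⟩) hinj hψ
  exact ⟨_, D, H.finrank_kHom, hD, hv hA⟩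

end Classification

end PervConifold

/-! ### Torus fixed standard representations -/

namespace PervConifold

namespace StdData

variable {κ l : ℕ} {M : Type} [AddCommGroup M] [Module ℂ M] (D : StdData κ l M)

/-- `φ` is the part on `M` of an isomorphism of the representation with its twist by `t`. -/
structure IsSemiInvariant (t : Torus) (φ : M →ₗ[ℂ] M) : Prop where
  c : ∀ m, φ (D.c m) = (t.1 3 : ℂ) • D.c (φ m)
  v : ∀ j : Fin (κ + 2), (t.1 0 : ℂ) ^ (j : ℕ) • φ (D.v j) = (t.1 3 : ℂ) ^ (l + 1) • D.v j
  α : ∀ i, ∀ j : Fin (κ + 1), (t.1 0 : ℂ) ^ (j : ℕ) • φ (D.α i j)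
    = ((![t.1 1, t.1 2] i : ℂˣ) : ℂ) • D.α i j
  β : ∀ (j : Fin κ) (m : M) (n : Fin (l + 1)),
    (t.1 0 : ℂ) ^ ((j : ℕ) + 1) * D.β j (φ m) n = (t.1 3 : ℂ) ^ (n : ℕ) * D.β j m n

variable {D}

theorem IsSemiInvariant.c_pow {t : Torus} {φ : M →ₗ[ℂ] M} (h : D.IsSemiInvariant t φ) (n : ℕ) (m : M) :
    φ ((D.c ^ n) m) = (t.1 3 : ℂ) ^ n • (D.c ^ n) (φ m) := by
  induction n with
  | zero => simp
  | succ n ih =>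
    rw [pow_succ', Module.End.mul_apply, h.c, ih, map_smul, smul_smul, pow_succ', Module.End.mul_apply]

/-- The linear automorphism `m ⊗ x ↦ t₀ʲ φ(m) ⊗ x` on the `j`-th copy of `M`. -/
def twistPi (z : ℂˣ) (φ : M ≃ₗ[ℂ] M) (n : ℕ) : (Fin n → M) ≃ₗ[ℂ] (Fin n → M) :=
  LinearEquiv.piCongrRight fun j => φ.trans (LinearEquiv.smulOfUnit (z ^ (j : ℕ)))

theorem twistPi_apply (z : ℂˣ) (φ : M ≃ₗ[ℂ] M) (n : ℕ) (f : Fin n → M) (j : Fin n) :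
    twistPi z φ n f j = (z : ℂ) ^ (j : ℕ) • φ (f j) := by
  rfl

/-- The linear automorphism `cⁿ ↦ zⁿ cⁿ`. -/
def twistThick (z : ℂˣ) (l : ℕ) : (Fin l → ℂ) ≃ₗ[ℂ] (Fin l → ℂ) :=
  LinearEquiv.piCongrRight fun n => LinearEquiv.smulOfUnit (z ^ (n : ℕ))

theorem twistThick_apply (z : ℂˣ) (p : Fin l → ℂ) (n : Fin l) :
    twistThick z l p n = (z : ℂ) ^ (n : ℕ) * p n := by
  rfl

theorem twistThick_c (z : ℂˣ) (p : Fin (l + 1) → ℂ) :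
    twistThick z (l + 1) ((thickIdeal (l + 1)).c p)
      = (z : ℂ) • (thickIdeal (l + 1)).c (twistThick z (l + 1) p) := by
  ext n
  refine Fin.cases ?_ (fun n => ?_) n
  · simp [twistThick_apply]
  · simp [twistThick_apply, pow_succ']; ring

/-- The coordinate b₂ has weight t₀ and b₁ has weight 1, so slot j of M ⊗ H⁰ carries an extra t₀^j.
Compatibility with c, a_i and b₂ uses the four semi-invariance conditions. -/
theorem IsSemiInvariant.isTorusIso {t : Torus} {φ : M ≃ₗ[ℂ] M}
    (h : D.IsSemiInvariant t φ.toLinearMap) :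
    IsTorusIso t D.toRep ((twistThick (t.1 3) (l + 1)).prodCongr (twistPi (t.1 0) φ (κ + 2)))
      (twistPi (t.1 0) φ (κ + 1)) := by
  refine ⟨fun u => ?_, fun i x => ?_, fun i y => ?_, fun x => ?_, fun y => ?_⟩
  · refine Prod.ext ?_ ?_
    · ext n
      refine Fin.cases ?_ (fun n => ?_) n
      · simp [twistThick_apply, FramedRep.twist]
      · simp [twistThick_apply, FramedRep.twist]
    · ext j
      simp [FramedRep.twist]
  · ext j
    simp only [toRep_a, LinearEquiv.coe_coe, twistPi_apply, FramedRep.twist, LinearMap.smul_apply,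
      Pi.smul_apply, LinearEquiv.prodCongr_apply, jet_apply, twistThick_apply, map_sum, map_smul,
      Finset.smul_sum]
    refine Finset.sum_congr rfl fun n _ => ?_
    have h1 := h.c_pow n (D.α i j)
    have h2 := h.α i j
    rw [LinearEquiv.coe_coe] at h1 h2
    rw [h1]
    rw [smul_comm ((t.1 0 : ℂ) ^ (j : ℕ)), smul_comm ((t.1 0 : ℂ) ^ (j : ℕ)), ← map_smul _ ((t.1 0 : ℂ) ^ (j : ℕ)), h2, map_smul]
    simp only [smul_smul]
    congr 1; ring
  · fin_cases i
    · refine Prod.ext ?_ ?_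
      · simp [FramedRep.twist]
      · ext j
        refine Fin.lastCases ?_ (fun j => ?_) j
        · simp [twistPi_apply, FramedRep.twist]
        · simp [twistPi_apply, FramedRep.twist]
    · refine Prod.ext ?_ ?_
      · ext n
        simp only [Fin.mk_one, toRep_b_one, LinearEquiv.coe_coe, LinearEquiv.prodCongr_apply,
          twistThick_apply, FramedRep.twist, LinearMap.smul_apply, Prod.smul_fst, Pi.smul_apply,
          Finset.sum_apply, Finset.mul_sum, smul_eq_mul]
        refine Finset.sum_congr rfl fun j _ => ?_
        rw [← LinearEquiv.coe_coe, ← h.β]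
        simp [twistPi_apply, pow_succ']
        ring
      · ext j
        refine Fin.cases ?_ (fun j => ?_) j
        · simp [twistPi_apply, FramedRep.twist]
        · simp [twistPi_apply, FramedRep.twist, pow_succ', smul_smul]
  · refine Prod.ext ?_ ?_
    · simp only [toRep_c, LinearEquiv.coe_coe, LinearEquiv.prodCongr_apply, twistThick_c]
      rfl
    · ext j
      have h1 := h.c (x.2 j)
      have h2 := h.v j
      rw [LinearEquiv.coe_coe] at h1 h2
      simp only [toRep_c, LinearEquiv.coe_coe, LinearEquiv.prodCongr_apply, twistPi_apply, map_add,
        map_smul, h1, FramedRep.twist, LinearMap.smul_apply, Prod.smul_snd, Pi.smul_apply, smul_add,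
        twistThick_apply, Fin.val_last]
      rw [smul_comm ((t.1 0 : ℂ) ^ (j : ℕ)) (x.1 (Fin.last l)), h2]
      simp only [smul_smul]
      congr 1
      · congr 1; ring
      · congr 1; ring
  · ext j
    have h1 := h.c (y j)
    rw [LinearEquiv.coe_coe] at h1
    simp only [toRep_d, LinearEquiv.coe_coe, twistPi_apply, h1, FramedRep.twist, LinearMap.smul_apply,
      Pi.smul_apply, map_smul, smul_smul]
    congr 1; ring

variable (D)

/-- The framing forces c^n·1 ↦ t₃^n c^n·1. On M ⊗ O(κ+1) there is no freedom beyond one endomorphism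
φ of M, because morphisms O(κ+1) → M ⊗ O(κ+1) are elements of M. -/
theorem exists_isSemiInvariant {t : Torus} {g₀ g₁} (h : IsTorusIso t D.toRep g₀ g₁) :
    ∃ φ : M →ₗ[ℂ] M, D.IsSemiInvariant t φ := by
  have h0 : ((t.1 0 : ℂˣ) : ℂ) ≠ 0 := (t.1 0).ne_zero
  have hb0 : ∀ y, g₀ (0, sh κ M 0 y) = (0, sh κ M 0 (g₁ y)) := fun y => by
    have := h.b 0 y
    simpa [FramedRep.twist] using this
  have hb1 : ∀ y, g₀ (∑ j : Fin κ, D.β j (y j.castSucc), sh κ M 1 y)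
      = (t.1 0 : ℂ) • (∑ j : Fin κ, D.β j (g₁ y j.castSucc), sh κ M 1 (g₁ y)) := fun y => by
    have := h.b 1 y
    simpa [FramedRep.twist] using this
  have hfr : ∀ n : ℕ, g₀ ((D.toRep.c ^ n) (D.toRep.fr 1))
      = (t.1 3 : ℂ) ^ n • (D.toRep.c ^ n) (D.toRep.fr 1) := by
    intro n
    induction n with
    | zero => simpa [FramedRep.twist] using h.fr 1
    | succ n ih =>
      have := h.c ((D.toRep.c ^ n) (D.toRep.fr 1))
      simp only [LinearEquiv.coe_coe] at this
      rw [ih, map_smul] at this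
      rw [pow_succ', Module.End.mul_apply, this, pow_succ', mul_comm, mul_smul]
      rfl
  have hthick : ∀ p : Fin (l + 1) → ℂ, g₀ (p, 0) = (twistThick (t.1 3) (l + 1) p, 0) := by
    intro p
    have e : ∀ q : Fin (l + 1) → ℂ, ((q, 0) : (Fin (l + 1) → ℂ) × (Fin (κ + 2) → M))
        = ∑ n, q n • (Pi.single n 1, 0) := fun q => by
      refine Prod.ext ?_ ?_
      · ext j
        simp [Prod.fst_sum, Finset.sum_apply, Pi.single_apply]
      · simp [Prod.snd_sum]
    rw [e p, e (twistThick _ _ _), map_sum]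
    refine Finset.sum_congr rfl fun n _ => ?_
    rw [map_smul, ← D.c_pow_fr n, hfr, smul_smul, twistThick_apply, mul_comm]
  let φ : M →ₗ[ℂ] M := LinearMap.proj 0 ∘ₗ g₁.toLinearMap ∘ₗ LinearMap.single ℂ (fun _ => M) 0
  have hsnd : ∀ p f, (g₀ (p, f)).2 = (g₀ (0, f)).2 := fun p f => by
    have : ((p, f) : (Fin (l + 1) → ℂ) × (Fin (κ + 2) → M)) = (p, 0) + (0, f) := by simp
    rw [this, map_add, hthick, Prod.snd_add, zero_add]
  have hg1 : ∀ (j : Fin (κ + 1)) m, g₁ (Pi.single j m) = Pi.single j ((t.1 0 : ℂ) ^ (j : ℕ) • φ m) := by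
    intro j m
    -- Dividing slot j by t₀^j turns the twisted relation into that of an untwisted morphism.
    obtain ⟨m', hm'⟩ := exists_eq_single (fun j : Fin (κ + 1) => ((t.1 0 : ℂ) ^ (j : ℕ))⁻¹ • g₁ (Pi.single j m))
      fun j => by
        have e1 := congrArg Prod.snd (hb1 (Pi.single j.castSucc m))
        have e2 := congrArg Prod.snd (hb0 (Pi.single j.succ m))
        rw [hsnd, sh_one_single, Fin.succ_castSucc] at e1
        rw [sh_zero_single] at e2
        rw [e1] at e2
        change (t.1 0 : ℂ) • sh κ M 1 (g₁ (Pi.single j.castSucc m)) = sh κ M 0 (g₁ (Pi.single j.succ m)) at e2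
        simp only [map_smul]
        rw [← e2]
        simp only [smul_smul, Fin.val_castSucc, Fin.val_succ]
        congr 1
        field_simp
        ring
    have hφ : φ m = m' := by
      have := congrFun (hm' 0) 0
      simpa [φ] using this
    have := hm' j
    rw [hφ, ← one_smul ℂ (g₁ _), ← mul_inv_cancel₀ (pow_ne_zero (j : ℕ) h0), mul_smul]
    rw [this, Pi.single_smul]
  have hg1' : ∀ f j, g₁ f j = (t.1 0 : ℂ) ^ (j : ℕ) • φ (f j) := by
    intro f j
    have : f = ∑ i, Pi.single i (f i) := (Finset.univ_sum_single f).symm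
    conv_lhs => rw [this]
    rw [map_sum, Finset.sum_apply, Finset.sum_eq_single j]
    · rw [hg1]; simp
    · intro i _ hi
      rw [hg1, Pi.single_eq_of_ne hi.symm]
    · simp
  have hg0 : ∀ (j : Fin (κ + 2)) m, g₀ (0, Pi.single j m) = (0, Pi.single j ((t.1 0 : ℂ) ^ (j : ℕ) • φ m)) := by
    intro j m
    refine Fin.lastCases ?_ (fun j => ?_) j
    -- The functionals β read only the first κ slots, so b₁ of the last monomial has no component in
    -- the thickened line.
    · have := hb1 (Pi.single (Fin.last κ) m)
      rw [hg1, sh_one_single, sh_one_single, Finset.sum_eq_zero, Finset.sum_eq_zero] at this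
      · rw [Fin.succ_last] at this
        rw [this]
        simp [← Pi.single_smul, smul_smul, pow_succ']
      · intro i _
        rw [Pi.single_eq_of_ne (Fin.castSucc_lt_last i).ne, map_zero]
      · intro i _
        rw [Pi.single_eq_of_ne (Fin.castSucc_lt_last i).ne, map_zero]
    · have := hb0 (Pi.single j m)
      rw [hg1, sh_zero_single, sh_zero_single] at this
      exact this
  have hg0' : ∀ f, g₀ (0, f) = (0, fun j : Fin (κ + 2) => (t.1 0 : ℂ) ^ (j : ℕ) • φ (f j)) := by
    intro f
    have e : ∀ f : Fin (κ + 2) → M, ((0, f) : (Fin (l + 1) → ℂ) × (Fin (κ + 2) → M))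
        = ∑ i, (0, Pi.single i (f i)) := fun f => by
      refine Prod.ext ?_ ?_
      · simp [Prod.fst_sum]
      · simp [Prod.snd_sum, Finset.univ_sum_single]
    rw [e f, map_sum, e (fun j : Fin (κ + 2) => (t.1 0 : ℂ) ^ (j : ℕ) • φ (f j))]
    exact Finset.sum_congr rfl fun i _ => hg0 i _
  refine ⟨φ, ⟨fun m => ?_, fun j => ?_, fun i j => ?_, fun j m n => ?_⟩⟩
  · have := congrFun (h.d (Pi.single 0 m)) 0
    simp only [LinearEquiv.coe_coe, FramedRep.twist, toRep_d, LinearMap.smul_apply, Pi.smul_apply, hg1',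
      Pi.single_eq_same, Fin.val_zero, pow_zero, one_smul] at this
    exact this
  · have := hfr (l + 1)
    rw [D.c_pow_succ_fr, hg0'] at this
    exact congrFun (congrArg Prod.snd this) j
  · have := congrFun (h.a i (D.toRep.fr 1)) j
    rw [LinearEquiv.coe_coe, hg1'] at this
    have e := hfr 0
    rw [pow_zero, pow_zero, one_smul, Module.End.one_apply] at e
    rw [LinearEquiv.coe_coe, e] at this
    simpa [FramedRep.twist, jet_single] using this
  · have := congrArg Prod.fst (hb1 (Pi.single j.castSucc m))
    have e : ∀ z, ∑ i : Fin κ, D.β i ((Pi.single j.castSucc z : Fin (κ + 1) → M) i.castSucc) = D.β j z := fun z => by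
      rw [Finset.sum_eq_single j]
      · simp
      · intro i _ hi
        rw [Pi.single_eq_of_ne (by simpa using hi), map_zero]
      · simp
    rw [e, hg1, e] at this
    have e2 : ((D.β j m, sh κ M 1 (Pi.single j.castSucc m)) : (Fin (l + 1) → ℂ) × (Fin (κ + 2) → M))
      = (D.β j m, 0) + (0, sh κ M 1 (Pi.single j.castSucc m)) := by simp
    rw [e2, map_add, hthick, hg0'] at this
    have := congrFun this n
    simp only [Prod.fst_add, add_zero, twistThick_apply, Prod.smul_fst, map_smul, Pi.smul_apply, smul_eq_mul, Fin.val_castSucc] at this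
    rw [this]
    ring

end StdData

end PervConifold

/-! ### Weight configurations -/

namespace PervConifold

section Characters

theorem charVal_add (v w : Wt) (t : Torus) : charVal (v + w) t = charVal v t * charVal w t := by
  simp only [charVal, Pi.add_apply, zpow_add, Finset.prod_mul_distrib]

theorem charVal_nsmul (n : ℕ) (w : Wt) (t : Torus) : charVal (n • w) t = charVal w t ^ n := by
  induction n with
  | zero => simp [charVal]
  | succ n ih => rw [add_smul, one_smul, charVal_add, ih, pow_succ]

theorem charVal_tw (i : Fin 4) (t : Torus) : charVal (tw i) t = t.1 i := by
  have h := t.2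
  rw [Fin.prod_univ_four] at h
  fin_cases i
  · simp [charVal, tw, Fin.prod_univ_three]
  · simp [charVal, tw, Fin.prod_univ_three]
  · simp [charVal, tw, Fin.prod_univ_three]
  · simp only [charVal, tw, Fin.prod_univ_three]
    simp only [Fin.reduceFinMk, Matrix.cons_val, zpow_neg_one]
    rw [← mul_inv, ← mul_inv]
    exact inv_eq_of_mul_eq_one_right h

end Characters

section Shift

variable (I : Finset Wt)

/-- The coordinate of weight `w`, zero for `w ∉ I`. -/
def coordAt (w : Wt) : (I → ℂ) →ₗ[ℂ] ℂ := if h : w ∈ I then LinearMap.proj ⟨w, h⟩ else 0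

/-- The basis vector of weight `w`, zero for `w ∉ I`. -/
def basisVec (w : Wt) : I → ℂ := fun x => if x.1 = w then 1 else 0

/-- The shift of weights by `t₃`. -/
def shiftEnd : (I → ℂ) →ₗ[ℂ] (I → ℂ) := LinearMap.pi fun x => coordAt I (x.1 - tw 3)

variable {I}

theorem coordAt_of_mem {w : Wt} (h : w ∈ I) (f : I → ℂ) : coordAt I w f = f ⟨w, h⟩ := by
  rw [coordAt, dif_pos h]; rfl

theorem coordAt_of_notMem {w : Wt} (h : w ∉ I) (f : I → ℂ) : coordAt I w f = 0 := by
  rw [coordAt, dif_neg h]; rfl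

theorem basisVec_of_notMem {w : Wt} (h : w ∉ I) : basisVec I w = 0 := by
  ext x
  exact if_neg fun e : x.1 = w => h (e ▸ x.2)

theorem shiftEnd_apply (f : I → ℂ) (x : I) : shiftEnd I f x = coordAt I (x.1 - tw 3) f := rfl

theorem coordAt_shiftEnd (w : Wt) (f : I → ℂ) :
    coordAt I w (shiftEnd I f) = if w ∈ I then coordAt I (w - tw 3) f else 0 := by
  split_ifs with h
  · rw [coordAt_of_mem h, shiftEnd_apply]
  · exact coordAt_of_notMem h _

theorem shiftEnd_basisVec {w : Wt} (hw : w ∈ I) :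
    shiftEnd I (basisVec I w) = basisVec I (w + tw 3) := by
  ext x
  rw [shiftEnd_apply]
  by_cases h : x.1 = w + tw 3
  · have e : x.1 - tw 3 = w := sub_eq_iff_eq_add.2 h
    rw [e, coordAt_of_mem hw]
    simp [basisVec, h]
  · have e : x.1 - tw 3 ≠ w := fun e => h (sub_eq_iff_eq_add.1 e)
    simp only [basisVec, if_neg h]
    by_cases hm : x.1 - tw 3 ∈ I
    · rw [coordAt_of_mem hm]; exact if_neg e
    · exact coordAt_of_notMem hm _

theorem shiftEnd_pow_basisVec (w : Wt) (n : ℕ) :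
    (shiftEnd I ^ n) (basisVec I w) = 0 ∨ (shiftEnd I ^ n) (basisVec I w) = basisVec I (w + n • tw 3) := by
  induction n with
  | zero => right; simp
  | succ n ih =>
    rw [pow_succ', Module.End.mul_apply]
    rcases ih with h | h
    · left; rw [h, map_zero]
    · rw [h]
      by_cases hm : w + n • tw 3 ∈ I
      · right; rw [shiftEnd_basisVec hm, add_smul, one_smul, add_assoc]
      · left; rw [basisVec_of_notMem hm, map_zero]

theorem eq_sum_basisVec (f : I → ℂ) : f = ∑ x : I, f x • basisVec I x.1 := by
  ext y
  rw [Finset.sum_apply, Finset.sum_eq_single y]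
  · simp [basisVec]
  · intro x _ hx
    have : y.1 ≠ x.1 := fun e => hx (Subtype.ext e.symm)
    simp [basisVec, this]
  · simp

theorem eq_top_of_basisVec_mem {N : Submodule ℂ (I → ℂ)} (h : ∀ w ∈ I, basisVec I w ∈ N) : N = ⊤ := by
  rw [eq_top_iff]
  intro f _
  rw [eq_sum_basisVec f]
  exact N.sum_mem fun x _ => N.smul_mem _ (h _ x.2)

variable (I) in
/-- The action of a torus element on the space with basis `I`. -/
noncomputable def diagAct (t : Torus) : (I → ℂ) ≃ₗ[ℂ] (I → ℂ) :=
  LinearEquiv.piCongrRight fun x => LinearEquiv.smulOfUnit (charVal x.1 t)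

theorem diagAct_apply (t : Torus) (f : I → ℂ) (x : I) : diagAct I t f x = charVal x.1 t * f x := rfl

theorem coordAt_diagAct (t : Torus) (f : I → ℂ) (w : Wt) :
    coordAt I w (diagAct I t f) = charVal w t * coordAt I w f := by
  by_cases h : w ∈ I
  · rw [coordAt_of_mem h, coordAt_of_mem h, diagAct_apply]
  · rw [coordAt_of_notMem h, coordAt_of_notMem h, mul_zero]

theorem diagAct_basisVec (t : Torus) (w : Wt) :
    diagAct I t (basisVec I w) = (charVal w t : ℂ) • basisVec I w := by
  ext x
  rw [diagAct_apply]
  by_cases h : x.1 = w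
  · rw [h]; rfl
  · simp [basisVec, h]

theorem diagAct_shiftEnd (t : Torus) (f : I → ℂ) :
    diagAct I t (shiftEnd I f) = (t.1 3 : ℂ) • shiftEnd I (diagAct I t f) := by
  ext x
  rw [diagAct_apply, shiftEnd_apply, Pi.smul_apply, shiftEnd_apply, coordAt_diagAct, smul_eq_mul,
    ← mul_assoc, ← charVal_tw 3 t, ← Units.val_mul, ← charVal_add, add_sub_cancel]

/-- The flag of coordinate subspaces. -/
theorem exists_flag (I : Finset Wt) : Nonempty (StdData.Flag (shiftEnd I) I.card) := by
  -- The weights are ordered by their t₀-exponent. Shifting by t₃ lowers this exponent, so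
  -- `shiftEnd` moves every coordinate subspace strictly down the flag.
  let f : Fin I.card → ℤ := fun i => (I.equivFin.symm i).1 0
  let e : Fin I.card ≃ I := (Tuple.sort f).trans I.equivFin.symm
  have hmono : Monotone fun i => (e i).1 0 := Tuple.monotone_sort f
  have hlt : ∀ i k, (e i).1 0 < (e k).1 0 → i < k := fun i k h => by
    by_contra hik
    exact absurd (hmono (not_lt.1 hik)) (not_le.2 h)
  refine ⟨⟨fun s => ⨅ (i : Fin I.card) (_ : (s : ℕ) ≤ i), LinearMap.ker (LinearMap.proj (e i)),
    fun s => LinearMap.proj (e s), ?_, ?_, ?_, ?_, ?_, ?_⟩⟩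
  · rw [Submodule.eq_bot_iff]
    intro x hx
    simp only [Submodule.mem_iInf, LinearMap.mem_ker, LinearMap.proj_apply] at hx
    ext y
    have := hx (e.symm y) (Nat.zero_le _)
    rwa [Equiv.apply_symm_apply] at this
  · rw [eq_top_iff]
    intro x _
    simp only [Submodule.mem_iInf]
    intro i hi
    rw [Fin.val_last] at hi
    exact absurd i.2 (not_lt.2 hi)
  · intro s x hx
    simp only [Submodule.mem_iInf] at hx ⊢
    intro i hi
    exact hx i (le_trans (Nat.le_succ _) hi)
  · intro s x hx
    simp only [Submodule.mem_iInf, LinearMap.mem_ker, LinearMap.proj_apply] at hx ⊢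
    intro i hi
    rw [shiftEnd_apply]
    by_cases hm : (e i).1 - tw 3 ∈ I
    · rw [coordAt_of_mem hm]
      have h := hx (e.symm ⟨_, hm⟩) (by
        have := hlt i (e.symm ⟨_, hm⟩) (by
          rw [Equiv.apply_symm_apply]
          simp [tw])
        rw [Fin.val_succ]
        have : (i : ℕ) < (e.symm ⟨_, hm⟩ : Fin _) := this
        rw [Fin.val_castSucc] at hi
        omega)
      rwa [Equiv.apply_symm_apply] at h
    · exact coordAt_of_notMem hm _
  · intro s
    refine ⟨Pi.single (e s) 1, ?_, by simp⟩
    simp only [Submodule.mem_iInf, LinearMap.mem_ker, LinearMap.proj_apply]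
    intro i hi
    rw [Pi.single_eq_of_ne]
    intro h
    rw [e.injective h, Fin.val_succ] at hi
    omega
  · intro s x hx
    simp only [Submodule.mem_iInf, LinearMap.mem_ker, LinearMap.proj_apply] at hx ⊢
    constructor
    · intro h i hi
      by_cases his : i = s
      · rw [his]; exact h
      · apply hx
        rw [Fin.val_castSucc] at hi
        rw [Fin.val_succ]
        have : (i : ℕ) ≠ s := fun h => his (Fin.ext h)
        omega
    · intro h
      exact h s le_rfl

end Shift

/-- The weights of the generators `c^{l+1} · 1`. -/
def vWt (l : ℕ) (j : ℕ) : Wt := ![-(l + 1) - j, -(l + 1), -(l + 1)]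

/-- The weights of the generators `a_i · 1`. -/
def αWt (i : Fin 2) (j : ℕ) : Wt := ![-j, ![1, 0] i, ![0, 1] i]

/-- The weights of the functionals `β`. -/
def βWt (j n : ℕ) : Wt := ![-n - (j + 1), -n, -n]

/-- The weights that can occur on the side of `Θ₊`. -/
def PlusChain (κ l : ℕ) (w : Wt) : Prop :=
  (w 1 = w 2 ∧ w 1 ≤ -(l + 1) ∧ w 1 - (κ + 1) ≤ w 0 ∧ w 0 ≤ w 1) ∨
  (w 1 = w 2 + 1 ∧ -l ≤ w 2 ∧ w 2 ≤ 0 ∧ w 2 - κ ≤ w 0 ∧ w 0 ≤ w 2) ∨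
  (w 2 = w 1 + 1 ∧ -l ≤ w 1 ∧ w 1 ≤ 0 ∧ w 1 - κ ≤ w 0 ∧ w 0 ≤ w 1)

/-- The weights that can occur on the side of `Θ₋`. -/
def MinusChain (κ l : ℕ) (w : Wt) : Prop :=
  w 1 = w 2 ∧ -l ≤ w 1 ∧ w 1 ≤ 0 ∧ w 1 - κ ≤ w 0 ∧ w 0 ≤ w 1 - 1

/-- The weights of a torus fixed point on the side of `Θ₊`. -/
structure IsPlusConf (κ l : ℕ) (I : Finset Wt) : Prop where
  chain : ∀ w ∈ I, PlusChain κ l w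
  closed : ∀ w ∈ I, PlusChain κ l (w - tw 3) → w - tw 3 ∈ I

/-- The weights of a torus fixed point on the side of `Θ₋`. -/
structure IsMinusConf (κ l : ℕ) (J : Finset Wt) : Prop where
  chain : ∀ w ∈ J, MinusChain κ l w
  closed : ∀ w ∈ J, MinusChain κ l (w + tw 3) → w + tw 3 ∈ J

theorem vWt_eq (l j : ℕ) : vWt l j + j • tw 0 = (l + 1) • tw 3 := by
  ext i
  fin_cases i <;> simp [vWt, tw]

theorem αWt_eq (i : Fin 2) (j : ℕ) : αWt i j + j • tw 0 = ![tw 1, tw 2] i := by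
  fin_cases i
  · ext i
    fin_cases i <;> simp [αWt, tw]
  · ext i
    fin_cases i <;> simp [αWt, tw]

theorem βWt_eq (j n : ℕ) : βWt j n + (j + 1) • tw 0 = n • tw 3 := by
  ext i
  fin_cases i <;> simp [βWt, tw]

theorem sub_tw_three_apply (w : Wt) (i : Fin 3) : (w - tw 3) i = w i + 1 := by
  fin_cases i <;> simp [tw]

theorem add_nsmul_tw_three_apply (w : Wt) (n : ℕ) (i : Fin 3) : (w + n • tw 3) i = w i - n := by
  fin_cases i <;> simp [tw] <;> ring

theorem add_tw_three_apply (w : Wt) (i : Fin 3) : (w + tw 3) i = w i - 1 := by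
  fin_cases i <;> simp [tw] <;> ring

variable {κ l : ℕ}

/-- The standard representation with the given weights, on the side of `Θ₊`. -/
def stdPlus {I : Finset Wt} (hI : IsPlusConf κ l I) : StdData κ l (I → ℂ) where
  c := shiftEnd I
  v j := basisVec I (vWt l j)
  α i j := basisVec I (αWt i j)
  β := 0
  hα i j := by
    rcases shiftEnd_pow_basisVec (I := I) (αWt i j) (l + 1) with h | h
    · exact h
    · rw [h]
      apply basisVec_of_notMem
      intro hm
      have := hI.chain _ hm
      simp only [PlusChain, add_nsmul_tw_three_apply] at this
      fin_cases i <;> simp [αWt] at this <;> omega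
  hβ j m := by simp
  hz := Or.inl rfl

/-- The standard representation with the given weights, on the side of `Θ₋`. -/
def stdMinus {J : Finset Wt} (hJ : IsMinusConf κ l J) : StdData κ l (J → ℂ) where
  c := shiftEnd J
  v := 0
  α := 0
  β j := LinearMap.pi fun n => coordAt J (βWt j n)
  hα i j := map_zero _
  hβ j m := by
    ext n
    rw [LinearMap.pi_apply, coordAt_shiftEnd]
    refine Fin.cases ?_ (fun n => ?_) n
    · rw [thickIdeal_c_zero]
      split_ifs
      · apply coordAt_of_notMem
        intro hm
        have := hJ.chain _ hm
        simp only [MinusChain, sub_tw_three_apply] at this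
        simp [βWt] at this
      · rfl
    · rw [thickIdeal_c_succ, LinearMap.pi_apply]
      have e : βWt j n.succ = βWt j n.castSucc + tw 3 := by
        ext i
        rw [add_tw_three_apply]
        fin_cases i <;> simp [βWt] <;> ring
      -- If the weight for n + 1 is absent from J, closedness excludes the weight for n as well, and
      -- both sides vanish.
      rw [e, add_sub_cancel_right]
      split_ifs with h
      · rfl
      · symm
        apply coordAt_of_notMem
        intro hm
        apply h
        apply hJ.closed _ hm
        have hn := n.2
        have hj := j.2
        rw [← e]
        simp only [MinusChain, βWt, Fin.val_succ]
        simp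
        omega
  hz := Or.inr ⟨rfl, rfl⟩

theorem stdPlus_isSemiInvariant {I : Finset Wt} (hI : IsPlusConf κ l I) (t : Torus) :
    (stdPlus hI).IsSemiInvariant t (diagAct I t).toLinearMap where
  c m := diagAct_shiftEnd t m
  v j := by
    change _ • diagAct I t (basisVec I _) = _ • basisVec I _
    rw [diagAct_basisVec, smul_smul]
    congr 1
    rw [← charVal_tw 0 t, ← charVal_tw 3 t]
    norm_cast
    rw [← charVal_nsmul, ← charVal_nsmul, ← charVal_add, add_comm, vWt_eq]
  α i j := by
    change _ • diagAct I t (basisVec I _) = _ • basisVec I _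
    rw [diagAct_basisVec, smul_smul]
    congr 1
    rw [← charVal_tw 0 t, ← charVal_tw 1 t, ← charVal_tw 2 t]
    norm_cast
    rw [← charVal_nsmul, ← charVal_add, add_comm, αWt_eq]
    fin_cases i <;> rfl
  β j m n := by simp [stdPlus]

theorem stdMinus_isSemiInvariant {J : Finset Wt} (hJ : IsMinusConf κ l J) (t : Torus) :
    (stdMinus hJ).IsSemiInvariant t (diagAct J t).toLinearMap where
  c m := diagAct_shiftEnd t m
  v j := by simp [stdMinus]
  α i j := by simp [stdMinus]
  β j m n := by
    change _ * coordAt J (βWt j n) (diagAct J t m) = _ * coordAt J (βWt j n) m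
    rw [coordAt_diagAct, ← mul_assoc]
    congr 1
    rw [← charVal_tw 0 t, ← charVal_tw 3 t]
    norm_cast
    rw [← charVal_nsmul, ← charVal_nsmul, ← charVal_add, add_comm, βWt_eq]

/-- Induction along the strings: passing to w - t₃ decreases 1 - w₂, and a weight with no admissible
predecessor is the weight of a generator. -/
theorem stdPlus_generated {I : Finset Wt} (hI : IsPlusConf κ l I) (N : Submodule ℂ (I → ℂ))
    (hc : ∀ m ∈ N, (stdPlus hI).c m ∈ N) (hv : ∀ j, (stdPlus hI).v j ∈ N)
    (hα : ∀ i j, (stdPlus hI).α i j ∈ N) : N = ⊤ := by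
  apply eq_top_of_basisVec_mem
  have key : ∀ n : ℕ, ∀ w ∈ I, (1 - w 2).toNat = n → basisVec I w ∈ N := by
    intro n
    induction n using Nat.strong_induction_on with
    | _ n ih =>
      intro w hw hn
      have hch := hI.chain w hw
      by_cases hp : PlusChain κ l (w - tw 3)
      · have hm := hI.closed w hw hp
        have h1 := ih _ ?_ _ hm rfl
        · have := hc _ h1
          change shiftEnd I _ ∈ N at this
          rwa [shiftEnd_basisVec hm, sub_add_cancel] at this
        · simp only [PlusChain, sub_tw_three_apply] at hp ⊢
          omega
      · simp only [PlusChain, sub_tw_three_apply] at hp hch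
        have hcase : (∃ j : Fin (κ + 2), w = vWt l j) ∨ ∃ (i : Fin 2) (j : Fin (κ + 1)), w = αWt i j := by
          rcases hch with ⟨h1, h2, h3, h4⟩ | ⟨h1, h2, h3, h4, h5⟩ | ⟨h1, h2, h3, h4, h5⟩
          · left
            refine ⟨⟨(w 1 - w 0).toNat, by omega⟩, ?_⟩
            ext i
            fin_cases i <;> simp [vWt] <;> omega
          · right
            refine ⟨0, ⟨(w 2 - w 0).toNat, by omega⟩, ?_⟩
            ext i
            fin_cases i <;> simp [αWt] <;> omega
          · right
            refine ⟨1, ⟨(w 1 - w 0).toNat, by omega⟩, ?_⟩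
            ext i
            fin_cases i <;> simp [αWt] <;> omega
        rcases hcase with ⟨j, rfl⟩ | ⟨i, j, rfl⟩
        · exact hv j
        · exact hα i j
  exact fun w hw => key _ w hw rfl

theorem exists_eq_βWt {w : Wt} (h : MinusChain κ l w) : ∃ (j : Fin κ) (n : Fin (l + 1)), w = βWt j n := by
  obtain ⟨h1, h2, h3, h4, h5⟩ := h
  refine ⟨⟨(w 1 - w 0 - 1).toNat, by omega⟩, ⟨(-w 1).toNat, by omega⟩, ?_⟩
  ext i
  fin_cases i <;> simp [βWt] <;> omega

theorem stdMinus_cogenerated {J : Finset Wt} (hJ : IsMinusConf κ l J) (N : Submodule ℂ (J → ℂ))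
    (hβ : ∀ j, ∀ m ∈ N, (stdMinus hJ).β j m = 0) : N = ⊥ := by
  rw [Submodule.eq_bot_iff]
  intro m hm
  ext w
  obtain ⟨j, n, h⟩ := exists_eq_βWt (hJ.chain _ w.2)
  have : coordAt J (βWt j n) m = 0 := congrFun (hβ j m hm) n
  rw [← h, coordAt_of_mem w.2] at this
  exact this

/-- The weights on `V₀`. -/
def weights₀ (κ l : ℕ) (I : Finset Wt) : Fin (l + 1) ⊕ (Fin (κ + 2) × I) → Wt :=
  Sum.elim (fun n => (n : ℕ) • tw 3) fun p => p.2.1 + (p.1 : ℕ) • tw 0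

/-- The weights on `V₁`. -/
def weights₁ (κ : ℕ) (I : Finset Wt) : Fin (κ + 1) × I → Wt := fun p => p.2.1 + (p.1 : ℕ) • tw 0

theorem StdData.hasWeights {I : Finset Wt} (D : StdData κ l (I → ℂ))
    (h : ∀ t, D.IsSemiInvariant t (diagAct I t).toLinearMap) :
    HasWeights D.toRep (weights₀ κ l I) (weights₁ κ I) := by
  let ρ₀ : ((Fin (l + 1) → ℂ) × (Fin (κ + 2) → (I → ℂ))) ≃ₗ[ℂ] (Fin (l + 1) ⊕ (Fin (κ + 2) × I) → ℂ) :=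
    { toFun := fun x => Sum.elim x.1 fun p => x.2 p.1 p.2
      map_add' := fun x y => by ext (i | i) <;> rfl
      map_smul' := fun z x => by ext (i | i) <;> rfl
      invFun := fun f => (fun n => f (Sum.inl n), fun j w => f (Sum.inr (j, w)))
      left_inv := fun x => rfl
      right_inv := fun f => by ext (i | i) <;> rfl }
  let ρ₁ : (Fin (κ + 1) → (I → ℂ)) ≃ₗ[ℂ] (Fin (κ + 1) × I → ℂ) :=
    { toFun := fun x p => x p.1 p.2
      map_add' := fun x y => rfl
      map_smul' := fun z x => rfl
      invFun := fun f j w => f (j, w)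
      left_inv := fun x => rfl
      right_inv := fun f => rfl }
  have hch : ∀ (t : Torus) (w : Wt) (j : ℕ), (charVal (w + j • tw 0) t : ℂ) = (t.1 0 : ℂ) ^ j * charVal w t := by
    intro t w j
    rw [charVal_add, charVal_nsmul, charVal_tw, mul_comm]
    push_cast
    rfl
  refine ⟨ρ₀, ρ₁, fun t => ⟨_, _, (h t).isTorusIso, ?_, ?_⟩⟩
  · rintro x (n | ⟨j, w⟩)
    · change StdData.twistThick _ _ _ n = (charVal ((n : ℕ) • tw 3) t : ℂ) * x.1 n
      rw [StdData.twistThick_apply, charVal_nsmul, charVal_tw]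
      push_cast
      rfl
    · change StdData.twistPi (t.1 0) (diagAct I t) (κ + 2) x.2 j w = (charVal (w.1 + (j : ℕ) • tw 0) t : ℂ) * x.2 j w
      rw [StdData.twistPi_apply, hch, Pi.smul_apply, diagAct_apply, smul_eq_mul, mul_assoc]
  · rintro x ⟨j, w⟩
    change StdData.twistPi (t.1 0) (diagAct I t) (κ + 1) x j w = (charVal (w.1 + (j : ℕ) • tw 0) t : ℂ) * x j w
    rw [StdData.twistPi_apply, hch, Pi.smul_apply, diagAct_apply, smul_eq_mul, mul_assoc]

end PervConifold

/-! ### Classification of the torus fixed points -/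

namespace PervConifold

variable {κ l : ℕ} {M : Type} [AddCommGroup M] [Module ℂ M] [FiniteDimensional ℂ M]

section Plus

variable (D : StdData κ l M)

/-- The generators of `M`. -/
def StdData.gen : Fin (κ + 2) ⊕ (Fin 2 × Fin (κ + 1)) → M := Sum.elim D.v fun p => D.α p.1 p.2

/-- The weights of the generators. -/
def genWt (κ l : ℕ) : Fin (κ + 2) ⊕ (Fin 2 × Fin (κ + 1)) → Wt :=
  Sum.elim (fun j => vWt l j) fun p => αWt p.1 p.2

/-- The t₃-strings issuing from the generators are disjoint. This makes M multiplicity free and the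
fixed points rigid. -/
theorem genWt_add_injective : Function.Injective
    fun x : (Fin (κ + 2) ⊕ (Fin 2 × Fin (κ + 1))) × ℕ => genWt κ l x.1 + x.2 • tw 3 := by
  rintro ⟨x, n⟩ ⟨y, n'⟩ h
  have h0 := congrFun h 0
  have h1 := congrFun h 1
  have h2 := congrFun h 2
  simp only [add_nsmul_tw_three_apply] at h0 h1 h2
  rcases x with j | ⟨i, j⟩ <;> rcases y with j' | ⟨i', j'⟩
  · simp [genWt, vWt] at h0 h1 h2
    have : j = j' := Fin.ext (by omega)
    have : n = n' := by omega
    subst_vars; rfl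
  · simp [genWt, vWt, αWt] at h0 h1 h2
    fin_cases i' <;> simp at h1 h2 <;> omega
  · simp [genWt, vWt, αWt] at h0 h1 h2
    fin_cases i <;> simp at h1 h2 <;> omega
  · simp [genWt, αWt] at h0 h1 h2
    have hi : i = i' := by fin_cases i <;> fin_cases i' <;> simp at h1 h2 ⊢ <;> omega
    subst hi
    have : j = j' := Fin.ext (by omega)
    have : n = n' := by omega
    subst_vars; rfl

theorem plusChain_genWt_add {x : Fin (κ + 2) ⊕ (Fin 2 × Fin (κ + 1))} {n : ℕ}
    (h : ∀ p, x = Sum.inr p → n ≤ l) : PlusChain κ l (genWt κ l x + n • tw 3) := by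
  rcases x with j | ⟨i, j⟩
  · have := j.2
    simp only [PlusChain, add_nsmul_tw_three_apply, genWt, Sum.elim_inl, vWt]
    simp
    omega
  · have := j.2
    have hn := h _ rfl
    simp only [PlusChain, add_nsmul_tw_three_apply, genWt, Sum.elim_inr, αWt]
    fin_cases i <;> simp <;> omega

theorem not_plusChain_genWt_sub (x : Fin (κ + 2) ⊕ (Fin 2 × Fin (κ + 1))) :
    ¬ PlusChain κ l (genWt κ l x - tw 3) := by
  rcases x with j | ⟨i, j⟩
  · simp only [PlusChain, sub_tw_three_apply, genWt, Sum.elim_inl, vWt]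
    simp
  · simp only [PlusChain, sub_tw_three_apply, genWt, Sum.elim_inr, αWt]
    fin_cases i <;> simp

/-- The vectors c^n applied to generators are eigenvectors of φ for different eigenvalues, so the
nonzero ones are independent; by generation they span M. Their weights form I, and in this basis the
data are those of `stdPlus`. -/
theorem exists_stdPlus (hgen : ∀ N : Submodule ℂ M, (∀ m ∈ N, D.c m ∈ N) → (∀ j, D.v j ∈ N) →
      (∀ i j, D.α i j ∈ N) → N = ⊤) (hβ : D.β = 0) {φ : M →ₗ[ℂ] M}
    (hφ : D.IsSemiInvariant genericPoint φ) :
    ∃ (I : Finset Wt) (hI : IsPlusConf κ l I), I.card = Module.finrank ℂ M ∧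
      RepIso D.toRep (stdPlus hI).toRep := by
  classical
  set g := Fin (κ + 2) ⊕ (Fin 2 × Fin (κ + 1)) with hg
  let wtG : g × ℕ → Wt := fun x => genWt κ l x.1 + x.2 • tw 3
  let vec : g × ℕ → M := fun x => (D.c ^ x.2) (D.gen x.1)
  have hwt : Function.Injective wtG := genWt_add_injective
  have hvecS : ∀ x n, D.c (vec (x, n)) = vec (x, n + 1) := fun x n => by
    simp only [vec, pow_succ', Module.End.mul_apply]
  have heig : ∀ x, φ (vec x) = (charVal (wtG x) genericPoint : ℂ) • vec x := by
    rintro ⟨x, n⟩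
    have h0 : ∀ x, φ (D.gen x) = (charVal (genWt κ l x) genericPoint : ℂ) • D.gen x := by
      have hcancel : ∀ (z : ℂˣ) (m m' : M), (z : ℂ) • m = (z : ℂ) • m' → m = m' := fun z m m' h => by
        have := congrArg ((z⁻¹ : ℂˣ) • ·) h
        simpa [Units.smul_def, smul_smul] using this
      rintro (j | ⟨i, j⟩)
      · apply hcancel (genericPoint.1 0 ^ (j : ℕ))
        have := hφ.v j
        rw [Units.val_pow_eq_pow_val]
        refine this.trans ?_
        rw [smul_smul]
        congr 1
        rw [← charVal_tw 0, ← charVal_tw 3]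
        change _ = _ * (charVal (vWt l j) genericPoint : ℂ)
        norm_cast
        rw [← charVal_nsmul, ← charVal_nsmul, ← charVal_add, add_comm _ (vWt l j), vWt_eq]
      · apply hcancel (genericPoint.1 0 ^ (j : ℕ))
        have := hφ.α i j
        rw [Units.val_pow_eq_pow_val]
        refine this.trans ?_
        rw [smul_smul]
        congr 1
        rw [← charVal_tw 0, ← charVal_tw 1, ← charVal_tw 2]
        change _ = _ * (charVal (αWt i j) genericPoint : ℂ)
        norm_cast
        rw [← charVal_nsmul, ← charVal_add, add_comm _ (αWt i j), αWt_eq]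
        fin_cases i <;> rfl
    simp only [vec]
    rw [hφ.c_pow, h0, map_smul, smul_smul]
    congr 1
    simp only [wtG]
    rw [charVal_add, charVal_nsmul, charVal_tw]
    push_cast
    ring
  let S : Set (g × ℕ) := {x | vec x ≠ 0}
  have hli : LinearIndependent ℂ fun x : S => vec x.1 :=
    Module.End.eigenvectors_linearIndependent' φ (fun x : S => (charVal (wtG x.1) genericPoint : ℂ))
      (fun x y h => Subtype.ext (hwt (charVal_genericPoint_injective h))) _
      fun x => ⟨Module.End.mem_eigenspace_iff.2 (heig x.1), x.2⟩
  have hfin : Finite S := hli.finite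
  have := Fintype.ofFinite S
  have hmem : ∀ x, vec x ∈ Submodule.span ℂ (Set.range fun x : S => vec x.1) := fun x => by
    by_cases h : vec x = 0
    · rw [h]; exact zero_mem _
    · exact Submodule.subset_span ⟨⟨x, h⟩, rfl⟩
  have hspan : ⊤ ≤ Submodule.span ℂ (Set.range fun x : S => vec x.1) := by
    rw [top_le_iff]
    apply hgen
    · intro m hm
      induction hm using Submodule.span_induction with
      | mem m hm =>
        obtain ⟨⟨⟨x, n⟩, hx⟩, rfl⟩ := hm
        simp only
        rw [hvecS]
        exact hmem _
      | zero => rw [map_zero]; exact zero_mem _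
      | add m m' _ _ h h' => rw [map_add]; exact Submodule.add_mem _ h h'
      | smul z m _ h => rw [map_smul]; exact Submodule.smul_mem _ _ h
    · exact fun j => hmem (Sum.inl j, 0)
    · exact fun i j => hmem (Sum.inr (i, j), 0)
  let b := Module.Basis.mk hli hspan
  let I : Finset Wt := Finset.univ.image fun x : S => wtG x.1
  have hmemI : ∀ x, wtG x ∈ I ↔ vec x ≠ 0 := fun x => by
    simp only [I, Finset.mem_image, Finset.mem_univ, true_and]
    constructor
    · rintro ⟨y, hy⟩
      rw [← hwt hy]; exact y.2
    · exact fun h => ⟨⟨x, h⟩, rfl⟩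
  have hinj : Function.Injective fun x : S => wtG x.1 := fun x y h => Subtype.ext (hwt h)
  let σ : S ≃ I := Equiv.ofBijective (fun x => ⟨wtG x.1, Finset.mem_image_of_mem _ (Finset.mem_univ x)⟩)
    ⟨fun x y h => hinj (congrArg Subtype.val h), fun y => by
      obtain ⟨x, -, hx⟩ := Finset.mem_image.1 y.2
      exact ⟨x, Subtype.ext hx⟩⟩
  let e : M ≃ₗ[ℂ] (I → ℂ) := b.equivFun.trans (LinearEquiv.funCongrLeft ℂ ℂ σ.symm)
  have he : ∀ x, e (vec x) = basisVec I (wtG x) := by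
    intro x
    by_cases h : vec x = 0
    · rw [h, map_zero, basisVec_of_notMem]
      rw [hmemI]; exact not_not.2 h
    · have hb : b ⟨x, h⟩ = vec x := Module.Basis.mk_apply _ _ _
      rw [← hb]
      ext y
      obtain ⟨z, rfl⟩ := σ.surjective y
      simp only [e, LinearEquiv.trans_apply, Module.Basis.equivFun_self, LinearEquiv.funCongrLeft_apply,
        LinearMap.funLeft_apply, Equiv.symm_apply_apply, basisVec]
      refine if_congr ?_ rfl rfl
      constructor
      · intro hz; rw [← hz]; rfl
      · intro hz; exact hinj hz.symm
  have hI : IsPlusConf κ l I := by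
    constructor
    · intro w hw
      obtain ⟨⟨⟨x, n⟩, hx⟩, -, rfl⟩ := Finset.mem_image.1 hw
      apply plusChain_genWt_add
      rintro ⟨i, j⟩ rfl
      -- The strings of the generators α stop after l + 1 terms because c^(l+1) kills α.
      by_contra hn
      simp only at hn
      apply hx
      obtain ⟨d, rfl⟩ : ∃ d, n = d + (l + 1) := ⟨n - (l + 1), by omega⟩
      simp only [vec, pow_add, Module.End.mul_apply]
      have : (D.c ^ (l + 1)) (D.gen (Sum.inr (i, j))) = 0 := D.hα i j
      rw [← Module.End.mul_apply (D.c ^ l), ← pow_add, this, map_zero]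
    · intro w hw hch
      obtain ⟨⟨⟨x, n⟩, hx⟩, -, rfl⟩ := Finset.mem_image.1 hw
      cases n with
      | zero =>
        simp only [wtG, zero_smul, add_zero] at hch
        exact absurd hch (not_plusChain_genWt_sub x)
      | succ n =>
        have : wtG (x, n + 1) - tw 3 = wtG (x, n) := by
          simp only [wtG, add_smul, one_smul]
          abel
        rw [this, hmemI]
        intro h0
        apply hx
        rw [← hvecS, h0, map_zero]
  refine ⟨I, hI, ?_, D.repIso _ e ?_ ?_ ?_ ?_⟩
  · rw [e.finrank_eq, Module.finrank_fintype_fun_eq_card, Fintype.card_coe]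
  · intro m
    change (e.toLinearMap ∘ₗ D.c) m = (shiftEnd I ∘ₗ e.toLinearMap) m
    congr 1
    apply b.ext
    rintro ⟨⟨x, n⟩, hx⟩
    have hb : b ⟨(x, n), hx⟩ = vec (x, n) := Module.Basis.mk_apply _ _ _
    rw [hb, LinearMap.comp_apply, LinearMap.comp_apply, hvecS, LinearEquiv.coe_coe, he, he,
      shiftEnd_basisVec ((hmemI _).2 hx)]
    congr 1
    simp only [wtG, add_smul, one_smul, add_assoc]
  · intro j
    have := he (Sum.inl j, 0)
    simp only [vec, wtG, zero_smul, add_zero] at this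
    exact this
  · intro i j
    have := he (Sum.inr (i, j), 0)
    simp only [vec, wtG, zero_smul, add_zero] at this
    exact this
  · intro j m
    rw [hβ]; rfl

end Plus

section Minus

variable (D : StdData κ l M)

theorem βWt_injective : Function.Injective fun x : Fin κ × Fin (l + 1) => βWt x.1 x.2 := by
  rintro ⟨j, n⟩ ⟨j', n'⟩ h
  have h0 := congrFun h 0
  have h1 := congrFun h 1
  simp [βWt] at h0 h1
  exact Prod.ext (Fin.ext (by simp only; omega)) (Fin.ext (by simp only; omega))

theorem minusChain_βWt (j : Fin κ) (n : Fin (l + 1)) : MinusChain κ l (βWt j n) := by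
  have := j.2
  have := n.2
  simp [MinusChain, βWt]
  omega

/-- The dual argument: the coordinates of the β j are eigenvectors of the transpose of φ with
different eigenvalues, so the nonzero ones are independent. Their common kernel is stable under c,
hence zero by cogeneration, and they are coordinates on M. -/
theorem exists_stdMinus (hcog : ∀ N : Submodule ℂ M, (∀ m ∈ N, D.c m ∈ N) →
      (∀ j, ∀ m ∈ N, D.β j m = 0) → N = ⊥) (hv : D.v = 0) (hα : D.α = 0) {φ : M →ₗ[ℂ] M}
    (hφ : D.IsSemiInvariant genericPoint φ) :
    ∃ (J : Finset Wt) (hJ : IsMinusConf κ l J), J.card = Module.finrank ℂ M ∧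
      RepIso D.toRep (stdMinus hJ).toRep := by
  classical
  let wtG : Fin κ × Fin (l + 1) → Wt := fun x => βWt x.1 x.2
  let vec : Fin κ × Fin (l + 1) → Module.Dual ℂ M := fun x => LinearMap.proj x.2 ∘ₗ D.β x.1
  have hvec : ∀ x m, vec x m = D.β x.1 m x.2 := fun _ _ => rfl
  have hwt : Function.Injective wtG := βWt_injective
  have heig : ∀ x, Module.Dual.transpose (R := ℂ) φ (vec x) = (charVal (wtG x) genericPoint : ℂ) • vec x := by
    rintro ⟨j, n⟩
    ext m
    rw [LinearMap.smul_apply, smul_eq_mul]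
    change D.β j (φ m) n = _ * D.β j m n
    have := hφ.β j m n
    rw [← charVal_tw 0, ← charVal_tw 3, ← Units.val_pow_eq_pow_val, ← Units.val_pow_eq_pow_val,
      ← charVal_nsmul, ← charVal_nsmul, ← βWt_eq (j : ℕ) n, charVal_add, Units.val_mul, mul_comm (charVal (βWt j n) genericPoint : ℂ), mul_assoc] at this
    exact mul_left_cancel₀ (Units.ne_zero _) this
  let S : Finset (Fin κ × Fin (l + 1)) := Finset.univ.filter fun x => vec x ≠ 0
  have hS : ∀ x, x ∈ S ↔ vec x ≠ 0 := fun x => by simp [S]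
  have hli : LinearIndependent ℂ fun x : S => vec x.1 :=
    Module.End.eigenvectors_linearIndependent' (Module.Dual.transpose (R := ℂ) φ)
      (fun x : S => (charVal (wtG x.1) genericPoint : ℂ))
      (fun x y h => Subtype.ext (hwt (charVal_genericPoint_injective h))) _
      fun x => ⟨Module.End.mem_eigenspace_iff.2 (heig x.1), (hS _).1 x.2⟩
  let J : Finset Wt := S.image wtG
  have hmemJ : ∀ x, wtG x ∈ J ↔ vec x ≠ 0 := fun x => by
    rw [← hS]
    simp only [J, Finset.mem_image]
    constructor
    · rintro ⟨y, hy, h⟩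
      rwa [← hwt h]
    · exact fun h => ⟨x, h, rfl⟩
  have hcardJ : J.card = S.card := Finset.card_image_of_injective _ hwt
  have hle : J.card ≤ Module.finrank ℂ M := by
    have := hli.fintype_card_le_finrank
    rwa [Fintype.card_coe, Subspace.dual_finrank_eq, ← hcardJ] at this
  have hex : ∀ w : J, ∃ x, wtG x = w.1 := fun w => by
    obtain ⟨x, -, hx⟩ := Finset.mem_image.1 w.2
    exact ⟨x, hx⟩
  choose x hx using hex
  let E : M →ₗ[ℂ] (J → ℂ) := LinearMap.pi fun w => vec (x w)
  have hE : ∀ y m, coordAt J (wtG y) (E m) = vec y m := fun y m => by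
    by_cases h : wtG y ∈ J
    · rw [coordAt_of_mem h]
      change vec (x ⟨_, h⟩) m = _
      rw [hwt (hx ⟨_, h⟩)]
    · rw [coordAt_of_notMem h]
      rw [hmemJ, not_not] at h
      rw [h]; rfl
  have hEinj : Function.Injective E := by
    rw [← LinearMap.ker_eq_bot]
    have hβ0 : ∀ m ∈ LinearMap.ker E, ∀ j, D.β j m = 0 := fun m hm j => by
      ext n
      have := hE (j, n) m
      rw [LinearMap.mem_ker.1 hm, map_zero] at this
      exact this.symm
    refine hcog _ (fun m hm => ?_) fun j m hm => hβ0 m hm j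
    rw [LinearMap.mem_ker]
    ext w
    change D.β _ (D.c m) _ = 0
    rw [D.hβ, hβ0 m hm, map_zero]
    rfl
  have hfr : Module.finrank ℂ M = Module.finrank ℂ (J → ℂ) := by
    apply le_antisymm (LinearMap.finrank_le_finrank_of_injective hEinj)
    rw [Module.finrank_fintype_fun_eq_card, Fintype.card_coe]
    exact hle
  let e := LinearEquiv.ofInjectiveOfFinrankEq E hEinj hfr
  have he : ∀ m, e m = E m := fun _ => rfl
  have hJ : IsMinusConf κ l J := by
    constructor
    · intro w hw
      have := minusChain_βWt (l := l) (x ⟨w, hw⟩).1 (x ⟨w, hw⟩).2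
      rwa [show βWt _ _ = w from hx ⟨w, hw⟩] at this
    · intro w hw hch
      obtain ⟨j, n, h⟩ := exists_eq_βWt hch
      have h' : w + tw 3 = wtG (j, n) := h
      rw [h', hmemJ]
      intro h0
      have hw' := (hmemJ _).1 (by rw [hx ⟨w, hw⟩]; exact hw)
      have hw2 : wtG (x ⟨w, hw⟩) = w := hx ⟨w, hw⟩
      obtain ⟨⟨j', n'⟩, hjn⟩ : ∃ y, x ⟨w, hw⟩ = y := ⟨_, rfl⟩
      rw [hjn] at hw' hw2
      have hw3 : βWt j' n' + tw 3 = βWt j n := by rw [← h]; exact congrArg (· + tw 3) hw2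
      have e0 := congrFun hw3 0
      have e1 := congrFun hw3 1
      rw [add_tw_three_apply] at e0 e1
      simp [βWt] at e0 e1
      have hj : j' = j := Fin.ext (by omega)
      subst hj
      have hn' : (n' : ℕ) < l := by have := n.2; omega
      have hn1 : n = Fin.succ ⟨n', hn'⟩ := Fin.ext (by rw [Fin.val_succ]; simp only; omega)
      apply hw'
      ext m
      have := congrArg (fun ψ : Module.Dual ℂ M => ψ (D.c m)) h0
      simp only [LinearMap.zero_apply, hvec, D.hβ, hn1, thickIdeal_c_succ] at this
      exact this
  refine ⟨J, hJ, ?_, D.repIso _ e ?_ ?_ ?_ ?_⟩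
  · rw [hfr, Module.finrank_fintype_fun_eq_card, Fintype.card_coe]
  · intro m
    rw [he, he]
    ext w
    change E (D.c m) w = coordAt J (w.1 - tw 3) (E m)
    change D.β (x w).1 (D.c m) (x w).2 = _
    have hw2 : βWt (x w).1 (x w).2 = w.1 := hx w
    obtain ⟨⟨j, n⟩, hjn⟩ : ∃ y, x w = y := ⟨_, rfl⟩
    rw [hjn] at hw2 ⊢
    rw [D.hβ, ← hw2]
    refine Fin.cases ?_ (fun n => ?_) n
    · rw [thickIdeal_c_zero]
      symm
      apply coordAt_of_notMem
      intro hm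
      have := hJ.chain _ hm
      simp only [MinusChain, sub_tw_three_apply] at this
      simp [βWt] at this
    · rw [thickIdeal_c_succ]
      have e1 : βWt j n.succ - tw 3 = wtG (j, n.castSucc) := by
        ext i
        rw [sub_tw_three_apply]
        fin_cases i <;> simp [βWt, wtG]
        ring
      rw [e1, hE]
      rfl
  · intro j
    rw [hv]; exact map_zero e
  · intro i j
    rw [hα]; exact map_zero e
  · intro j m
    ext n
    exact (hE (j, n) m).symm

end Minus

end PervConifold

/-! ### The fibres -/

namespace PervConifold

variable {κ l : ℕ}

/-- The class of a set of weights. -/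
noncomputable def chSum (I : Finset Wt) : KT := ∑ w ∈ I, ch w

/-- `1 + t₀ + ⋯ + t₀^{n-1}`. -/
noncomputable def geom (n : ℕ) : KT := ∑ j ∈ Finset.range n, ch (j • tw 0)

/-- The class of the sheaf with the given weights. -/
noncomputable def confClass (κ l : ℕ) (M : KT) : KP1 :=
  (thick (l + 1) + M * geom (κ + 2), M * geom (κ + 1))

theorem ch_add (v w : Wt) : ch (v + w) = ch v * ch w := by
  rw [ch, ch, ch, AddMonoidAlgebra.single_mul_single, one_mul]

theorem ch_zero : ch 0 = 1 := rfl

theorem coeff_ch (w v : Wt) : (ch w).coeff v = if w = v then 1 else 0 := by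
  rw [ch, AddMonoidAlgebra.coeff_single, Finsupp.single_apply]

theorem coeff_chSum (I : Finset Wt) (v : Wt) : (chSum I).coeff v = if v ∈ I then 1 else 0 := by
  rw [chSum, AddMonoidAlgebra.coeff_sum, Finsupp.finsetSum_apply]
  simp [coeff_ch]

theorem chSum_injective : Function.Injective chSum := by
  intro I J h
  ext v
  have := congrArg (fun x : KT => x.coeff v) h
  simp only [coeff_chSum] at this
  by_cases h1 : v ∈ I <;> by_cases h2 : v ∈ J <;> simp_all

theorem geom_ne_zero (n : ℕ) : geom (n + 1) ≠ 0 := by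
  intro h
  have := congrArg (fun x : KT => x.coeff 0) h
  rw [geom, Finset.sum_range_succ'] at this
  have h2 : ∀ j : ℕ, (ch ((j + 1) • tw 0)).coeff 0 = 0 := fun j => by
    rw [coeff_ch, if_neg]
    intro e
    have := congrFun e 0
    simp [tw] at this
    omega
  rw [AddMonoidAlgebra.coeff_add, Finsupp.add_apply, AddMonoidAlgebra.coeff_sum, Finsupp.finsetSum_apply,
    Finset.sum_eq_zero fun j _ => h2 j] at this
  simp [coeff_ch] at this

/-- The second component is M times a nonzero element, which cancels in the group ring of the
character lattice. -/
theorem confClass_injective : Function.Injective (confClass κ l) := by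
  intro M M' h
  have h2 := congrArg Prod.snd h
  exact mul_right_cancel₀ (geom_ne_zero κ) h2

theorem StdData.kClass_eq {I : Finset Wt} {θ : ℝ × ℝ} {D : StdData κ l (I → ℂ)}
    (hD : IsStable θ D.toRep) (h : ∀ t, D.IsSemiInvariant t (diagAct I t).toLinearMap)
    {V₀ V₁ : Type} [AddCommGroup V₀] [Module ℂ V₀] [AddCommGroup V₁] [Module ℂ V₁]
    {R : FramedRep ℂ V₀ V₁} (hR : RepIso D.toRep R) [FiniteDimensional ℂ V₀] [FiniteDimensional ℂ V₁] :
    kClass R = confClass κ l (chSum I) := by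
  rw [HasWeights.kClass_eq (hR.isStable hD) ((D.hasWeights h).of_repIso hR), confClass, Fintype.sum_sum_type,
    Fintype.sum_prod_type, Fintype.sum_prod_type]
  simp only [weights₀, weights₁, Sum.elim_inl, Sum.elim_inr, ch_add, chSum, geom, thick,
    Finset.sum_mul_sum]
  refine Prod.ext ?_ ?_
  · simp only
    rw [Finset.sum_comm, Fin.sum_univ_eq_sum_range (fun n => ch (n • tw 3)), ← Finset.sum_coe_sort I]
    congr 1
    refine Finset.sum_congr rfl fun w _ => ?_
    rw [Fin.sum_univ_eq_sum_range (fun j => ch w.1 * ch (j • tw 0))]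
  · simp only
    rw [Finset.sum_comm, ← Finset.sum_coe_sort I]
    refine Finset.sum_congr rfl fun w _ => ?_
    rw [Fin.sum_univ_eq_sum_range (fun j => ch w.1 * ch (j • tw 0))]

/-- Classes separate configurations, so the r-element configurations biject with the fibre; every
fibre sum of a function of the class is a sum over configurations. -/
theorem fibre_eq {θ' : ℝ × ℝ} {Conf : Finset Wt → Prop} (std : ∀ I, Conf I → StdData κ l (I → ℂ)) (r : ℕ)
    (C : Finset (Finset Wt)) (hC : ∀ I, I ∈ C ↔ Conf I ∧ I.card = r)
    (hstable : ∀ I hI, I.card = r → IsStable θ' (std I hI).toRep)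
    (hsemi : ∀ I hI t, (std I hI).IsSemiInvariant t (diagAct I t).toLinearMap)
    (hJH : ∀ I hI, HasJHFactors (std I hI).toRep (thickIdeal (l + 1)) (lineRep (κ + 2)) I.card)
    (hcl : ∀ R : RepSpace ((l + 1) + r * (κ + 2)) (0 + r * (κ + 2 - 1)), IsStable θ' R → IsTorusFixed R →
      HasJHFactors R (thickIdeal (l + 1)) (lineRep (κ + 2)) r →
      ∃ I hI, I.card = r ∧ RepIso R (std I hI).toRep) :
    (fibre θ' (thickIdeal (l + 1)) (lineRep (κ + 2)) r).Finite ∧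
    (∀ q ∈ fibre θ' (thickIdeal (l + 1)) (lineRep (κ + 2)) r,
      ∃ I ∈ C, kClass q.out = confClass κ l (chSum I)) ∧
    ∀ f : KP1 → Lam, ∑ᶠ q ∈ fibre θ' (thickIdeal (l + 1)) (lineRep (κ + 2)) r, f (kClass q.out)
      = ∑ I ∈ C, f (confClass κ l (chSum I)) := by
  have hpt : ∀ I : C, ∃ q ∈ fibre θ' (thickIdeal (l + 1)) (lineRep (κ + 2)) r,
      kClass q.out = confClass κ l (chSum I.1) ∧ RepIso (std I.1 ((hC _).1 I.2).1).toRep q.out := by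
    rintro ⟨I, hI⟩
    obtain ⟨hI, hr⟩ := (hC I).1 hI
    have e0 : Module.finrank ℂ ((Fin (l + 1) → ℂ) × (Fin (κ + 2) → (I → ℂ)))
        = Module.finrank ℂ (Fin ((l + 1) + r * (κ + 2)) → ℂ) := by
      rw [StdData.finrank_V₀, Module.finrank_fintype_fun_eq_card, Module.finrank_fintype_fun_eq_card,
        Fintype.card_coe, Fintype.card_fin, hr]
      ring
    have e1 : Module.finrank ℂ (Fin (κ + 1) → (I → ℂ))
        = Module.finrank ℂ (Fin (0 + r * (κ + 2 - 1)) → ℂ) := by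
      rw [StdData.finrank_V₁, Module.finrank_fintype_fun_eq_card, Module.finrank_fintype_fun_eq_card,
        Fintype.card_coe, Fintype.card_fin, hr, zero_add, mul_comm]
      rfl
    let R := (std I hI).toRep.transport (LinearEquiv.ofFinrankEq _ _ e0) (LinearEquiv.ofFinrankEq _ _ e1)
    have hR : RepIso (std I hI).toRep R := repIso_transport _ _ _
    have hout : RepIso R (Quotient.mk (isoSetoid _ _) R).out :=
      Quotient.exact (Quotient.out_eq (Quotient.mk (isoSetoid _ _) R)).symm
    have hst := hstable I hI hr
    have hR2 := hR.trans hout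
    refine ⟨Quotient.mk _ R, ⟨R, rfl, hR.isStable hst, hR.isTorusFixed
      ((std I hI).hasWeights (hsemi I hI)).isTorusFixed, ?_⟩,
      StdData.kClass_eq hst (hsemi I hI) hR2, hR2⟩
    have := hJH I hI
    rw [hr] at this
    exact hR.symm.hasJHFactors this
  choose Φ hΦ using hpt
  have hinj : Function.Injective Φ := by
    intro I J h
    have h1 := (hΦ I).2.1
    rw [h, (hΦ J).2.1] at h1
    exact Subtype.ext (chSum_injective (confClass_injective h1)).symm
  have hsurj : fibre θ' (thickIdeal (l + 1)) (lineRep (κ + 2)) r = Set.range Φ := by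
    ext q
    constructor
    · rintro ⟨R, hq, h1, h2, h3⟩
      obtain ⟨I, hI, hr, h⟩ := hcl R h1 h2 h3
      refine ⟨⟨I, (hC I).2 ⟨hI, hr⟩⟩, ?_⟩
      rw [← Quotient.out_eq (Φ _), ← hq]
      exact Quotient.sound (RepIso.symm (h.trans (hΦ ⟨I, _⟩).2.2))
    · rintro ⟨I, rfl⟩
      exact (hΦ I).1
  refine ⟨?_, ?_, ?_⟩
  · rw [hsurj]; exact Set.finite_range _
  · intro q hq
    rw [hsurj] at hq
    obtain ⟨I, rfl⟩ := hq
    exact ⟨I.1, I.2, (hΦ I).2.1⟩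
  · intro f
    rw [hsurj, finsum_mem_range hinj, finsum_eq_sum_of_fintype, ← Finset.sum_coe_sort C]
    exact Finset.sum_congr rfl fun I _ => by rw [(hΦ I).2.1]

theorem eventually_of_forall_small {p : ℝ → Prop} {n : ℕ}
    (h : ∃ ε₀ : ℝ, 0 < ε₀ ∧ ∀ ε : ℝ, 0 < ε → ε * (n : ℝ) < ε₀ → p ε) : ∀ᶠ ε in 𝓝[>] (0 : ℝ), p ε := by
  obtain ⟨ε₀, h0, h⟩ := h
  have : (0 : ℝ) < ε₀ / (n + 1) := by positivity
  filter_upwards [Ioo_mem_nhdsGT this] with ε hε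
  refine h ε hε.1 ?_
  have h2 := (lt_div_iff₀ (by positivity)).1 hε.2
  nlinarith [hε.1]

/-- There are finitely many configurations of size r, so one small ε makes all their standard
representations stable. Conversely `exists_stdData_plus` and `exists_stdPlus` bring every fixed
point of the fibre into standard form. -/
theorem fibre_plus {θ : ℝ × ℝ} (hθ : θ ∈ wallLmm (κ + 2)) (r : ℕ) (C : Finset (Finset Wt))
    (hC : ∀ I, I ∈ C ↔ IsPlusConf κ l I ∧ I.card = r) : ∀ᶠ ε in 𝓝[>] (0 : ℝ),
    (fibre (θ.1 - ε, θ.2) (thickIdeal (l + 1)) (lineRep (κ + 2)) r).Finite ∧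
    (∀ q ∈ fibre (θ.1 - ε, θ.2) (thickIdeal (l + 1)) (lineRep (κ + 2)) r,
      ∃ I ∈ C, kClass q.out = confClass κ l (chSum I)) ∧
    ∀ f : KP1 → Lam, ∑ᶠ q ∈ fibre (θ.1 - ε, θ.2) (thickIdeal (l + 1)) (lineRep (κ + 2)) r, f (kClass q.out)
      = ∑ I ∈ C, f (confClass κ l (chSum I)) := by
  have hst : ∀ᶠ ε in 𝓝[>] (0 : ℝ), ∀ I ∈ C, ∀ hI : IsPlusConf κ l I,
      IsStable (θ.1 - ε, θ.2) (stdPlus hI).toRep := by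
    rw [Finset.eventually_all]
    intro I hI
    have hI := ((hC I).1 hI).1
    filter_upwards [eventually_of_forall_small ((stdPlus hI).isStable_plus hθ rfl (stdPlus_generated hI))]
      with ε hε _ using hε
  obtain ⟨z, hz, hslope⟩ := slope_eq_of_mem_wallLmm hθ
  filter_upwards [hst, self_mem_nhdsWithin] with ε hε hpos
  have hneg : slope (θ.1 - ε, θ.2) (κ + 2) (κ + 1) < 0 := by
    have := hslope (-ε) (κ + 2) (κ + 1)
    rw [← sub_eq_add_neg] at this
    rw [this]
    push_cast
    have : (0 : ℝ) < ε := hpos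
    have : 0 < ε * ((κ : ℝ) + 2) := by positivity
    linarith
  refine fibre_eq (fun I hI => stdPlus hI) r C hC (fun I hI hr => hε I ((hC I).2 ⟨hI, hr⟩) hI)
    (fun I hI t => stdPlus_isSemiInvariant hI t) (fun I hI => ?_) fun R h1 h2 h3 => ?_
  · obtain ⟨F⟩ := exists_flag I
    exact (stdPlus hI).hasJHFactors_plus F rfl
  · obtain ⟨A, D, hr, hD, hβ⟩ := exists_stdData_plus hneg h1 h3
    obtain ⟨g₀, g₁, hg⟩ := hD.symm.isTorusFixed h2 genericPoint
    obtain ⟨φ, hφ⟩ := D.exists_isSemiInvariant hg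
    obtain ⟨I, hI, hcard, h⟩ := exists_stdPlus D (D.generated_of_isStable hneg (hD.symm.isStable h1)) hβ hφ
    exact ⟨I, hI, hcard.trans hr, hD.symm.trans h⟩

theorem fibre_minus {θ : ℝ × ℝ} (hθ : θ ∈ wallLmm (κ + 2)) (r : ℕ) (C : Finset (Finset Wt))
    (hC : ∀ I, I ∈ C ↔ IsMinusConf κ l I ∧ I.card = r) : ∀ᶠ ε in 𝓝[>] (0 : ℝ),
    (fibre (θ.1 + ε, θ.2) (thickIdeal (l + 1)) (lineRep (κ + 2)) r).Finite ∧
    (∀ q ∈ fibre (θ.1 + ε, θ.2) (thickIdeal (l + 1)) (lineRep (κ + 2)) r,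
      ∃ I ∈ C, kClass q.out = confClass κ l (chSum I)) ∧
    ∀ f : KP1 → Lam, ∑ᶠ q ∈ fibre (θ.1 + ε, θ.2) (thickIdeal (l + 1)) (lineRep (κ + 2)) r, f (kClass q.out)
      = ∑ I ∈ C, f (confClass κ l (chSum I)) := by
  have hst : ∀ᶠ ε in 𝓝[>] (0 : ℝ), ∀ I ∈ C, ∀ hI : IsMinusConf κ l I,
      IsStable (θ.1 + ε, θ.2) (stdMinus hI).toRep := by
    rw [Finset.eventually_all]
    intro I hI
    have hI := ((hC I).1 hI).1
    filter_upwards [eventually_of_forall_small ((stdMinus hI).isStable_minus hθ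
      fun N _ h => stdMinus_cogenerated hI N h)] with ε hε _ using hε
  obtain ⟨z, hz, hslope⟩ := slope_eq_of_mem_wallLmm hθ
  filter_upwards [hst, self_mem_nhdsWithin] with ε hε hpos
  have hneg : 0 < slope (θ.1 + ε, θ.2) (κ + 2) (κ + 1) := by
    rw [hslope]
    push_cast
    have : (0 : ℝ) < ε := hpos
    have : 0 < ε * ((κ : ℝ) + 2) := by positivity
    linarith
  refine fibre_eq (fun I hI => stdMinus hI) r C hC (fun I hI hr => hε I ((hC I).2 ⟨hI, hr⟩) hI)
    (fun I hI t => stdMinus_isSemiInvariant hI t) (fun I hI => ?_) fun R h1 h2 h3 => ?_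
  · obtain ⟨F⟩ := exists_flag I
    exact (stdMinus hI).hasJHFactors_minus F rfl rfl
  · obtain ⟨A, D, hr, hD, hv, hα⟩ := exists_stdData_minus hneg h1 h3
    obtain ⟨g₀, g₁, hg⟩ := hD.symm.isTorusFixed h2 genericPoint
    obtain ⟨φ, hφ⟩ := D.exists_isSemiInvariant hg
    obtain ⟨I, hI, hcard, h⟩ := exists_stdMinus D (D.cogenerated_of_isStable hneg (hD.symm.isStable h1)) hv hα hφ
    exact ⟨I, hI, hcard.trans hr, hD.symm.trans h⟩

end PervConifold

/-! ### Characters and Euler classes -/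

namespace PervConifold

section Dual

theorem dual_eq_ringHom (V : KT) :
    dual V = AddMonoidAlgebra.mapDomainRingHom ℤ (negAddMonoidHom : Wt →+ Wt) V := rfl

theorem dual_add (V W : KT) : dual (V + W) = dual V + dual W := by simp only [dual_eq_ringHom, map_add]

theorem dual_sub (V W : KT) : dual (V - W) = dual V - dual W := by simp only [dual_eq_ringHom, map_sub]

theorem dual_mul (V W : KT) : dual (V * W) = dual V * dual W := by simp only [dual_eq_ringHom, map_mul]

theorem dual_one : dual 1 = 1 := by simp only [dual_eq_ringHom, map_one]

theorem dual_sum {ι : Type*} (s : Finset ι) (f : ι → KT) : dual (∑ i ∈ s, f i) = ∑ i ∈ s, dual (f i) := by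
  simp only [dual_eq_ringHom, map_sum]

theorem dual_ch (w : Wt) : dual (ch w) = ch (-w) := by
  rw [dual, ch, AddMonoidAlgebra.mapDomain_single]; rfl

theorem ch_mul_ch_neg (w : Wt) : ch w * ch (-w) = 1 := by rw [← ch_add, add_neg_cancel, ch_zero]

theorem ch_nsmul (n : ℕ) (w : Wt) : ch (n • w) = ch w ^ n := by
  induction n with
  | zero => rw [zero_smul, pow_zero, ch_zero]
  | succ n ih => rw [add_smul, one_smul, ch_add, ih, pow_succ]

theorem dual_chSum (I : Finset Wt) : dual (chSum I) = ∑ w ∈ I, ch (-w) := by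
  rw [chSum, dual_sum]
  exact Finset.sum_congr rfl fun w _ => dual_ch w

end Dual

/-! ### The square root of the virtual tangent character as a function of M. -/

section SqrtClass

variable (κ l : ℕ)

theorem geom_succ (n : ℕ) : geom (n + 1) = 1 + ch (tw 0) * geom n := by
  rw [geom, geom, Finset.sum_range_succ', zero_smul, ch_zero, Finset.mul_sum, add_comm]
  congr 1
  refine Finset.sum_congr rfl fun j _ => ?_
  rw [add_smul, one_smul, ch_add, mul_comm]

theorem dual_geom_succ_eq : dual (geom (κ + 2)) = 1 + ch (-tw 0) * dual (geom (κ + 1)) := by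
  rw [geom_succ, dual_add, dual_mul, dual_one, dual_ch]

theorem geom_mul (n : ℕ) : (ch (tw 0) - 1) * geom n = ch (tw 0) ^ n - 1 := by
  simp only [geom, ch_nsmul]
  exact mul_geom_sum _ _

/-- Reversing the summation gives t₀^(κ+1) S^∨ = t₀ S for S = `geom (κ + 1)`; combined with (t₀ -
1)S = t₀^(κ+1) - 1 this removes all powers of t₀. -/
theorem geom_mul_dual_geom : (ch (tw 0) - 1) * (geom (κ + 1) * dual (geom (κ + 1)))
    = ch (tw 0) * geom (κ + 1) - dual (geom (κ + 1)) := by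
  have h1 := geom_mul (κ + 1)
  have h2 := congrArg dual h1
  simp only [dual_mul, dual_sub, dual_one, dual_ch, ← ch_nsmul] at h2
  have h3 := ch_mul_ch_neg (tw 0)
  have h4 := ch_mul_ch_neg ((κ + 1) • tw 0)
  have h5 : ch (tw 0) ^ (κ + 1) * dual (geom (κ + 1)) = ch (tw 0) * geom (κ + 1) := by
    rw [geom, dual_sum, Finset.mul_sum, Finset.mul_sum, ← Finset.sum_range_reflect]
    refine Finset.sum_congr rfl fun j hj => ?_
    have hj := Finset.mem_range.1 hj
    rw [dual_ch, ← ch_nsmul, ← ch_add, ← ch_add]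
    congr 1
    obtain ⟨d, hd⟩ : ∃ d, κ = j + d := ⟨κ - j, by omega⟩
    rw [show κ + 1 - 1 - j = d by omega, hd]
    simp only [add_smul, one_smul]
    abel
  linear_combination dual (geom (κ + 1)) * h1 + h5

theorem thick_mul (n : ℕ) : (1 - ch (tw 3)) * thick n = 1 - ch (n • tw 3) := by
  simp only [thick, ch_nsmul]
  exact mul_neg_geom_sum _ _

theorem dual_thick_mul (n : ℕ) : (1 - ch (-tw 3)) * dual (thick n) = 1 - ch (-(n • tw 3)) := by
  rw [← dual_ch, ← dual_ch, ← dual_one, ← dual_sub, ← dual_mul, thick_mul, dual_sub, dual_one]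

theorem ch_neg_tw_prod : ch (-tw 0) * ch (-tw 1) * ch (-tw 3) = ch (tw 2) := by
  rw [← ch_add, ← ch_add]
  congr 1
  ext i
  fin_cases i <;> simp [tw]

/-- The part of the square root that depends on the `r` copies of `O(κ+1)`. -/
noncomputable def moving (M : KT) : KT :=
  dual M * M * (1 - ch (-tw 3))
    + M * (-(ch (-((l + 1) • tw 3)) * geom (κ + 2))
      - ch (-tw 1) * (1 - ch (-((l + 1) • tw 3))) * geom (κ + 1))
    + dual M * ((1 - ch ((l + 1) • tw 3)) * (ch (-tw 3) * (dual (geom (κ + 1)) - 1)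
      - ch (tw 2) * dual (geom (κ + 1))))

/-- Only the geometric-sum relations for the monomials of P¹ and for the thickened line enter. The
term without M is common to all fixed points and cancels in the quotient of the two series. -/
theorem sqrtClass_confClass (M : KT) : sqrtClass (confClass κ l M)
    = -(ch (-((l + 1) • tw 3)) * thick (l + 1)) + moving κ l M := by
  have hA := geom_succ (κ + 1)
  have hA' := dual_geom_succ_eq κ
  have ha := geom_mul_dual_geom κ
  have hL := thick_mul (l + 1)
  have hL' := dual_thick_mul (l + 1)
  have h0 := ch_mul_ch_neg (tw 0)
  have h3 := ch_mul_ch_neg (tw 3)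
  have hp := ch_mul_ch_neg ((l + 1) • tw 3)
  have h2 := ch_neg_tw_prod
  have h13 : ch (-tw 1 - tw 3) = ch (-tw 1) * ch (-tw 3) := by rw [sub_eq_add_neg, ch_add]
  simp only [sqrtClass, chiY, chiP1, twistZinf, confClass, Prod.smul_fst, Prod.smul_snd, Prod.fst_add,
    Prod.snd_add, smul_eq_mul, dual_add, dual_mul, h13, moving]
  rw [hA', hA, ← h2]
  clear hA hA' hp h2 h13
  generalize dual (geom (κ + 1)) = a' at *
  generalize geom (κ + 1) = a at *
  generalize dual (thick (l + 1)) = L' at *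
  generalize thick (l + 1) = L at *
  generalize dual M = M' at *
  linear_combination (M' * M) * (-(1 - ch (-tw 3)) + ch (-tw 1) * (1 - ch (-tw 3)) * ch (-tw 0)) * ha
    + M' * M * ch (-tw 1) * (1 - ch (-tw 3)) * a * h0
    + (L + M * (1 + ch (tw 0) * a) - ch (-tw 1) * a * M) * hL'
    + M' * (1 - a' + ch (-tw 1) * ch (-tw 0) * a') * (-L * h3 - ch (-tw 3) * hL)

end SqrtClass

/-! ### Euler classes as multiplicative classes. -/

section Euler

/-- The multiplicative class with the given value on characters. -/
noncomputable def multClass (φ : Wt → Lamˣ) (V : KT) : Lamˣ := V.coeff.prod fun w n => φ w ^ n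

variable (φ : Wt → Lamˣ)

theorem multClass_add (V W : KT) : multClass φ (V + W) = multClass φ V * multClass φ W := by
  rw [multClass, AddMonoidAlgebra.coeff_add]
  exact Finsupp.prod_add_index' (fun _ => zpow_zero _) fun _ _ _ => zpow_add _ _ _

theorem multClass_zero : multClass φ 0 = 1 := by simp [multClass]

/-- The multiplicative class as a homomorphism. -/
noncomputable def multClassHom : KT →+ Additive Lamˣ where
  toFun V := Additive.ofMul (multClass φ V)
  map_zero' := congrArg _ (multClass_zero φ)
  map_add' V W := congrArg _ (multClass_add φ V W)

theorem multClass_sub (V W : KT) : multClass φ (V - W) = multClass φ V / multClass φ W :=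
  congrArg Additive.toMul (map_sub (multClassHom φ) V W)

theorem multClass_sum {ι : Type*} (s : Finset ι) (f : ι → KT) :
    multClass φ (∑ i ∈ s, f i) = ∏ i ∈ s, multClass φ (f i) :=
  congrArg Additive.toMul (map_sum (multClassHom φ) f s)

theorem multClass_ch (w : Wt) : multClass φ (ch w) = φ w := by
  rw [multClass, ch, AddMonoidAlgebra.coeff_single, Finsupp.prod_single_index, zpow_one]
  exact zpow_zero _

theorem multClass_mul (ψ : Wt → Lamˣ) (V : KT) :
    multClass (φ * ψ) V = multClass φ V * multClass ψ V := by
  simp only [multClass, Pi.mul_apply, mul_zpow]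
  exact Finsupp.prod_mul

theorem multClass_dual (V : KT) : multClass φ (dual V) = multClass (fun w => φ (-w)) V := by
  rw [multClass, dual, AddMonoidAlgebra.coeff_mapDomain]
  exact Finsupp.prod_mapDomain_index (fun _ => zpow_zero _) fun _ _ _ => zpow_add _ _ _

theorem lin_add (v w : Wt) : lin (v + w) = lin v + lin w := by
  simp only [lin, Pi.add_apply, Int.cast_add, add_mul, Finset.sum_add_distrib]

theorem lin_neg (w : Wt) : lin (-w) = -lin w := by
  simp only [lin, Pi.neg_apply, Int.cast_neg, neg_mul, Finset.sum_neg_distrib]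

theorem lin_sub (v w : Wt) : lin (v - w) = lin v - lin w := by
  rw [sub_eq_add_neg, lin_add, lin_neg, sub_eq_add_neg]

theorem lin_zero : lin 0 = 0 := by simp [lin]

theorem lin_nsmul (n : ℕ) (w : Wt) : lin (n • w) = n * lin w := by
  induction n with
  | zero => simp [lin_zero]
  | succ n ih => rw [add_smul, one_smul, lin_add, ih]; push_cast; ring

theorem lin_eq_algebraMap (w : Wt) : lin w = algebraMap (MvPolynomial (Fin 4) ℚ) Lam
    (∑ i : Fin 3, MvPolynomial.C (w i : ℚ) * MvPolynomial.X i.castSucc) := by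
  simp only [lin, map_sum, map_mul, map_intCast]

theorem lin_add_mPar_ne_zero (w : Wt) : lin w + mPar ≠ 0 := by
  rw [lin_eq_algebraMap, mPar, ← map_add]
  rw [Ne, map_eq_zero_iff _ (IsFractionRing.injective (MvPolynomial (Fin 4) ℚ) Lam)]
  intro h
  have := congrArg (MvPolynomial.eval (Pi.single 3 1 : Fin 4 → ℚ)) h
  simp [Fin.sum_univ_three] at this

theorem lin_eq_zero_iff {w : Wt} : lin w = 0 ↔ w = 0 := by
  constructor
  · intro h
    rw [lin_eq_algebraMap, map_eq_zero_iff _ (IsFractionRing.injective (MvPolynomial (Fin 4) ℚ) Lam)] at h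
    ext i
    have := congrArg (MvPolynomial.eval (Pi.single i.castSucc 1 : Fin 4 → ℚ)) h
    fin_cases i <;> simpa [Fin.sum_univ_three] using this
  · rintro rfl; exact lin_zero

theorem lin_injective : Function.Injective lin := fun v w h =>
  sub_eq_zero.1 (lin_eq_zero_iff.1 (by rw [lin_sub, h, sub_self]))

/-- The weight of a character, with the weight of the trivial character replaced by `1`. -/
noncomputable def linUnit (w : Wt) : Lamˣ :=
  if h : w = 0 then 1 else Units.mk0 (lin w) (mt lin_eq_zero_iff.1 h)

theorem linUnit_val {w : Wt} (h : w ≠ 0) : (linUnit w : Lam) = lin w := by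
  rw [linUnit, dif_neg h]; rfl

/-- The sign of `w ↦ w⁻¹` on weights. -/
noncomputable def signUnit (w : Wt) : Lamˣ := if w = 0 then 1 else -1

theorem linUnit_neg (w : Wt) : linUnit (-w) = signUnit w * linUnit w := by
  by_cases h : w = 0
  · simp [h, linUnit, signUnit]
  · apply Units.ext
    rw [linUnit_val (neg_ne_zero.2 h), Units.val_mul, linUnit_val h, lin_neg, signUnit, if_neg h]
    simp

theorem multClass_linUnit_dual (V : KT) :
    multClass linUnit (dual V) = multClass signUnit V * multClass linUnit V := by
  rw [multClass_dual, ← multClass_mul]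
  congr 1
  ext1 w
  exact linUnit_neg w

/-- Since `lin 0 = 0` is not invertible, `euler` is not multiplicative in general. Giving the
trivial character weight 1 yields a homomorphism that agrees with it where that character has
multiplicity zero. -/
theorem euler_eq_multClass {V : KT} (h : V.coeff 0 = 0) : euler V = multClass linUnit V := by
  rw [euler, multClass, Finsupp.prod, Finsupp.prod, Units.coe_prod]
  refine Finset.prod_congr rfl fun w hw => ?_
  have hw0 : w ≠ 0 := by
    rintro rfl
    exact (Finsupp.mem_support_iff.1 hw) h
  rw [Units.val_zpow_eq_zpow_val, linUnit_val hw0]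

theorem eulerM_add (V W : KT) : eulerM (V + W) = eulerM V * eulerM W := by
  rw [eulerM, AddMonoidAlgebra.coeff_add]
  exact Finsupp.prod_add_index' (fun _ => zpow_zero _)
    fun w _ _ => zpow_add₀ (lin_add_mPar_ne_zero w) _ _

theorem eulerM_sum {ι : Type*} (s : Finset ι) (f : ι → KT) :
    eulerM (∑ i ∈ s, f i) = ∏ i ∈ s, eulerM (f i) := by
  classical
  induction s using Finset.induction_on with
  | empty => simp [eulerM]
  | insert i s hi ih => rw [Finset.sum_insert hi, Finset.prod_insert hi, eulerM_add, ih]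

theorem eulerM_ch (w : Wt) : eulerM (ch w) = lin w + mPar := by
  rw [eulerM, ch, AddMonoidAlgebra.coeff_single, Finsupp.prod_single_index, zpow_one]
  exact zpow_zero _

end Euler

end PervConifold

/-! ### Localisation weights -/

namespace PervConifold

variable (κ l d : ℕ)

/-- The weights `w` with `PlusChain κ l w` and `w 1 > -(l + 1 + d)`. -/
def plusSet : Finset Wt :=
  ((Finset.range d ×ˢ Finset.range (κ + 2)).image fun x => vWt l x.2 + x.1 • tw 3) ∪
  (((Finset.range (l + 1) ×ˢ Finset.range (κ + 1)).image fun x => αWt 0 x.2 + x.1 • tw 3) ∪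
  ((Finset.range (l + 1) ×ˢ Finset.range (κ + 1)).image fun x => αWt 1 x.2 + x.1 • tw 3))

/-- The weights `w` with `MinusChain κ l w`. -/
def minusSet : Finset Wt := (Finset.range (l + 1) ×ˢ Finset.range κ).image fun x => βWt x.2 x.1

variable {κ l d}

theorem eq_of_coords {v w : Wt} (h0 : v 0 = w 0) (h1 : v 1 = w 1) (h2 : v 2 = w 2) : v = w := by
  ext i
  fin_cases i
  · exact h0
  · exact h1
  · exact h2

theorem vWt_add_apply (j n : ℕ) : (vWt l j + n • tw 3) 0 = -(l + 1) - j - n ∧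
    (vWt l j + n • tw 3) 1 = -(l + 1) - n ∧ (vWt l j + n • tw 3) 2 = -(l + 1) - n := by
  simp only [add_nsmul_tw_three_apply]; simp [vWt]

theorem αWt_zero_add_apply (j n : ℕ) : (αWt 0 j + n • tw 3) 0 = -j - n ∧
    (αWt 0 j + n • tw 3) 1 = 1 - n ∧ (αWt 0 j + n • tw 3) 2 = -n := by
  simp only [add_nsmul_tw_three_apply]; simp [αWt]

theorem αWt_one_add_apply (j n : ℕ) : (αWt 1 j + n • tw 3) 0 = -j - n ∧
    (αWt 1 j + n • tw 3) 1 = -n ∧ (αWt 1 j + n • tw 3) 2 = 1 - n := by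
  simp only [add_nsmul_tw_three_apply]; simp [αWt]

theorem βWt_apply (j n : ℕ) : βWt j n 0 = -n - (j + 1) ∧ βWt j n 1 = -n ∧ βWt j n 2 = -n := by
  simp [βWt]

theorem mem_plusSet {w : Wt} : w ∈ plusSet κ l d ↔ PlusChain κ l w ∧ -(l + 1 + d : ℤ) < w 1 := by
  simp only [plusSet, Finset.mem_union, Finset.mem_image, Finset.mem_product, Finset.mem_range,
    Prod.exists]
  constructor
  · rintro (⟨n, j, ⟨hn, hj⟩, rfl⟩ | ⟨n, j, ⟨hn, hj⟩, rfl⟩ | ⟨n, j, ⟨hn, hj⟩, rfl⟩)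
    · obtain ⟨e0, e1, e2⟩ := vWt_add_apply (l := l) j n
      rw [PlusChain, e0, e1, e2]; omega
    · obtain ⟨e0, e1, e2⟩ := αWt_zero_add_apply j n
      rw [PlusChain, e0, e1, e2]; omega
    · obtain ⟨e0, e1, e2⟩ := αWt_one_add_apply j n
      rw [PlusChain, e0, e1, e2]; omega
  · rintro ⟨⟨h1, h2, h3, h4⟩ | ⟨h1, h2, h3, h4, h5⟩ | ⟨h1, h2, h3, h4, h5⟩, hd⟩
    · left
      obtain ⟨e0, e1, e2⟩ := vWt_add_apply (l := l) (w 1 - w 0).toNat (-w 1 - (l + 1)).toNat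
      exact ⟨(-w 1 - (l + 1)).toNat, (w 1 - w 0).toNat, by omega, eq_of_coords (by omega) (by omega) (by omega)⟩
    · right; left
      obtain ⟨e0, e1, e2⟩ := αWt_zero_add_apply (w 2 - w 0).toNat (-w 2).toNat
      exact ⟨(-w 2).toNat, (w 2 - w 0).toNat, by omega, eq_of_coords (by omega) (by omega) (by omega)⟩
    · right; right
      obtain ⟨e0, e1, e2⟩ := αWt_one_add_apply (w 1 - w 0).toNat (-w 1).toNat
      exact ⟨(-w 1).toNat, (w 1 - w 0).toNat, by omega, eq_of_coords (by omega) (by omega) (by omega)⟩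

theorem mem_minusSet {w : Wt} : w ∈ minusSet κ l ↔ MinusChain κ l w := by
  simp only [minusSet, Finset.mem_image, Finset.mem_product, Finset.mem_range, Prod.exists]
  constructor
  · rintro ⟨n, j, ⟨hn, hj⟩, rfl⟩
    obtain ⟨e0, e1, e2⟩ := βWt_apply j n
    rw [MinusChain, e0, e1, e2]; omega
  · intro h
    obtain ⟨j, n, rfl⟩ := exists_eq_βWt h
    exact ⟨n, j, ⟨n.2, j.2⟩, rfl⟩

theorem injective_of_coords {f : ℕ × ℕ → Wt}
    (h : ∀ j n j' n', f (n, j) = f (n', j') → j = j' ∧ n = n') : Function.Injective f := by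
  rintro ⟨n, j⟩ ⟨n', j'⟩ e
  obtain ⟨rfl, rfl⟩ := h _ _ _ _ e
  rfl

theorem vWt_add_injective : Function.Injective fun x : ℕ × ℕ => vWt l x.2 + x.1 • tw 3 :=
  injective_of_coords fun j n j' n' e => by
    obtain ⟨e0, e1, e2⟩ := vWt_add_apply (l := l) j n
    obtain ⟨f0, f1, f2⟩ := vWt_add_apply (l := l) j' n'
    simp only at e
    rw [e] at e0 e1
    omega

theorem αWt_zero_add_injective : Function.Injective fun x : ℕ × ℕ => αWt 0 x.2 + x.1 • tw 3 :=
  injective_of_coords fun j n j' n' e => by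
    obtain ⟨e0, e1, e2⟩ := αWt_zero_add_apply j n
    obtain ⟨f0, f1, f2⟩ := αWt_zero_add_apply j' n'
    simp only at e
    rw [e] at e0 e1
    omega

theorem αWt_one_add_injective : Function.Injective fun x : ℕ × ℕ => αWt 1 x.2 + x.1 • tw 3 :=
  injective_of_coords fun j n j' n' e => by
    obtain ⟨e0, e1, e2⟩ := αWt_one_add_apply j n
    obtain ⟨f0, f1, f2⟩ := αWt_one_add_apply j' n'
    simp only at e
    rw [e] at e0 e1
    omega

theorem βWt_nat_injective : Function.Injective fun x : ℕ × ℕ => βWt x.2 x.1 :=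
  injective_of_coords fun j n j' n' e => by
    obtain ⟨e0, e1, e2⟩ := βWt_apply j n
    obtain ⟨f0, f1, f2⟩ := βWt_apply j' n'
    simp only at e
    rw [e] at e0 e1
    omega

theorem disjoint_αWt : Disjoint
    ((Finset.range (l + 1) ×ˢ Finset.range (κ + 1)).image fun x => αWt 0 x.2 + x.1 • tw 3)
    ((Finset.range (l + 1) ×ˢ Finset.range (κ + 1)).image fun x => αWt 1 x.2 + x.1 • tw 3) := by
  rw [Finset.disjoint_left]
  intro w h h'
  obtain ⟨⟨n, j⟩, -, rfl⟩ := Finset.mem_image.1 h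
  obtain ⟨⟨n', j'⟩, -, e⟩ := Finset.mem_image.1 h'
  obtain ⟨e0, e1, e2⟩ := αWt_zero_add_apply j n
  obtain ⟨f0, f1, f2⟩ := αWt_one_add_apply j' n'
  simp only at e
  rw [e] at f1 f2
  omega

theorem disjoint_vWt : Disjoint
    ((Finset.range d ×ˢ Finset.range (κ + 2)).image fun x => vWt l x.2 + x.1 • tw 3)
    (((Finset.range (l + 1) ×ˢ Finset.range (κ + 1)).image fun x => αWt 0 x.2 + x.1 • tw 3) ∪
    ((Finset.range (l + 1) ×ˢ Finset.range (κ + 1)).image fun x => αWt 1 x.2 + x.1 • tw 3)) := by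
  rw [Finset.disjoint_left]
  intro w h h'
  obtain ⟨⟨n, j⟩, -, rfl⟩ := Finset.mem_image.1 h
  obtain ⟨e0, e1, e2⟩ := vWt_add_apply (l := l) j n
  rcases Finset.mem_union.1 h' with h' | h'
  · obtain ⟨⟨n', j'⟩, -, e⟩ := Finset.mem_image.1 h'
    obtain ⟨f0, f1, f2⟩ := αWt_zero_add_apply j' n'
    simp only at e
    rw [e] at f1 f2
    omega
  · obtain ⟨⟨n', j'⟩, -, e⟩ := Finset.mem_image.1 h'
    obtain ⟨f0, f1, f2⟩ := αWt_one_add_apply j' n'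
    simp only at e
    rw [e] at f1 f2
    omega

/-- The excess (κ+2)(l+1+d) is the value of km/λ₃ at m = (l+1+d)λ₃, and it becomes the exponent of 1
- t. -/
theorem card_plusSet : (plusSet κ l d).card = (minusSet κ l).card + (κ + 2) * (l + 1 + d) := by
  rw [plusSet, minusSet, Finset.card_union_of_disjoint disjoint_vWt,
    Finset.card_union_of_disjoint disjoint_αWt, Finset.card_image_of_injective _ vWt_add_injective,
    Finset.card_image_of_injective _ αWt_zero_add_injective,
    Finset.card_image_of_injective _ αWt_one_add_injective,
    Finset.card_image_of_injective _ βWt_nat_injective]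
  simp only [Finset.card_product, Finset.card_range]
  ring

theorem sum_prod_ch (m n : ℕ) (u : Wt) (f : ℕ → ℕ → Wt) (hf : ∀ j k, f j k = u + k • tw 3 + -(j • tw 0)) :
    ∑ x ∈ Finset.range m ×ˢ Finset.range n, ch (f x.2 x.1) = ch u * thick m * dual (geom n) := by
  rw [Finset.sum_product, geom, dual_sum, thick, mul_assoc, Finset.sum_mul_sum, Finset.mul_sum]
  refine Finset.sum_congr rfl fun k _ => ?_
  rw [Finset.mul_sum]
  refine Finset.sum_congr rfl fun j _ => ?_
  rw [hf, ch_add, ch_add, dual_ch, mul_assoc]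

/-- Each string is a geometric sum in t₃, so multiplication by 1 - t₃ leaves only its two ends. In
this form the set of all weights can be matched with the terms of `moving` that are linear in M. -/
theorem chSum_plusSet : (1 - ch (tw 3)) * chSum (plusSet κ l d)
    = (ch ((l + 1) • tw 3) - ch ((l + 1 + d) • tw 3)) * dual (geom (κ + 2))
      + (1 - ch ((l + 1) • tw 3)) * (ch (tw 1) + ch (tw 2)) * dual (geom (κ + 1)) := by
  have h1 : ∑ x ∈ Finset.range d ×ˢ Finset.range (κ + 2), ch (vWt l x.2 + x.1 • tw 3) = _ :=
    sum_prod_ch d (κ + 2) ((l + 1) • tw 3) (fun j k => vWt l j + k • tw 3) fun j k => by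
      rw [← vWt_eq l j]; abel
  have h2 : ∑ x ∈ Finset.range (l + 1) ×ˢ Finset.range (κ + 1), ch (αWt 0 x.2 + x.1 • tw 3) = _ :=
    sum_prod_ch (l + 1) (κ + 1) (tw 1) (fun j k => αWt 0 j + k • tw 3) fun j k => by
      have := αWt_eq 0 j
      simp only [Matrix.cons_val_zero] at this
      rw [← this]; abel
  have h3 : ∑ x ∈ Finset.range (l + 1) ×ˢ Finset.range (κ + 1), ch (αWt 1 x.2 + x.1 • tw 3) = _ :=
    sum_prod_ch (l + 1) (κ + 1) (tw 2) (fun j k => αWt 1 j + k • tw 3) fun j k => by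
      have := αWt_eq 1 j
      simp only [Matrix.cons_val_one, Matrix.cons_val_zero] at this
      rw [← this]; abel
  have e1 := thick_mul d
  have e2 := thick_mul (l + 1)
  rw [chSum, plusSet, Finset.sum_union disjoint_vWt, Finset.sum_union disjoint_αWt,
    Finset.sum_image (vWt_add_injective.injOn), Finset.sum_image (αWt_zero_add_injective.injOn),
    Finset.sum_image (αWt_one_add_injective.injOn), h1, h2, h3, add_smul (l + 1) d, ch_add]
  linear_combination ch ((l + 1) • tw 3) * dual (geom (κ + 2)) * e1
    + (ch (tw 1) + ch (tw 2)) * dual (geom (κ + 1)) * e2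

theorem chSum_minusSet : (1 - ch (tw 3)) * chSum (minusSet κ l)
    = (1 - ch ((l + 1) • tw 3)) * (dual (geom (κ + 1)) - 1) := by
  have h1 : ∑ x ∈ Finset.range (l + 1) ×ˢ Finset.range κ, ch (βWt x.2 x.1) = _ :=
    sum_prod_ch (l + 1) κ (-tw 0) (fun j k => βWt j k) fun j k => by
      have := βWt_eq j k
      rw [← this, add_smul, one_smul]; abel
  have e2 := thick_mul (l + 1)
  have hg : dual (geom (κ + 1)) = 1 + ch (-tw 0) * dual (geom κ) := by
    rw [geom_succ, dual_add, dual_mul, dual_one, dual_ch]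
  rw [chSum, minusSet, Finset.sum_image (βWt_nat_injective.injOn), h1, hg]
  linear_combination ch (-tw 0) * dual (geom κ) * e2

/-- The tangent weights on the side of `Θ₊` for `m = (l + 1 + d) λ₃`. -/
noncomputable def plusTangent (M X Y : KT) : KT :=
  (ch (-tw 3) - 1) * M * dual (X - M) + (ch (tw 3) - 1) * M * dual Y

/-- The tangent weights on the side of `Θ₋` for `m = (l + 1 + d) λ₃`. -/
noncomputable def minusTangent (M X Y : KT) : KT :=
  (ch (tw 3) - 1) * M * dual (Y - M) + (ch (tw 3) - 1) * dual M * X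

variable (κ l d) in
/-- The self-dual correction on the side of `Θ₊`. -/
noncomputable def plusCorrection (M : KT) : KT :=
  M * (geom (κ + 2) * ch (-((l + 1 + d) • tw 3))
    + (1 - ch (-((l + 1) • tw 3))) * (ch (tw 3) * (geom (κ + 1) - 1) - ch (-tw 2) * geom (κ + 1)))

variable (κ l d) in
/-- The self-dual correction on the side of `Θ₋`. -/
noncomputable def minusCorrection (M : KT) : KT :=
  M * (geom (κ + 2) * ch (-((l + 1 + d) • tw 3))
    - (1 - ch (-((l + 1) • tw 3))) * (ch (-tw 2) * geom (κ + 1)))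

theorem dual_dual (V : KT) : dual (dual V) = V := by
  rw [dual, dual]
  apply AddMonoidAlgebra.ext
  rw [AddMonoidAlgebra.coeff_mapDomain, AddMonoidAlgebra.coeff_mapDomain, ← Finsupp.mapDomain_comp]
  have : ((fun w : Wt => -w) ∘ fun w => -w) = id := by ext w; simp
  rw [this, Finsupp.mapDomain_id]

theorem dual_chSum_plusSet : (1 - ch (-tw 3)) * dual (chSum (plusSet κ l d))
    = (ch (-((l + 1) • tw 3)) - ch (-((l + 1 + d) • tw 3))) * geom (κ + 2)
      + (1 - ch (-((l + 1) • tw 3))) * (ch (-tw 1) + ch (-tw 2)) * geom (κ + 1) := by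
  have := congrArg dual (chSum_plusSet (κ := κ) (l := l) (d := d))
  simpa only [dual_mul, dual_add, dual_sub, dual_one, dual_ch, dual_dual] using this

theorem dual_chSum_minusSet : (1 - ch (-tw 3)) * dual (chSum (minusSet κ l))
    = (1 - ch (-((l + 1) • tw 3))) * (geom (κ + 1) - 1) := by
  have := congrArg dual (chSum_minusSet (κ := κ) (l := l))
  simpa only [dual_mul, dual_add, dual_sub, dual_one, dual_ch, dual_dual] using this

/-- The term added on the left is the insertion at m = (l+1+d)λ₃. Dualising a term changes its Euler
class by a sign only, so the terms in M^∨ may be traded for terms in M; after that the linear part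
is the pairing of M with the duals of X and Y. -/
theorem moving_eq_plus (M : KT) :
    moving κ l M + dual M * dual (geom (κ + 2)) * ch ((l + 1 + d) • tw 3)
      = plusTangent M (chSum (plusSet κ l d)) (chSum (minusSet κ l))
        + (dual (plusCorrection κ l d M) - plusCorrection κ l d M) := by
  have hX := dual_chSum_plusSet (κ := κ) (l := l) (d := d)
  have hY := dual_chSum_minusSet (κ := κ) (l := l)
  have h3 := ch_mul_ch_neg (tw 3)
  simp only [plusTangent, plusCorrection, moving, dual_mul, dual_add, dual_sub, dual_one, dual_ch, neg_neg]
  linear_combination M * hX - ch (tw 3) * M * hY - M * dual (chSum (minusSet κ l)) * h3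

/-- The same function of M, organised for the other side of the wall: subsets of Y now take the
place of subsets of X, and the tangent character appears dualised. -/
theorem moving_eq_minus (M : KT) :
    moving κ l M + dual M * dual (geom (κ + 2)) * ch ((l + 1 + d) • tw 3)
      = dual (minusTangent M (chSum (plusSet κ l d)) (chSum (minusSet κ l)))
        + (dual (minusCorrection κ l d M) - minusCorrection κ l d M) := by
  have hX := dual_chSum_plusSet (κ := κ) (l := l) (d := d)
  have hY := chSum_minusSet (κ := κ) (l := l)
  have h3 := ch_mul_ch_neg (tw 3)
  simp only [minusTangent, minusCorrection, moving, dual_mul, dual_add, dual_sub, dual_one, dual_ch, neg_neg,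
    dual_dual]
  linear_combination M * hX - ch (-tw 3) * dual M * hY - dual M * chSum (minusSet κ l) * h3

end PervConifold

/-! ### Evaluation of the Euler classes -/

namespace PervConifold

variable {κ l d : ℕ}

/-- The multiplicity of the trivial character. -/
noncomputable def coeffZero : KT →+ ℤ where
  toFun V := V.coeff 0
  map_zero' := by simp
  map_add' V W := by rw [AddMonoidAlgebra.coeff_add, Finsupp.add_apply]

theorem coeffZero_ch {w : Wt} (h : w ≠ 0) : coeffZero (ch w) = 0 := by
  show (ch w).coeff 0 = 0
  rw [coeff_ch, if_neg h]

theorem coeffZero_dual (V : KT) : coeffZero (dual V) = coeffZero V := by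
  show (dual V).coeff 0 = V.coeff 0
  rw [dual, AddMonoidAlgebra.coeff_mapDomain]
  exact (congrArg _ neg_zero.symm).trans (Finsupp.mapDomain_apply neg_injective V.coeff (0 : Wt))

theorem mul_chSum_mul_dual (a : Wt) (I J : Finset Wt) : (ch a - 1) * chSum I * dual (chSum J)
    = ∑ i ∈ I, ∑ j ∈ J, (ch (i - j + a) - ch (i - j)) := by
  rw [dual_chSum, mul_assoc, chSum, Finset.sum_mul_sum, Finset.mul_sum]
  refine Finset.sum_congr rfl fun i _ => ?_
  rw [Finset.mul_sum]
  refine Finset.sum_congr rfl fun j _ => ?_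
  rw [ch_add, sub_eq_add_neg i j, ch_add]
  ring

theorem chSum_mul_geom_mul (I : Finset Wt) (n : ℕ) (u : Wt) : chSum I * (geom n * ch u)
    = ∑ w ∈ I, ∑ j ∈ Finset.range n, ch (w + j • tw 0 + u) := by
  rw [chSum, geom, Finset.sum_mul]
  refine Finset.sum_congr rfl fun w _ => ?_
  rw [Finset.sum_mul, Finset.mul_sum]
  refine Finset.sum_congr rfl fun j _ => ?_
  rw [ch_add, ch_add, mul_assoc]

theorem chSum_sub {I X : Finset Wt} (h : I ⊆ X) : chSum X - chSum I = chSum (X \ I) := by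
  rw [chSum, chSum, chSum, ← Finset.sum_sdiff h, add_sub_cancel_right]

/-- All the characters in the difference of `I` and `J`, shifted by `a` or not, are nontrivial. -/
def Separated (a : Wt) (I J : Finset Wt) : Prop := ∀ i ∈ I, ∀ j ∈ J, i - j + a ≠ 0 ∧ i - j ≠ 0

theorem Separated.coeffZero_eq {a : Wt} {I J : Finset Wt} (h : Separated a I J) :
    coeffZero ((ch a - 1) * chSum I * dual (chSum J)) = 0 := by
  rw [mul_chSum_mul_dual, map_sum]
  refine Finset.sum_eq_zero fun i hi => ?_
  rw [map_sum]
  refine Finset.sum_eq_zero fun j hj => ?_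
  rw [map_sub, coeffZero_ch (h i hi j hj).1, coeffZero_ch (h i hi j hj).2, sub_zero]

theorem Separated.linUnit_eq {a : Wt} {I J : Finset Wt} (h : Separated a I J) :
    (multClass linUnit ((ch a - 1) * chSum I * dual (chSum J)) : Lam)
      = ∏ i ∈ I, ∏ j ∈ J, (lin i - lin j + lin a) / (lin i - lin j) := by
  rw [mul_chSum_mul_dual, multClass_sum, Units.coe_prod]
  refine Finset.prod_congr rfl fun i hi => ?_
  rw [multClass_sum, Units.coe_prod]
  refine Finset.prod_congr rfl fun j hj => ?_
  rw [multClass_sub, multClass_ch, multClass_ch, Units.val_div_eq_div_val,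
    linUnit_val (h i hi j hj).1, linUnit_val (h i hi j hj).2, lin_add, lin_sub]

theorem Separated.signUnit_eq {a : Wt} {I J : Finset Wt} (h : Separated a I J) :
    multClass signUnit ((ch a - 1) * chSum I * dual (chSum J)) = 1 := by
  rw [mul_chSum_mul_dual, multClass_sum]
  refine Finset.prod_eq_one fun i hi => ?_
  rw [multClass_sum]
  refine Finset.prod_eq_one fun j hj => ?_
  rw [multClass_sub, multClass_ch, multClass_ch, signUnit, signUnit, if_neg (h i hi j hj).1,
    if_neg (h i hi j hj).2, div_self']

/-- Each nontrivial character is divided out against its inverse and leaves -1. The trivial one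
leaves 1, which is why its occurrences in V matter for the sign. -/
theorem multClass_dual_sub (V : KT) : multClass linUnit (dual V - V) = multClass signUnit V := by
  rw [multClass_sub, multClass_linUnit_dual, mul_div_cancel_right]

theorem multClass_signUnit_chSum_mul_geom {I : Finset Wt} {n : ℕ} {u : Wt}
    (h : ∀ w ∈ I, ∀ j < n, w + j • tw 0 + u ≠ 0) :
    multClass signUnit (chSum I * (geom n * ch u)) = (-1) ^ (n * I.card) := by
  rw [chSum_mul_geom_mul, multClass_sum, pow_mul, ← Finset.prod_const]
  refine Finset.prod_congr rfl fun w hw => ?_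
  rw [multClass_sum, ← Finset.card_range n, ← Finset.prod_const, Finset.card_range]
  refine Finset.prod_congr rfl fun j hj => ?_
  rw [multClass_ch, signUnit, if_neg (h w hw j (Finset.mem_range.1 hj))]

/-- The number of `t₂`-strings that meet `I`. -/
def stringCount (κ : ℕ) (I : Finset Wt) : ℕ := ((Finset.range (κ + 1)).filter fun j => αWt 1 j ∈ I).card

/-- A pair (w, j) contributes -1 unless w + j·t₀ = t₂, that is, unless w is the head of a t₂-string.
These exceptional pairs are the origin of the sign rule. -/
theorem multClass_signUnit_string (I : Finset Wt) :
    multClass signUnit (chSum I * (geom (κ + 1) * ch (-tw 2)))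
      = (-1) ^ ((κ + 1) * I.card + stringCount κ I) := by
  have key : ∀ (w : Wt) (j : ℕ), signUnit (w + j • tw 0 + -tw 2)
      = (-1) * if αWt 1 j = w then -1 else 1 := fun w j => by
    have hα := αWt_eq 1 j
    simp only [Matrix.cons_val_one, Matrix.cons_val_zero] at hα
    have : w + j • tw 0 + -tw 2 = 0 ↔ αWt 1 j = w := by
      rw [← hα]
      constructor
      · intro h
        have : w - αWt 1 j = 0 := by rw [← h]; abel
        exact (sub_eq_zero.1 this).symm
      · rintro rfl; abel
    rw [signUnit]
    by_cases h : αWt 1 j = w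
    · rw [if_pos (this.2 h), if_pos h]; simp
    · rw [if_neg (mt this.1 h), if_neg h, mul_one]
  rw [chSum_mul_geom_mul, multClass_sum]
  simp only [multClass_sum, multClass_ch, key, Finset.prod_mul_distrib, Finset.prod_const,
    Finset.card_range]
  rw [Finset.prod_comm, pow_add _ (_ * _), pow_mul]
  congr 1
  simp only [Finset.prod_ite_eq]
  rw [Finset.prod_ite, Finset.prod_const_one, mul_one, Finset.prod_const, stringCount]

/-- The denominators of the Euler classes. -/
noncomputable def insertion (κ : ℕ) (I : Finset Wt) (T : Lam) : Lam :=
  ∏ w ∈ I, ∏ j ∈ Finset.range (κ + 2), (T - lin w - j * lin (tw 0))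

theorem dual_chSum_mul_geom_mul (I : Finset Wt) (s : ℕ) :
    dual (chSum I) * dual (geom (κ + 2)) * ch (s • tw 3)
      = ∑ w ∈ I, ∑ j ∈ Finset.range (κ + 2), ch (-(w + j • tw 0 + -(s • tw 3))) := by
  have := congrArg dual (chSum_mul_geom_mul I (κ + 2) (-(s • tw 3)))
  simpa only [dual_mul, dual_sum, dual_ch, neg_neg, mul_assoc] using this

theorem linUnit_insertion {I : Finset Wt} {s : ℕ}
    (h : ∀ w ∈ I, ∀ j < κ + 2, w + j • tw 0 + -(s • tw 3) ≠ 0) :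
    (multClass linUnit (dual (chSum I) * dual (geom (κ + 2)) * ch (s • tw 3)) : Lam)
      = insertion κ I (s * lam3) := by
  rw [dual_chSum_mul_geom_mul, multClass_sum, Units.coe_prod, insertion]
  refine Finset.prod_congr rfl fun w hw => ?_
  rw [multClass_sum, Units.coe_prod]
  refine Finset.prod_congr rfl fun j hj => ?_
  rw [multClass_ch, linUnit_val (neg_ne_zero.2 (h w hw j (Finset.mem_range.1 hj))), lin_neg, lin_add,
    lin_add, lin_neg, lin_nsmul, lin_nsmul, lam3]
  ring

theorem coeffZero_insertion {I : Finset Wt} {s : ℕ}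
    (h : ∀ w ∈ I, ∀ j < κ + 2, w + j • tw 0 + -(s • tw 3) ≠ 0) :
    coeffZero (dual (chSum I) * dual (geom (κ + 2)) * ch (s • tw 3)) = 0 := by
  rw [dual_chSum_mul_geom_mul, map_sum]
  refine Finset.sum_eq_zero fun w hw => ?_
  rw [map_sum]
  exact Finset.sum_eq_zero fun j hj => coeffZero_ch (neg_ne_zero.2 (h w hw j (Finset.mem_range.1 hj)))

theorem shift_apply (w : Wt) (j s : ℕ) (i : Fin 3) :
    (w + j • tw 0 + -(s • tw 3)) i = w i + (j : ℤ) * tw 0 i + s := by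
  have h3 : tw 3 i = -1 := by fin_cases i <;> rfl
  rw [Pi.add_apply, Pi.add_apply, Pi.neg_apply, Pi.smul_apply, Pi.smul_apply, h3, nsmul_eq_mul, nsmul_eq_mul]
  ring

theorem ne_zero_of_apply {w : Wt} (i : Fin 3) (h : w i ≠ 0) : w ≠ 0 := fun e => h (by rw [e]; rfl)

theorem insertion_shift_ne_zero_of_plus {w : Wt} (h : w ∈ plusSet κ l d) (j : ℕ) :
    w + j • tw 0 + -((l + 1 + d) • tw 3) ≠ 0 := by
  refine ne_zero_of_apply 1 ?_
  have := (mem_plusSet.1 h).2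
  rw [shift_apply]
  simp [tw]
  omega

theorem insertion_shift_ne_zero_of_minus {w : Wt} (h : w ∈ minusSet κ l) (j : ℕ) :
    w + j • tw 0 + -((l + 1 + d) • tw 3) ≠ 0 := by
  refine ne_zero_of_apply 1 ?_
  have := mem_minusSet.1 h
  rw [MinusChain] at this
  rw [shift_apply]
  simp [tw]
  omega

theorem tw_apply : (tw 0 0 = 1 ∧ tw 0 1 = 0 ∧ tw 0 2 = 0) ∧ (tw 2 0 = 0 ∧ tw 2 1 = 0 ∧ tw 2 2 = 1) ∧
    ∀ i, tw 3 i = -1 :=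
  ⟨⟨rfl, rfl, rfl⟩, ⟨rfl, rfl, rfl⟩, fun i => by fin_cases i <;> rfl⟩

theorem nsmul_tw_apply (n : ℕ) : ((n • tw 0) 0 = n ∧ (n • tw 0) 1 = 0 ∧ (n • tw 0) 2 = 0) ∧
    ∀ i, (n • tw 3) i = -n := by
  refine ⟨⟨?_, ?_, ?_⟩, fun i => ?_⟩
  all_goals rw [Pi.smul_apply, nsmul_eq_mul]; simp [tw_apply]

theorem neg_one_pow_mul_self {G : Type*} [Group G] [HasDistribNeg G] (n : ℕ) :
    (-1 : G) ^ n * (-1) ^ n = 1 := by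
  rw [← pow_add, ← two_mul, pow_mul, neg_one_sq, one_pow]

/-- The terms come in pairs that differ by a shift by t₃^(-(l+1)) and have equal signs, except that
the string term meets trivial characters and its shift does not. What remains is the insertion term,
giving (κ+2)|I|, and `stringCount`. -/
theorem signUnit_plusCorrection {I : Finset Wt} (hI : I ⊆ plusSet κ l d) :
    multClass signUnit (plusCorrection κ l d (chSum I)) = (-1) ^ ((κ + 2) * I.card + stringCount κ I) := by
  have e : plusCorrection κ l d (chSum I) = chSum I * (geom (κ + 2) * ch (-((l + 1 + d) • tw 3)))
      + chSum I * (geom κ * ch (tw 0 + tw 3)) - chSum I * (geom κ * ch (tw 0 + tw 3 + -((l + 1) • tw 3)))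
      - chSum I * (geom (κ + 1) * ch (-tw 2))
      + chSum I * (geom (κ + 1) * ch (-tw 2 + -((l + 1) • tw 3))) := by
    have := geom_succ κ
    rw [plusCorrection, ch_add _ (-((l + 1) • tw 3)), ch_add, ch_add]
    linear_combination chSum I * (1 - ch (-((l + 1) • tw 3))) * ch (tw 3) * this
  have hc : ∀ w ∈ I, PlusChain κ l w := fun w hw => (mem_plusSet.1 (hI hw)).1
  rw [e, multClass_add, multClass_sub, multClass_sub, multClass_add,
    multClass_signUnit_chSum_mul_geom fun w hw j _ => insertion_shift_ne_zero_of_plus (hI hw) j,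
    multClass_signUnit_chSum_mul_geom (u := tw 0 + tw 3), multClass_signUnit_chSum_mul_geom,
    multClass_signUnit_string, multClass_signUnit_chSum_mul_geom]
  · rw [mul_div_cancel_right, div_mul_eq_mul_div, div_eq_iff_eq_mul, pow_add, pow_add, mul_assoc]
    congr 1
    rw [mul_left_comm, neg_one_pow_mul_self, mul_one]
  all_goals
    intro w hw j hj h
    have hch := hc w hw
    have h0 := congrFun h 0
    have h1 := congrFun h 1
    have h2 := congrFun h 2
    simp only [Pi.add_apply, Pi.neg_apply, nsmul_tw_apply, tw_apply, Pi.zero_apply] at h0 h1 h2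
    rw [PlusChain] at hch
    push_cast at h0 h1 h2
    omega

/-- Weights of `MinusChain` satisfy w₁ = w₂ and are never heads of t₂-strings, so both string terms
have the same sign; this is why sign(F) = 0 for Θ₋. -/
theorem signUnit_minusCorrection {J : Finset Wt} (hJ : J ⊆ minusSet κ l) :
    multClass signUnit (minusCorrection κ l d (chSum J)) = (-1) ^ ((κ + 2) * J.card) := by
  have e : minusCorrection κ l d (chSum J) = chSum J * (geom (κ + 2) * ch (-((l + 1 + d) • tw 3)))
      - chSum J * (geom (κ + 1) * ch (-tw 2))
      + chSum J * (geom (κ + 1) * ch (-tw 2 + -((l + 1) • tw 3))) := by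
    rw [minusCorrection, ch_add]
    ring
  have hc : ∀ w ∈ J, MinusChain κ l w := fun w hw => mem_minusSet.1 (hJ hw)
  rw [e, multClass_add, multClass_sub,
    multClass_signUnit_chSum_mul_geom fun w hw j _ => insertion_shift_ne_zero_of_minus (hJ hw) j,
    multClass_signUnit_chSum_mul_geom (u := -tw 2), multClass_signUnit_chSum_mul_geom, div_mul_cancel]
  all_goals
    intro w hw j hj h
    have hch := hc w hw
    have h0 := congrFun h 0
    have h1 := congrFun h 1
    have h2 := congrFun h 2
    simp only [Pi.add_apply, Pi.neg_apply, nsmul_tw_apply, tw_apply, Pi.zero_apply] at h0 h1 h2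
    rw [MinusChain] at hch
    push_cast at h0 h1 h2
    omega

end PervConifold

/-! ### The Cauchy–Vandermonde determinant and a type A Euler transformation -/

namespace SourceIdentity

open Finset Polynomial

section CauchyVandermonde

variable {K : Type*} [Field K] {p q : ℕ}

/-- The matrix with columns `1 / (x - y_k)`, `k < p`, and `x ^ j`, `j < q`. -/
def cauchyVandermonde (x : Fin p ⊕ Fin q → K) (y : Fin p → K) :
    Matrix (Fin p ⊕ Fin q) (Fin p ⊕ Fin q) K :=
  Matrix.of fun i => Sum.elim (fun k => (x i - y k)⁻¹) (fun j => x i ^ (j : ℕ))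

/-- The Cauchy–Vandermonde columns after multiplication by `∏ (X - y_k)`. -/
noncomputable def columnPoly (y : Fin p → K) : Fin p ⊕ Fin q → K[X] :=
  Sum.elim (fun k => ∏ k' ∈ {k}ᶜ, (X - C (y k'))) (fun j => X ^ (j : ℕ) * ∏ k, (X - C (y k)))

theorem natDegree_columnPoly_lt (y : Fin p → K) (c : Fin p ⊕ Fin q) :
    (columnPoly y c).natDegree < p + q := by
  rcases c with k | j
  · have hk := k.isLt
    simp only [columnPoly, Sum.elim_inl, natDegree_finsetProd_X_sub_C_eq_card, card_compl,
      card_singleton, Fintype.card_fin]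
    omega
  · have hj := j.isLt
    have : (columnPoly y (Sum.inr j)).natDegree = j + p := by
      simp only [columnPoly, Sum.elim_inr]
      rw [Monic.natDegree_mul (monic_X_pow _) (monic_prod_of_monic _ _ fun k _ => monic_X_sub_C _),
        natDegree_X_pow, natDegree_finsetProd_X_sub_C_eq_card]
      simp
    omega

/-- The coefficients of the column polynomials. -/
noncomputable def columnCoeff (y : Fin p → K) : Matrix (Fin p ⊕ Fin q) (Fin p ⊕ Fin q) K :=
  Matrix.of fun d c => (columnPoly y c).coeff (finSumFinEquiv d)

/-- The columns are polynomials of degree below p + q, so evaluating them at the nodes is a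
Vandermonde matrix times the matrix of coefficients. -/
theorem det_eval_columnPoly (x : Fin p ⊕ Fin q → K) (y : Fin p → K) :
    (Matrix.of fun i c => (columnPoly y c).eval (x i) : Matrix (Fin p ⊕ Fin q) _ K).det
      = (∏ i, ∏ j > i, (x (finSumFinEquiv.symm j) - x (finSumFinEquiv.symm i)))
        * (columnCoeff (q := q) y).det := by
  have h : (Matrix.of fun i c => (columnPoly y c).eval (x i) : Matrix (Fin p ⊕ Fin q) _ K)
      = (Matrix.reindex finSumFinEquiv.symm finSumFinEquiv.symm
          (Matrix.vandermonde (x ∘ finSumFinEquiv.symm))) * columnCoeff y := by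
    ext i c
    rw [Matrix.mul_apply, Matrix.of_apply,
      eval_eq_sum_range' (natDegree_columnPoly_lt y c), ← Fin.sum_univ_eq_sum_range
        (fun d => (columnPoly y c).coeff d * x i ^ d), ← finSumFinEquiv.sum_comp]
    refine Finset.sum_congr rfl fun d _ => ?_
    simp [columnCoeff, Matrix.vandermonde_apply, mul_comm]
  rw [h, Matrix.det_mul, Matrix.det_reindex_self, Matrix.det_vandermonde]
  rfl

/-- Block triangular: the Cauchy columns have degree below p, and X^j ∏(X - y_k) is monic of degree
p + j. The remaining block times the Vandermonde matrix of y is diagonal, as in Lagrange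
interpolation. If two y_k coincide, two columns do, and both sides vanish. -/
theorem det_columnCoeff (y : Fin p → K) :
    (columnCoeff (q := q) y).det = ∏ i, ∏ j > i, (y i - y j) := by
  have hblock : columnCoeff (q := q) y = Matrix.fromBlocks
      (Matrix.of fun (d k : Fin p) => (columnPoly (q := q) y (Sum.inl k)).coeff d)
      (Matrix.of fun (d : Fin p) (j : Fin q) => (columnPoly y (Sum.inr j)).coeff d) 0
      (Matrix.of fun (d j : Fin q) => (columnPoly y (Sum.inr j)).coeff (p + d)) := by
    ext (d | d) (k | j)
    · simp [columnCoeff]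
    · simp [columnCoeff]
    · simp only [columnCoeff, Matrix.of_apply, Matrix.fromBlocks_apply₂₁, Matrix.zero_apply]
      apply coeff_eq_zero_of_natDegree_lt
      have hk := k.isLt
      simp only [columnPoly, Sum.elim_inl, natDegree_finsetProd_X_sub_C_eq_card, card_compl,
        card_singleton, Fintype.card_fin, finSumFinEquiv_apply_right, Fin.val_natAdd]
      omega
    · simp [columnCoeff]
  have hmonic : (∏ k, (X - C (y k))).Monic := monic_prod_of_monic _ _ fun k _ => monic_X_sub_C _
  have hdeg : (∏ k, (X - C (y k))).natDegree = p := by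
    rw [natDegree_finsetProd_X_sub_C_eq_card]; simp
  have h22 : (Matrix.of fun (d j : Fin q) => (columnPoly y (Sum.inr j)).coeff (p + d)).det = 1 := by
    rw [Matrix.det_of_isUpperTriangular]
    · refine Finset.prod_eq_one fun j _ => ?_
      simp only [Matrix.of_apply, columnPoly, Sum.elim_inr]
      rw [add_comm, mul_comm, add_comm, coeff_mul_X_pow]
      have := hmonic.coeff_natDegree
      rwa [hdeg] at this
    · intro d j hdj
      simp only [Matrix.of_apply, columnPoly, Sum.elim_inr]
      have hdj' : (j : ℕ) < d := hdj
      have hd : p + (d : ℕ) = (p + (d - j)) + j := by omega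
      rw [mul_comm, hd, coeff_mul_X_pow]
      apply coeff_eq_zero_of_natDegree_lt
      omega
  rw [hblock, Matrix.det_fromBlocks_zero₂₁, h22, mul_one]
  by_cases hy : Function.Injective y
  · have hV : (Matrix.vandermonde y).det ≠ 0 := Matrix.det_vandermonde_ne_zero_iff.2 hy
    have hmul : Matrix.vandermonde y
        * (Matrix.of fun (d k : Fin p) => (columnPoly (q := q) y (Sum.inl k)).coeff d)
        = Matrix.diagonal fun k => ∏ k' ∈ {k}ᶜ, (y k - y k') := by
      ext i k
      have hlt : (columnPoly (q := q) y (Sum.inl k)).natDegree < p := by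
        have hk := k.isLt
        simp only [columnPoly, Sum.elim_inl, natDegree_finsetProd_X_sub_C_eq_card, card_compl,
          card_singleton, Fintype.card_fin]
        omega
      have : ∑ d : Fin p, y i ^ (d : ℕ) * (columnPoly (q := q) y (Sum.inl k)).coeff d
          = (columnPoly (q := q) y (Sum.inl k)).eval (y i) := by
        rw [eval_eq_sum_range' hlt, ← Fin.sum_univ_eq_sum_range
          (fun d => (columnPoly (q := q) y (Sum.inl k)).coeff d * y i ^ d)]
        exact Finset.sum_congr rfl fun d _ => mul_comm _ _
      rw [Matrix.mul_apply]
      simp only [Matrix.vandermonde_apply, Matrix.of_apply]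
      rw [this]
      simp only [columnPoly, Sum.elim_inl, eval_prod, eval_sub, eval_X, eval_C]
      by_cases hik : i = k
      · subst hik; simp
      · rw [Matrix.diagonal_apply_ne _ hik]
        exact Finset.prod_eq_zero (i := i) (by simpa using hik) (sub_self _)
    have hdet := congrArg Matrix.det hmul
    rw [Matrix.det_mul, Matrix.det_diagonal,
      ← prod_prod_Ioi_mul_eq_prod_prod_off_diag (fun j i => y i - y j)] at hdet
    simp only [Finset.prod_mul_distrib] at hdet
    rw [Matrix.det_vandermonde] at hdet hV
    exact mul_left_cancel₀ hV (by rw [hdet, mul_comm])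
  · obtain ⟨a, b, hab, hne⟩ : ∃ a b, y a = y b ∧ a ≠ b := by
      simpa [Function.Injective] using hy
    rw [Matrix.det_zero_of_column_eq hne]
    · symm
      rcases lt_or_gt_of_ne hne with h | h
      · exact Finset.prod_eq_zero (mem_univ a)
          (Finset.prod_eq_zero (i := b) (by simpa using h) (by rw [hab, sub_self]))
      · exact Finset.prod_eq_zero (mem_univ b)
          (Finset.prod_eq_zero (i := a) (by simpa using h) (by rw [hab, sub_self]))
    · intro d
      simp only [Matrix.of_apply, columnPoly, Sum.elim_inl]
      congr 1
      have h1 := Finset.mul_prod_erase univ (fun k => X - C (y k)) (mem_univ a)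
      have h2 := Finset.mul_prod_erase univ (fun k => X - C (y k)) (mem_univ b)
      rw [← compl_singleton] at h1 h2
      rw [← h2, hab] at h1
      exact mul_left_cancel₀ (X_sub_C_ne_zero _) h1

theorem det_cauchyVandermonde (x : Fin p ⊕ Fin q → K) (y : Fin p → K) (hxy : ∀ i k, x i ≠ y k) :
    (cauchyVandermonde x y).det * ∏ i, ∏ k, (x i - y k)
      = (∏ i, ∏ j > i, (x (finSumFinEquiv.symm j) - x (finSumFinEquiv.symm i)))
        * ∏ i, ∏ j > i, (y i - y j) := by
  rw [← det_columnCoeff (q := q) y, ← det_eval_columnPoly, mul_comm, ← Matrix.det_mul_column]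
  congr 1
  ext i c
  rcases c with k | j
  · simp only [cauchyVandermonde, columnPoly, Matrix.of_apply, Sum.elim_inl, eval_prod, eval_sub,
      eval_X, eval_C]
    rw [← Finset.mul_prod_erase univ _ (mem_univ k), ← compl_singleton]
    field_simp [sub_ne_zero.2 (hxy i k)]
  · simp [cauchyVandermonde, columnPoly, eval_prod, mul_comm]

/-- Only pairs with exactly one member in I contribute, and by symmetry each such pair may be listed
with its member of I first. -/
theorem prod_Ioi_eq_prod_prod_compl {α M : Type*} [CommMonoid M] [LinearOrder α] [Fintype α]
    [LocallyFiniteOrderTop α] [LocallyFiniteOrderBot α] (I : Finset α) (s : α → α → M)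
    (hs : ∀ i j, s i j = s j i) (h1 : ∀ i j, i ≠ j → (i ∈ I ↔ j ∈ I) → s i j = 1) :
    ∏ i, ∏ j > i, s i j = ∏ i ∈ I, ∏ j ∈ Iᶜ, s i j := by
  classical
  have key := prod_prod_Ioi_mul_eq_prod_prod_off_diag
    (fun j i => if i ∈ I ∧ j ∉ I then s i j else 1)
  have hL : ∀ i, ∀ j ∈ Ioi i, ((if i ∈ I ∧ j ∉ I then s i j else 1)
      * (if j ∈ I ∧ i ∉ I then s j i else 1)) = s i j := by
    intro i j hj
    have hij : i ≠ j := (mem_Ioi.1 hj).ne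
    by_cases hi : i ∈ I <;> by_cases hj : j ∈ I
    · simp [hi, hj, h1 i j hij]
    · simp [hi, hj]
    · simp [hi, hj, hs i j]
    · simp [hi, hj, h1 i j hij]
  rw [Finset.prod_congr rfl fun i _ => Finset.prod_congr rfl (hL i)] at key
  rw [key, ← Finset.prod_subset (Finset.subset_univ I)]
  · refine Finset.prod_congr rfl fun i hi => ?_
    rw [← Finset.prod_subset (s₁ := Iᶜ) (s₂ := {i}ᶜ)]
    · exact Finset.prod_congr rfl fun j hj => by simp [hi, mem_compl.1 hj]
    · intro j hj
      simp only [mem_compl, mem_singleton] at hj ⊢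
      rintro rfl; exact hj hi
    · intro j _ hj
      simp only [mem_compl, not_not] at hj
      simp [hj]
  · intro i _ hi
    exact Finset.prod_eq_one fun j _ => by simp [hi]

theorem det_cauchyVandermonde_ne_zero {x : Fin p ⊕ Fin q → K} {y : Fin p → K}
    (hx : Function.Injective x) (hy : Function.Injective y) (hxy : ∀ i k, x i ≠ y k) :
    (cauchyVandermonde x y).det ≠ 0 := by
  intro h
  have := det_cauchyVandermonde x y hxy
  rw [h, zero_mul, eq_comm, mul_eq_zero, Finset.prod_eq_zero_iff, Finset.prod_eq_zero_iff] at this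
  rcases this with ⟨i, _, hi⟩ | ⟨i, _, hi⟩
  · obtain ⟨j, hj, h0⟩ := Finset.prod_eq_zero_iff.1 hi
    exact (mem_Ioi.1 hj).ne' (by simpa using hx (sub_eq_zero.1 h0))
  · obtain ⟨j, hj, h0⟩ := Finset.prod_eq_zero_iff.1 hi
    exact (mem_Ioi.1 hj).ne (hy (sub_eq_zero.1 h0))

/-- In the product formula a simultaneous shift preserves differences inside I and inside its
complement. Only the mixed differences, and the differences from the y_k, change. -/
theorem det_cauchyVandermonde_shift_left {x : Fin p ⊕ Fin q → K} {y : Fin p → K} (lam : K)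
    (hx : Function.Injective x) (hxy : ∀ i k, x i ≠ y k) (hxy' : ∀ i k, x i - lam ≠ y k)
    (I : Finset (Fin p ⊕ Fin q)) :
    (cauchyVandermonde (I.piecewise (fun i => x i - lam) x) y).det
      = (∏ i ∈ I, ((∏ j ∈ Iᶜ, (x i - x j - lam) / (x i - x j))
          * ∏ k, (x i - y k) / (x i - y k - lam))) * (cauchyVandermonde x y).det := by
  classical
  set x' := I.piecewise (fun i => x i - lam) x with hx'
  have hx'y : ∀ i k, x' i ≠ y k := by
    intro i k
    by_cases hi : i ∈ I <;> simp [hx', hi, hxy, hxy']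
  have h1 := det_cauchyVandermonde x y hxy
  have h2 := det_cauchyVandermonde x' y hx'y
  set e := (finSumFinEquiv (m := p) (n := q)).symm with he
  have hratio : (∏ i, ∏ j > i, (x' (e j) - x' (e i)))
      = (∏ i ∈ I, ∏ j ∈ Iᶜ, (x i - x j - lam) / (x i - x j))
        * ∏ i, ∏ j > i, (x (e j) - x (e i)) := by
    have h := prod_Ioi_eq_prod_prod_compl (I.map e.symm.toEmbedding)
      (fun i j => (x' (e j) - x' (e i)) / (x (e j) - x (e i)))
      (fun i j => by rw [← neg_div_neg_eq, neg_sub, neg_sub]) (fun i j hij hI => by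
        have hne : x (e j) - x (e i) ≠ 0 := sub_ne_zero.2 fun h => hij (e.injective (hx h)).symm
        rw [div_eq_one_iff_eq hne]
        simp only [mem_map_equiv, Equiv.symm_symm] at hI
        by_cases hi : e i ∈ I
        · simp [hx', hi, hI.1 hi]
        · simp [hx', hi, show e j ∉ I from fun h => hi (hI.2 h)])
    rw [Finset.prod_map] at h
    have hc : ∀ i : Fin p ⊕ Fin q, i ∈ I →
        ∏ j ∈ (I.map e.symm.toEmbedding)ᶜ, (x' (e j) - x' (e (e.symm i))) / (x (e j) - x (e (e.symm i)))
          = ∏ j ∈ Iᶜ, (x i - x j - lam) / (x i - x j) := by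
      intro i hi
      have hm : (I.map e.symm.toEmbedding)ᶜ = Iᶜ.map e.symm.toEmbedding := by
        ext j; simp
      rw [hm, Finset.prod_map]
      refine Finset.prod_congr rfl fun j hj => ?_
      have hj' : j ∉ I := mem_compl.1 hj
      simp only [Equiv.coe_toEmbedding, Equiv.apply_symm_apply]
      rw [← neg_div_neg_eq]
      simp only [hx', piecewise_eq_of_mem _ _ _ hi, piecewise_eq_of_notMem _ _ _ hj']
      congr 1 <;> ring
    rw [← Finset.prod_congr rfl hc]
    simp only [Equiv.coe_toEmbedding] at h
    rw [← h, ← Finset.prod_mul_distrib]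
    refine Finset.prod_congr rfl fun i _ => ?_
    rw [← Finset.prod_mul_distrib]
    refine Finset.prod_congr rfl fun j hj => ?_
    rw [div_mul_cancel₀]
    exact sub_ne_zero.2 fun h => (mem_Ioi.1 hj).ne' (e.injective (hx h))
  have hP : (∏ i, ∏ k, (x i - y k)) ≠ 0 := Finset.prod_ne_zero_iff.2 fun i _ =>
    Finset.prod_ne_zero_iff.2 fun k _ => sub_ne_zero.2 (hxy i k)
  have hP' : (∏ i, ∏ k, (x' i - y k)) ≠ 0 := Finset.prod_ne_zero_iff.2 fun i _ =>
    Finset.prod_ne_zero_iff.2 fun k _ => sub_ne_zero.2 (hx'y i k)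
  have hPP : (∏ i ∈ I, ∏ k, (x i - y k) / (x i - y k - lam)) * (∏ i, ∏ k, (x' i - y k))
      = ∏ i, ∏ k, (x i - y k) := by
    rw [← Finset.prod_mul_prod_compl I, ← Finset.prod_mul_prod_compl I (fun i => ∏ k, (x i - y k)),
      ← mul_assoc, ← Finset.prod_mul_distrib]
    congr 1
    · refine Finset.prod_congr rfl fun i hi => ?_
      rw [← Finset.prod_mul_distrib]
      refine Finset.prod_congr rfl fun k _ => ?_
      simp only [hx', piecewise_eq_of_mem _ _ _ hi]
      have := sub_ne_zero.2 (hxy' i k)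
      rw [show x i - y k - lam = x i - lam - y k by ring, div_mul_cancel₀ _ this]
    · refine Finset.prod_congr rfl fun i hi => ?_
      simp only [hx', piecewise_eq_of_notMem _ _ _ (mem_compl.1 hi)]
  rw [Finset.prod_mul_distrib]
  apply mul_right_cancel₀ hP'
  rw [h2, hratio]
  linear_combination (-(∏ i ∈ I, ∏ j ∈ Iᶜ, (x i - x j - lam) / (x i - x j))) * h1
    - (∏ i ∈ I, ∏ j ∈ Iᶜ, (x i - x j - lam) / (x i - x j)) * (cauchyVandermonde x y).det * hPP

theorem det_cauchyVandermonde_shift_right {x : Fin p ⊕ Fin q → K} {y : Fin p → K} (lam : K)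
    (hy : Function.Injective y) (hxy : ∀ i k, x i ≠ y k) (hxy' : ∀ i k, x i ≠ y k + lam)
    (J : Finset (Fin p)) :
    (cauchyVandermonde x (J.piecewise (fun k => y k + lam) y)).det
      = (∏ k ∈ J, ((∏ k' ∈ Jᶜ, (y k - y k' + lam) / (y k - y k'))
          * ∏ i, (x i - y k) / (x i - y k - lam))) * (cauchyVandermonde x y).det := by
  classical
  set y' := J.piecewise (fun k => y k + lam) y with hy'
  have hxy1 : ∀ i k, x i ≠ y' k := by
    intro i k
    by_cases hk : k ∈ J <;> simp [hy', hk, hxy, hxy']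
  have h1 := det_cauchyVandermonde x y hxy
  have h2 := det_cauchyVandermonde x y' hxy1
  have hratio : (∏ i, ∏ j > i, (y' i - y' j))
      = (∏ k ∈ J, ∏ k' ∈ Jᶜ, (y k - y k' + lam) / (y k - y k')) * ∏ i, ∏ j > i, (y i - y j) := by
    have h := prod_Ioi_eq_prod_prod_compl J
      (fun i j => (y' i - y' j) / (y i - y j))
      (fun i j => by rw [← neg_div_neg_eq, neg_sub, neg_sub]) (fun i j hij hI => by
        have hne : y i - y j ≠ 0 := sub_ne_zero.2 fun h => hij (hy h)
        rw [div_eq_one_iff_eq hne]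
        by_cases hi : i ∈ J
        · simp [hy', hi, hI.1 hi]
        · simp [hy', hi, show j ∉ J from fun h => hi (hI.2 h)])
    have hc : ∀ k ∈ J, ∏ k' ∈ Jᶜ, (y' k - y' k') / (y k - y k')
        = ∏ k' ∈ Jᶜ, (y k - y k' + lam) / (y k - y k') := by
      intro k hk
      refine Finset.prod_congr rfl fun j hj => ?_
      have hj' : j ∉ J := mem_compl.1 hj
      simp only [hy', piecewise_eq_of_mem _ _ _ hk, piecewise_eq_of_notMem _ _ _ hj']
      congr 1; ring
    rw [← Finset.prod_congr rfl hc, ← h, ← Finset.prod_mul_distrib]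
    refine Finset.prod_congr rfl fun i _ => ?_
    rw [← Finset.prod_mul_distrib]
    refine Finset.prod_congr rfl fun j hj => ?_
    rw [div_mul_cancel₀]
    exact sub_ne_zero.2 fun h => (mem_Ioi.1 hj).ne (hy h)
  have hP' : (∏ i, ∏ k, (x i - y' k)) ≠ 0 := Finset.prod_ne_zero_iff.2 fun i _ =>
    Finset.prod_ne_zero_iff.2 fun k _ => sub_ne_zero.2 (hxy1 i k)
  have hPP : (∏ k ∈ J, ∏ i, (x i - y k) / (x i - y k - lam)) * (∏ i, ∏ k, (x i - y' k))
      = ∏ i, ∏ k, (x i - y k) := by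
    rw [Finset.prod_comm (s := univ) (t := univ) (f := fun i k => x i - y' k),
      Finset.prod_comm (s := univ) (t := univ) (f := fun i k => x i - y k),
      ← Finset.prod_mul_prod_compl J, ← Finset.prod_mul_prod_compl J (fun k => ∏ i, (x i - y k)),
      ← mul_assoc, ← Finset.prod_mul_distrib]
    congr 1
    · refine Finset.prod_congr rfl fun k hk => ?_
      rw [← Finset.prod_mul_distrib]
      refine Finset.prod_congr rfl fun i _ => ?_
      simp only [hy', piecewise_eq_of_mem _ _ _ hk]
      have := sub_ne_zero.2 (hxy' i k)
      rw [show x i - y k - lam = x i - (y k + lam) by ring, div_mul_cancel₀ _ this]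
    · refine Finset.prod_congr rfl fun i hi => ?_
      simp only [hy', piecewise_eq_of_notMem _ _ _ (mem_compl.1 hi)]
  rw [Finset.prod_mul_distrib]
  apply mul_right_cancel₀ hP'
  rw [h2, hratio]
  linear_combination (-(∏ k ∈ J, ∏ k' ∈ Jᶜ, (y k - y k' + lam) / (y k - y k'))) * h1
    - (∏ k ∈ J, ∏ k' ∈ Jᶜ, (y k - y k' + lam) / (y k - y k')) * (cauchyVandermonde x y).det * hPP

/-- The Cauchy–Vandermonde matrix with columns replaced by `F(x) - t F(x - lam)`. -/
def shiftedMatrix (x : Fin p ⊕ Fin q → K) (y : Fin p → K) (lam t : K) :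
    Matrix (Fin p ⊕ Fin q) (Fin p ⊕ Fin q) K :=
  cauchyVandermonde x y - t • cauchyVandermonde (fun i => x i - lam) y

theorem det_add_eq_sum {n R : Type*} [Fintype n] [DecidableEq n] [CommRing R]
    (A B : Matrix n n R) : (A + B).det
      = ∑ I : Finset n, (Matrix.of fun i c => if i ∈ I then A i c else B i c).det := by
  refine ((Matrix.detRowAlternating (R := R)).toMultilinearMap.map_add_univ A B).trans ?_
  refine Finset.sum_congr rfl fun I _ => ?_
  refine congrArg Matrix.det ?_
  ext i c
  simp only [Finset.piecewise, Matrix.of_apply]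
  split_ifs <;> rfl

/-- Multilinearity in the rows: I is the set of rows in which the shifted term is chosen. -/
theorem det_shiftedMatrix_rows (x : Fin p ⊕ Fin q → K) (y : Fin p → K) (lam t : K) :
    (shiftedMatrix x y lam t).det = ∑ I : Finset (Fin p ⊕ Fin q), (-t) ^ I.card
      * (cauchyVandermonde (I.piecewise (fun i => x i - lam) x) y).det := by
  classical
  rw [shiftedMatrix, sub_eq_neg_add, det_add_eq_sum]
  refine Finset.sum_congr rfl fun I _ => ?_
  have := Matrix.det_mul_column (fun i => if i ∈ I then -t else 1)
    (cauchyVandermonde (I.piecewise (fun i => x i - lam) x) y)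
  rw [Finset.prod_ite_mem, Finset.univ_inter, Finset.prod_const] at this
  rw [← this]
  congr 1
  ext i c
  by_cases hi : i ∈ I <;> simp [hi, cauchyVandermonde]

/-- Shifting x by -lam in 1/(x - y) amounts to shifting y by lam. On powers, x^j - t(x - lam)^j is a
triangular combination of x^0, …, x^j with leading coefficient 1 - t, so the q power columns give (1
- t)^q and only the Cauchy columns are expanded. -/
theorem det_shiftedMatrix_columns (x : Fin p ⊕ Fin q → K) (y : Fin p → K) (lam t : K) :
    (shiftedMatrix x y lam t).det = (1 - t) ^ q * ∑ J : Finset (Fin p), (-t) ^ J.card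
      * (cauchyVandermonde x (J.piecewise (fun k => y k + lam) y)).det := by
  classical
  set N : Matrix (Fin p ⊕ Fin q) (Fin p ⊕ Fin q) K := Matrix.of fun i => Sum.elim
    (fun k => (x i - y k)⁻¹ - t * (x i - (y k + lam))⁻¹) (fun j => x i ^ (j : ℕ)) with hN
  set U : Matrix (Fin q) (Fin q) K := Matrix.of fun d j =>
    (X ^ (j : ℕ) - C t * (X - C lam) ^ (j : ℕ) : K[X]).coeff d with hU
  have hdeg : ∀ j : Fin q, (X ^ (j : ℕ) - C t * (X - C lam) ^ (j : ℕ) : K[X]).natDegree ≤ j := by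
    intro j
    refine (natDegree_sub_le _ _).trans (max_le (natDegree_X_pow_le _) ?_)
    refine (natDegree_C_mul_le _ _).trans (natDegree_pow_le.trans ?_)
    simp
  have hdetU : U.det = (1 - t) ^ q := by
    rw [Matrix.det_of_isUpperTriangular]
    · have : ∀ j : Fin q, U j j = 1 - t := by
        intro j
        have h1 : ((X - C lam) ^ (j : ℕ) : K[X]).coeff j = 1 := by
          have := ((monic_X_sub_C lam).pow (j : ℕ)).coeff_natDegree
          rwa [natDegree_pow, natDegree_X_sub_C, mul_one] at this
        simp only [hU, Matrix.of_apply, coeff_sub, coeff_X_pow, coeff_C_mul, h1]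
        simp
      simp [this]
    · intro d j hdj
      exact coeff_eq_zero_of_natDegree_lt ((hdeg j).trans_lt hdj)
  have hmul : shiftedMatrix x y lam t = N * Matrix.fromBlocks 1 0 0 U := by
    ext i (k | j)
    · rw [Matrix.mul_apply, Fintype.sum_sum_type]
      simp [shiftedMatrix, cauchyVandermonde, hN, Matrix.one_apply, sub_sub, add_comm]
    · rw [Matrix.mul_apply, Fintype.sum_sum_type]
      simp only [shiftedMatrix, cauchyVandermonde, hN, Matrix.of_apply, Matrix.sub_apply,
        Matrix.smul_apply, Sum.elim_inr, Sum.elim_inl, Matrix.fromBlocks_apply₁₂,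
        Matrix.fromBlocks_apply₂₂, Matrix.zero_apply, mul_zero, Finset.sum_const_zero, zero_add,
        smul_eq_mul, hU]
      rw [Fin.sum_univ_eq_sum_range (fun d => x i ^ d
        * (X ^ (j : ℕ) - C t * (X - C lam) ^ (j : ℕ) : K[X]).coeff d)]
      have := eval_eq_sum_range' ((hdeg j).trans_lt j.isLt) (x i)
      simp only [eval_sub, eval_pow, eval_X, eval_mul, eval_C] at this
      rw [this]
      exact Finset.sum_congr rfl fun d _ => mul_comm _ _
  rw [hmul, Matrix.det_mul, Matrix.det_fromBlocks_zero₂₁, Matrix.det_one, one_mul, hdetU, mul_comm]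
  congr 1
  have hNT : N.transpose = Matrix.of (fun c i =>
      Sum.elim (fun k => -t * (x i - (y k + lam))⁻¹) (fun _ => 0) c)
      + (cauchyVandermonde x y).transpose := by
    ext (k | j) i
    · simp [hN, cauchyVandermonde, Matrix.transpose_apply]; ring
    · simp [hN, cauchyVandermonde, Matrix.transpose_apply]
  rw [← Matrix.det_transpose, hNT, det_add_eq_sum,
    ← Finset.sumEquiv.symm.toEquiv.sum_comp, Fintype.sum_prod_type]
  refine Finset.sum_congr rfl fun J _ => ?_
  -- The power columns have no shifted term left, so choosing one produces a zero column.
  rw [Finset.sum_eq_single ∅]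
  · have := Matrix.det_mul_column (fun c => if c ∈ J.disjSum (∅ : Finset (Fin q)) then -t else 1)
      (cauchyVandermonde x (J.piecewise (fun k => y k + lam) y)).transpose
    rw [Finset.prod_ite_mem, Finset.univ_inter, Finset.prod_const, Finset.card_disjSum,
      Finset.card_empty, add_zero, Matrix.det_transpose] at this
    rw [← this]
    congr 1
    ext (k | j) i
    · by_cases hk : k ∈ J <;> simp [hk, cauchyVandermonde]
    · simp [cauchyVandermonde]
  · intro B _ hB
    obtain ⟨j, hj⟩ := Finset.nonempty_iff_ne_empty.2 hB
    refine Matrix.det_eq_zero_of_row_eq_zero (Sum.inr j) fun i => ?_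
    simp [hj]
  · simp

theorem sum_subsets_eq_aux {x : Fin p ⊕ Fin q → K} {y : Fin p → K} (lam t : K)
    (hx : Function.Injective x) (hy : Function.Injective y) (hxy : ∀ i k, x i - y k ≠ 0)
    (hxy' : ∀ i k, x i - y k + lam ≠ 0) :
    ∑ I : Finset (Fin p ⊕ Fin q), (-t) ^ I.card * ∏ i ∈ I,
        ((∏ j ∈ Iᶜ, (x i - x j - lam) / (x i - x j)) * ∏ k, (x i - y k + lam) / (x i - y k))
      = (1 - t) ^ q * ∑ J : Finset (Fin p), (-t) ^ J.card * ∏ k ∈ J,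
        ((∏ k' ∈ Jᶜ, (y k - y k' + lam) / (y k - y k'))
          * ∏ i, (x i - y k + lam) / (x i - y k)) := by
  -- With z = y - lam the factors (x - z)/(x - z - lam) from both shift formulas become (x - y +
  -- lam)/(x - y).
  set z : Fin p → K := fun k => y k - lam with hz
  have hzi : Function.Injective z := fun a b h => hy (sub_left_injective h)
  have h1 : ∀ i k, x i ≠ z k := fun i k h => hxy' i k (by rw [h]; simp [hz])
  have h2 : ∀ i k, x i - lam ≠ z k := fun i k h => hxy i k (by
    rw [sub_eq_zero]; exact sub_left_injective h)
  have h3 : ∀ i k, x i ≠ z k + lam := fun i k h => hxy i k (by rw [h]; simp [hz])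
  have hD := det_cauchyVandermonde_ne_zero hx hzi h1
  apply mul_right_cancel₀ hD
  rw [mul_assoc, Finset.sum_mul, Finset.sum_mul]
  have hrow := det_shiftedMatrix_rows x z lam t
  rw [det_shiftedMatrix_columns] at hrow
  refine Eq.trans ?_ (hrow.symm.trans ?_)
  · refine Finset.sum_congr rfl fun I _ => ?_
    rw [det_cauchyVandermonde_shift_left lam hx h1 h2, mul_assoc]
    congr 2
    refine Finset.prod_congr rfl fun i _ => ?_
    congr 1
    refine Finset.prod_congr rfl fun k _ => ?_
    congr 1 <;> simp [hz] <;> ring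
  · congr 1
    refine Finset.sum_congr rfl fun J _ => ?_
    rw [det_cauchyVandermonde_shift_right lam hzi h1 h3, mul_assoc]
    congr 2
    refine Finset.prod_congr rfl fun i _ => ?_
    congr 1
    · refine Finset.prod_congr rfl fun k _ => ?_
      congr 1 <;> simp [hz]
    · refine Finset.prod_congr rfl fun k _ => ?_
      congr 1 <;> simp [hz] <;> ring

end CauchyVandermonde

/-- The rational Euler transformation of type A (Kajihara–Noumi), for multiplicity-free sums. -/
theorem sum_subsets_eq {K α : Type*} [Field K] [DecidableEq α] (f : α → K) (S T : Finset α) {q : ℕ}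
    (lam t : K) (hcard : S.card = T.card + q) (hS : Set.InjOn f S) (hT : Set.InjOn f T)
    (h0 : ∀ i ∈ S, ∀ k ∈ T, f i - f k ≠ 0) (h1 : ∀ i ∈ S, ∀ k ∈ T, f i - f k + lam ≠ 0) :
    ∑ I ∈ S.powerset, (-t) ^ I.card * ∏ i ∈ I,
        ((∏ j ∈ S \ I, (f i - f j - lam) / (f i - f j)) * ∏ k ∈ T, (f i - f k + lam) / (f i - f k))
      = (1 - t) ^ q * ∑ J ∈ T.powerset, (-t) ^ J.card * ∏ k ∈ J,
        ((∏ k' ∈ T \ J, (f k - f k' + lam) / (f k - f k'))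
          * ∏ i ∈ S, (f i - f k + lam) / (f i - f k)) := by
  let eT : Fin T.card ≃ T := T.equivFin.symm
  let eS : Fin T.card ⊕ Fin q ≃ S :=
    finSumFinEquiv.trans ((finCongr hcard.symm).trans S.equivFin.symm)
  have key := sum_subsets_eq_aux (p := T.card) (q := q) (x := fun i => f (eS i))
    (y := fun k => f (eT k)) lam t
    (fun a b h => eS.injective (Subtype.ext (hS (eS a).2 (eS b).2 h)))
    (fun a b h => eT.injective (Subtype.ext (hT (eT a).2 (eT b).2 h)))
    (fun i k => h0 _ (eS i).2 _ (eT k).2) (fun i k => h1 _ (eS i).2 _ (eT k).2)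
  have tr : ∀ {β : Type} [Fintype β] [DecidableEq β] {A : Finset α} (e : β ≃ A)
      (G : Finset α → K), ∑ I ∈ A.powerset, G I
        = ∑ I : Finset β, G (I.map (e.toEmbedding.trans (Function.Embedding.subtype _))) := by
    intro β _ _ A e G
    symm
    refine Finset.sum_bij (fun I _ => I.map (e.toEmbedding.trans (Function.Embedding.subtype _)))
      ?_ ?_ ?_ ?_
    · intro I _
      rw [mem_powerset]
      intro a ha
      obtain ⟨b, _, rfl⟩ := Finset.mem_map.1 ha
      exact (e b).2
    · intro I _ I' _ h
      exact Finset.map_injective _ h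
    · intro I hI
      refine ⟨univ.filter fun b => (e b : α) ∈ I, mem_univ _, ?_⟩
      ext a
      simp only [Finset.mem_map, Finset.mem_filter, mem_univ, true_and]
      constructor
      · rintro ⟨b, hb, rfl⟩; exact hb
      · intro ha
        exact ⟨e.symm ⟨a, mem_powerset.1 hI ha⟩, by simpa using ha, by simp⟩
    · intros; rfl
  have pr : ∀ {β : Type} [Fintype β] [DecidableEq β] {A : Finset α} (e : β ≃ A) (I : Finset β)
      (G : α → K), ∏ j ∈ A \ I.map (e.toEmbedding.trans (Function.Embedding.subtype _)), G j
        = ∏ j ∈ Iᶜ, G (e j) := by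
    intro β _ _ A e I G
    have : A \ I.map (e.toEmbedding.trans (Function.Embedding.subtype _))
        = Iᶜ.map (e.toEmbedding.trans (Function.Embedding.subtype _)) := by
      ext a
      simp only [Finset.mem_sdiff, Finset.mem_map, mem_compl]
      constructor
      · rintro ⟨ha, h⟩
        exact ⟨e.symm ⟨a, ha⟩, fun hI => h ⟨_, hI, by simp⟩, by simp⟩
      · rintro ⟨b, hb, rfl⟩
        refine ⟨(e b).2, ?_⟩
        rintro ⟨b', hb', h⟩
        exact hb (e.injective (Subtype.ext h) ▸ hb')
    rw [this, Finset.prod_map]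
    rfl
  have pru : ∀ {β : Type} [Fintype β] [DecidableEq β] {A : Finset α} (e : β ≃ A)
      (G : α → K), ∏ j ∈ A, G j = ∏ j, G (e j) := by
    intro β _ _ A e G
    rw [e.prod_comp (fun j : A => G j), ← Finset.prod_coe_sort]
  rw [tr eS, tr eT]
  simp only [Finset.card_map, Finset.prod_map, pr, pru eT, pru eS]
  exact key

end SourceIdentity

/-! ### The localisation sums -/

namespace PervConifold

variable {κ l d : ℕ}

/-- The summand attached to `I ⊆ X` in the source identity. -/
noncomputable def ratioPlus (X Y I : Finset Wt) : Lam :=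
  ∏ i ∈ I, ((∏ j ∈ X \ I, (lin i - lin j - lam3) / (lin i - lin j)) *
    ∏ k ∈ Y, (lin i - lin k + lam3) / (lin i - lin k))

/-- The summand attached to `J ⊆ Y` in the source identity. -/
noncomputable def ratioMinus (X Y J : Finset Wt) : Lam :=
  ∏ k ∈ J, ((∏ k' ∈ Y \ J, (lin k - lin k' + lam3) / (lin k - lin k')) *
    ∏ i ∈ X, (lin i - lin k + lam3) / (lin i - lin k))

/-- No weight of X equals a weight k of Y or its predecessor k - t₃, so the factors mixing X and Y
have neither zeros nor poles. -/
theorem separated_plus_minus : Separated (tw 3) (plusSet κ l d) (minusSet κ l) := by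
  intro i hi k hk
  have h1 := (mem_plusSet.1 hi).1
  have h2 := mem_minusSet.1 hk
  rw [PlusChain] at h1
  rw [MinusChain] at h2
  constructor <;>
  · intro h
    have e0 := congrFun h 0
    have e1 := congrFun h 1
    have e2 := congrFun h 2
    simp only [Pi.add_apply, Pi.sub_apply, tw_apply, Pi.zero_apply] at e0 e1 e2
    omega

theorem Separated.mono {a : Wt} {I J I' J' : Finset Wt} (h : Separated a I J) (hI : I' ⊆ I) (hJ : J' ⊆ J) :
    Separated a I' J' := fun i hi j hj => h i (hI hi) j (hJ hj)

theorem IsPlusConf.separated {I : Finset Wt} (hI : IsPlusConf κ l I) :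
    Separated (-tw 3) I (plusSet κ l d \ I) := by
  intro i hi j hj
  obtain ⟨hj, hjI⟩ := Finset.mem_sdiff.1 hj
  constructor
  · intro h
    have e : i - tw 3 = j := by
      rw [← sub_eq_zero, ← h]; abel
    exact hjI (e ▸ hI.closed i hi (e ▸ (mem_plusSet.1 hj).1))
  · intro h
    exact hjI (sub_eq_zero.1 h ▸ hi)

theorem IsMinusConf.separated {J : Finset Wt} (hJ : IsMinusConf κ l J) :
    Separated (tw 3) J (minusSet κ l \ J) := by
  intro k hk k' hk'
  obtain ⟨hk', hkJ⟩ := Finset.mem_sdiff.1 hk'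
  constructor
  · intro h
    have e : k + tw 3 = k' := by
      rw [← sub_eq_zero, ← h]; abel
    exact hkJ (e ▸ hJ.closed k hk (e ▸ mem_minusSet.1 hk'))
  · intro h
    exact hkJ (sub_eq_zero.1 h ▸ hk)

theorem IsMinusConf.subset {J : Finset Wt} (hJ : IsMinusConf κ l J) : J ⊆ minusSet κ l :=
  fun w hw => mem_minusSet.2 (hJ.chain w hw)

/-- A weight outside the truncated set sits at depth at least d on an infinite string, and
closedness forces its d predecessors into I as well: d + 1 elements in all. -/
theorem IsPlusConf.subset {I : Finset Wt} (hI : IsPlusConf κ l I) (hd : I.card ≤ d) : I ⊆ plusSet κ l d := by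
  intro w hw
  refine mem_plusSet.2 ⟨hI.chain w hw, ?_⟩
  by_contra! hlt
  have hv := hI.chain w hw
  have key : ∀ n : ℕ, n ≤ d → w - n • tw 3 ∈ I := by
    intro n
    induction n with
    | zero => intro _; simpa using hw
    | succ n ih =>
      intro hn
      have := hI.closed _ (ih (by omega)) ?_
      · rwa [sub_sub, ← succ_nsmul] at this
      · rw [PlusChain] at hv ⊢
        left
        simp only [Pi.sub_apply, tw_apply, nsmul_tw_apply]
        omega
  have hinj : Function.Injective fun n : ℕ => w - n • tw 3 := by
    intro n n' h
    have := congrFun h 0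
    simp only [Pi.sub_apply, nsmul_tw_apply] at this
    omega
  have := Finset.card_le_card (s := (Finset.range (d + 1)).image fun n : ℕ => w - n • tw 3) (t := I) ?_
  · rw [Finset.card_image_of_injective _ hinj, Finset.card_range] at this
    omega
  · intro v hv
    obtain ⟨n, hn, rfl⟩ := Finset.mem_image.1 hv
    exact key n (by have := Finset.mem_range.1 hn; omega)

/-- In `moving_eq_plus` the tangent and insertion terms contain no trivial character, and V^∨ - V
contains it with multiplicity zero. Hence the Euler class is defined. -/
theorem IsPlusConf.coeffZero_moving {I : Finset Wt} (hI : IsPlusConf κ l I) :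
    coeffZero (moving κ l (chSum I)) = 0 := by
  have hX := hI.subset le_rfl
  have h := congrArg coeffZero (moving_eq_plus (κ := κ) (l := l) (d := I.card) (chSum I))
  rw [plusTangent, chSum_sub hX, map_add, map_add, map_add, map_sub, coeffZero_dual, sub_self,
    hI.separated.coeffZero_eq, (separated_plus_minus.mono hX subset_rfl).coeffZero_eq,
    coeffZero_insertion fun w hw j _ => insertion_shift_ne_zero_of_plus (hX hw) j] at h
  simpa using h

theorem IsMinusConf.coeffZero_moving {J : Finset Wt} (hJ : IsMinusConf κ l J) :
    coeffZero (moving κ l (chSum J)) = 0 := by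
  have hY := hJ.subset
  have h := congrArg coeffZero (moving_eq_minus (κ := κ) (l := l) (d := 0) (chSum J))
  rw [minusTangent, chSum_sub hY, map_add, map_add, map_sub, coeffZero_dual, coeffZero_dual, sub_self, map_add,
    hJ.separated.coeffZero_eq, mul_right_comm _ (dual (chSum J)) (chSum (plusSet κ l 0)), (separated_plus_minus.mono subset_rfl hY).coeffZero_eq,
    coeffZero_insertion fun w hw j _ => insertion_shift_ne_zero_of_minus (hY hw) j] at h
  simpa using h

theorem IsPlusConf.euler_moving {I : Finset Wt} (hI : IsPlusConf κ l I) (hX : I ⊆ plusSet κ l d) :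
    euler (moving κ l (chSum I)) * insertion κ I ((l + 1 + d : ℕ) * lam3)
      = (-1) ^ ((κ + 2) * I.card + stringCount κ I) * ratioPlus (plusSet κ l d) (minusSet κ l) I := by
  have h := congrArg (fun V => (multClass linUnit V : Lam))
    (moving_eq_plus (κ := κ) (l := l) (d := d) (chSum I))
  simp only [plusTangent, chSum_sub hX, multClass_add, Units.val_mul] at h
  rw [multClass_dual_sub, signUnit_plusCorrection hX, hI.separated.linUnit_eq,
    (separated_plus_minus.mono hX subset_rfl).linUnit_eq, ← euler_eq_multClass hI.coeffZero_moving,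
    linUnit_insertion fun w hw j _ => insertion_shift_ne_zero_of_plus (hX hw) j] at h
  rw [h, ratioPlus, Finset.prod_mul_distrib, mul_comm]
  simp only [lin_neg, lam3, sub_eq_add_neg, Units.val_pow_eq_pow_val, Units.val_neg, Units.val_one]

theorem IsMinusConf.euler_moving {J : Finset Wt} (hJ : IsMinusConf κ l J) :
    euler (moving κ l (chSum J)) * insertion κ J ((l + 1 + d : ℕ) * lam3)
      = (-1) ^ ((κ + 2) * J.card) * ratioMinus (plusSet κ l d) (minusSet κ l) J := by
  have hY := hJ.subset
  have h := congrArg (fun V => (multClass linUnit V : Lam))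
    (moving_eq_minus (κ := κ) (l := l) (d := d) (chSum J))
  simp only [minusTangent, chSum_sub hY, multClass_add, Units.val_mul] at h
  have hs := (separated_plus_minus (d := d)).mono subset_rfl hY
  rw [multClass_linUnit_dual, mul_right_comm _ (dual (chSum J)) (chSum (plusSet κ l d)), multClass_add, multClass_add, multClass_dual_sub,
    signUnit_minusCorrection hY, hJ.separated.signUnit_eq, hs.signUnit_eq, one_mul, one_mul, Units.val_mul,
    hJ.separated.linUnit_eq, hs.linUnit_eq, ← euler_eq_multClass hJ.coeffZero_moving,
    linUnit_insertion fun w hw j _ => insertion_shift_ne_zero_of_minus (hY hw) j] at h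
  rw [h, ratioMinus, Finset.prod_mul_distrib, mul_comm, Finset.prod_comm (s := J) (t := plusSet κ l d)]
  simp only [lam3, Units.val_pow_eq_pow_val, Units.val_neg, Units.val_one]

/-- If w in I has an admissible predecessor w - t₃ outside I, the numerator x_w - x_(w-t₃) - λ₃
vanishes. Subsets that are not configurations may thus be added to the sum at no cost. -/
theorem ratioPlus_eq_zero {I : Finset Wt} (hX : I ⊆ plusSet κ l d) (hI : ¬IsPlusConf κ l I) (Y : Finset Wt) :
    ratioPlus (plusSet κ l d) Y I = 0 := by
  obtain ⟨w, hw, hc, hn⟩ : ∃ w ∈ I, PlusChain κ l (w - tw 3) ∧ w - tw 3 ∉ I := by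
    by_contra! h
    exact hI ⟨fun w hw => (mem_plusSet.1 (hX hw)).1, h⟩
  have hm : w - tw 3 ∈ plusSet κ l d \ I := by
    refine Finset.mem_sdiff.2 ⟨mem_plusSet.2 ⟨hc, ?_⟩, hn⟩
    have := (mem_plusSet.1 (hX hw)).2
    rw [sub_tw_three_apply]
    omega
  refine Finset.prod_eq_zero hw (mul_eq_zero_of_left (Finset.prod_eq_zero hm ?_) _)
  rw [lin_sub, lam3, sub_sub_cancel, sub_self, zero_div]

theorem ratioMinus_eq_zero {J : Finset Wt} (hY : J ⊆ minusSet κ l) (hJ : ¬IsMinusConf κ l J) (X : Finset Wt) :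
    ratioMinus X (minusSet κ l) J = 0 := by
  obtain ⟨w, hw, hc, hn⟩ : ∃ w ∈ J, MinusChain κ l (w + tw 3) ∧ w + tw 3 ∉ J := by
    by_contra! h
    exact hJ ⟨fun w hw => mem_minusSet.1 (hY hw), h⟩
  have hm : w + tw 3 ∈ minusSet κ l \ J := Finset.mem_sdiff.2 ⟨mem_minusSet.2 hc, hn⟩
  refine Finset.prod_eq_zero hw (mul_eq_zero_of_left (Finset.prod_eq_zero hm ?_) _)
  rw [lin_add, lam3, sub_add_eq_sub_sub, sub_self, zero_sub, neg_add_cancel, zero_div]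

open scoped Classical in
/-- The configurations with `n` elements on the side of `Θ₊`. -/
noncomputable def plusConfs (κ l n : ℕ) : Finset (Finset Wt) :=
  ((plusSet κ l n).powersetCard n).filter fun I => IsPlusConf κ l I

open scoped Classical in
/-- The configurations with `n` elements on the side of `Θ₋`. -/
noncomputable def minusConfs (κ l n : ℕ) : Finset (Finset Wt) :=
  ((minusSet κ l).powersetCard n).filter fun J => IsMinusConf κ l J

theorem mem_plusConfs {n : ℕ} {I : Finset Wt} : I ∈ plusConfs κ l n ↔ IsPlusConf κ l I ∧ I.card = n := by
  classical
  rw [plusConfs, Finset.mem_filter, Finset.mem_powersetCard]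
  exact ⟨fun h => ⟨h.2, h.1.2⟩, fun h => ⟨⟨h.1.subset h.2.le, h.2⟩, h.1⟩⟩

theorem mem_minusConfs {n : ℕ} {J : Finset Wt} : J ∈ minusConfs κ l n ↔ IsMinusConf κ l J ∧ J.card = n := by
  classical
  rw [minusConfs, Finset.mem_filter, Finset.mem_powersetCard]
  exact ⟨fun h => ⟨h.2, h.1.2⟩, fun h => ⟨⟨h.1.subset, h.2⟩, h.1⟩⟩

/-! ### Interpolation in m. -/

open Polynomial

/-- The insertion as a polynomial in `m`. -/
noncomputable def insertionPoly (κ : ℕ) (I : Finset Wt) : Lam[X] :=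
  ∏ w ∈ I, ∏ j ∈ Finset.range (κ + 2), (X - C (lin w) - C (j * lin (tw 0)))

theorem eval_insertionPoly (I : Finset Wt) (T : Lam) : (insertionPoly κ I).eval T = insertion κ I T := by
  simp only [insertionPoly, insertion, eval_prod, eval_sub, eval_X, eval_C]

/-- The normalised coefficient of `t^n` on the side of `Θ₊`, as a polynomial in `m`. -/
noncomputable def plusPoly (κ l n : ℕ) : Lam[X] :=
  ∑ I ∈ plusConfs κ l n, C ((-1) ^ n * (-1) ^ ((κ + 2) * n + stringCount κ I)
    * euler (moving κ l (chSum I))) * insertionPoly κ I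

/-- The normalised coefficient of `t^n` on the side of `Θ₋`, as a polynomial in `m`. -/
noncomputable def minusPoly (κ l n : ℕ) : Lam[X] :=
  ∑ J ∈ minusConfs κ l n, C ((-1) ^ n * (-1) ^ ((κ + 2) * n)
    * euler (moving κ l (chSum J))) * insertionPoly κ J

theorem neg_one_pow_mul_cancel {R : Type*} [Ring R] (n : ℕ) (x : R) : (-1) ^ n * ((-1) ^ n * x) = x := by
  rw [← mul_assoc, ← pow_add, ← two_mul, pow_mul, neg_one_sq, one_pow, one_mul]

/-- The condition n ≤ d makes every n-element configuration fit into the truncated set. The signs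
built into `plusPoly` cancel those of `euler_moving`, sign rule included, and the added subsets
contribute zero. -/
theorem eval_plusPoly {n : ℕ} (hd : n ≤ d) : (plusPoly κ l n).eval ((l + 1 + d : ℕ) * lam3)
    = ∑ I ∈ (plusSet κ l d).powersetCard n, (-1) ^ n * ratioPlus (plusSet κ l d) (minusSet κ l) I := by
  rw [plusPoly, eval_finsetSum]
  refine (Finset.sum_congr rfl fun I hI => ?_).trans (Finset.sum_subset (s₁ := plusConfs κ l n) ?_ ?_)
  · obtain ⟨hI, hn⟩ := mem_plusConfs.1 hI
    rw [eval_mul, eval_C, eval_insertionPoly, mul_assoc, hI.euler_moving (hI.subset (hn.trans_le hd)), hn,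
      mul_assoc, neg_one_pow_mul_cancel]
  · intro I hI
    obtain ⟨hI, hn⟩ := mem_plusConfs.1 hI
    exact Finset.mem_powersetCard.2 ⟨hI.subset (hn.trans_le hd), hn⟩
  · intro I hI hc
    obtain ⟨hX, hn⟩ := Finset.mem_powersetCard.1 hI
    rw [ratioPlus_eq_zero hX fun h => hc (mem_plusConfs.2 ⟨h, hn⟩), mul_zero]

theorem eval_minusPoly {n : ℕ} (d : ℕ) : (minusPoly κ l n).eval ((l + 1 + d : ℕ) * lam3)
    = ∑ J ∈ (minusSet κ l).powersetCard n, (-1) ^ n * ratioMinus (plusSet κ l d) (minusSet κ l) J := by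
  rw [minusPoly, eval_finsetSum]
  refine (Finset.sum_congr rfl fun J hJ => ?_).trans (Finset.sum_subset (s₁ := minusConfs κ l n) ?_ ?_)
  · obtain ⟨hJ, hn⟩ := mem_minusConfs.1 hJ
    rw [eval_mul, eval_C, eval_insertionPoly, mul_assoc, hJ.euler_moving (d := d), hn,
      mul_assoc, neg_one_pow_mul_cancel]
  · intro J hJ
    obtain ⟨hJ, hn⟩ := mem_minusConfs.1 hJ
    exact Finset.mem_powersetCard.2 ⟨hJ.subset, hn⟩
  · intro J hJ hc
    obtain ⟨hX, hn⟩ := Finset.mem_powersetCard.1 hJ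
    rw [ratioMinus_eq_zero hX fun h => hc (mem_minusConfs.2 ⟨h, hn⟩), mul_zero]

theorem coeff_sum_powerset (X : Finset Wt) (w : Finset Wt → Lam) (n : ℕ) :
    (∑ I ∈ X.powerset, (-Polynomial.X : Lam[X]) ^ I.card * C (w I)).coeff n
      = ∑ I ∈ X.powersetCard n, (-1) ^ n * w I := by
  rw [finsetSum_coeff, Finset.powersetCard_eq_filter, Finset.sum_filter]
  refine Finset.sum_congr rfl fun I _ => ?_
  rw [coeff_mul_C, neg_pow (Polynomial.X : Lam[X]), ← C_1, ← C_neg, ← C_pow, coeff_C_mul, coeff_X_pow]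
  by_cases h : I.card = n
  · rw [if_pos h, if_pos h.symm, h, mul_one]
  · rw [if_neg h, if_neg (Ne.symm h), mul_zero, zero_mul]

theorem coeff_one_sub_X_pow (q i : ℕ) : ((1 - X : Lam[X]) ^ q).coeff i = (-1) ^ i * (q.choose i : Lam) := by
  have : (1 - X : Lam[X]) = (1 + X : Lam[X]).comp (C (-1) * X) := by
    rw [add_comp, one_comp, X_comp, C_neg, C_1]
    ring
  rw [this, ← pow_comp, comp_C_mul_X_coeff, coeff_one_add_X_pow, mul_comm]

/-- The Euler transformation holds for every t in an infinite field, hence as an identity of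
polynomials in t, whose coefficients can be compared. -/
theorem sum_subsets_poly : ∑ I ∈ (plusSet κ l d).powerset,
      (-X : Lam[X]) ^ I.card * C (ratioPlus (plusSet κ l d) (minusSet κ l) I)
    = (1 - X) ^ ((κ + 2) * (l + 1 + d)) * ∑ J ∈ (minusSet κ l).powerset,
      (-X : Lam[X]) ^ J.card * C (ratioMinus (plusSet κ l d) (minusSet κ l) J) := by
  refine Polynomial.funext fun t => ?_
  have hs := separated_plus_minus (κ := κ) (l := l) (d := d)
  have := SourceIdentity.sum_subsets_eq lin (plusSet κ l d) (minusSet κ l) lam3 t card_plusSet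
    lin_injective.injOn lin_injective.injOn
    (fun i hi k hk => by rw [← lin_sub]; exact mt lin_eq_zero_iff.1 (hs i hi k hk).2)
    (fun i hi k hk => by rw [lam3, ← lin_sub, ← lin_add]; exact mt lin_eq_zero_iff.1 (hs i hi k hk).1)
  simpa only [eval_finsetSum, eval_mul, eval_pow, eval_neg, eval_X, eval_C, eval_sub, eval_one, ratioPlus,
    ratioMinus] using this

theorem eval_plusPoly_eq {n : ℕ} (hd : n ≤ d) : (plusPoly κ l n).eval ((l + 1 + d : ℕ) * lam3)
    = ∑ x ∈ Finset.HasAntidiagonal.antidiagonal n, (-1) ^ x.1 * ((((κ + 2) * (l + 1 + d)).choose x.1 : ℕ) : Lam)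
      * (minusPoly κ l x.2).eval ((l + 1 + d : ℕ) * lam3) := by
  have := congrArg (fun p => p.coeff n) (sum_subsets_poly (κ := κ) (l := l) (d := d))
  simp only [coeff_sum_powerset, coeff_mul, coeff_one_sub_X_pow] at this
  simpa only [eval_plusPoly hd, eval_minusPoly] using this

/-- The polynomial `x ↦ (x choose i)`. -/
noncomputable def binomPoly (i : ℕ) : Lam[X] := C ((i.factorial : Lam)⁻¹) * descPochhammer Lam i

theorem eval_descPochhammer_eq_choose {K : Type*} [Field K] [BinomialRing K] (i : ℕ) (x : K) :
    (descPochhammer K i).eval x = i.factorial * Ring.choose x i := by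
  rw [← nsmul_eq_mul, ← Ring.descPochhammer_eq_factorial_smul_choose,
    ← descPochhammer_map (algebraMap ℤ K) i, eval_map, ← aeval_def]
  exact aeval_eq_smeval x (descPochhammer ℤ i)

theorem eval_binomPoly (i : ℕ) (x : Lam) : (binomPoly i).eval x = Ring.choose x i := by
  rw [binomPoly, eval_mul, eval_C, eval_descPochhammer_eq_choose,
    inv_mul_cancel_left₀ (by exact_mod_cast i.factorial_ne_zero)]

theorem lam3_ne_zero : lam3 ≠ 0 := by
  rw [lam3, Ne, lin_eq_zero_iff]
  exact ne_zero_of_apply 0 (by simp [tw])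

/-- Both sides are polynomials in m and agree at m = (l+1+d)λ₃ for every d ≥ n. These are infinitely
many values because λ₃ ≠ 0. -/
theorem plusPoly_eq (n : ℕ) : plusPoly κ l n = ∑ x ∈ Finset.HasAntidiagonal.antidiagonal n,
    C ((-1) ^ x.1) * (binomPoly x.1).comp (C ((κ + 2 : ℕ) / lam3) * X) * minusPoly κ l x.2 := by
  refine Polynomial.eq_of_infinite_eval_eq _ _ (Set.infinite_of_injective_forall_mem
    (f := fun e : ℕ => ((l + 1 + (n + e) : ℕ) : Lam) * lam3) ?_ ?_)
  · intro e e' h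
    have := mul_right_cancel₀ lam3_ne_zero h
    have := Nat.cast_injective this
    omega
  · intro e
    show _ = _
    rw [eval_plusPoly_eq (Nat.le_add_right n e), eval_finsetSum]
    refine Finset.sum_congr rfl fun x _ => ?_
    rw [eval_mul, eval_mul, eval_C, eval_comp, eval_mul, eval_C, eval_X, eval_binomPoly]
    congr 2
    rw [show ((κ + 2 : ℕ) : Lam) / lam3 * ((l + 1 + (n + e) : ℕ) * lam3) = ((κ + 2) * (l + 1 + (n + e)) : ℕ) by
      have := lam3_ne_zero
      push_cast; field_simp, Ring.choose_natCast]

theorem eval_plusPoly_mPar (n : ℕ) : (plusPoly κ l n).eval mPar = ∑ x ∈ Finset.HasAntidiagonal.antidiagonal n,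
    (-1) ^ x.1 * Ring.choose ((κ + 2 : ℕ) * (mPar / lam3)) x.1 * (minusPoly κ l x.2).eval mPar := by
  rw [plusPoly_eq, eval_finsetSum]
  refine Finset.sum_congr rfl fun x _ => ?_
  rw [eval_mul, eval_mul, eval_C, eval_comp, eval_mul, eval_C, eval_X, eval_binomPoly]
  congr 3
  ring

theorem minusPoly_zero : minusPoly κ l 0 = 1 := by
  have : minusConfs κ l 0 = {∅} := by
    ext J
    rw [mem_minusConfs, Finset.card_eq_zero, Finset.mem_singleton]
    refine ⟨fun h => h.2, fun h => ⟨?_, h⟩⟩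
    rw [h]
    exact ⟨by simp, by simp⟩
  rw [minusPoly, this, Finset.sum_singleton]
  simp [chSum, moving, insertionPoly, euler, dual]

end PervConifold

/-! ### The sign rule -/

namespace PervConifold

variable {κ l : ℕ}

theorem exists_filter_range_eq (P : ℕ → Prop) [DecidablePred P] (n : ℕ)
    (h : ∀ m, m + 1 < n → P (m + 1) → P m) : ∃ e, (Finset.range n).filter P = Finset.range e := by
  induction n with
  | zero => exact ⟨0, by simp⟩
  | succ n ih =>
    by_cases hn : P n
    · refine ⟨n + 1, Finset.filter_true_of_mem fun m hm => ?_⟩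
      have hm : m ≤ n := Nat.lt_succ_iff.1 (Finset.mem_range.1 hm)
      exact Nat.decreasingInduction' (P := P) (fun j hj _ hp => h j (by omega) hp) hm hn
    · obtain ⟨e, he⟩ := ih fun m hm => h m (by omega)
      exact ⟨e, by rw [Finset.range_add_one, Finset.filter_insert, if_neg hn, he]⟩

theorem exists_string_sum {I : Finset Wt} (u : Wt) (n : ℕ)
    (h : ∀ m, m + 1 < n → u + (m + 1) • tw 3 ∈ I → u + m • tw 3 ∈ I) :
    ∃ e, ∑ m ∈ Finset.range n, (if u + m • tw 3 ∈ I then ch (u + m • tw 3) else 0)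
      = ∑ m ∈ Finset.range e, ch (u + m • tw 3) := by
  obtain ⟨e, he⟩ := exists_filter_range_eq (fun m => u + m • tw 3 ∈ I) n h
  exact ⟨e, by rw [← he, Finset.sum_filter]⟩

/-- The class of the weights of the canonical form, indexed by the exponents of `t₀⁻¹`. -/
noncomputable def stringSum (κ l : ℕ) (d e f : ℕ → ℕ) : KT :=
  ∑ j ∈ Finset.range (κ + 1), ∑ n ∈ Finset.range (d j), ch (αWt 0 j + n • tw 3)
    + ∑ j ∈ Finset.range (κ + 1), ∑ n ∈ Finset.range (e j), ch (αWt 1 j + n • tw 3)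
    + ∑ j ∈ Finset.range (κ + 2), ∑ n ∈ Finset.range (f j), ch (vWt l j + n • tw 3)

/-- Closedness makes I an initial segment on each string; the lengths of these segments are the
exponents of the canonical form. -/
theorem IsPlusConf.exists_stringSum {I : Finset Wt} (hI : IsPlusConf κ l I) :
    ∃ d e f : ℕ → ℕ, chSum I = stringSum κ l d e f := by
  have hX := hI.subset le_rfl
  have hstep : ∀ (u : Wt) (m : ℕ), PlusChain κ l (u + m • tw 3) → u + (m + 1) • tw 3 ∈ I →
      u + m • tw 3 ∈ I := fun u m hc hm => by
    have e : u + (m + 1) • tw 3 - tw 3 = u + m • tw 3 := by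
      rw [add_smul, one_smul]; abel
    exact e ▸ hI.closed _ hm (e ▸ hc)
  have hchain : ∀ {w}, w ∈ plusSet κ l I.card → PlusChain κ l w := fun h => (mem_plusSet.1 h).1
  have h0 : ∀ j, ∃ e, j < κ + 1 → ∑ m ∈ Finset.range (l + 1),
      (if αWt 0 j + m • tw 3 ∈ I then ch (αWt 0 j + m • tw 3) else 0)
      = ∑ m ∈ Finset.range e, ch (αWt 0 j + m • tw 3) := fun j => by
    by_cases hj : j < κ + 1
    · obtain ⟨e, he⟩ := exists_string_sum (I := I) (αWt 0 j) (l + 1) fun m hm => hstep _ m <| by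
        obtain ⟨e0, e1, e2⟩ := αWt_zero_add_apply j m
        rw [PlusChain, e0, e1, e2]; omega
      exact ⟨e, fun _ => he⟩
    · exact ⟨0, fun h => (hj h).elim⟩
  have h1 : ∀ j, ∃ e, j < κ + 1 → ∑ m ∈ Finset.range (l + 1),
      (if αWt 1 j + m • tw 3 ∈ I then ch (αWt 1 j + m • tw 3) else 0)
      = ∑ m ∈ Finset.range e, ch (αWt 1 j + m • tw 3) := fun j => by
    by_cases hj : j < κ + 1
    · obtain ⟨e, he⟩ := exists_string_sum (I := I) (αWt 1 j) (l + 1) fun m hm => hstep _ m <| by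
        obtain ⟨e0, e1, e2⟩ := αWt_one_add_apply j m
        rw [PlusChain, e0, e1, e2]; omega
      exact ⟨e, fun _ => he⟩
    · exact ⟨0, fun h => (hj h).elim⟩
  have h2 : ∀ j, ∃ e, j < κ + 2 → ∑ m ∈ Finset.range I.card,
      (if vWt l j + m • tw 3 ∈ I then ch (vWt l j + m • tw 3) else 0)
      = ∑ m ∈ Finset.range e, ch (vWt l j + m • tw 3) := fun j => by
    by_cases hj : j < κ + 2
    · obtain ⟨e, he⟩ := exists_string_sum (I := I) (vWt l j) I.card fun m hm => hstep _ m <| by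
        obtain ⟨e0, e1, e2⟩ := vWt_add_apply (l := l) j m
        rw [PlusChain, e0, e1, e2]; omega
      exact ⟨e, fun _ => he⟩
    · exact ⟨0, fun h => (hj h).elim⟩
  choose d hd using h0
  choose e he using h1
  choose f hf using h2
  refine ⟨d, e, f, ?_⟩
  have : chSum I = ∑ w ∈ plusSet κ l I.card, if w ∈ I then ch w else 0 := by
    rw [← Finset.sum_filter, Finset.filter_mem_eq_inter, Finset.inter_eq_right.2 hX, chSum]
  rw [this, plusSet, Finset.sum_union disjoint_vWt, Finset.sum_union disjoint_αWt,
    Finset.sum_image (vWt_add_injective.injOn), Finset.sum_image (αWt_zero_add_injective.injOn),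
    Finset.sum_image (αWt_one_add_injective.injOn), Finset.sum_product_right, Finset.sum_product_right,
    Finset.sum_product_right, stringSum, add_comm]
  refine congrArg₂ _ (congrArg₂ _ ?_ ?_) ?_
  · exact Finset.sum_congr rfl fun j hj => hd j (Finset.mem_range.1 hj)
  · exact Finset.sum_congr rfl fun j hj => he j (Finset.mem_range.1 hj)
  · exact Finset.sum_congr rfl fun j hj => hf j (Finset.mem_range.1 hj)

/-- The strings are disjoint, so the coefficient at the head of a t₂-string tells whether that
string is nonempty. -/
theorem coeff_stringSum (d e f : ℕ → ℕ) {j : ℕ} (hj : j < κ + 1) :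
    (stringSum κ l d e f).coeff (αWt 1 j) = if 0 < e j then 1 else 0 := by
  obtain ⟨a0, a1, a2⟩ := αWt_one_add_apply j 0
  rw [zero_smul, add_zero] at a0 a1 a2
  simp only [stringSum, AddMonoidAlgebra.coeff_add, Finsupp.add_apply, AddMonoidAlgebra.coeff_sum,
    Finsupp.finsetSum_apply, coeff_ch]
  rw [Finset.sum_eq_zero fun j' _ => Finset.sum_eq_zero fun n _ => if_neg fun h => ?_,
    Finset.sum_eq_single j (fun j' _ hne => Finset.sum_eq_zero fun n _ => if_neg fun h => hne ?_)
      (fun h => (h (Finset.mem_range.2 hj)).elim),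
    Finset.sum_eq_zero (s := Finset.range (κ + 2)) fun j' _ => Finset.sum_eq_zero fun n _ => if_neg fun h => ?_,
    zero_add, add_zero]
  · by_cases h : 0 < e j
    · rw [if_pos h, Finset.sum_eq_single 0 (fun n _ hn => if_neg fun h => hn ?_)
        (fun h' => (h' (Finset.mem_range.2 h)).elim), if_pos (by rw [zero_smul, add_zero])]
      obtain ⟨e0, e1, e2⟩ := αWt_one_add_apply j n
      rw [h] at e1
      omega
    · rw [if_neg h, show e j = 0 by omega, Finset.sum_range_zero]
  · obtain ⟨e0, e1, e2⟩ := vWt_add_apply (l := l) j' n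
    rw [h] at e2
    omega
  · obtain ⟨e0, e1, e2⟩ := αWt_one_add_apply j' n
    rw [h] at e0 e1
    omega
  · obtain ⟨e0, e1, e2⟩ := αWt_zero_add_apply j' n
    rw [h] at e2
    omega

theorem sum_Icc_eq (i : ℤ) (j n : ℕ) (hn : i + j + 1 = n) :
    ∑ a ∈ Finset.Icc (-(j : ℤ)) i, ch (a • tw 0) = ch (-(j • tw 0)) * geom n := by
  rw [geom, Finset.mul_sum]
  refine (Finset.sum_nbij' (fun m : ℕ => (m : ℤ) - j) (fun a => (a + j).toNat) ?_ ?_ ?_ ?_ ?_).symm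
  · intro m hm
    have := Finset.mem_range.1 hm
    rw [Finset.mem_Icc]; omega
  · intro a ha
    have := Finset.mem_Icc.1 ha
    rw [Finset.mem_range]; omega
  · intro m _; omega
  · intro a ha
    have := Finset.mem_Icc.1 ha
    omega
  · intro m _
    rw [← ch_add, sub_smul, natCast_zsmul, natCast_zsmul, neg_add_eq_sub]

theorem smul_lineClass {i j : ℕ} (h : i + j = κ + 1) (v u : Wt) (hv : u + j • tw 0 = v) (n : ℕ) :
    (ch v * thick n) • lineClass (((κ + 2 : ℕ) : ℤ) - 1 - i) i
      = ((∑ m ∈ Finset.range n, ch (u + m • tw 3)) * geom (κ + 2),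
        (∑ m ∈ Finset.range n, ch (u + m • tw 3)) * geom (κ + 1)) := by
  have e : ((κ + 2 : ℕ) : ℤ) - 1 - i = j := by omega
  have e2 : ∑ m ∈ Finset.range n, ch (u + m • tw 3) = ch v * thick n * ch (-(j • tw 0)) := by
    rw [mul_right_comm, ← ch_add, ← hv, add_neg_cancel_right, thick, Finset.mul_sum]
    simp only [ch_add]
  rw [e, lineClass, sum_Icc_eq _ j (κ + 2) (by omega), sum_Icc_eq _ j (κ + 1) (by omega), e2, Prod.smul_mk,
    smul_eq_mul, smul_eq_mul, mul_assoc _ _ (geom (κ + 2)), mul_assoc _ _ (geom (κ + 1))]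

theorem sum_smul_lineClass (s : Finset ℕ) (hs : ∀ j ∈ s, j ≤ κ + 1) (v : Wt) (u : ℕ → Wt)
    (hv : ∀ j, u j + j • tw 0 = v) (d : ℕ → ℕ) :
    ∑ j ∈ s, (ch v * thick (d (κ + 1 - j))) • lineClass (((κ + 2 : ℕ) : ℤ) - 1 - (κ + 1 - j : ℕ)) (κ + 1 - j : ℕ)
      = ((∑ j ∈ s, ∑ m ∈ Finset.range (d (κ + 1 - j)), ch (u j + m • tw 3)) * geom (κ + 2),
        (∑ j ∈ s, ∑ m ∈ Finset.range (d (κ + 1 - j)), ch (u j + m • tw 3)) * geom (κ + 1)) := by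
  rw [Finset.sum_mul, Finset.sum_mul, Finset.sum_congr rfl fun j hj =>
    smul_lineClass (i := κ + 1 - j) (j := j) (by have := hs j hj; omega) v (u j) (hv j) _]
  exact Prod.ext (Prod.fst_sum ..) (Prod.snd_sum ..)

theorem sum_Icc_one_eq {A : Type*} [AddCommMonoid A] (g : ℕ → A) :
    ∑ i ∈ Finset.Icc 1 (κ + 2 - 1), g i = ∑ j ∈ Finset.range (κ + 1), g (κ + 1 - j) := by
  refine Finset.sum_nbij' (fun i => κ + 1 - i) (fun j => κ + 1 - j) ?_ ?_ ?_ ?_ ?_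
  · intro i hi; rw [Finset.mem_Icc] at hi; rw [Finset.mem_range]; omega
  · intro i hi; rw [Finset.mem_range] at hi; rw [Finset.mem_Icc]; omega
  · intro i hi; rw [Finset.mem_Icc] at hi; omega
  · intro i hi; rw [Finset.mem_range] at hi; omega
  · intro i hi; rw [Finset.mem_Icc] at hi; rw [show κ + 1 - (κ + 1 - i) = i by omega]

/-- The lowest character of F_i is t₀^(-(k-1-i)), so the slots run in the opposite order: string j
belongs to F_(κ+1-j). The thickened line has no second component because O(-1) has no cohomology. -/
theorem canonicalClass_eq (d e f : ℕ → ℕ) : canonicalClass (κ + 2) (l + 1) d e f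
    = confClass κ l (stringSum κ l (fun j => d (κ + 1 - j)) (fun j => e (κ + 1 - j)) fun j => f (κ + 1 - j)) := by
  have h0 : lineClass 0 0 = (1, 0) := by simp [lineClass, ch_zero]
  rw [canonicalClass, sum_Icc_one_eq, sum_Icc_one_eq, ← Finset.sum_range_reflect _ (κ + 2), h0,
    sum_smul_lineClass _ (fun j hj => (Finset.mem_range.1 hj).le) (tw 1) (αWt 0) (αWt_eq 0),
    sum_smul_lineClass _ (fun j hj => (Finset.mem_range.1 hj).le) (tw 2) (αWt 1) (αWt_eq 1)]
  rw [show κ + 2 - 1 = κ + 1 from rfl,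
    sum_smul_lineClass _ (fun j hj => Nat.lt_succ_iff.1 (Finset.mem_range.1 hj)) _ (vWt l) (vWt_eq l)]
  refine Prod.ext ?_ ?_
  · simp only [confClass, stringSum, Prod.fst_add, Prod.smul_fst, smul_eq_mul, mul_one]
    ring
  · simp only [confClass, stringSum, Prod.snd_add, Prod.smul_snd, smul_eq_mul, mul_zero]
    ring

/-- The exponents come from an existence statement. Whichever are chosen, their positivity is read
off from the class by `coeff_stringSum`, so the count does not depend on the choice. -/
theorem signPlus_eq {d₀ d₁ : ℕ} {R : RepSpace d₀ d₁} {I : Finset Wt} (hI : IsPlusConf κ l I)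
    (hR : kClass R = confClass κ l (chSum I)) : signPlus (κ + 2) (l + 1) R = stringCount κ I := by
  have key : ∀ e d f : ℕ → ℕ, kClass R = canonicalClass (κ + 2) (l + 1) d e f → ∀ j < κ + 1,
      (0 < e (κ + 1 - j) ↔ αWt 1 j ∈ I) := fun e d f h j hj => by
    rw [hR, canonicalClass_eq] at h
    have := congrArg (fun V : KT => V.coeff (αWt 1 j)) (confClass_injective h)
    simp only [coeff_chSum, coeff_stringSum _ _ _ hj] at this
    by_cases h1 : αWt 1 j ∈ I <;> by_cases h2 : 0 < e (κ + 1 - j) <;> simp_all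
  have hex : ∃ e : ℕ → ℕ, ∃ d f : ℕ → ℕ, kClass R = canonicalClass (κ + 2) (l + 1) d e f := by
    obtain ⟨d, e, f, h⟩ := hI.exists_stringSum
    refine ⟨fun i => e (κ + 1 - i), fun i => d (κ + 1 - i), fun i => f (κ + 1 - i), ?_⟩
    rw [hR, canonicalClass_eq, h]
    congr 1
    simp only [stringSum]
    refine congrArg₂ _ (congrArg₂ _ ?_ ?_) ?_ <;>
    · refine Finset.sum_congr rfl fun j hj => ?_
      rw [show κ + 1 - (κ + 1 - j) = j by have := Finset.mem_range.1 hj; omega]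
  obtain ⟨d, f, hc⟩ := hex.choose_spec
  rw [signPlus, dif_pos hex, stringCount]
  congr 1
  refine Finset.card_nbij' (fun i => κ + 1 - i) (fun j => κ + 1 - j) ?_ ?_ ?_ ?_
  · intro i hi
    simp only [Finset.coe_filter, Finset.mem_Icc, Set.mem_ofPred_eq, Finset.mem_range] at hi ⊢
    refine ⟨by omega, (key _ d f hc _ (by omega)).1 ?_⟩
    rw [show κ + 1 - (κ + 1 - i) = i by omega]
    exact hi.2
  · intro j hj
    simp only [Finset.coe_filter, Finset.mem_Icc, Set.mem_ofPred_eq, Finset.mem_range] at hj ⊢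
    exact ⟨by omega, (key _ d f hc _ hj.1).2 hj.2⟩
  · intro i hi
    simp only [Finset.coe_filter, Finset.mem_Icc, Set.mem_ofPred_eq] at hi ⊢
    omega
  · intro j hj
    simp only [Finset.coe_filter, Finset.mem_range, Set.mem_ofPred_eq] at hj ⊢
    omega

end PervConifold

/-! ### The wall-crossing identity -/

namespace PervConifold

variable {κ l : ℕ}

/-- The factor common to all the contributions. -/
noncomputable def wallConst (l : ℕ) : Lam :=
  (multClass linUnit (-(ch (-((l + 1) • tw 3)) * thick (l + 1))) : Lam) * eulerM (dual (thick (l + 1)))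

theorem eulerM_dual_thick_ne_zero (n : ℕ) : eulerM (dual (thick n)) ≠ 0 := by
  rw [thick, dual_sum, eulerM_sum]
  refine Finset.prod_ne_zero_iff.2 fun j _ => ?_
  rw [dual_ch, eulerM_ch]
  exact lin_add_mPar_ne_zero _

theorem wallConst_ne_zero : wallConst l ≠ 0 := mul_ne_zero (Units.ne_zero _) (eulerM_dual_thick_ne_zero _)

theorem coeffZero_thick : coeffZero (-(ch (-((l + 1) • tw 3)) * thick (l + 1))) = 0 := by
  rw [map_neg, thick, Finset.mul_sum, map_sum, neg_eq_zero]
  refine Finset.sum_eq_zero fun j hj => ?_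
  have hj := Finset.mem_range.1 hj
  rw [← ch_add]
  refine coeffZero_ch (ne_zero_of_apply 0 ?_)
  simp only [Pi.add_apply, Pi.neg_apply, nsmul_tw_apply]
  omega

theorem coeffZero_sqrtClass {M : KT} (h : coeffZero (moving κ l M) = 0) :
    coeffZero (sqrtClass (confClass κ l M)) = 0 := by
  rw [sqrtClass_confClass, map_add, coeffZero_thick, h, add_zero]

theorem euler_sqrtClass {M : KT} (h : coeffZero (moving κ l M) = 0) :
    euler (sqrtClass (confClass κ l M))
      = (multClass linUnit (-(ch (-((l + 1) • tw 3)) * thick (l + 1))) : Lam) * euler (moving κ l M) := by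
  rw [euler_eq_multClass (coeffZero_sqrtClass h), euler_eq_multClass h, sqrtClass_confClass, multClass_add,
    Units.val_mul]

theorem eulerM_dual_confClass (I : Finset Wt) : eulerM (dual (confClass κ l (chSum I)).1)
    = eulerM (dual (thick (l + 1))) * insertion κ I mPar := by
  have h := dual_chSum_mul_geom_mul (κ := κ) I 0
  rw [zero_smul, neg_zero, ch_zero, mul_one] at h
  rw [confClass, dual_add, dual_mul, eulerM_add, h, eulerM_sum, insertion]
  congr 1
  refine Finset.prod_congr rfl fun w _ => ?_
  rw [eulerM_sum]
  refine Finset.prod_congr rfl fun j _ => ?_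
  rw [eulerM_ch, add_zero, lin_neg, lin_add, lin_nsmul]
  ring

/-- The contribution as a function of the dimension vector, the sign and the class. -/
noncomputable def classContribution (d₀ d₁ : ℕ) (sgn : ℤ) (K : KP1) : Lam :=
  (-1 : Lam) ^ ((d₀ : ℤ) + ((d₀ : ℤ) - d₁) + sgn) * euler (sqrtClass K) * eulerM (dual K.1)

/-- Modulo the even number 2(l+1), the exponent χ(F) + deg F is r + (κ+2)r. The first part is the
sign of (-t)^r; the second, together with the sign rule c, matches the sign produced by the
correction term. -/
theorem classContribution_eq (r c : ℕ) {I : Finset Wt} (h : coeffZero (moving κ l (chSum I)) = 0) :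
    classContribution ((l + 1) + r * (κ + 2)) (0 + r * (κ + 2 - 1)) c (confClass κ l (chSum I))
      = wallConst l * ((-1) ^ r * (-1) ^ ((κ + 2) * r + c) * euler (moving κ l (chSum I)) * insertion κ I mPar) := by
  have hs : (-1 : Lam) ^ ((((l + 1) + r * (κ + 2) : ℕ) : ℤ) + ((((l + 1) + r * (κ + 2) : ℕ) : ℤ)
      - (0 + r * (κ + 2 - 1) : ℕ)) + c) = (-1) ^ r * (-1) ^ ((κ + 2) * r + c) := by
    have e : (((l + 1) + r * (κ + 2) : ℕ) : ℤ) + ((((l + 1) + r * (κ + 2) : ℕ) : ℤ)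
      - (0 + r * (κ + 2 - 1) : ℕ)) + c = (2 * (l + 1) + (r + ((κ + 2) * r + c)) : ℕ) := by
      rw [show κ + 2 - 1 = κ + 1 from rfl]
      push_cast
      ring
    rw [e, zpow_natCast, pow_add, pow_mul, neg_one_sq, one_pow, one_mul, pow_add]
  rw [classContribution, hs, euler_sqrtClass h, eulerM_dual_confClass, wallConst]
  ring

theorem coeff_fibreSeries_plus {θ : ℝ × ℝ} (hθ : θ ∈ wallLmm (κ + 2)) (r : ℕ) : ∀ᶠ ε in 𝓝[>] (0 : ℝ),
    (fibre (θ.1 - ε, θ.2) (thickIdeal (l + 1)) (lineRep (κ + 2)) r).Finite ∧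
    (∀ q ∈ fibre (θ.1 - ε, θ.2) (thickIdeal (l + 1)) (lineRep (κ + 2)) r,
      (sqrtClass (kClass q.out)).coeff 0 = 0) ∧
    PowerSeries.coeff r (fibreSeries (θ.1 - ε, θ.2) (thickIdeal (l + 1)) (lineRep (κ + 2))
      (signPlus (κ + 2) (l + 1))) = wallConst l * (plusPoly κ l r).eval mPar := by
  classical
  filter_upwards [fibre_plus hθ r (plusConfs κ l r) fun I => mem_plusConfs] with ε ⟨hfin, hcl, hsum⟩
  refine ⟨hfin, fun q hq => ?_, ?_⟩
  · obtain ⟨I, hI, hq⟩ := hcl q hq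
    rw [hq]
    exact coeffZero_sqrtClass (mem_plusConfs.1 hI).1.coeffZero_moving
  · let sgn : KP1 → ℤ := fun K => if h : ∃ I ∈ plusConfs κ l r, K = confClass κ l (chSum I) then
      stringCount κ h.choose else 0
    have hsgn : ∀ I ∈ plusConfs κ l r, sgn (confClass κ l (chSum I)) = stringCount κ I := fun I hI => by
      have h : ∃ J ∈ plusConfs κ l r, confClass κ l (chSum I) = confClass κ l (chSum J) := ⟨I, hI, rfl⟩
      have e := chSum_injective (confClass_injective h.choose_spec.2)
      show dite _ _ _ = _
      rw [dif_pos h, ← e]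
    rw [fibreSeries, PowerSeries.coeff_mk]
    have := hsum fun K => classContribution ((l + 1) + r * (κ + 2)) (0 + r * (κ + 2 - 1)) (sgn K) K
    refine (finsum_mem_congr rfl fun q hq => ?_).trans (this.trans ?_)
    · obtain ⟨I, hI, hq⟩ := hcl q hq
      rw [hq, hsgn I hI, contribution, signPlus_eq (mem_plusConfs.1 hI).1 hq, classContribution, hq]
    · rw [plusPoly, Polynomial.eval_finsetSum, Finset.mul_sum]
      refine Finset.sum_congr rfl fun I hI => ?_
      rw [hsgn I hI, classContribution_eq _ _ (mem_plusConfs.1 hI).1.coeffZero_moving, Polynomial.eval_mul,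
        Polynomial.eval_C, eval_insertionPoly]

theorem coeff_fibreSeries_minus {θ : ℝ × ℝ} (hθ : θ ∈ wallLmm (κ + 2)) (r : ℕ) : ∀ᶠ ε in 𝓝[>] (0 : ℝ),
    (fibre (θ.1 + ε, θ.2) (thickIdeal (l + 1)) (lineRep (κ + 2)) r).Finite ∧
    (∀ q ∈ fibre (θ.1 + ε, θ.2) (thickIdeal (l + 1)) (lineRep (κ + 2)) r,
      (sqrtClass (kClass q.out)).coeff 0 = 0) ∧
    PowerSeries.coeff r (fibreSeries (θ.1 + ε, θ.2) (thickIdeal (l + 1)) (lineRep (κ + 2))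
      fun _ => 0) = wallConst l * (minusPoly κ l r).eval mPar := by
  filter_upwards [fibre_minus hθ r (minusConfs κ l r) fun J => mem_minusConfs] with ε ⟨hfin, hcl, hsum⟩
  refine ⟨hfin, fun q hq => ?_, ?_⟩
  · obtain ⟨J, hJ, hq⟩ := hcl q hq
    rw [hq]
    exact coeffZero_sqrtClass (mem_minusConfs.1 hJ).1.coeffZero_moving
  · rw [fibreSeries, PowerSeries.coeff_mk]
    refine (hsum (classContribution ((l + 1) + r * (κ + 2)) (0 + r * (κ + 2 - 1)) (0 : ℕ))).trans ?_
    rw [minusPoly, Polynomial.eval_finsetSum, Finset.mul_sum]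
    refine Finset.sum_congr rfl fun J hJ => ?_
    rw [classContribution_eq _ _ (mem_minusConfs.1 hJ).1.coeffZero_moving, Polynomial.eval_mul,
      Polynomial.eval_C, eval_insertionPoly, add_zero]

theorem coeff_mul_inv_eq {K : Type*} [Field K] {A B P : PowerSeries K} {N : ℕ}
    (hB : PowerSeries.constantCoeff B ≠ 0)
    (h : ∀ n ≤ N, PowerSeries.coeff n A = PowerSeries.coeff n (P * B)) {n : ℕ} (hn : n ≤ N) :
    PowerSeries.coeff n (A * B⁻¹) = PowerSeries.coeff n P := by
  have : PowerSeries.coeff n (A * B⁻¹) = PowerSeries.coeff n (P * B * B⁻¹) := by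
    rw [PowerSeries.coeff_mul, PowerSeries.coeff_mul]
    refine Finset.sum_congr rfl fun x hx => ?_
    have := Finset.HasAntidiagonal.mem_antidiagonal.1 hx
    rw [h x.1 (by omega)]
  rw [this, mul_assoc, PowerSeries.mul_inv_cancel B hB, mul_one]

/-- Each degree r ≤ N holds for all small ε, so finitely many degrees hold together. The common
factor `wallConst` is nonzero and `minusPoly` equals 1 in degree zero, hence the denominator is
invertible and the convolution identity `eval_plusPoly_mPar` can be divided by it. -/
theorem wallCrossingUpTo {θ : ℝ × ℝ} (hθ : θ ∈ wallLmm (κ + 2)) (N : ℕ) :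
    WallCrossingUpTo (κ + 2) (l + 1) θ N := by
  have hp := (Filter.eventually_all_finset (Finset.range (N + 1))).2 fun r _ =>
    coeff_fibreSeries_plus (l := l) hθ r
  have hm := (Filter.eventually_all_finset (Finset.range (N + 1))).2 fun r _ =>
    coeff_fibreSeries_minus (l := l) hθ r
  filter_upwards [hp, hm] with ε hp hm
  replace hp := fun r (hr : r ≤ N) => hp r (Finset.mem_range.2 (Nat.lt_succ_iff.2 hr))
  replace hm := fun r (hr : r ≤ N) => hm r (Finset.mem_range.2 (Nat.lt_succ_iff.2 hr))
  have hB : PowerSeries.constantCoeff (fibreSeries (θ.1 + ε, θ.2) (thickIdeal (l + 1)) (lineRep (κ + 2))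
      fun _ => 0) ≠ 0 := by
    rw [← PowerSeries.coeff_zero_eq_constantCoeff_apply, (hm 0 N.zero_le).2.2, minusPoly_zero,
      Polynomial.eval_one, mul_one]
    exact wallConst_ne_zero
  refine ⟨?_, hB, fun n hn => coeff_mul_inv_eq hB (fun n hn => ?_) hn⟩
  · rintro θ' (rfl | rfl) r hr
    · exact ⟨(hp r hr).1, fun q hq => ((hp r hr).2.1 q hq).ge⟩
    · exact ⟨(hm r hr).1, fun q hq => ((hm r hr).2.1 q hq).ge⟩
  · rw [(hp n hn).2.2, eval_plusPoly_mPar, PowerSeries.coeff_mul, Finset.mul_sum]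
    refine Finset.sum_congr rfl fun x hx => ?_
    have := Finset.HasAntidiagonal.mem_antidiagonal.1 hx
    rw [(hm x.2 (by omega)).2.2, oneSubPow, PowerSeries.coeff_mk]
    ring

end PervConifold

theorem proposition3p19 :
    (∀ θ ∈ PervConifold.wallLmm 2,
      PervConifold.WallCrossingUpTo 2 1 θ 16 ∧
      PervConifold.WallCrossingUpTo 2 2 θ 10 ∧
      (∀ l : ℕ, l = 3 ∨ l = 4 → PervConifold.WallCrossingUpTo 2 l θ 9) ∧
      PervConifold.WallCrossingUpTo 2 5 θ 8 ∧
      PervConifold.WallCrossingUpTo 2 6 θ 7 ∧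
      (∀ l : ℕ, 7 ≤ l → l ≤ 10 → PervConifold.WallCrossingUpTo 2 l θ 6) ∧
      (∀ l : ℕ, 1 ≤ l → PervConifold.WallCrossingUpTo 2 l θ 5)) ∧
    (∀ θ ∈ PervConifold.wallLmm 3, PervConifold.WallCrossingUpTo 3 1 θ 5) ∧
    (∀ k : ℕ, k = 4 ∨ k = 5 → ∀ θ ∈ PervConifold.wallLmm k,
      PervConifold.WallCrossingUpTo k 1 θ 2) ∧
    (∀ k : ℕ, 3 ≤ k → k ≤ 12 → ∀ θ ∈ PervConifold.wallLmm k,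
      PervConifold.WallCrossingUpTo k 1 θ 1) := by
  have main : ∀ k l N : ℕ, 2 ≤ k → 1 ≤ l → ∀ θ ∈ PervConifold.wallLmm k,
      PervConifold.WallCrossingUpTo k l θ N := by
    intro k l N hk hl θ hθ
    obtain ⟨κ, rfl⟩ := Nat.exists_eq_add_of_le' hk
    obtain ⟨l, rfl⟩ := Nat.exists_eq_add_of_le' hl
    exact PervConifold.wallCrossingUpTo hθ N
  refine ⟨fun θ hθ => ⟨main 2 1 16 (by omega) le_rfl θ hθ, main 2 2 10 (by omega) (by omega) θ hθ,
    fun l hl => main 2 l 9 le_rfl (by omega) θ hθ, main 2 5 8 le_rfl (by omega) θ hθ,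
    main 2 6 7 le_rfl (by omega) θ hθ, fun l hl _ => main 2 l 6 le_rfl (by omega) θ hθ,
    fun l hl => main 2 l 5 le_rfl hl θ hθ⟩, fun θ hθ => main 3 1 5 (by omega) le_rfl θ hθ,
    fun k hk θ hθ => main k 1 2 (by omega) le_rfl θ hθ, fun k hk _ θ hθ => main k 1 1 (by omega) le_rfl θ hθ⟩
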